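/- Let $K$ be an algebraically closed field of characteristic $0$ and let $X$ be a smooth irreducible algebraic variety of dimension $n$ over $K$ (for instance quasi-projective), with structure sheaf $\mathcal O$ and tangent sheaf $\Theta$. A *sheaf of $AV$-modules* on $X$ is a sheaf of $\mathcal O$-modules $\mathcal M$ with an action of the sheaf of Lie algebras $\Theta$ such that $\eta(fm)=\eta(f)m+f(\eta m)$ for vector fields $\eta$ and functions $f$. It is *$N$-differentiable* if $\sum_{k=0}^{N}(-1)^k\binom Nk f^k\,(f^{N-k}\eta)$ annihilates its sections for all functions $f$ and all vector fields $\eta$ (it is then a module over the completed smash product $A\widehat{\#}U(V)$ on each affine open set, where $A=\mathcal O(U)$, $V=\Theta(U)$). On $\mathcal M\otimes_{\mathcal O}\mathcal N$ vector fields act by $\eta(m\otimes m')=\eta m\otimes m'+m\otimes\eta m'$. An *étale chart* is an affine open set $U\subset X$ with functions $x_1,\dots,x_n\in\mathcal O(U)$ that are algebraically independent over $K$, such that $\mathcal O(U)$ is algebraic over $K[x_1,\dots,x_n]$ and the derivations $\partial/\partial x_i$ of $K[x_1,\dots,x_n]$ extend to $\mathcal O(U)$. For $f\in\mathcal O(U)$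 put $f(x+X)=\sum_{s\in\mathbb Z_+^n}\frac1{s!}\frac{\partial^s f}{\partial x^s}X^s\in\mathcal O(U)[[X_1,\dots,X_n]]$. Let $\widehat L_+$ be the Lie algebra of derivations of $K[[X_1,\dots,X_n]]$ that vanish at $0$, and let $L_0\cong\mathfrak{gl}_n$ be its subalgebra with basis $X_j\,\partial/\partial X_i$, where $X_j\,\partial/\partial X_i$ corresponds to the elementary matrix $E_{ji}$. A finite-dimensional $\widehat L_+$-module $(W,\rho)$ is *rational* if the action of $L_0$ integrates to a rational representation of $GL_n$; then the group of automorphisms of the algebra of formal power series acts on $W$, again denoted by $\rho$ (a linear automorphism by the representation of $GL_n$, and $\exp(v)$ by $\exp(\rho(v))$ for a derivation $v$ with coefficients vanishing to order $2$). Let $K_{\mathrm{tr}}$ be the one-dimensional $\widehat L_+$-module on which $\sum_i f_i\,\partial/\partial X_i$ acts by $\sum_i\frac{\partial f_i}{\partial X_i}(0)$; thus $L_0$ acts by the trace, which integrates to the determinant. For a rational $W$, the sheaf $\mathcal J^W$ is the vector bundle given by $\mathcal O(U)\otimes W$ in each étale chart $U$, with the gluing $g(x)\,w\mapsto g(G(y))\,\rho(\varphi_G)w$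 on the intersection of charts with parameters $x$ and $y$, where $x_i=G_i(y)$ and $\varphi_G$ is the automorphism $X_i\mapsto G_i(y+Y)-G_i(y)$ of power series. Vector fields act in an étale chart by $$f\frac{\partial}{\partial x_i}(g\otimes w)=f\frac{\partial g}{\partial x_i}\otimes w+\sum_{s\in\mathbb Z_+^n\setminus\{0\}}\frac1{s!}\,g\,\frac{\partial^sf}{\partial x^s}\otimes\Big(X^s\frac{\partial}{\partial X_i}\Big)w .$$ Let $P$ be a (closed) point of $X$. For an étale chart $U\ni P$ with parameters $x_1,\dots,x_n$, let $A=\mathcal O(U)$, $V=\Theta(U)$ and let $\mathfrak m_P\subset A$ be the maximal ideal of $P$. Let $A$ act on $W$ by $fw=f(P)w$, and let $\mathfrak m_PV$ act on $W$ through the expansion at $P$: $f\frac{\partial}{\partial x_i}\mapsto\sum_{s\ne0}\frac1{s!}\frac{\partial^sf}{\partial x^s}(P)\,X^s\frac{\partial}{\partial X_i}\in\widehat L_+$, for $f\in\mathfrak m_P$. Let $\mathcal R_P^W$ be the sheaf of $AV$-modules supported at $P$ that is given by the Rudakov module $$R_P^W=\mathrm{Ind}_{A\#U(\mathfrak m_PV)}^{A\#U(V)}W\cong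 K\Big[\frac{\partial}{\partial x_1},\dots,\frac{\partial}{\partial x_n}\Big]\otimes W .$$ Let $\mathcal F_P$ be the sheaf of $D$-modules of delta functions, supported at $P$ and given by $D/D\mathfrak m_P\cong K[\frac{\partial}{\partial x_1},\dots,\frac{\partial}{\partial x_n}]\,\delta_P$, where $f\delta_P=f(P)\delta_P$ and $D$ is the algebra of differential operators. **Theorem.** Let $W$ be a rational finite-dimensional $\widehat L_+$-module, let $P\in X$ be a point, and let $\mathcal R_P^W$ be defined by means of any étale chart containing $P$. Then the formulas above define a sheaf of $AV$-modules $\mathcal J^{W\otimes K_{\mathrm{tr}}}$; there is $N\ge1$ such that $\mathcal R_P^W$ and $\mathcal F_P\otimes_{\mathcal O}\mathcal J^{W\otimes K_{\mathrm{tr}}}$ are both $N$-differentiable; and there is an isomorphism of sheaves of $AV$-modules $$\mathcal R_P^W\;\cong\;\mathcal F_P\otimes_{\mathcal O}\mathcal J^{W\otimes K_{\mathrm{tr}}}.$$ -/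

import Mathlib

open CategoryTheory AlgebraicGeometry TopologicalSpace TensorProduct

universe u

namespace AVMod

noncomputable section

section Formal

variable (n : ℕ) (K : Type u) [Field K]

/-- Formal power series `R[[X₁, …, Xₙ]]`. -/
abbrev PS (R : Type u) : Type u := MvPowerSeries (Fin n) R

/-- The Lie algebra `L̂₊` of the derivations of `K[[X₁, …, Xₙ]]` that vanish at `0`, that is,
whose values lie in the maximal ideal of power series without constant term. -/
def Lplus : LieSubalgebra K (Derivation K (PS n K) (PS n K)) where
  carrier := {D | ∀ f, MvPowerSeries.constantCoeff (D f) = 0}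
  add_mem' := by
    intro a b ha hb f
    simp [ha f, hb f]
  zero_mem' := by intro f; simp
  smul_mem' := by
    intro c D hD f
    simp [hD f]
  lie_mem' := by
    intro a b ha hb f
    have h1 : MvPowerSeries.constantCoeff (a (b f)) = 0 := ha _
    have h2 : MvPowerSeries.constantCoeff (b (a f)) = 0 := hb _
    rw [Derivation.commutator_apply, map_sub, h1, h2, sub_zero]

variable {n K}

/-- The derivation `∑ᵢ uᵢ ∂/∂Xᵢ` of `R[[X₁, …, Xₙ]]`. -/
def vecField {R : Type u} [CommRing R] (v : Fin n → PS n R) :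
    Derivation R (PS n R) (PS n R) :=
  ∑ i, v i • MvPowerSeries.pderiv R i

/-- The element `X^s ∂/∂Xᵢ` of `L̂₊`, for `s ≠ 0`. -/
def mono (s : {s : Fin n →₀ ℕ // s ≠ 0}) (i : Fin n) : Lplus n K :=
  ⟨MvPowerSeries.monomial s.1 (1 : K) • MvPowerSeries.pderiv K i, by
    intro f
    have h : MvPowerSeries.constantCoeff (MvPowerSeries.monomial s.1 (1 : K)) = 0 := by
      rw [← MvPowerSeries.coeff_zero_eq_constantCoeff_apply,
        MvPowerSeries.coeff_monomial, if_neg (fun h => s.2 h.symm)]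
    rw [Derivation.smul_apply, smul_eq_mul, map_mul, h, zero_mul]⟩

/-- The exponent of the monomial `Xⱼ`. -/
def unitExp (j : Fin n) : {s : Fin n →₀ ℕ // s ≠ 0} :=
  ⟨Finsupp.single j 1, by simp⟩

/-- The embedding `gl_n ≅ L₀ ⊆ L̂₊`, sending the matrix unit `E_{ji}` to `Xⱼ ∂/∂Xᵢ`. -/
def glToLplus (M : Matrix (Fin n) (Fin n) K) : Lplus n K :=
  ∑ j, ∑ i, M j i • mono (unitExp j) i

theorem exists_decomp (f : PS n K) : ∃ g : Fin n → PS n K,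
    f = MvPowerSeries.C (MvPowerSeries.constantCoeff f) + ∑ k, MvPowerSeries.X k * g k := by
  classical
  obtain ⟨g, hg⟩ : ∃ g : Fin n → PS n K, ∀ k d, MvPowerSeries.coeff d (g k) =
      if ∀ j < k, d j = 0 then MvPowerSeries.coeff (d + Finsupp.single k 1) f else 0 :=
    ⟨fun k => fun d => if ∀ j < k, d j = 0 then
      MvPowerSeries.coeff (d + Finsupp.single k 1) f else 0, fun _ _ => rfl⟩
  refine ⟨g, ?_⟩
  ext s
  by_cases hs : s = 0
  · subst hs
    simp
  · have hC : MvPowerSeries.coeff s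
        (MvPowerSeries.C (σ := Fin n) (MvPowerSeries.constantCoeff f)) = 0 := by
      rw [MvPowerSeries.coeff_C, if_neg hs]
    rw [map_add, hC, zero_add, map_sum]
    obtain ⟨k, hk, hmin⟩ : ∃ k : Fin n, s k ≠ 0 ∧ ∀ j < k, s j = 0 := by
      have hne : (Finset.univ.filter fun k => s k ≠ 0).Nonempty := by
        by_contra h
        apply hs
        ext j
        by_contra hj
        exact h ⟨j, by simpa using hj⟩
      refine ⟨_, (Finset.mem_filter.mp (Finset.min'_mem _ hne)).2, fun j hj => ?_⟩
      by_contra hj0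
      exact absurd (Finset.min'_le _ j (by simpa using hj0)) (not_le.mpr hj)
    rw [Finset.sum_eq_single k]
    · rw [MvPowerSeries.X, MvPowerSeries.coeff_monomial_mul, if_pos, one_mul]
      · have h1 : s - Finsupp.single k 1 + Finsupp.single k 1 = s :=
          tsub_add_cancel_of_le (by simpa using Nat.one_le_iff_ne_zero.mpr hk)
        rw [hg, if_pos, h1]
        intro j hj
        simp [hmin j hj]
      · simpa using Nat.one_le_iff_ne_zero.mpr hk
    · intro j _ hjk
      rw [MvPowerSeries.X, MvPowerSeries.coeff_monomial_mul]
      split_ifs with h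
      · rw [one_mul, hg]
        have hj : s j ≠ 0 := Nat.one_le_iff_ne_zero.mp (by simpa using h)
        have hkj : k < j := by
          rcases lt_trichotomy k j with h' | h' | h'
          · exact h'
          · exact absurd h'.symm hjk
          · exact absurd (hmin j h') hj
        rw [if_neg]
        intro hall
        have := hall k hkj
        simp [hkj.ne, hk] at this
      · rfl
    · simp

theorem coeff_unit_mul (j : Fin n) (f g : PS n K) :
    MvPowerSeries.coeff (Finsupp.single j 1) (f * g) =
      MvPowerSeries.constantCoeff f * MvPowerSeries.coeff (Finsupp.single j 1) g +
      MvPowerSeries.coeff (Finsupp.single j 1) f * MvPowerSeries.constantCoeff g := by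
  classical
  have h := congrArg (fun t => MvPowerSeries.constantCoeff t)
    ((MvPowerSeries.pderiv K j).leibniz f g)
  simp only [← MvPowerSeries.coeff_zero_eq_constantCoeff_apply, map_add, smul_eq_mul] at h
  simp only [MvPowerSeries.coeff_zero_eq_constantCoeff_apply, map_mul] at h
  simp only [← MvPowerSeries.coeff_zero_eq_constantCoeff_apply,
    MvPowerSeries.coeff_pderiv] at h
  simp only [MvPowerSeries.coeff_zero_eq_constantCoeff_apply, zero_add, Finsupp.coe_zero,
    Pi.zero_apply, Nat.cast_zero, mul_one] at h
  rw [h]; ring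

theorem coeff_unit_apply (D : Lplus n K) (j : Fin n) (f : PS n K) :
    MvPowerSeries.coeff (Finsupp.single j 1) (D.1 f) =
      ∑ k, MvPowerSeries.coeff (Finsupp.single k 1) f *
        MvPowerSeries.coeff (Finsupp.single j 1) (D.1 (MvPowerSeries.X k)) := by
  classical
  obtain ⟨g, hg⟩ := exists_decomp f
  have hk : ∀ k, MvPowerSeries.coeff (Finsupp.single k 1) f =
      MvPowerSeries.constantCoeff (g k) := by
    intro k
    conv_lhs => rw [hg]
    simp [map_sum, coeff_unit_mul, MvPowerSeries.coeff_X, MvPowerSeries.coeff_C,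
      Finsupp.single_left_inj, Finset.sum_ite_eq]
  have hC : D.1 (MvPowerSeries.C (σ := Fin n) (MvPowerSeries.constantCoeff f)) = 0 := by
    exact D.1.map_algebraMap (MvPowerSeries.constantCoeff f)
  conv_lhs => rw [hg]
  rw [map_add, hC, zero_add, map_sum, map_sum]
  refine Finset.sum_congr rfl fun k _ => ?_
  rw [Derivation.leibniz, map_add, smul_eq_mul, smul_eq_mul, coeff_unit_mul, coeff_unit_mul, hk,
    D.2 (g k), D.2 (MvPowerSeries.X k)]
  simp

/-- The trace character of `L̂₊`: the trace of the linear part of a derivation. -/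
def traceChar : Lplus n K →ₗ[K] K where
  toFun D := ∑ i, MvPowerSeries.coeff (Finsupp.single i 1) (D.1 (MvPowerSeries.X i))
  map_add' := by intro a b; simp [Finset.sum_add_distrib]
  map_smul' := by intro c a; simp [Finset.mul_sum]

theorem traceChar_lie (a b : Lplus n K) : traceChar ⁅a, b⁆ = 0 := by
  have h : ∀ i, MvPowerSeries.coeff (Finsupp.single i 1) ((⁅a, b⁆ : Lplus n K).1
      (MvPowerSeries.X i)) =
      (∑ k, MvPowerSeries.coeff (Finsupp.single k 1) (b.1 (MvPowerSeries.X i)) *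
        MvPowerSeries.coeff (Finsupp.single i 1) (a.1 (MvPowerSeries.X k))) -
      ∑ k, MvPowerSeries.coeff (Finsupp.single k 1) (a.1 (MvPowerSeries.X i)) *
        MvPowerSeries.coeff (Finsupp.single i 1) (b.1 (MvPowerSeries.X k)) := by
    intro i
    rw [← coeff_unit_apply, ← coeff_unit_apply, ← map_sub]
    rfl
  change ∑ i : Fin n, _ = (0 : K)
  rw [Finset.sum_congr rfl fun i _ => h i, Finset.sum_sub_distrib, sub_eq_zero,
    Finset.sum_comm]
  exact Finset.sum_congr rfl fun i _ => Finset.sum_congr rfl fun j _ => mul_comm _ _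

variable (n K) in
/-- The one-dimensional `L̂₊`-module `K_tr`, on which `L̂₊` acts by the trace character. -/
def KTr (_n : ℕ) (K : Type u) : Type u := K

instance : AddCommGroup (KTr n K) := inferInstanceAs (AddCommGroup K)
instance : Module K (KTr n K) := inferInstanceAs (Module K K)

instance : LieRingModule (Lplus n K) (KTr n K) where
  bracket D c := traceChar D • c
  add_lie a b c := by
    change traceChar (a + b) • c = traceChar a • c + traceChar b • c
    rw [map_add, add_smul]
  lie_add a b c := smul_add (traceChar a) b c
  leibniz_lie a b c := by
    change traceChar a • traceChar b • c =
      traceChar ⁅a, b⁆ • c + traceChar b • traceChar a • c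
    rw [traceChar_lie, zero_smul, zero_add, smul_comm]

instance : LieModule K (Lplus n K) (KTr n K) where
  smul_lie t a c := by
    change traceChar (t • a) • c = t • traceChar a • c
    rw [map_smul, smul_eq_mul, mul_smul]
  lie_smul t a c := smul_comm (traceChar a) t c

section Rational

variable (n K) in
/-- The datum `g ↦ det(g)^(-pole) · coact(g)` of a linear representation of `GL_n` on `W` whose
matrix coefficients are polynomials in the entries of `g`, divided by a power of `det g`. -/
structure GLForm (W : Type u) [AddCommGroup W] [Module K W] where
  coact : W →ₗ[K] MvPolynomial (Fin n × Fin n) K ⊗[K] W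
  pole : ℕ

variable {W : Type u} [AddCommGroup W] [Module K W]

/-- The operator by which a matrix `g ∈ GL_n(R)` acts on `R ⊗ W`, for a commutative
`K`-algebra `R`. -/
def GLForm.act (σ : GLForm n K W) {R : Type u} [CommRing R] [Algebra K R]
    (g : GL (Fin n) R) : Module.End R (R ⊗[K] W) :=
  (((Matrix.GeneralLinearGroup.det g)⁻¹ : Rˣ) : R) ^ σ.pole •
    LinearMap.liftBaseChange R
      ((TensorProduct.map
        (MvPolynomial.aeval (fun ij : Fin n × Fin n => (g : Matrix _ _ R) ij.1 ij.2)).toLinearMap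
        LinearMap.id) ∘ₗ σ.coact)

open DualNumber in
/-- `σ` is a rational representation of `GL_n` on the `L̂₊`-module `W`, and its differential
(computed on `GL_n(K[ε])`) is the action of `L₀ ≅ gl_n`. -/
structure GLForm.Integrates [LieRingModule (Lplus n K) W] [LieModule K (Lplus n K) W]
    (σ : GLForm n K W) : Prop where
  one : σ.act (1 : GL (Fin n) K) = 1
  mul : ∀ g h : GL (Fin n) K, σ.act (g * h) = σ.act g * σ.act h
  deriv : ∀ (M : Matrix (Fin n) (Fin n) K) (g : GL (Fin n) K[ε]),
    (g : Matrix (Fin n) (Fin n) K[ε]) = 1 + M.map (fun a => a • ε) →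
    ∀ w : W, σ.act g ((1 : K[ε]) ⊗ₜ[K] w) =
      (1 : K[ε]) ⊗ₜ[K] w + (ε : K[ε]) ⊗ₜ[K] ⁅glToLplus M, w⁆

/-- The determinant character of `GL_n`, acting on `K_tr`. -/
def detForm : GLForm n K (KTr n K) where
  coact := TensorProduct.mk K _ _ (Matrix.mvPolynomialX (Fin n) (Fin n) K).det
  pole := 0

/-- The tensor product of two representations of `GL_n`. -/
def GLForm.tensor {W' : Type u} [AddCommGroup W'] [Module K W']
    (σ : GLForm n K W) (τ : GLForm n K W') : GLForm n K (W ⊗[K] W') where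
  coact := TensorProduct.map (LinearMap.mul' K (MvPolynomial (Fin n × Fin n) K)) LinearMap.id ∘ₗ
    (TensorProduct.tensorTensorTensorComm K _ W _ W').toLinearMap ∘ₗ
      TensorProduct.map σ.coact τ.coact
  pole := σ.pole + τ.pole

end Rational

section GroupAction

variable {R : Type u} [CommRing R] [Algebra K R]

variable (K) in
/-- `exp(u) f = ∑ₖ uᵏ(f)/k!` for a derivation `u = ∑ᵢ uᵢ ∂/∂Xᵢ` whose coefficients have no terms of
degree `< 2`. As `uᵏ(f)` has no terms of degree `< k`, the coefficient at `X^s` involves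
only the terms with `k ≤ |s|`. -/
def expSeries (v : Fin n → PS n R) (f : PS n R) : PS n R := fun s =>
  ∑ k ∈ Finset.range (s.degree + 1),
    ((k.factorial : K)⁻¹) • MvPowerSeries.coeff s ((vecField v)^[k] f)

variable (K) in
/-- Let `φ` be the `R`-linear automorphism `Xᵢ ↦ φᵢ` of `R[[X₁, …, Xₙ]]`. This says that
`φ = exp(v) ∘ g` with a derivation `v = ∑ᵢ vᵢ ∂/∂Xᵢ`, where the `vᵢ` have no terms of degree `< 2`,
and the linear automorphism `g : Xᵢ ↦ ∑ⱼ gⱼᵢ Xⱼ`. Every automorphism has exactly one such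
factorization. -/
structure IsFactorization (φ : Fin n → PS n R) (g : GL (Fin n) R) (v : Fin n → PS n R) :
    Prop where
  unipotent : ∀ i s, s.degree < 2 → MvPowerSeries.coeff s (v i) = 0
  eq : ∀ i, φ i = ∑ j, (g : Matrix (Fin n) (Fin n) R) j i •
    expSeries K v (MvPowerSeries.X j : PS n R)

variable (W : Type u) [AddCommGroup W] [Module K W]
  [LieRingModule (Lplus n K) W] [LieModule K (Lplus n K) W]

variable (K) in
/-- The action on `R ⊗ W` of the derivation `∑ᵢ vᵢ ∂/∂Xᵢ` with coefficients in `R[[X₁, …, Xₙ]]`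
(the constant terms of the `vᵢ` being discarded). For finite-dimensional `W`, only finitely many of
the `X^s ∂/∂Xᵢ` act on `W` in a non-zero way, so the sum is finite. -/
def lieAct (v : Fin n → PS n R) : Module.End R (R ⊗[K] W) :=
  ∑ᶠ s : {s : Fin n →₀ ℕ // s ≠ 0}, ∑ i, MvPowerSeries.coeff s.1 (v i) •
    (LieModule.toEnd K (Lplus n K) W (mono s i)).baseChange R

variable (K) in
/-- The exponential of a nilpotent operator. -/
def expEnd {M : Type u} [AddCommGroup M] [Module R M] (T : Module.End R M) : Module.End R M :=
  ∑ᶠ k : ℕ, algebraMap K R ((k.factorial : K)⁻¹) • T ^ k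

variable {W} in
/-- The operator `ρ(φ)` on `R ⊗ W` for the automorphism `φ = exp(v) ∘ g` of `R[[X₁, …, Xₙ]]`. -/
def autAct (σ : GLForm n K W) (g : GL (Fin n) R) (v : Fin n → PS n R) :
    Module.End R (R ⊗[K] W) :=
  expEnd K (lieAct K W v) * σ.act g

/-- The Taylor series `f(x + X) = ∑ₛ (1/s!) ∂ˢf Xˢ` with respect to (commuting) derivations
`∂₁, …, ∂ₙ` of `R`. -/
def taylor (d : Fin n → Derivation K R R) (f : R) : PS n R := fun s =>
  ((∏ i, (s i).factorial : ℕ) : K)⁻¹ •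
    (List.ofFn fun i => ((d i : R →ₗ[K] R) : Module.End K R) ^ s i).prod f

end GroupAction

end Formal


section Geometry

variable (K : Type u) [Field K] {X : Scheme.{u}} [X.Over (Spec (.of K))]

/-- The structure map `K → Γ(X, U)` of a scheme over `Spec K`. -/
def structureMap (U : X.Opens) : K →+* Γ(X, U) :=
  (X.presheaf.map (homOfLE (le_top : U ≤ ⊤)).op).hom.comp
    ((X ↘ Spec (.of K)).appTop.hom.comp (Scheme.ΓSpecIso (.of K)).inv.hom)

instance (U : X.Opens) : Algebra K Γ(X, U) := (structureMap K U).toAlgebra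

instance (P : X) : Algebra K (X.presheaf.stalk P) :=
  ((X.presheaf.germ ⊤ P trivial).hom.comp (structureMap K ⊤)).toAlgebra

/-- Restriction of functions. -/
def resFun {U V : X.Opens} (h : V ≤ U) : Γ(X, U) →ₐ[K] Γ(X, V) where
  toRingHom := (X.presheaf.map (homOfLE h).op).hom
  commutes' c := by
    change (X.presheaf.map (homOfLE h).op).hom
      ((X.presheaf.map (homOfLE (le_top : U ≤ ⊤)).op).hom _) =
      (X.presheaf.map (homOfLE (le_top : V ≤ ⊤)).op).hom _
    rw [← CommRingCat.comp_apply, ← X.presheaf.map_comp]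
    rfl

theorem resFun_id {U : X.Opens} (f : Γ(X, U)) : resFun K (le_refl U) f = f := by
  change (X.presheaf.map (𝟙 _)).hom f = f
  rw [X.presheaf.map_id]; rfl

theorem resFun_comp {U V V' : X.Opens} (h : V ≤ U) (h' : V' ≤ V) (f : Γ(X, U)) :
    resFun K h' (resFun K h f) = resFun K (h'.trans h) f := by
  change (X.presheaf.map (homOfLE h').op).hom ((X.presheaf.map (homOfLE h).op).hom f) = _
  rw [← CommRingCat.comp_apply, ← X.presheaf.map_comp]
  rfl

/-- The germ of a function at a point. -/
def germFun {U : X.Opens} {P : X} (hP : P ∈ U) : Γ(X, U) →ₐ[K] X.presheaf.stalk P where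
  toRingHom := (X.presheaf.germ U P hP).hom
  commutes' c := by
    change (X.presheaf.germ U P hP).hom
      ((X.presheaf.map (homOfLE (le_top : U ≤ ⊤)).op).hom _) = (X.presheaf.germ ⊤ P trivial).hom
        ((X.presheaf.map (homOfLE (le_top : (⊤ : X.Opens) ≤ ⊤)).op).hom _)
    exact (TopCat.Presheaf.germ_res_apply X.presheaf _ _ _ _).trans
      (TopCat.Presheaf.germ_res_apply X.presheaf _ _ _ _).symm

theorem germFun_res {U V : X.Opens} (h : V ≤ U) {P : X} (hP : P ∈ V) (f : Γ(X, U)) :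
    germFun K hP (resFun K h f) = germFun K (h hP) f :=
  TopCat.Presheaf.germ_res_apply X.presheaf (homOfLE h) P hP f

/-- Vector fields on `U`, i.e. the sections over `U` of the tangent sheaf `Θ`: the `K`-linear
derivations of the sheaf of rings `𝒪_X` restricted to `U`. -/
@[ext]
structure VectorField (U : X.Opens) where
  der : ∀ V : X.Opens, V ≤ U → Derivation K Γ(X, V) Γ(X, V)
  der_res : ∀ (V V' : X.Opens) (h : V' ≤ V) (hV : V ≤ U) (f : Γ(X, V)),
    resFun K h (der V hV f) = der V' (h.trans hV) (resFun K h f)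

variable {K}

namespace VectorField

variable {U : X.Opens}

instance : Add (VectorField K U) where
  add η μ := ⟨fun V h => η.der V h + μ.der V h, fun V V' h hV f => by
    simp [η.der_res, μ.der_res]⟩

instance : SMul K (VectorField K U) where
  smul c η := ⟨fun V h => c • η.der V h, fun V V' h hV f => by
    simp [η.der_res]⟩

/-- Multiplication of vector fields by functions. -/
instance : SMul Γ(X, U) (VectorField K U) where
  smul g η := ⟨fun V h => resFun K h g • η.der V h, fun V V' h hV f => by
    simp [η.der_res, resFun_comp]⟩

/-- The Lie bracket of vector fields. -/
instance : Bracket (VectorField K U) (VectorField K U) where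
  bracket η μ := ⟨fun V h => ⁅η.der V h, μ.der V h⁆, fun V V' h hV f => by
    simp [Derivation.commutator_apply, η.der_res, μ.der_res]⟩

/-- The action of vector fields on functions. -/
def app (η : VectorField K U) (f : Γ(X, U)) : Γ(X, U) := η.der U le_rfl f

/-- Restriction of vector fields. -/
def restrict (η : VectorField K U) {V : X.Opens} (h : V ≤ U) : VectorField K V :=
  ⟨fun V' h' => η.der V' (h'.trans h), fun V V' h _ f => η.der_res V V' h _ f⟩

section Stalk

variable {P : X}

theorem exists_germ_le (hP : P ∈ U) (a : X.presheaf.stalk P) :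
    ∃ (V : X.Opens) (_ : V ≤ U) (hPV : P ∈ V) (f : Γ(X, V)), germFun K hPV f = a := by
  obtain ⟨V, hV, f, rfl⟩ := TopCat.Presheaf.exists_germ_eq X.presheaf a
  exact ⟨V ⊓ U, inf_le_right, ⟨hV, hP⟩, resFun K inf_le_left f, germFun_res K _ _ _⟩

theorem exists_der_germ (η : VectorField K U) (hP : P ∈ U) (a : X.presheaf.stalk P) :
    ∃ b : X.presheaf.stalk P, ∀ (V : X.Opens) (hV : V ≤ U) (hPV : P ∈ V) (f : Γ(X, V)),
      germFun K hPV f = a → germFun K hPV (η.der V hV f) = b := by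
  obtain ⟨V, hV, hPV, f, rfl⟩ := exists_germ_le (K := K) hP a
  refine ⟨germFun K hPV (η.der V hV f), fun V' hV' hPV' f' h => ?_⟩
  obtain ⟨V₀, hP₀, i, j, hij⟩ :=
    TopCat.Presheaf.germ_eq X.presheaf P hPV' hPV f' f h
  have hij' : resFun K i.le f' = resFun K j.le f := hij
  rw [← germFun_res K i.le hP₀, ← germFun_res K j.le hP₀, η.der_res _ _ _ hV',
    η.der_res _ _ _ hV, hij']

theorem exists_germ_le₂ (hP : P ∈ U) (a b : X.presheaf.stalk P) :
    ∃ (V : X.Opens) (_ : V ≤ U) (hPV : P ∈ V) (f g : Γ(X, V)),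
      germFun K hPV f = a ∧ germFun K hPV g = b := by
  obtain ⟨V, hV, hPV, f, rfl⟩ := exists_germ_le (K := K) hP a
  obtain ⟨V', hV', hPV', g, rfl⟩ := exists_germ_le (K := K) hP b
  exact ⟨V ⊓ V', inf_le_left.trans hV, ⟨hPV, hPV'⟩, resFun K inf_le_left f,
    resFun K inf_le_right g, germFun_res K _ _ _, germFun_res K _ _ _⟩

/-- The value at a germ of the derivation of `𝒪_{X,P}` induced by a vector field. -/
def stalkFun (η : VectorField K U) (hP : P ∈ U) (a : X.presheaf.stalk P) :
    X.presheaf.stalk P :=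
  (exists_der_germ η hP a).choose

theorem stalkFun_germ (η : VectorField K U) (hP : P ∈ U) {V : X.Opens} (hV : V ≤ U)
    (hPV : P ∈ V) (f : Γ(X, V)) :
    stalkFun η hP (germFun K hPV f) = germFun K hPV (η.der V hV f) :=
  ((exists_der_germ η hP (germFun K hPV f)).choose_spec V hV hPV f rfl).symm

/-- The derivation of the local ring `𝒪_{X,P}` induced by a vector field on a neighbourhood
of `P`. -/
def stalk (η : VectorField K U) (hP : P ∈ U) :
    Derivation K (X.presheaf.stalk P) (X.presheaf.stalk P) :=
  Derivation.mk'
    { toFun := stalkFun η hP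
      map_add' := fun a b => by
        obtain ⟨V, hV, hPV, f, g, rfl, rfl⟩ := exists_germ_le₂ (K := K) hP a b
        rw [← map_add, stalkFun_germ η hP hV, stalkFun_germ η hP hV, stalkFun_germ η hP hV,
          map_add, map_add]
      map_smul' := fun c a => by
        obtain ⟨V, hV, hPV, f, rfl⟩ := exists_germ_le (K := K) hP a
        rw [← map_smul, stalkFun_germ η hP hV, stalkFun_germ η hP hV, Derivation.map_smul, map_smul]
        rfl }
    (fun a b => by
      obtain ⟨V, hV, hPV, f, g, rfl, rfl⟩ := exists_germ_le₂ (K := K) hP a b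
      change stalkFun η hP _ = _ • stalkFun η hP _ + _ • stalkFun η hP _
      rw [← map_mul, stalkFun_germ η hP hV, stalkFun_germ η hP hV, stalkFun_germ η hP hV,
        Derivation.leibniz, map_add, smul_eq_mul, smul_eq_mul, map_mul, map_mul]
      rfl)

theorem stalk_germ (η : VectorField K U) (hP : P ∈ U) {V : X.Opens} (hV : V ≤ U)
    (hPV : P ∈ V) (f : Γ(X, V)) :
    stalk η hP (germFun K hPV f) = germFun K hPV (η.der V hV f) :=
  stalkFun_germ η hP hV hPV f

theorem stalk_restrict (η : VectorField K U) {V : X.Opens} (h : V ≤ U) (hP : P ∈ V) :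
    (η.restrict h).stalk hP = η.stalk (h hP) := by
  ext a
  obtain ⟨V', hV', hPV, f, rfl⟩ := exists_germ_le (K := K) hP a
  rw [stalk_germ _ hP hV', stalk_germ _ (h hP) (hV'.trans h)]
  rfl

theorem stalk_add (η μ : VectorField K U) (hP : P ∈ U) :
    (η + μ).stalk hP = η.stalk hP + μ.stalk hP := by
  ext a
  obtain ⟨V', hV', hPV, f, rfl⟩ := exists_germ_le (K := K) hP a
  rw [Derivation.add_apply, stalk_germ _ hP hV', stalk_germ _ hP hV', stalk_germ _ hP hV',
    ← map_add]
  rfl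

theorem stalk_smul (c : K) (η : VectorField K U) (hP : P ∈ U) :
    (c • η).stalk hP = c • η.stalk hP := by
  ext a
  obtain ⟨V', hV', hPV, f, rfl⟩ := exists_germ_le (K := K) hP a
  rw [Derivation.smul_apply, stalk_germ _ hP hV', stalk_germ _ hP hV', ← map_smul]
  rfl

theorem stalk_lie (η μ : VectorField K U) (hP : P ∈ U) :
    ⁅η, μ⁆.stalk hP = ⁅η.stalk hP, μ.stalk hP⁆ := by
  ext a
  obtain ⟨V', hV', hPV, f, rfl⟩ := exists_germ_le (K := K) hP a
  rw [Derivation.commutator_apply, stalk_germ _ hP hV', stalk_germ _ hP hV',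
    stalk_germ _ hP hV', stalk_germ _ hP hV', stalk_germ _ hP hV', ← map_sub,
    ← Derivation.commutator_apply]
  rfl

end Stalk

end VectorField

variable (K X) in
/-- An étale chart: an affine open subset with uniformizing parameters `x₁, …, xₙ`. The derivations
`∂/∂xᵢ` are uniquely determined by the `xᵢ` (if `X` is integral and `char K = 0`). -/
structure EtaleChart (n : ℕ) where
  U : X.Opens
  isAffine : IsAffineOpen U
  x : Fin n → Γ(X, U)
  algebraicIndependent : AlgebraicIndependent K x
  isAlgebraic : ∀ f : Γ(X, U), IsAlgebraic (Algebra.adjoin K (Set.range x)) f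
  pd : Fin n → VectorField K U
  pd_x : ∀ i j, (pd i).app (x j) = if i = j then 1 else 0

/-- The Taylor expansion of a function on an open subset of an étale chart, in the parameters of
the chart. -/
def EtaleChart.taylor {n : ℕ} (c : EtaleChart K X n) {V : X.Opens} (hV : V ≤ c.U) (f : Γ(X, V)) :
    PS n Γ(X, V) :=
  AVMod.taylor (fun i => (c.pd i).der V hV) f

end Geometry

section AVSheaves

variable (K : Type u) [Field K] (X : Scheme.{u}) [X.Over (Spec (.of K))]

/-- Presheaves of `AV`-modules: presheaves of `𝒪_X`-modules with a compatible action of the Lie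
algebras of vector fields, subject to the Leibniz rule. A sheaf of `AV`-modules is such a
presheaf that is a sheaf; homomorphisms of sheaves are homomorphisms of presheaves. -/
structure AVPresheaf where
  obj : X.Opens → Type u
  [addCommGroup : ∀ U, AddCommGroup (obj U)]
  [module : ∀ U, Module Γ(X, U) (obj U)]
  act : ∀ {U : X.Opens}, VectorField K U → obj U →+ obj U
  res : ∀ {U V : X.Opens}, V ≤ U → (obj U →+ obj V)
  add_act : ∀ {U : X.Opens} (η μ : VectorField K U) (m : obj U),
    act (η + μ) m = act η m + act μ m
  smul_act : ∀ {U : X.Opens} (c : K) (η : VectorField K U) (m : obj U),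
    act (c • η) m = algebraMap K Γ(X, U) c • act η m
  lie_act : ∀ {U : X.Opens} (η μ : VectorField K U) (m : obj U),
    act ⁅η, μ⁆ m = act η (act μ m) - act μ (act η m)
  leibniz : ∀ {U : X.Opens} (η : VectorField K U) (f : Γ(X, U)) (m : obj U),
    act η (f • m) = η.app f • m + f • act η m
  res_id : ∀ {U : X.Opens} (m : obj U), res (le_refl U) m = m
  res_comp : ∀ {U V V' : X.Opens} (h : V ≤ U) (h' : V' ≤ V) (m : obj U),
    res h' (res h m) = res (h'.trans h) m
  res_smul : ∀ {U V : X.Opens} (h : V ≤ U) (f : Γ(X, U)) (m : obj U),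
    res h (f • m) = resFun K h f • res h m
  res_act : ∀ {U V : X.Opens} (h : V ≤ U) (η : VectorField K U) (m : obj U),
    res h (act η m) = act (η.restrict h) (res h m)

attribute [instance] AVPresheaf.addCommGroup AVPresheaf.module

variable {K X}

namespace AVPresheaf

/-- Isomorphisms of (pre)sheaves of `AV`-modules. -/
structure Iso (M N : AVPresheaf K X) where
  equiv : ∀ U, M.obj U ≃+ N.obj U
  map_smul : ∀ U (f : Γ(X, U)) (m : M.obj U), equiv U (f • m) = f • equiv U m
  map_act : ∀ U (η : VectorField K U) (m : M.obj U), equiv U (M.act η m) = N.act η (equiv U m)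
  map_res : ∀ {U V : X.Opens} (h : V ≤ U) (m : M.obj U),
    equiv V (M.res h m) = N.res h (equiv U m)

/-- `M` is `N`-differentiable: it is annihilated by the elements
`∑ₖ (-1)ᵏ (N choose k) fᵏ # f^(N-k) η` of `A # V`, which span `Δᴺ ⊗_A V`. The action of `A # V` on
a differentiable module factors through `(A ⊗ A)/Δᴺ ⊗_A V`, and so extends to the completion
`A #̂ V`; a homomorphism of differentiable modules is automatically compatible with this. -/
def IsDifferentiable (M : AVPresheaf K X) (N : ℕ) : Prop :=
  ∀ (U : X.Opens) (f : Γ(X, U)) (η : VectorField K U) (m : M.obj U),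
    ∑ k ∈ Finset.range (N + 1), ((-1) ^ k * (N.choose k : Γ(X, U)) * f ^ k) •
      M.act (f ^ (N - k) • η) m = 0

/-! ### Stalks and the associated sheaf -/

section Stalk

variable (M : AVPresheaf K X) (P : X)

/-- The open neighbourhoods of `P`, ordered by reverse inclusion. -/
structure Nhd where
  U : X.Opens
  mem : P ∈ U

instance : Preorder (Nhd P) where
  le a b := b.U ≤ a.U
  le_refl a := le_refl a.U
  le_trans a b c h h' := le_trans (α := X.Opens) h' h

instance : Nonempty (Nhd P) := ⟨⟨⊤, trivial⟩⟩

instance : IsDirectedOrder (Nhd P) where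
  directed a b := ⟨⟨a.U ⊓ b.U, ⟨a.mem, b.mem⟩⟩, (inf_le_left : a.U ⊓ b.U ≤ a.U),
    (inf_le_right : a.U ⊓ b.U ≤ b.U)⟩

/-- The transition maps of the system of sections of `M` over the neighbourhoods of `P`. -/
abbrev nhdRes (i j : Nhd P) (h : i ≤ j) : M.obj i.U →+ M.obj j.U := M.res h

instance : DirectedSystem (fun i : Nhd P => M.obj i.U) (M.nhdRes P · · ·) where
  map_self _ _ := M.res_id _
  map_map _ _ _ h h' _ := M.res_comp h h' _

/-- The stalk of `M` at `P`. -/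
abbrev Stalk : Type u := DirectLimit (fun i : Nhd P => M.obj i.U) (M.nhdRes P)

variable {P}

/-- The germ of a section of `M`. -/
def germ {U : X.Opens} (hP : P ∈ U) (m : M.obj U) : M.Stalk P :=
  ⟦⟨⟨U, hP⟩, m⟩⟧

theorem germ_res {U V : X.Opens} (h : V ≤ U) (hP : P ∈ V) (m : M.obj U) :
    M.germ hP (M.res h m) = M.germ (h hP) m :=
  DirectLimit.mk_apply (F := fun i : Nhd P => M.obj i.U) (f := M.nhdRes P) ⟨U, h hP⟩ ⟨V, hP⟩
    m h

theorem germ_add {U : X.Opens} (hP : P ∈ U) (m m' : M.obj U) :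
    M.germ hP (m + m') = M.germ hP m + M.germ hP m' :=
  (DirectLimit.add_def (G := fun i : Nhd P => M.obj i.U) (f := M.nhdRes P) ⟨U, hP⟩ m m').symm

theorem exists_germ {U : X.Opens} (hP : P ∈ U) (a : M.Stalk P) :
    ∃ (V : X.Opens) (_ : V ≤ U) (hPV : P ∈ V) (m : M.obj V), M.germ hPV m = a := by
  obtain ⟨i, m, rfl⟩ := DirectLimit.exists_eq_mk _ a
  exact ⟨i.U ⊓ U, inf_le_right, ⟨i.mem, hP⟩, M.res inf_le_left m, M.germ_res _ _ _⟩

theorem exists_germ₂ {U : X.Opens} (hP : P ∈ U) (a b : M.Stalk P) :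
    ∃ (V : X.Opens) (_ : V ≤ U) (hPV : P ∈ V) (m m' : M.obj V),
      M.germ hPV m = a ∧ M.germ hPV m' = b := by
  obtain ⟨V, hV, hPV, m, rfl⟩ := M.exists_germ hP a
  obtain ⟨V', hV', hPV', m', rfl⟩ := M.exists_germ hP b
  exact ⟨V ⊓ V', inf_le_left.trans hV, ⟨hPV, hPV'⟩, M.res inf_le_left m,
    M.res inf_le_right m', M.germ_res _ _ _, M.germ_res _ _ _⟩

/-- Additive operators on sections over the open subsets of `U`, compatible with restriction. -/
structure LocalOp (U : X.Opens) where
  op : ∀ V : X.Opens, V ≤ U → (M.obj V →+ M.obj V)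
  op_res : ∀ (V V' : X.Opens) (h : V' ≤ V) (hV : V ≤ U) (m : M.obj V),
    M.res h (op V hV m) = op V' (h.trans hV) (M.res h m)

variable {M}

/-- The operator on the stalk at `P ∈ U` induced by a local operator on `U`. -/
def LocalOp.stalk {U : X.Opens} (T : M.LocalOp U) (hP : P ∈ U) : M.Stalk P →+ M.Stalk P :=
  have compat : ∀ (i j : Nhd P) (h : i ≤ j) (m : M.obj i.U),
      M.germ (U := i.U ⊓ U) ⟨i.mem, hP⟩ (T.op _ inf_le_right (M.res inf_le_left m)) =
      M.germ (U := j.U ⊓ U) ⟨j.mem, hP⟩ (T.op _ inf_le_right (M.res inf_le_left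
        (M.nhdRes P i j h m))) := by
    intro i j h m
    have hle : j.U ⊓ U ≤ i.U ⊓ U := inf_le_inf_right _ h
    rw [← M.germ_res hle ⟨j.mem, hP⟩, T.op_res _ _ hle, M.res_comp, M.res_comp]
  have lift_germ : ∀ {V : X.Opens} (hV : V ≤ U) (hPV : P ∈ V) (m : M.obj V),
      DirectLimit.lift (M.nhdRes P) (fun i m =>
        M.germ (U := i.U ⊓ U) ⟨i.mem, hP⟩ (T.op _ inf_le_right (M.res inf_le_left m)))
        compat (M.germ hPV m) = M.germ hPV (T.op V hV m) := by
    intro V hV hPV m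
    change M.germ (U := V ⊓ U) ⟨hPV, hP⟩ (T.op _ inf_le_right (M.res inf_le_left m)) = _
    rw [← M.germ_res (inf_le_left : V ⊓ U ≤ V) ⟨hPV, hP⟩, T.op_res]
  AddMonoidHom.mk' (DirectLimit.lift (M.nhdRes P) (fun i m =>
      M.germ (U := i.U ⊓ U) ⟨i.mem, hP⟩ (T.op _ inf_le_right (M.res inf_le_left m))) compat)
    (fun a b => by
      obtain ⟨V, hV, hPV, m, m', rfl, rfl⟩ := M.exists_germ₂ hP a b
      rw [← germ_add, lift_germ hV, lift_germ hV, lift_germ hV, map_add, germ_add])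

theorem LocalOp.stalk_germ {U : X.Opens} (T : M.LocalOp U) (hP : P ∈ U) {V : X.Opens}
    (hV : V ≤ U) (hPV : P ∈ V) (m : M.obj V) :
    T.stalk hP (M.germ hPV m) = M.germ hPV (T.op V hV m) := by
  change M.germ (U := V ⊓ U) ⟨hPV, hP⟩ (T.op _ inf_le_right (M.res inf_le_left m)) = _
  rw [← M.germ_res (inf_le_left : V ⊓ U ≤ V) ⟨hPV, hP⟩, T.op_res]

variable (M)

/-- Multiplication by a function, as a local operator. -/
def smulOp {U : X.Opens} (f : Γ(X, U)) : M.LocalOp U where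
  op _ hV := DistribSMul.toAddMonoidHom _ (resFun K hV f)
  op_res _ _ h _ m := by
    simp [M.res_smul, resFun_comp]

/-- The action of a vector field, as a local operator. -/
def actOp {U : X.Opens} (η : VectorField K U) : M.LocalOp U where
  op _ hV := M.act (η.restrict hV)
  op_res _ _ h _ m := M.res_act h _ m

end Stalk

section Sheafify

variable (M : AVPresheaf K X)

/-- The sections over `U` of the sheaf associated with `M`: the families of germs, one at each point
of `U`, that come locally from sections of `M`. -/
def shSections (U : X.Opens) : AddSubgroup (∀ P : U, M.Stalk P.1) where
  carrier := {s | ∀ P : U, ∃ (V : X.Opens) (hV : V ≤ U) (_ : P.1 ∈ V) (m : M.obj V),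
    ∀ (Q : X) (hQ : Q ∈ V), s ⟨Q, hV hQ⟩ = M.germ hQ m}
  add_mem' := by
    intro s t hs ht P
    obtain ⟨V, hV, hP, m, hm⟩ := hs P
    obtain ⟨V', hV', hP', m', hm'⟩ := ht P
    refine ⟨V ⊓ V', inf_le_left.trans hV, ⟨hP, hP'⟩, M.res inf_le_left m + M.res inf_le_right m',
      fun Q hQ => ?_⟩
    rw [germ_add, germ_res, germ_res, ← hm Q hQ.1, ← hm' Q hQ.2]
    rfl
  zero_mem' := by
    intro P
    refine ⟨U, le_rfl, P.2, 0, fun Q hQ => ?_⟩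
    have := M.germ_add hQ 0 0
    rw [add_zero] at this
    exact (left_eq_add.mp this).symm
  neg_mem' := by
    intro s hs P
    obtain ⟨V, hV, hP, m, hm⟩ := hs P
    refine ⟨V, hV, hP, -m, fun Q hQ => ?_⟩
    have h0 := M.germ_add hQ 0 0
    rw [add_zero] at h0
    have h1 := M.germ_add hQ m (-m)
    rw [add_neg_cancel, left_eq_add.mp h0] at h1
    rw [Pi.neg_apply, hm Q hQ]
    exact neg_eq_of_add_eq_zero_right h1.symm

/-- The operator on sections of the associated sheaf induced by a local operator. -/
def LocalOp.sh {M : AVPresheaf K X} {U : X.Opens} (T : M.LocalOp U) :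
    M.shSections U →+ M.shSections U where
  toFun s := ⟨fun P => T.stalk P.2 (s.1 P), fun P => by
    obtain ⟨V, hV, hP, m, hm⟩ := s.2 P
    exact ⟨V, hV, hP, T.op V hV m, fun Q hQ =>
      (congrArg (T.stalk (hV hQ)) (hm Q hQ)).trans (T.stalk_germ (hV hQ) hV hQ m)⟩⟩
  map_zero' := by
    ext P
    exact map_zero _
  map_add' s t := by
    ext P
    exact map_add _ _ _

/-- Sections of the associated sheaf are determined by their germs. -/
theorem shSections_ext {U : X.Opens} {s t : M.shSections U} (h : ∀ P, s.1 P = t.1 P) : s = t :=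
  Subtype.ext (funext h)

instance (U : X.Opens) : Module Γ(X, U) (M.shSections U) where
  smul f s := (M.smulOp f).sh s
  one_smul s := M.shSections_ext fun P => by
    change (M.smulOp 1).stalk P.2 (s.1 P) = s.1 P
    obtain ⟨V, hV, hP, m, h⟩ := M.exists_germ P.2 (s.1 P)
    rw [← h, LocalOp.stalk_germ _ _ hV]
    simp [smulOp]
  mul_smul f g s := M.shSections_ext fun P => by
    change (M.smulOp (f * g)).stalk P.2 (s.1 P) =
      (M.smulOp f).stalk P.2 ((M.smulOp g).stalk P.2 (s.1 P))
    obtain ⟨V, hV, hP, m, h⟩ := M.exists_germ P.2 (s.1 P)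
    rw [← h, LocalOp.stalk_germ _ _ hV, LocalOp.stalk_germ _ _ hV, LocalOp.stalk_germ _ _ hV]
    simp [smulOp, mul_smul]
  smul_zero f := map_zero _
  smul_add f s t := map_add _ s t
  add_smul f g s := M.shSections_ext fun P => by
    change (M.smulOp (f + g)).stalk P.2 (s.1 P) =
      (M.smulOp f).stalk P.2 (s.1 P) + (M.smulOp g).stalk P.2 (s.1 P)
    obtain ⟨V, hV, hP, m, h⟩ := M.exists_germ P.2 (s.1 P)
    rw [← h, LocalOp.stalk_germ _ _ hV, LocalOp.stalk_germ _ _ hV, LocalOp.stalk_germ _ _ hV,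
      ← germ_add]
    simp [smulOp, add_smul]
  zero_smul s := M.shSections_ext fun P => by
    change (M.smulOp 0).stalk P.2 (s.1 P) = 0
    obtain ⟨V, hV, hP, m, h⟩ := M.exists_germ P.2 (s.1 P)
    have h0 := M.germ_add hP 0 0
    rw [add_zero] at h0
    rw [← h, LocalOp.stalk_germ _ _ hV, ← left_eq_add.mp h0]
    simp [smulOp]

/-- The sheaf of `AV`-modules associated with a presheaf of `AV`-modules. -/
def sheafify : AVPresheaf K X where
  obj U := M.shSections U
  act η := (M.actOp η).sh
  res h :=
    { toFun := fun s => ⟨fun P => s.1 ⟨P.1, h P.2⟩, fun P => by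
        obtain ⟨V, hV, hP, m, hm⟩ := s.2 ⟨P.1, h P.2⟩
        exact ⟨V ⊓ _, inf_le_right, ⟨hP, P.2⟩, M.res inf_le_left m, fun Q hQ => by
          rw [germ_res]; exact hm Q hQ.1⟩⟩
      map_zero' := rfl
      map_add' := fun _ _ => rfl }
  add_act {U} η μ s := M.shSections_ext fun P => by
    change (M.actOp (η + μ)).stalk P.2 (s.1 P) =
      (M.actOp η).stalk P.2 (s.1 P) + (M.actOp μ).stalk P.2 (s.1 P)
    obtain ⟨V, hV, hP, m, h⟩ := M.exists_germ P.2 (s.1 P)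
    rw [← h, LocalOp.stalk_germ _ _ hV, LocalOp.stalk_germ _ _ hV, LocalOp.stalk_germ _ _ hV,
      ← germ_add]
    exact congrArg _ (M.add_act (η.restrict hV) (μ.restrict hV) m)
  smul_act {U} c η s := M.shSections_ext fun P => by
    change (M.actOp (c • η)).stalk P.2 (s.1 P) =
      (M.smulOp (algebraMap K Γ(X, U) c)).stalk P.2 ((M.actOp η).stalk P.2 (s.1 P))
    obtain ⟨V, hV, hP, m, h⟩ := M.exists_germ P.2 (s.1 P)
    rw [← h, LocalOp.stalk_germ _ _ hV, LocalOp.stalk_germ _ _ hV, LocalOp.stalk_germ _ _ hV]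
    refine congrArg _ ((M.smul_act c (η.restrict hV) m).trans ?_)
    change _ = resFun K hV (algebraMap K Γ(X, U) c) • M.act (η.restrict hV) m
    rw [AlgHom.commutes]
  lie_act {U} η μ s := M.shSections_ext fun P => by
    change (M.actOp ⁅η, μ⁆).stalk P.2 (s.1 P) =
      (M.actOp η).stalk P.2 ((M.actOp μ).stalk P.2 (s.1 P)) -
        (M.actOp μ).stalk P.2 ((M.actOp η).stalk P.2 (s.1 P))
    obtain ⟨V, hV, hP, m, h⟩ := M.exists_germ P.2 (s.1 P)
    rw [← h, LocalOp.stalk_germ _ _ hV, LocalOp.stalk_germ _ _ hV, LocalOp.stalk_germ _ _ hV,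
      LocalOp.stalk_germ _ _ hV, LocalOp.stalk_germ _ _ hV, eq_sub_iff_add_eq, ← germ_add]
    refine congrArg _ ?_
    rw [← eq_sub_iff_add_eq]
    exact M.lie_act (η.restrict hV) (μ.restrict hV) m
  leibniz {U} η f s := M.shSections_ext fun P => by
    change (M.actOp η).stalk P.2 ((M.smulOp f).stalk P.2 (s.1 P)) =
      (M.smulOp (η.app f)).stalk P.2 (s.1 P) +
        (M.smulOp f).stalk P.2 ((M.actOp η).stalk P.2 (s.1 P))
    obtain ⟨V, hV, hP, m, h⟩ := M.exists_germ P.2 (s.1 P)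
    rw [← h, LocalOp.stalk_germ _ _ hV, LocalOp.stalk_germ _ _ hV, LocalOp.stalk_germ _ _ hV,
      LocalOp.stalk_germ _ _ hV, LocalOp.stalk_germ _ _ hV, ← germ_add]
    refine congrArg _ ((M.leibniz (η.restrict hV) (resFun K hV f) m).trans ?_)
    change _ = resFun K hV (η.der U le_rfl f) • m + resFun K hV f • M.act (η.restrict hV) m
    rw [η.der_res]
    rfl
  res_id _ := rfl
  res_comp _ _ _ := rfl
  res_smul {U V} h f s := M.shSections_ext fun P => by
    change (M.smulOp f).stalk (h P.2) (s.1 ⟨P.1, h P.2⟩) =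
      (M.smulOp (resFun K h f)).stalk P.2 (s.1 ⟨P.1, h P.2⟩)
    obtain ⟨V', hV', hP, m, hm⟩ := M.exists_germ P.2 (s.1 ⟨P.1, h P.2⟩)
    rw [← hm, LocalOp.stalk_germ _ _ (hV'.trans h), LocalOp.stalk_germ _ _ hV']
    simp [smulOp, resFun_comp]
  res_act {U V} h η s := M.shSections_ext fun P => by
    change (M.actOp η).stalk (h P.2) (s.1 ⟨P.1, h P.2⟩) =
      (M.actOp (η.restrict h)).stalk P.2 (s.1 ⟨P.1, h P.2⟩)
    obtain ⟨V', hV', hP, m, hm⟩ := M.exists_germ P.2 (s.1 ⟨P.1, h P.2⟩)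
    rw [← hm, LocalOp.stalk_germ _ _ (hV'.trans h), LocalOp.stalk_germ _ _ hV']
    rfl

end Sheafify

section Tensor

variable (M N : AVPresheaf K X)

/-- The action of a vector field on `M(U) ⊗ N(U)`: `η(m ⊗ m') = ηm ⊗ m' + m ⊗ ηm'`. -/
def tensorAct {U : X.Opens} (η : VectorField K U) :
    M.obj U ⊗[Γ(X, U)] N.obj U →+ M.obj U ⊗[Γ(X, U)] N.obj U :=
  TensorProduct.liftAddHom
    { toFun := fun m =>
        { toFun := fun n => M.act η m ⊗ₜ n + m ⊗ₜ N.act η n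
          map_zero' := by simp
          map_add' := fun n n' => by
            rw [TensorProduct.tmul_add, map_add, TensorProduct.tmul_add]; abel }
      map_zero' := by ext n; simp
      map_add' := fun m m' => by
        ext n
        simp only [AddMonoidHom.add_apply, AddMonoidHom.coe_mk, ZeroHom.coe_mk, map_add, TensorProduct.add_tmul]
        abel }
    (fun f m n => by
      simp only [AddMonoidHom.coe_mk, ZeroHom.coe_mk, M.leibniz, N.leibniz,
        TensorProduct.add_tmul, TensorProduct.tmul_add, TensorProduct.smul_tmul]
      abel)

theorem tensorAct_tmul {U : X.Opens} (η : VectorField K U) (m : M.obj U) (n : N.obj U) :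
    tensorAct M N η (m ⊗ₜ n) = M.act η m ⊗ₜ n + m ⊗ₜ N.act η n := rfl

/-- The restriction maps `M(U) ⊗ N(U) → M(V) ⊗ N(V)`. -/
def tensorRes {U V : X.Opens} (h : V ≤ U) :
    M.obj U ⊗[Γ(X, U)] N.obj U →+ M.obj V ⊗[Γ(X, V)] N.obj V :=
  TensorProduct.liftAddHom
    { toFun := fun m =>
        { toFun := fun n => M.res h m ⊗ₜ N.res h n
          map_zero' := by simp
          map_add' := fun n n' => by rw [map_add, TensorProduct.tmul_add] }
      map_zero' := by ext n; simp
      map_add' := fun m m' => by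
        ext n
        simp only [AddMonoidHom.add_apply, AddMonoidHom.coe_mk, ZeroHom.coe_mk, map_add, TensorProduct.add_tmul] }
    (fun f m n => by
      simp only [AddMonoidHom.coe_mk, ZeroHom.coe_mk, M.res_smul, N.res_smul,
        TensorProduct.smul_tmul])

theorem tensorRes_tmul {U V : X.Opens} (h : V ≤ U) (m : M.obj U) (n : N.obj U) :
    tensorRes M N h (m ⊗ₜ n) = M.res h m ⊗ₜ N.res h n := rfl

/-- The presheaf `U ↦ M(U) ⊗_{𝒪(U)} N(U)`. -/
def preTensor : AVPresheaf K X where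
  obj U := M.obj U ⊗[Γ(X, U)] N.obj U
  act η := tensorAct M N η
  res h := tensorRes M N h
  add_act η μ t := by
    induction t with
    | zero => simp
    | add a b ha hb => simp only [map_add, ha, hb]; abel
    | tmul m n =>
      simp only [tensorAct_tmul, M.add_act, N.add_act, TensorProduct.add_tmul,
        TensorProduct.tmul_add]
      abel
  smul_act c η t := by
    induction t with
    | zero => simp
    | add a b ha hb => simp only [map_add, ha, hb, smul_add]
    | tmul m n =>
      simp only [tensorAct_tmul, M.smul_act, N.smul_act, smul_add, TensorProduct.smul_tmul',
        TensorProduct.tmul_smul]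
  lie_act η μ t := by
    induction t with
    | zero => simp
    | add a b ha hb => simp only [map_add, ha, hb]; abel
    | tmul m n =>
      simp only [tensorAct_tmul, M.lie_act, N.lie_act, map_add, TensorProduct.sub_tmul,
        TensorProduct.tmul_sub]
      abel
  leibniz η f t := by
    induction t with
    | zero => simp
    | add a b ha hb => simp only [map_add, ha, hb, smul_add]; abel
    | tmul m n =>
      simp only [tensorAct_tmul, M.leibniz, TensorProduct.smul_tmul', smul_add,
        TensorProduct.add_tmul]
      abel
  res_id t := by
    induction t with
    | zero => simp
    | add a b ha hb => simp only [map_add, ha, hb]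
    | tmul m n => simp only [tensorRes_tmul, M.res_id, N.res_id]
  res_comp h h' t := by
    induction t with
    | zero => simp
    | add a b ha hb => simp only [map_add, ha, hb]
    | tmul m n => simp only [tensorRes_tmul, M.res_comp, N.res_comp]
  res_smul h f t := by
    induction t with
    | zero => simp
    | add a b ha hb => simp only [map_add, ha, hb, smul_add]
    | tmul m n => simp only [tensorRes_tmul, M.res_smul, TensorProduct.smul_tmul']
  res_act h η t := by
    induction t with
    | zero => simp
    | add a b ha hb => simp only [map_add, ha, hb]
    | tmul m n => simp only [tensorRes_tmul, tensorAct_tmul, map_add, M.res_act, N.res_act]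

/-- The tensor product `M ⊗_𝒪 N` of sheaves of `AV`-modules. -/
def tensor : AVPresheaf K X := (preTensor M N).sheafify

end Tensor

end AVPresheaf

end AVSheaves

section Smash

variable (K : Type u) [Field K] (A : Type u) [CommRing A] [Algebra K A]

/-- The defining relations of `A # U(V)`, with `V = Der_K(A)`: the sums, products and scalars of `A`,
the sums, multiples by scalars and brackets of `V`, and `η · f = η(f) + f · η`. -/
inductive SmashRel : FreeAlgebra K (A ⊕ Derivation K A A) →
    FreeAlgebra K (A ⊕ Derivation K A A) → Prop
  | fun_add (a b : A) : SmashRel (.ι K (.inl (a + b))) (.ι K (.inl a) + .ι K (.inl b))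
  | fun_mul (a b : A) : SmashRel (.ι K (.inl (a * b))) (.ι K (.inl a) * .ι K (.inl b))
  | fun_scalar (c : K) : SmashRel (.ι K (.inl (algebraMap K A c))) (algebraMap K _ c)
  | vec_add (η μ : Derivation K A A) :
      SmashRel (.ι K (.inr (η + μ))) (.ι K (.inr η) + .ι K (.inr μ))
  | vec_smul (c : K) (η : Derivation K A A) :
      SmashRel (.ι K (.inr (c • η))) (c • .ι K (.inr η))
  | vec_lie (η μ : Derivation K A A) : SmashRel (.ι K (.inr ⁅η, μ⁆))
      (.ι K (.inr η) * .ι K (.inr μ) - .ι K (.inr μ) * .ι K (.inr η))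
  | leibniz (η : Derivation K A A) (f : A) : SmashRel (.ι K (.inr η) * .ι K (.inl f))
      (.ι K (.inl (η f)) + .ι K (.inl f) * .ι K (.inr η))

/-- The smash product `A # U(V)` with `V = Der_K(A)`. -/
def Smash : Type u := RingQuot (SmashRel K A)

instance : Ring (Smash K A) := inferInstanceAs (Ring (RingQuot (SmashRel K A)))
instance : Algebra K (Smash K A) := inferInstanceAs (Algebra K (RingQuot (SmashRel K A)))

namespace Smash

/-- The quotient map from the free algebra. -/
def mk : FreeAlgebra K (A ⊕ Derivation K A A) →ₐ[K] Smash K A :=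
  RingQuot.mkAlgHom K (SmashRel K A)

theorem mk_rel {x y : FreeAlgebra K (A ⊕ Derivation K A A)} (h : SmashRel K A x y) :
    mk K A x = mk K A y :=
  RingQuot.mkAlgHom_rel K h

variable {A}

/-- The embedding `A → A # U(V)`. -/
def fn (a : A) : Smash K A := mk K A (.ι K (.inl a))

variable {K}

/-- The embedding `V → A # U(V)`. -/
def vec (η : Derivation K A A) : Smash K A := mk K A (.ι K (.inr η))

variable (K)

theorem fn_add (a b : A) : fn K (a + b) = fn K a + fn K b := by
  simpa [fn] using mk_rel K A (.fun_add a b)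

theorem fn_mul (a b : A) : fn K (a * b) = fn K a * fn K b := by
  simpa [fn] using mk_rel K A (.fun_mul a b)

theorem fn_scalar (c : K) : fn K (algebraMap K A c) = algebraMap K (Smash K A) c := by
  simpa [fn] using mk_rel K A (.fun_scalar c)

theorem fn_one : fn K (1 : A) = 1 := by
  simpa using fn_scalar K (A := A) 1

theorem fn_zero : fn K (0 : A) = 0 := by
  simpa using fn_scalar K (A := A) 0

theorem vec_add (η μ : Derivation K A A) : vec (η + μ) = vec η + vec μ := by
  simpa [vec] using mk_rel K A (.vec_add η μ)

theorem vec_smul (c : K) (η : Derivation K A A) : vec (c • η) = c • vec η := by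
  simpa [vec] using mk_rel K A (.vec_smul c η)

theorem vec_lie (η μ : Derivation K A A) : vec ⁅η, μ⁆ = vec η * vec μ - vec μ * vec η := by
  simpa [vec] using mk_rel K A (.vec_lie η μ)

theorem vec_mul_fn (η : Derivation K A A) (f : A) :
    vec η * fn K f = fn K (η f) + fn K f * vec η := by
  simpa [vec, fn] using mk_rel K A (.leibniz η f)

variable (A)

/-- The natural homomorphism `A # U(V) → End_K(A)`: functions act by multiplication, vector fields
by derivations. -/
def toEnd : Smash K A →ₐ[K] Module.End K A :=
  RingQuot.liftAlgHom K ⟨FreeAlgebra.lift K (Sum.elim (fun a => LinearMap.mulLeft K a)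
    (fun η => (η : A →ₗ[K] A))), by
      intro x y h
      induction h with
      | fun_scalar c =>
        ext b
        simp [Algebra.smul_def, Module.algebraMap_end_apply]
      | vec_lie η μ =>
        ext b
        simp
        rfl
      | leibniz η f =>
        ext b
        simp [mul_comm, add_comm]
      | _ =>
        ext b
        simp [add_mul]⟩

/-- The algebra `D` of differential operators: the subalgebra of `End_K(A)` generated by the
multiplications by elements of `A` and the derivations of `A`. -/
def DiffOp : Type u := (toEnd K A).range

instance : Ring (DiffOp K A) := inferInstanceAs (Ring (toEnd K A).range)

/-- The surjection `A # U(V) → D`. -/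
def toDiffOp : Smash K A →+* DiffOp K A := (toEnd K A).rangeRestrict.toRingHom

end Smash

end Smash

section PointModules

variable (K : Type u) [Field K] {X : Scheme.{u}} [X.Over (Spec (.of K))] (P : X)

/-- The skyscraper sheaf of `AV`-modules at `P` given by a module over `A # U(V)`, where
`A = 𝒪_{X,P}` and `V = Der_K(A)` is the stalk of the tangent sheaf. -/
def skyscraper (M : Type u) [AddCommGroup M] [Module (Smash K (X.presheaf.stalk P)) M] :
    AVPresheaf K X where
  obj U := PLift (P ∈ U) → M
  module U :=
    { smul := fun f m h => Smash.fn K (germFun K h.down f) • m h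
      one_smul := fun m => by
        funext h
        change Smash.fn K (germFun K h.down 1) • m h = m h
        rw [map_one, Smash.fn_one, one_smul]
      mul_smul := fun f g m => by
        funext h
        change Smash.fn K (germFun K h.down (f * g)) • m h =
          Smash.fn K (germFun K h.down f) • Smash.fn K (germFun K h.down g) • m h
        rw [map_mul, Smash.fn_mul, mul_smul]
      smul_zero := fun f => by
        funext h
        exact smul_zero _
      smul_add := fun f m m' => by
        funext h
        exact smul_add _ _ _
      add_smul := fun f g m => by
        funext h
        change Smash.fn K (germFun K h.down (f + g)) • m h =
          Smash.fn K (germFun K h.down f) • m h + Smash.fn K (germFun K h.down g) • m h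
        rw [map_add, Smash.fn_add, add_smul]
      zero_smul := fun m => by
        funext h
        change Smash.fn K (germFun K h.down 0) • m h = 0
        rw [map_zero, Smash.fn_zero, zero_smul] }
  act η :=
    { toFun := fun m h => Smash.vec (η.stalk h.down) • m h
      map_zero' := by
        funext h
        exact smul_zero _
      map_add' := fun m m' => by
        funext h
        exact smul_add _ _ _ }
  res hle :=
    { toFun := fun m h => m ⟨hle h.down⟩
      map_zero' := rfl
      map_add' := fun _ _ => rfl }
  add_act η μ m := by
    funext h
    change Smash.vec ((η + μ).stalk h.down) • m h =
      Smash.vec (η.stalk h.down) • m h + Smash.vec (μ.stalk h.down) • m h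
    rw [VectorField.stalk_add, Smash.vec_add, add_smul]
  smul_act c η m := by
    funext h
    change Smash.vec ((c • η).stalk h.down) • m h =
      Smash.fn K (germFun K h.down (algebraMap K _ c)) • Smash.vec (η.stalk h.down) • m h
    rw [VectorField.stalk_smul, Smash.vec_smul, AlgHom.commutes, Smash.fn_scalar, ← mul_smul,
      Algebra.smul_def]
  lie_act η μ m := by
    funext h
    change Smash.vec (⁅η, μ⁆.stalk h.down) • m h =
      Smash.vec (η.stalk h.down) • Smash.vec (μ.stalk h.down) • m h -
        Smash.vec (μ.stalk h.down) • Smash.vec (η.stalk h.down) • m h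
    rw [VectorField.stalk_lie, Smash.vec_lie, sub_smul, mul_smul, mul_smul]
  leibniz η f m := by
    funext h
    change Smash.vec (η.stalk h.down) • Smash.fn K (germFun K h.down f) • m h =
      Smash.fn K (germFun K h.down (η.der _ le_rfl f)) • m h +
        Smash.fn K (germFun K h.down f) • Smash.vec (η.stalk h.down) • m h
    rw [← mul_smul, Smash.vec_mul_fn, add_smul, mul_smul,
      VectorField.stalk_germ η h.down le_rfl h.down]
  res_id _ := rfl
  res_comp _ _ _ := rfl
  res_smul hle f m := by
    funext h
    change Smash.fn K (germFun K (hle h.down) f) • m ⟨hle h.down⟩ =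
      Smash.fn K (germFun K h.down (resFun K hle f)) • m ⟨hle h.down⟩
    rw [germFun_res]
  res_act hle η m := by
    funext h
    change Smash.vec (η.stalk (hle h.down)) • m ⟨hle h.down⟩ =
      Smash.vec ((η.restrict hle).stalk h.down) • m ⟨hle h.down⟩
    rw [VectorField.stalk_restrict]

variable (A : Type u) [CommRing A] [Algebra K A]

/-- For an ideal `m` of `A`, the `D`-module `D / D m = D ⊗_A (A / m)` induced from the
`A`-module `A / m`. It is generated by the class `δ` of `1`, with `f δ = 0` for `f ∈ m`. -/
def DeltaModule (m : Ideal A) : Type u :=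
  Smash.DiffOp K A ⧸ Submodule.span (Smash.DiffOp K A)
    ((fun f => Smash.toDiffOp K A (Smash.fn K f)) '' (m : Set A))

instance (m : Ideal A) : AddCommGroup (DeltaModule K A m) :=
  inferInstanceAs (AddCommGroup (_ ⧸ Submodule.span (Smash.DiffOp K A)
    ((fun f => Smash.toDiffOp K A (Smash.fn K f)) '' (m : Set A))))

instance (m : Ideal A) : Module (Smash.DiffOp K A) (DeltaModule K A m) :=
  inferInstanceAs (Module (Smash.DiffOp K A) (_ ⧸ Submodule.span (Smash.DiffOp K A)
    ((fun f => Smash.toDiffOp K A (Smash.fn K f)) '' (m : Set A))))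

instance (m : Ideal A) : Module (Smash K A) (DeltaModule K A m) :=
  Module.compHom _ (Smash.toDiffOp K A)

/-- The sheaf `F_P` of delta functions supported at `P`. -/
def delta : AVPresheaf K X :=
  skyscraper K P (DeltaModule K (X.presheaf.stalk P)
    (IsLocalRing.maximalIdeal (X.presheaf.stalk P)))

variable {K P} {n : ℕ} (W : Type u) [AddCommGroup W] [Module K W]
  [LieRingModule (Lplus n K) W] [LieModule K (Lplus n K) W]

/-- `ξ = ∑ᵢ fᵢ(X) ∂/∂Xᵢ ∈ L̂₊` is the expansion in the local parameters `x` of the derivation `η` at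
the point `P`: the power series `fᵢ = ξ(Xᵢ) ∈ K[[X₁, …, Xₙ]]` is the Taylor series at `P` of `η(xᵢ)`.
Here `m` is the maximal ideal of `P`, `x` are functions and `d` the derivations `∂/∂xᵢ`. -/
def IsExpansion (m : Ideal A) (x : Fin n → A) (d : Fin n → Derivation K A A)
    (η : Derivation K A A) (ξ : Lplus n K) : Prop :=
  ∀ i s, MvPowerSeries.coeff s (taylor d (η (x i))) -
    algebraMap K A (MvPowerSeries.coeff s (ξ.1 (MvPowerSeries.X i))) ∈ m

/-- The relations that make `A # U(V) ⊗_K W` the module induced from the subalgebra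
`A # U(m V)`, whose action on `W` is the following: the functions in `m` act by zero (so that `f`
acts by `f(P)`), and a derivation `η ∈ m V` acts by its expansion in local parameters. -/
def inducedRel (m : Ideal A) (x : Fin n → A) (d : Fin n → Derivation K A A) :
    Submodule (Smash K A) (Smash K A ⊗[K] W) :=
  Submodule.span (Smash K A)
    ({t | ∃ f ∈ m, ∃ w : W, t = Smash.fn K f ⊗ₜ w} ∪
      {t | ∃ η ∈ m • (⊤ : Submodule A (Derivation K A A)), ∃ ξ : Lplus n K,
        IsExpansion A m x d η ξ ∧ ∃ w : W, t = Smash.vec η ⊗ₜ w - 1 ⊗ₜ ⁅ξ, w⁆})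

/-- The Rudakov module: the module over `A # U(V)` induced from the module `W` over the subalgebra
`A # U(m V)`. -/
abbrev RudakovModule (m : Ideal A) (x : Fin n → A) (d : Fin n → Derivation K A A) : Type u :=
  (Smash K A ⊗[K] W) ⧸ inducedRel A W m x d

/-- The sheaf version `R_P^W` of the Rudakov module, supported at the point `P` of an étale
chart. The chart is used to let `m_P V` act on `W`. As an induced module it is spanned by the
`∂/∂x`-monomials applied to `W`, so that it does not change if the stalks `𝒪_{X,P}` and `Θ_{X,P}` are
replaced by the sections of `𝒪_X` and `Θ` over an étale chart containing `P`. -/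
def rudakov (c : EtaleChart K X n) (hP : P ∈ c.U) : AVPresheaf K X :=
  skyscraper K P (RudakovModule (X.presheaf.stalk P) W
    (IsLocalRing.maximalIdeal (X.presheaf.stalk P)) (fun i => germFun K hP (c.x i))
    (fun i => (c.pd i).stalk hP))

end PointModules

section Jets

variable {K : Type u} [Field K] {X : Scheme.{u}} [X.Over (Spec (.of K))] {n : ℕ}
  {W : Type u} [AddCommGroup W] [Module K W]

variable (W) in
/-- Restriction of `W`-valued functions. -/
def resTensor {U V : X.Opens} (h : V ≤ U) : Γ(X, U) ⊗[K] W →ₗ[K] Γ(X, V) ⊗[K] W :=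
  TensorProduct.map (resFun K h).toLinearMap LinearMap.id

theorem resTensor_smul {U V : X.Opens} (h : V ≤ U) (f : Γ(X, U)) (t : Γ(X, U) ⊗[K] W) :
    resTensor W h (f • t) = resFun K h f • resTensor W h t := by
  induction t with
  | zero => simp
  | add a b ha hb => simp only [smul_add, map_add, ha, hb]
  | tmul g w => simp [resTensor, TensorProduct.smul_tmul']

theorem resTensor_id {U : X.Opens} (t : Γ(X, U) ⊗[K] W) : resTensor W (le_refl U) t = t := by
  have h : resFun K (le_refl U) = AlgHom.id K Γ(X, U) := AlgHom.ext (resFun_id K)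
  rw [resTensor, h]
  exact DFunLike.congr_fun TensorProduct.map_id t

theorem resTensor_comp {U V V' : X.Opens} (h : V ≤ U) (h' : V' ≤ V) (t : Γ(X, U) ⊗[K] W) :
    resTensor W h' (resTensor W h t) = resTensor W (h'.trans h) t := by
  induction t with
  | zero => simp
  | add a b ha hb => simp only [map_add, ha, hb]
  | tmul g w => simp [resTensor, resFun_comp]

variable (K X n W) in
/-- Families of `W`-valued functions on the intersections of `U` with all étale charts. -/
def JetFamily (U : X.Opens) : Type u := ∀ c : EtaleChart K X n, Γ(X, U ⊓ c.U) ⊗[K] W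

instance (U : X.Opens) : AddCommGroup (JetFamily K X n W U) :=
  inferInstanceAs (AddCommGroup (∀ c : EtaleChart K X n, Γ(X, U ⊓ c.U) ⊗[K] W))

instance (U : X.Opens) : Module Γ(X, U) (JetFamily K X n W U) where
  smul f s := fun c => resFun K (inf_le_left : U ⊓ c.U ≤ U) f • s c
  one_smul s := by
    funext c
    change resFun K (inf_le_left : U ⊓ c.U ≤ U) 1 • s c = s c
    rw [map_one, one_smul]
  mul_smul f g s := by
    funext c
    change resFun K (inf_le_left : U ⊓ c.U ≤ U) (f * g) • s c =
      resFun K (inf_le_left : U ⊓ c.U ≤ U) f • resFun K (inf_le_left : U ⊓ c.U ≤ U) g • s c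
    rw [map_mul, mul_smul]
  smul_zero f := by
    funext c
    exact smul_zero (resFun K (inf_le_left : U ⊓ c.U ≤ U) f)
  smul_add f s t := by
    funext c
    exact smul_add (resFun K (inf_le_left : U ⊓ c.U ≤ U) f) (s c) (t c)
  add_smul f g s := by
    funext c
    change resFun K (inf_le_left : U ⊓ c.U ≤ U) (f + g) • s c =
      resFun K (inf_le_left : U ⊓ c.U ≤ U) f • s c + resFun K (inf_le_left : U ⊓ c.U ≤ U) g • s c
    rw [map_add, add_smul]
  zero_smul s := by
    funext c
    change resFun K (inf_le_left : U ⊓ c.U ≤ U) 0 • s c = 0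
    rw [map_zero, zero_smul]

/-- Restriction of families to a smaller open subset. -/
def JetFamily.restrict {U V : X.Opens} (h : V ≤ U) : JetFamily K X n W U →+ JetFamily K X n W V where
  toFun s := fun c => resTensor W (inf_le_inf_right c.U h) (s c)
  map_zero' := by
    funext c
    exact map_zero _
  map_add' s t := by
    funext c
    exact map_add _ _ _

/-- On an open subset `V` of two étale charts `c` (with parameters `x`) and `c'` (with parameters `y`),
this is the automorphism `Xᵢ ↦ xᵢ(y + Y) - xᵢ(y)` of the algebra of power series with
coefficients in `𝒪(V)`; here `xᵢ(y + Y)` is the Taylor expansion of `xᵢ` in the parameters `y`. -/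
def coordChange (c c' : EtaleChart K X n) {V : X.Opens} (hc : V ≤ c.U) (hc' : V ≤ c'.U)
    (i : Fin n) : PS n Γ(X, V) :=
  c'.taylor hc' (resFun K hc (c.x i)) - MvPowerSeries.C (resFun K hc (c.x i))

variable [LieRingModule (Lplus n K) W] [LieModule K (Lplus n K) W]

/-- The sections over `U` of the jet bundle `J^W`: families of `W`-valued functions `s_c` in the étale
charts `c`, that are related by the gluing transformations `s_{c'} = ρ(φ) s_c`, where `φ` is
the automorphism of the algebra of power series given by the coordinate change. -/
def jetSections (σ : GLForm n K W) (U : X.Opens) : Submodule Γ(X, U) (JetFamily K X n W U) where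
  carrier := {s | ∀ (c c' : EtaleChart K X n) (V : X.Opens) (hU : V ≤ U) (hc : V ≤ c.U)
    (hc' : V ≤ c'.U) (g : GL (Fin n) Γ(X, V)) (v : Fin n → PS n Γ(X, V)),
    IsFactorization K (coordChange c c' hc hc') g v →
    resTensor W (le_inf hU hc') (s c') = autAct σ g v (resTensor W (le_inf hU hc) (s c))}
  add_mem' := by
    intro s t hs ht c c' V hU hc hc' g v h
    change resTensor W _ (s c' + t c') = autAct σ g v (resTensor W _ (s c + t c))
    rw [map_add, map_add, map_add, hs c c' V hU hc hc' g v h, ht c c' V hU hc hc' g v h]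
  zero_mem' := by
    intro c c' V hU hc hc' g v h
    change resTensor W _ 0 = autAct σ g v (resTensor W _ 0)
    rw [map_zero, map_zero, map_zero]
  smul_mem' := by
    intro f s hs c c' V hU hc hc' g v h
    change resTensor W _ (resFun K (inf_le_left : U ⊓ c'.U ≤ U) f • s c') =
      autAct σ g v (resTensor W _ (resFun K (inf_le_left : U ⊓ c.U ≤ U) f • s c))
    rw [resTensor_smul, resTensor_smul, map_smul, resFun_comp, resFun_comp,
      hs c c' V hU hc hc' g v h]

variable (W) in
/-- The action of a vector field `η = ∑ᵢ fᵢ ∂/∂xᵢ` (with `fᵢ = η(xᵢ)`) on `W`-valued functions in an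
étale chart: `η(g ⊗ w) = η(g) ⊗ w + ∑ᵢ ∑_{s ≠ 0} (1/s!) g ∂ˢfᵢ/∂xˢ ⊗ (X^s ∂/∂Xᵢ) w`. -/
def jetOp {U : X.Opens} (η : VectorField K U) (c : EtaleChart K X n) :
    Γ(X, U ⊓ c.U) ⊗[K] W →+ Γ(X, U ⊓ c.U) ⊗[K] W :=
  (LinearMap.rTensor W
    (η.der (U ⊓ c.U) inf_le_left : Γ(X, U ⊓ c.U) →ₗ[K] Γ(X, U ⊓ c.U))).toAddMonoidHom +
  (lieAct K W (fun i => c.taylor inf_le_right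
    (η.der (U ⊓ c.U) inf_le_left (resFun K inf_le_right (c.x i))))).toAddMonoidHom

theorem jetOp_smul {U : X.Opens} (η : VectorField K U) (c : EtaleChart K X n)
    (f : Γ(X, U)) (t : Γ(X, U ⊓ c.U) ⊗[K] W) :
    jetOp W η c (resFun K (inf_le_left : U ⊓ c.U ≤ U) f • t) =
      resFun K (inf_le_left : U ⊓ c.U ≤ U) (η.app f) • t + resFun K (inf_le_left : U ⊓ c.U ≤ U) f • jetOp W η c t := by
  have h : ∀ a : Γ(X, U ⊓ c.U), LinearMap.rTensor W
      (η.der (U ⊓ c.U) inf_le_left : Γ(X, U ⊓ c.U) →ₗ[K] Γ(X, U ⊓ c.U)) (a • t) =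
      η.der (U ⊓ c.U) inf_le_left a • t + a • LinearMap.rTensor W
      (η.der (U ⊓ c.U) inf_le_left : Γ(X, U ⊓ c.U) →ₗ[K] Γ(X, U ⊓ c.U)) t := by
    intro a
    induction t with
    | zero => simp
    | add b b' hb hb' => rw [smul_add, map_add, hb, hb', map_add, smul_add, smul_add]; abel
    | tmul b w =>
      simp only [TensorProduct.smul_tmul', LinearMap.rTensor_tmul, smul_eq_mul,
        Derivation.coeFn_coe, Derivation.leibniz, TensorProduct.add_tmul]
      rw [add_comm, mul_comm b]
  change LinearMap.rTensor W _ (resFun K (inf_le_left : U ⊓ c.U ≤ U) f • t) +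
    lieAct K W _ (resFun K (inf_le_left : U ⊓ c.U ≤ U) f • t) = resFun K (inf_le_left : U ⊓ c.U ≤ U) (η.der U le_rfl f) • t +
      resFun K (inf_le_left : U ⊓ c.U ≤ U) f • (LinearMap.rTensor W _ t + lieAct K W _ t)
  rw [h, map_smul, η.der_res, smul_add, add_assoc]

/-- The action of vector fields in étale charts is compatible with the gluing transformations, and it
satisfies the axioms of a Lie algebra action. In other words, `J^W` with this action is a
sheaf of `AV`-modules. -/
structure IsJetAction (X : Scheme.{u}) [X.Over (Spec (.of K))] (σ : GLForm n K W) : Prop where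
  mem : ∀ (U : X.Opens) (η : VectorField K U), ∀ s ∈ jetSections σ U,
    (fun c => jetOp W η c (s c) : JetFamily K X n W U) ∈ jetSections σ U
  add : ∀ (U : X.Opens) (η μ : VectorField K U) (c : EtaleChart K X n)
    (t : Γ(X, U ⊓ c.U) ⊗[K] W), jetOp W (η + μ) c t = jetOp W η c t + jetOp W μ c t
  smul : ∀ (U : X.Opens) (a : K) (η : VectorField K U) (c : EtaleChart K X n)
    (t : Γ(X, U ⊓ c.U) ⊗[K] W), jetOp W (a • η) c t = a • jetOp W η c t
  lie : ∀ (U : X.Opens) (η μ : VectorField K U) (c : EtaleChart K X n)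
    (t : Γ(X, U ⊓ c.U) ⊗[K] W),
    jetOp W ⁅η, μ⁆ c t = jetOp W η c (jetOp W μ c t) - jetOp W μ c (jetOp W η c t)
  res : ∀ (U V : X.Opens) (h : V ≤ U) (η : VectorField K U) (c : EtaleChart K X n)
    (t : Γ(X, U ⊓ c.U) ⊗[K] W),
    resTensor W (inf_le_inf_right c.U h) (jetOp W η c t) =
      jetOp W (η.restrict h) c (resTensor W (inf_le_inf_right c.U h) t)

theorem restrict_mem (σ : GLForm n K W) {U V : X.Opens} (h : V ≤ U) (s : JetFamily K X n W U)
    (hs : s ∈ jetSections σ U) : JetFamily.restrict h s ∈ jetSections σ V := by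
  intro c c' V' hU hc hc' g v hf
  change resTensor W _ (resTensor W _ (s c')) = autAct σ g v (resTensor W _ (resTensor W _ (s c)))
  rw [resTensor_comp, resTensor_comp]
  exact hs c c' V' (hU.trans h) hc hc' g v hf

/-- The sheaf `J^W` of jet `AV`-modules. Its well-definedness `hJ` is a statement about the explicit
formulas above. -/
def jet (σ : GLForm n K W) (hJ : IsJetAction X σ) : AVPresheaf K X where
  obj U := jetSections σ U
  act {U} η :=
    { toFun := fun s => ⟨fun c => jetOp W η c (s.1 c), hJ.mem U η s.1 s.2⟩
      map_zero' := Subtype.ext (funext fun c => map_zero (jetOp W η c))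
      map_add' := fun s t => Subtype.ext (funext fun c => map_add (jetOp W η c) (s.1 c) (t.1 c)) }
  res {U V} h :=
    { toFun := fun s => ⟨JetFamily.restrict h s.1, restrict_mem σ h s.1 s.2⟩
      map_zero' := Subtype.ext (map_zero _)
      map_add' := fun s t => Subtype.ext (map_add _ _ _) }
  add_act {U} η μ s := Subtype.ext (funext fun c => hJ.add U η μ c (s.1 c))
  smul_act {U} a η s := Subtype.ext (funext fun c => by
    change jetOp W (a • η) c (s.1 c) =
      resFun K (inf_le_left : U ⊓ c.U ≤ U) (algebraMap K Γ(X, U) a) • jetOp W η c (s.1 c)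
    rw [hJ.smul, AlgHom.commutes, algebraMap_smul])
  lie_act {U} η μ s := Subtype.ext (funext fun c => hJ.lie U η μ c (s.1 c))
  leibniz {U} η f s := Subtype.ext (funext fun c => jetOp_smul η c f (s.1 c))
  res_id {U} s := Subtype.ext (funext fun c => resTensor_id (s.1 c))
  res_comp {U V V'} h h' s := Subtype.ext (funext fun c => resTensor_comp _ _ (s.1 c))
  res_smul {U V} h f s := Subtype.ext (funext fun c => by
    change resTensor W (inf_le_inf_right c.U h)
      (resFun K (inf_le_left : U ⊓ c.U ≤ U) f • s.1 c) =
      resFun K (inf_le_left : V ⊓ c.U ≤ V) (resFun K h f) •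
        resTensor W (inf_le_inf_right c.U h) (s.1 c)
    rw [resTensor_smul, resFun_comp, resFun_comp])
  res_act {U V} h η s := Subtype.ext (funext fun c => hJ.res U V h η c (s.1 c))

end Jets

end

end AVMod

/-! Fix a chart around P with parameters x and dual derivations ∂_i, and let A be the local ring at
P with maximal ideal 𝔪. The isomorphism is induced by w ↦ δ_P ⊗ (1 ⊗ w). In the algebra of
differential operators fμ = μf - μ(f), so a derivation η in 𝔪V satisfies η δ_P = -(div η)(P) δ_P
(`vec_smul_deltaGen`). On the other factor, the value at P of η(1 ⊗ w) is the action on w of the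
expansion ξ of η at P; on W ⊗ K_tr this is ξw + tr(ξ)w, and tr(ξ) = (div η)(P). The two multiples of
the divergence cancel, so the map on W is compatible with A # U(𝔪V) (`act_deltaVec`) and extends to
the induced module. Because ∂_i kills 1 ⊗ w, the extension sends ∂^α w to ∂^α δ_P ⊗ w. Such elements
span both sides (`smul_mem_diffSpan`). If a sum of ∂^α δ_P ⊗ w_α vanishes, then every w_α vanishes,
since the functions (x - x(P))^β are dual to the ∂^α δ_P under the formal adjoint
(`exists_deltaPairing`, `exists_dual_function`). No separate PBW theorem is needed for the Rudakov
module: independence is detected on the images.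

Most of the work lies in the claim that the jet bundle is well defined. The gluing maps have to
commute with vector fields and to satisfy the cocycle condition. For power series both are forms of
the chain rule: a coordinate change φ takes Taylor series in x to Taylor series in y
(`IsFrame.autEquiv_taylor`), hence conjugates the derivation δ + ξ of R[[X]] attached to a vector
field in one chart into the one attached to it in the other (`IsFrame.autEquiv_totalDer`). What must
be shown is that these facts pass from R[[X]] to R ⊗ W, where R is a ring of functions: intertwining
is `autAct_totalAct`, multiplicativity is `autAct_comp`.

Finite-dimensionality enters through the Euler field: derivations of large order, including infinite
sums, act on W by zero (`exists_degreeBound`), so that all sums are finite and exponentials of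
fields of order two are polynomials. For the unipotent factor exp(v), intertwining follows from
exp(v) D exp(-v) = ∑ ad(v)^k(D)/k!, where the iterated commutators obey the same recursion on R[[X]]
and on R ⊗ W. For the linear factor, the hypotheses concern only GL_n over K and over the dual
numbers. They are extended to all R by evaluating at generic matrices; the homomorphism r ↦ r +
δ(r)ε yields the derivative of ρ(g) along δ (`derT_act`); and equivariance for the adjoint action
follows by differentiating along the straight path from 1 to a matrix (`polyAct_lieAct`).
Multiplicativity is again a deformation argument: the dilation X ↦ tX joins an automorphism to its
linear part, and two families annihilated by d/dt agree if they agree at t = 0.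

Differentiability holds for the jet bundle because the defining operator acts through (f(x + X) -
f(x))^N, which has order N; for delta functions because the action is linear over functions in the
vector field; and it passes to tensor products, associated sheaves and isomorphic sheaves. Finally,
the presheaf tensor product is constant on small neighbourhoods of P and zero on open sets missing
P, so its associated sheaf is a skyscraper. -/

namespace AVMod

noncomputable section

/-! ### The filtration of power series by order, and derivations δ + ξ -/

section Filtration

variable {n : ℕ} {R : Type u} [CommRing R]

/-- The power series with given coefficients. -/
def psMk (c : (Fin n →₀ ℕ) → R) : PS n R := c

@[simp]
theorem coeff_psMk (c : (Fin n →₀ ℕ) → R) (s : Fin n →₀ ℕ) :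
    MvPowerSeries.coeff s (psMk c) = c s := rfl

variable (n R) in
/-- The ideal of the power series without terms of degree `< k`. -/
def ordIdeal (k : ℕ) : Ideal (PS n R) where
  carrier := {f | ∀ s : Fin n →₀ ℕ, s.degree < k → MvPowerSeries.coeff s f = 0}
  add_mem' ha hb s hs := by rw [map_add, ha s hs, hb s hs, add_zero]
  zero_mem' s _ := map_zero _
  smul_mem' c f hf s hs := by
    classical
    rw [smul_eq_mul, MvPowerSeries.coeff_mul]
    refine Finset.sum_eq_zero fun p hp => ?_
    rw [hf p.2, mul_zero]
    have h := congrArg Finsupp.degree (Finset.HasAntidiagonal.mem_antidiagonal.mp hp)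
    rw [map_add] at h
    omega

theorem ordIdeal_mono {a b : ℕ} (h : a ≤ b) : ordIdeal n R b ≤ ordIdeal n R a :=
  fun _ hf s hs => hf s (hs.trans_le h)

theorem mem_ordIdeal_zero (f : PS n R) : f ∈ ordIdeal n R 0 :=
  fun _ hs => absurd hs (Nat.not_lt_zero _)

theorem mem_ordIdeal_one {f : PS n R} :
    f ∈ ordIdeal n R 1 ↔ MvPowerSeries.constantCoeff f = 0 := by
  rw [← MvPowerSeries.coeff_zero_eq_constantCoeff_apply]
  constructor
  · intro h
    exact h 0 (by simp)
  · intro h s hs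
    rw [Nat.lt_one_iff, Finsupp.degree_eq_zero_iff] at hs
    rw [hs, h]

/-- The filtration by order is separated. Identities between power series are proved modulo each
`ordIdeal`, where infinite sums become finite, and then combined by this criterion. -/
theorem eq_of_sub_mem_ordIdeal {f g : PS n R} (h : ∀ k, f - g ∈ ordIdeal n R k) : f = g := by
  ext s
  have := h (s.degree + 1) s (Nat.lt_succ_self _)
  rwa [map_sub, sub_eq_zero] at this

theorem coeff_eq_of_sub_mem_ordIdeal {k : ℕ} {f g : PS n R} (h : f - g ∈ ordIdeal n R k)
    {s : Fin n →₀ ℕ} (hs : s.degree < k) :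
    MvPowerSeries.coeff s f = MvPowerSeries.coeff s g := by
  have := h s hs
  rwa [map_sub, sub_eq_zero] at this

theorem mul_mem_ordIdeal {a b : ℕ} {f g : PS n R} (hf : f ∈ ordIdeal n R a)
    (hg : g ∈ ordIdeal n R b) : f * g ∈ ordIdeal n R (a + b) := by
  classical
  intro s hs
  rw [MvPowerSeries.coeff_mul]
  refine Finset.sum_eq_zero fun p hp => ?_
  have h := congrArg Finsupp.degree (Finset.HasAntidiagonal.mem_antidiagonal.mp hp)
  rw [map_add] at h
  rcases lt_or_ge p.1.degree a with h1 | h1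
  · rw [hf _ h1, zero_mul]
  · rw [hg _ (by omega), mul_zero]

theorem smul_mem_ordIdeal {S : Type*} [CommSemiring S] [Algebra S R] {k : ℕ} (r : S) {f : PS n R}
    (hf : f ∈ ordIdeal n R k) : r • f ∈ ordIdeal n R k := by
  intro s hs
  change r • MvPowerSeries.coeff s f = 0
  rw [hf s hs, smul_zero]

theorem pderiv_mem_ordIdeal {k : ℕ} {f : PS n R} (hf : f ∈ ordIdeal n R (k + 1)) (i : Fin n) :
    MvPowerSeries.pderiv R i f ∈ ordIdeal n R k := by
  intro s hs
  rw [MvPowerSeries.coeff_pderiv, hf, zero_mul]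
  rw [map_add, Finsupp.degree_single]
  omega

theorem X_mem_ordIdeal (i : Fin n) : (MvPowerSeries.X i : PS n R) ∈ ordIdeal n R 1 :=
  mem_ordIdeal_one.mpr (MvPowerSeries.constantCoeff_X i)

theorem vecField_apply (v : Fin n → PS n R) (f : PS n R) :
    vecField v f = ∑ i, v i * MvPowerSeries.pderiv R i f := by
  have h : ∀ T : Finset (Fin n), (∑ i ∈ T, v i • MvPowerSeries.pderiv R i) f =
      ∑ i ∈ T, v i * MvPowerSeries.pderiv R i f := by
    intro T
    induction T using Finset.cons_induction with
    | empty => simp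
    | cons a T ha ih =>
      rw [Finset.sum_cons, Finset.sum_cons, Derivation.add_apply, ih]
      rfl
  exact h _

theorem vecField_X (v : Fin n → PS n R) (i : Fin n) : vecField v (MvPowerSeries.X i) = v i := by
  classical
  rw [vecField_apply]
  simp [MvPowerSeries.pderiv_X, Pi.single_apply]

theorem vecField_C (v : Fin n → PS n R) (r : R) : vecField v (MvPowerSeries.C r : PS n R) = 0 := by
  rw [vecField_apply]
  simp

/-- A partial derivative costs one degree, which is charged to the coefficients `v`; thus nothing is
required of `f`, and the case `b = 0` only uses that the coefficients generate the order. -/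
theorem vecField_mem_ordIdeal {v : Fin n → PS n R} {a b : ℕ}
    (hv : ∀ i, v i ∈ ordIdeal n R (a + 1)) {f : PS n R} (hf : f ∈ ordIdeal n R b) :
    vecField v f ∈ ordIdeal n R (a + b) := by
  rw [vecField_apply]
  refine Ideal.sum_mem _ fun i _ => ?_
  cases b with
  | zero => exact Ideal.mul_mem_right _ _ (ordIdeal_mono (Nat.le_succ a) (hv i))
  | succ b =>
    have := mul_mem_ordIdeal (hv i) (pderiv_mem_ordIdeal hf i)
    rwa [show a + 1 + b = a + (b + 1) by ring] at this

/-- Here the degree lost by differentiation is charged to `f`, so that no extra order of `v` is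
needed. -/
theorem vecField_mem_ordIdeal' {v : Fin n → PS n R} {a b : ℕ}
    (hv : ∀ i, v i ∈ ordIdeal n R a) {f : PS n R} (hf : f ∈ ordIdeal n R (b + 1)) :
    vecField v f ∈ ordIdeal n R (a + b) := by
  rw [vecField_apply]
  exact Ideal.sum_mem _ fun i _ => mul_mem_ordIdeal (hv i) (pderiv_mem_ordIdeal hf i)

theorem vecField_add (v w : Fin n → PS n R) : vecField (v + w) = vecField v + vecField w := by
  ext f : 1
  simp only [vecField_apply, Derivation.add_apply, Pi.add_apply, add_mul, Finset.sum_add_distrib]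

theorem vecField_sub (v w : Fin n → PS n R) : vecField (v - w) = vecField v - vecField w := by
  ext f : 1
  simp only [vecField_apply, Derivation.sub_apply, Pi.sub_apply, sub_mul, Finset.sum_sub_distrib]

/-- A power series is its constant term plus a combination of the variables. -/
theorem exists_eq_C_add (f : PS n R) : ∃ g : Fin n → PS n R,
    f = MvPowerSeries.C (MvPowerSeries.constantCoeff f) + ∑ k, MvPowerSeries.X k * g k := by
  classical
  -- Each non-constant monomial is divided by the first variable that occurs in it; the condition on
  -- `d` selects the monomials assigned to the variable `k`.
  obtain ⟨g, hg⟩ : ∃ g : Fin n → PS n R, ∀ k d, MvPowerSeries.coeff d (g k) =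
      if ∀ j < k, d j = 0 then MvPowerSeries.coeff (d + Finsupp.single k 1) f else 0 :=
    ⟨fun k => fun d => if ∀ j < k, d j = 0 then
      MvPowerSeries.coeff (d + Finsupp.single k 1) f else 0, fun _ _ => rfl⟩
  refine ⟨g, ?_⟩
  ext s
  by_cases hs : s = 0
  · subst hs
    simp
  · have hC : MvPowerSeries.coeff s
        (MvPowerSeries.C (σ := Fin n) (MvPowerSeries.constantCoeff f)) = 0 := by
      rw [MvPowerSeries.coeff_C, if_neg hs]
    rw [map_add, hC, zero_add, map_sum]
    obtain ⟨k, hk, hmin⟩ : ∃ k : Fin n, s k ≠ 0 ∧ ∀ j < k, s j = 0 := by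
      have hne : (Finset.univ.filter fun k => s k ≠ 0).Nonempty := by
        by_contra h
        apply hs
        ext j
        by_contra hj
        exact h ⟨j, by simpa using hj⟩
      refine ⟨_, (Finset.mem_filter.mp (Finset.min'_mem _ hne)).2, fun j hj => ?_⟩
      by_contra hj0
      exact absurd (Finset.min'_le _ j (by simpa using hj0)) (not_le.mpr hj)
    rw [Finset.sum_eq_single k]
    · rw [MvPowerSeries.X, MvPowerSeries.coeff_monomial_mul, if_pos, one_mul]
      · have h1 : s - Finsupp.single k 1 + Finsupp.single k 1 = s :=
          tsub_add_cancel_of_le (by simpa using Nat.one_le_iff_ne_zero.mpr hk)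
        rw [hg, if_pos, h1]
        intro j hj
        simp [hmin j hj]
      · simpa using Nat.one_le_iff_ne_zero.mpr hk
    · intro j _ hjk
      rw [MvPowerSeries.X, MvPowerSeries.coeff_monomial_mul]
      split_ifs with h
      · rw [one_mul, hg]
        have hj : s j ≠ 0 := Nat.one_le_iff_ne_zero.mp (by simpa using h)
        have hkj : k < j := by
          rcases lt_trichotomy k j with h' | h' | h'
          · exact h'
          · exact absurd h'.symm hjk
          · exact absurd (hmin j h') hj
        rw [if_neg]
        intro hall
        have := hall k hkj
        simp [hkj.ne, hk] at this
      · rfl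
    · simp

/-- An additive operator that vanishes on constants, and that is semilinear with respect to an
endomorphism of the power series ring taking the variables to series without constant term,
vanishes. -/
theorem eq_zero_of_semilinear {R' : Type u} [CommRing R'] (D : PS n R →+ PS n R')
    (p : Fin n → PS n R') (hp : ∀ k, p k ∈ ordIdeal n R' 1) (hC : ∀ r, D (MvPowerSeries.C r) = 0)
    (hX : ∀ k g, D (MvPowerSeries.X k * g) = p k * D g) : D = 0 := by
  -- No continuity of `D` is assumed. After splitting off the constant term, each `p j` contributes
  -- one order and `D (g j)` has order `k` by induction, so every value of `D` has every order.
  have h : ∀ k f, D f ∈ ordIdeal n R' k := by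
    intro k
    induction k with
    | zero => intro f; exact mem_ordIdeal_zero _
    | succ k ih =>
      intro f
      obtain ⟨g, hg⟩ := exists_eq_C_add f
      rw [hg, map_add, hC, zero_add, map_sum]
      refine Ideal.sum_mem _ fun j _ => ?_
      rw [hX, add_comm]
      exact mul_mem_ordIdeal (hp j) (ih _)
  ext1 f
  exact eq_of_sub_mem_ordIdeal fun k => by simpa using h k f

/-- The difference of the two homomorphisms is semilinear over `Ψ`, so `eq_zero_of_semilinear`
applies; continuity is not needed. -/
theorem algHom_ext_X {Φ Ψ : PS n R →ₐ[R] PS n R}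
    (hΨ : ∀ i, Ψ (MvPowerSeries.X i) ∈ ordIdeal n R 1)
    (h : ∀ i, Φ (MvPowerSeries.X i) = Ψ (MvPowerSeries.X i)) : Φ = Ψ := by
  have := eq_zero_of_semilinear ((Φ : PS n R →+ PS n R) - (Ψ : PS n R →+ PS n R))
    (fun i => Ψ (MvPowerSeries.X i)) hΨ
    (fun r => by
      have h1 : ∀ Θ : PS n R →ₐ[R] PS n R, Θ (MvPowerSeries.C r) = MvPowerSeries.C r :=
        fun Θ => Θ.commutes r
      simp [h1])
    (fun k g => by simp [h, mul_sub])
  ext1 f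
  exact sub_eq_zero.mp (DFunLike.congr_fun this f)

theorem algHom_mem_ordIdeal {Φ : PS n R →ₐ[R] PS n R}
    (hΦ : ∀ i, Φ (MvPowerSeries.X i) ∈ ordIdeal n R 1) {k : ℕ} {f : PS n R}
    (hf : f ∈ ordIdeal n R k) : Φ f ∈ ordIdeal n R k := by
  classical
  induction k generalizing f with
  | zero => exact mem_ordIdeal_zero _
  | succ k ih =>
    have key : ∃ g : Fin n → PS n R, (∀ j, g j ∈ ordIdeal n R k) ∧
        f = ∑ j, MvPowerSeries.X j * g j := by
      obtain ⟨g, hg⟩ := exists_eq_C_add f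
      have h0 : MvPowerSeries.constantCoeff f = 0 :=
        mem_ordIdeal_one.mp (ordIdeal_mono (by omega) hf)
      rw [h0, map_zero, zero_add] at hg
      -- The quotients may contain terms of degree below `k`. Deleting these changes `∑ X_j g_j`
      -- only in degrees at most `k`, where `f` has no terms anyway.
      refine ⟨fun j => psMk fun s => if s.degree < k then 0 else MvPowerSeries.coeff s (g j),
        fun j s hs => if_pos hs, ?_⟩
      ext s
      by_cases hs : s.degree < k + 1
      · rw [hf s hs, map_sum]
        refine (Finset.sum_eq_zero fun j _ => ?_).symm
        rw [MvPowerSeries.X, MvPowerSeries.coeff_monomial_mul]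
        split_ifs with h
        · rw [one_mul]
          refine if_pos ?_
          have := congrArg Finsupp.degree (tsub_add_cancel_of_le h)
          rw [map_add, Finsupp.degree_single] at this
          omega
        · rfl
      · conv_lhs => rw [hg]
        rw [map_sum, map_sum]
        refine Finset.sum_congr rfl fun j _ => ?_
        rw [MvPowerSeries.X, MvPowerSeries.coeff_monomial_mul, MvPowerSeries.coeff_monomial_mul]
        split_ifs with h
        · congr 1
          refine (if_neg ?_).symm
          have := congrArg Finsupp.degree (tsub_add_cancel_of_le h)
          rw [map_add, Finsupp.degree_single] at this
          omega
        · rfl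
    obtain ⟨g, hg, rfl⟩ := key
    rw [map_sum]
    refine Ideal.sum_mem _ fun j _ => ?_
    rw [map_mul, add_comm]
    exact mul_mem_ordIdeal (hΦ j) (ih (hg j))

variable {K : Type u} [Field K] [Algebra K R]

theorem derivation_ext_X {D D' : Derivation K (PS n R) (PS n R)}
    (hC : ∀ r, D (MvPowerSeries.C r) = D' (MvPowerSeries.C r))
    (hX : ∀ i, D (MvPowerSeries.X i) = D' (MvPowerSeries.X i)) : D = D' := by
  have := eq_zero_of_semilinear (((D - D' : Derivation K (PS n R) (PS n R)) :
    PS n R →ₗ[K] PS n R).toAddMonoidHom) MvPowerSeries.X X_mem_ordIdeal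
    (fun r => by simp [hC])
    (fun k g => by
      change (D - D') (MvPowerSeries.X k * g) = MvPowerSeries.X k * (D - D') g
      have h0 : (D - D') (MvPowerSeries.X k) = 0 := sub_eq_zero.mpr (hX k)
      rw [Derivation.leibniz, h0, smul_zero, add_zero, smul_eq_mul])
  ext1 f
  exact sub_eq_zero.mp (DFunLike.congr_fun this f)

/-- The derivation of `R[[X]]` acting by `δ` on the coefficients. -/
def coeffDer (δ : Derivation K R R) : Derivation K (PS n R) (PS n R) :=
  Derivation.mk'
    { toFun := fun f => psMk fun s => δ (MvPowerSeries.coeff s f)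
      map_add' := fun f g => by
        funext s
        exact (congrArg δ (map_add _ f g)).trans (map_add δ _ _)
      map_smul' := fun c f => by
        funext s
        exact δ.map_smul c _ }
    (fun f g => by
      classical
      ext s
      change δ (MvPowerSeries.coeff s (f * g)) = MvPowerSeries.coeff s
        (f * psMk (fun s => δ (MvPowerSeries.coeff s g)) +
          g * psMk (fun s => δ (MvPowerSeries.coeff s f)))
      rw [map_add, mul_comm g, MvPowerSeries.coeff_mul, MvPowerSeries.coeff_mul,
        MvPowerSeries.coeff_mul, map_sum, ← Finset.sum_add_distrib]
      refine Finset.sum_congr rfl fun p _ => ?_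
      rw [Derivation.leibniz, smul_eq_mul, smul_eq_mul, mul_comm (MvPowerSeries.coeff p.2 g)]
      rfl)

theorem coeff_coeffDer (δ : Derivation K R R) (f : PS n R) (s : Fin n →₀ ℕ) :
    MvPowerSeries.coeff s (coeffDer δ f) = δ (MvPowerSeries.coeff s f) := rfl

theorem coeffDer_mem_ordIdeal (δ : Derivation K R R) {f : PS n R} {k : ℕ}
    (hf : f ∈ ordIdeal n R k) : coeffDer δ f ∈ ordIdeal n R k := by
  intro s hs
  rw [coeff_coeffDer, hf s hs, map_zero]

theorem coeffDer_C (δ : Derivation K R R) (r : R) :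
    coeffDer δ (MvPowerSeries.C r : PS n R) = MvPowerSeries.C (δ r) := by
  classical
  ext s
  rw [coeff_coeffDer, MvPowerSeries.coeff_C, MvPowerSeries.coeff_C]
  split_ifs
  · rfl
  · exact map_zero δ

theorem coeffDer_X (δ : Derivation K R R) (i : Fin n) :
    coeffDer δ (MvPowerSeries.X i : PS n R) = 0 := by
  classical
  ext s
  rw [coeff_coeffDer, MvPowerSeries.coeff_X]
  split_ifs
  · rw [δ.map_one_eq_zero, map_zero]
  · rw [map_zero, map_zero]

/-- The derivation `δ + ∑ᵢ ξᵢ ∂/∂Xᵢ` of `R[[X]]`, where `δ` acts on the coefficients. -/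
def totalDer (δ : Derivation K R R) (ξ : Fin n → PS n R) : Derivation K (PS n R) (PS n R) :=
  coeffDer δ + (vecField ξ).restrictScalars K

theorem totalDer_apply (δ : Derivation K R R) (ξ : Fin n → PS n R) (f : PS n R) :
    totalDer δ ξ f = coeffDer δ f + vecField ξ f := rfl

theorem totalDer_X (δ : Derivation K R R) (ξ : Fin n → PS n R) (i : Fin n) :
    totalDer δ ξ (MvPowerSeries.X i) = ξ i := by
  rw [totalDer_apply, coeffDer_X, vecField_X, zero_add]

theorem totalDer_C (δ : Derivation K R R) (ξ : Fin n → PS n R) (r : R) :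
    totalDer δ ξ (MvPowerSeries.C r) = MvPowerSeries.C (δ r) := by
  rw [totalDer_apply, coeffDer_C, vecField_C, add_zero]

/-- A derivation is determined by the constants and the variables. This is why the shape δ + ξ
survives conjugation by automorphisms that fix the coefficient ring. -/
theorem eq_totalDer {D : Derivation K (PS n R) (PS n R)} {δ : Derivation K R R}
    (h : ∀ r, D (MvPowerSeries.C r) = MvPowerSeries.C (δ r)) :
    D = totalDer δ fun i => D (MvPowerSeries.X i) :=
  derivation_ext_X (fun r => by rw [h, totalDer_C]) (fun i => by rw [totalDer_X])

theorem totalDer_mem_ordIdeal {δ : Derivation K R R} {ξ : Fin n → PS n R}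
    (hξ : ∀ i, ξ i ∈ ordIdeal n R 1) {k : ℕ} {f : PS n R} (hf : f ∈ ordIdeal n R k) :
    totalDer δ ξ f ∈ ordIdeal n R k := by
  rw [totalDer_apply]
  refine add_mem (coeffDer_mem_ordIdeal δ hf) ?_
  have := vecField_mem_ordIdeal (a := 0) hξ hf
  rwa [zero_add] at this

/-- The commutator of `∑ᵢ vᵢ ∂/∂Xᵢ` and `δ + ∑ᵢ ξᵢ ∂/∂Xᵢ` is `∑ᵢ cᵢ ∂/∂Xᵢ` with these
coefficients `cᵢ`. -/
def adTotal (δ : Derivation K R R) (v ξ : Fin n → PS n R) (i : Fin n) : PS n R :=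
  vecField v (ξ i) - totalDer δ ξ (v i)

theorem lie_totalDer (δ : Derivation K R R) (v ξ : Fin n → PS n R) :
    ⁅(vecField v).restrictScalars K, totalDer δ ξ⁆ =
      (vecField (adTotal δ v ξ)).restrictScalars K := by
  refine derivation_ext_X (fun r => ?_) (fun i => ?_)
  · change vecField v (totalDer δ ξ (MvPowerSeries.C r)) -
      totalDer δ ξ (vecField v (MvPowerSeries.C r)) = vecField _ (MvPowerSeries.C r)
    rw [totalDer_C, vecField_C, vecField_C, vecField_C, map_zero, sub_zero]
  · change vecField v (totalDer δ ξ (MvPowerSeries.X i)) -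
      totalDer δ ξ (vecField v (MvPowerSeries.X i)) = vecField _ (MvPowerSeries.X i)
    rw [totalDer_X, vecField_X, vecField_X]
    rfl

theorem adTotal_mem_ordIdeal {δ : Derivation K R R} {v ξ : Fin n → PS n R} {a : ℕ}
    (hv : ∀ i, v i ∈ ordIdeal n R (a + 1)) (hξ : ∀ i, ξ i ∈ ordIdeal n R 1) (i : Fin n) :
    adTotal δ v ξ i ∈ ordIdeal n R (a + 1) :=
  sub_mem (vecField_mem_ordIdeal hv (hξ i)) (totalDer_mem_ordIdeal hξ (hv i))

end Filtration


/-! ### Finite-dimensional modules over the Lie algebra of formal vector fields -/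

section LieAction

variable {n : ℕ} {K : Type u} [Field K]

theorem Lplus.ext_X {a b : Lplus n K}
    (h : ∀ i, a.1 (MvPowerSeries.X i) = b.1 (MvPowerSeries.X i)) : a = b :=
  Subtype.ext (derivation_ext_X (fun r =>
    (a.1.map_algebraMap r).trans (b.1.map_algebraMap r).symm) h)

/-- The element of `L̂₊` with given coefficients, the constant terms being discarded. -/
def toLplus (v : Fin n → PS n K) : Lplus n K :=
  ⟨vecField fun i => v i - MvPowerSeries.C (MvPowerSeries.constantCoeff (v i)), fun f => by
    have := vecField_mem_ordIdeal (n := n) (R := K) (a := 0) (b := 0)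
      (v := fun i => v i - MvPowerSeries.C (MvPowerSeries.constantCoeff (v i)))
      (fun i => mem_ordIdeal_one.mpr (by simp)) (mem_ordIdeal_zero f)
    rw [vecField_apply, map_sum]
    exact Finset.sum_eq_zero fun i _ => by simp⟩

theorem toLplus_X (v : Fin n → PS n K) (i : Fin n) :
    (toLplus v).1 (MvPowerSeries.X i) =
      v i - MvPowerSeries.C (MvPowerSeries.constantCoeff (v i)) :=
  vecField_X _ i

theorem coeff_toLplus_X (v : Fin n → PS n K) (i : Fin n) {s : Fin n →₀ ℕ} (hs : s ≠ 0) :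
    MvPowerSeries.coeff s ((toLplus v).1 (MvPowerSeries.X i)) = MvPowerSeries.coeff s (v i) := by
  classical
  rw [toLplus_X, map_sub, MvPowerSeries.coeff_C, if_neg hs, sub_zero]

theorem Lplus.coeff_zero (a : Lplus n K) (i : Fin n) :
    MvPowerSeries.coeff 0 (a.1 (MvPowerSeries.X i)) = 0 := by
  rw [MvPowerSeries.coeff_zero_eq_constantCoeff_apply]
  exact a.2 _

theorem mono_X (s : {s : Fin n →₀ ℕ // s ≠ 0}) (i j : Fin n) :
    (mono s i : Lplus n K).1 (MvPowerSeries.X j) =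
      if i = j then MvPowerSeries.monomial s.1 (1 : K) else 0 := by
  classical
  change MvPowerSeries.monomial s.1 (1 : K) * MvPowerSeries.pderiv K i (MvPowerSeries.X j) = _
  rw [MvPowerSeries.pderiv_X, Pi.single_apply]
  simp [eq_comm]

theorem Lplus.apply_sum {ι : Type*} (T : Finset ι) (a : ι → Lplus n K) (f : PS n K) :
    (∑ x ∈ T, a x).1 f = ∑ x ∈ T, (a x).1 f := by
  classical
  induction T using Finset.induction_on with
  | empty => rfl
  | insert x T hx ih =>
    rw [Finset.sum_insert hx, Finset.sum_insert hx, ← ih]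
    rfl

theorem coeff_euler (f : PS n K) (s : Fin n →₀ ℕ) :
    MvPowerSeries.coeff s ((∑ j, mono (unitExp j) j : Lplus n K).1 f) =
      (s.degree : K) * MvPowerSeries.coeff s f := by
  classical
  rw [Lplus.apply_sum, map_sum]
  have h : ∀ j, MvPowerSeries.coeff s ((mono (unitExp j) j : Lplus n K).1 f) =
      (s j : K) * MvPowerSeries.coeff s f := by
    intro j
    change MvPowerSeries.coeff s (MvPowerSeries.monomial (Finsupp.single j 1) (1 : K) *
      MvPowerSeries.pderiv K j f) = _
    rw [MvPowerSeries.coeff_monomial_mul]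
    split_ifs with h
    · rw [MvPowerSeries.coeff_pderiv, tsub_add_cancel_of_le h, one_mul, mul_comm]
      congr 1
      have h1 : 1 ≤ s j := by simpa using h
      rw [Finsupp.tsub_apply, Finsupp.single_eq_same]
      push_cast [Nat.cast_sub h1]
      ring
    · have h1 : s j = 0 := by
        by_contra h0
        exact h (by simpa using Nat.one_le_iff_ne_zero.mpr h0)
      rw [h1, Nat.cast_zero, zero_mul]
  rw [Finset.sum_congr rfl fun j _ => h j, ← Finset.sum_mul, Finsupp.degree_eq_sum]
  push_cast
  rfl

/-- The Euler field multiplies a monomial by its degree, and the shift by one comes from its action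
on the variable `X i`. Hence bracketing with it is diagonal on coefficients. -/
theorem coeff_euler_lie (a : Lplus n K) (i : Fin n) (s : Fin n →₀ ℕ) :
    MvPowerSeries.coeff s ((⁅(∑ j, mono (unitExp j) j : Lplus n K), a⁆ : Lplus n K).1
      (MvPowerSeries.X i)) =
      ((s.degree : K) - 1) * MvPowerSeries.coeff s (a.1 (MvPowerSeries.X i)) := by
  change MvPowerSeries.coeff s ((∑ j, mono (unitExp j) j : Lplus n K).1 (a.1 (MvPowerSeries.X i)) -
    a.1 ((∑ j, mono (unitExp j) j : Lplus n K).1 (MvPowerSeries.X i))) = _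
  have h : (∑ j, mono (unitExp j) j : Lplus n K).1 (MvPowerSeries.X i) =
      (MvPowerSeries.X i : PS n K) := by
    rw [Lplus.apply_sum, Finset.sum_congr rfl fun j _ => mono_X (unitExp j) j i]
    simp [unitExp, MvPowerSeries.X]
  rw [h, map_sub, coeff_euler]
  ring

variable (W : Type u) [AddCommGroup W] [Module K W] [LieRingModule (Lplus n K) W]
  [LieModule K (Lplus n K) W]

theorem toEnd_lie (a b : Lplus n K) : LieModule.toEnd K (Lplus n K) W ⁅a, b⁆ =
    LieModule.toEnd K (Lplus n K) W a * LieModule.toEnd K (Lplus n K) W b -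
      LieModule.toEnd K (Lplus n K) W b * LieModule.toEnd K (Lplus n K) W a := by
  ext w
  exact lie_lie a b w

/-- The Euler vector field `∑ⱼ Xⱼ ∂/∂Xⱼ` acting on `W`. -/
def eulerEnd : Module.End K W :=
  LieModule.toEnd K (Lplus n K) W (∑ j, mono (unitExp j) j)

/-- `N` bounds the degrees in which `L̂₊` acts on `W`. -/
structure IsDegreeBound (N : ℕ) : Prop where
  weight : ∀ (a : Module.End K W) (e : ℕ), N ≤ e → 
    eulerEnd (n := n) (K := K) W * a - a * eulerEnd (n := n) (K := K) W = (e : K) • a → a = 0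
  act : ∀ a : Lplus n K, (∀ i, a.1 (MvPowerSeries.X i) ∈ ordIdeal n K N) →
    LieModule.toEnd K (Lplus n K) W a = 0

variable (n K) in
/-- On a finite-dimensional module, the homogeneous derivations of large degree act by zero, and so do
the infinite sums of such derivations. -/
theorem exists_degreeBound [CharZero K] [FiniteDimensional K W] :
    ∃ N, IsDegreeBound (n := n) (K := K) W N := by
  classical
  -- The commutator with the Euler operator acts on the finite-dimensional space End(W). In
  -- characteristic zero its minimal polynomial `p` has no natural number beyond some `N` as a root.
  let T : Module.End K (Module.End K W) := LinearMap.mulLeft K (eulerEnd (n := n) (K := K) W) -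
    LinearMap.mulRight K (eulerEnd (n := n) (K := K) W)
  let p : Polynomial K := minpoly K T
  have hp : p ≠ 0 := minpoly.ne_zero (Algebra.IsIntegral.isIntegral T)
  obtain ⟨N, hN⟩ : ∃ N : ℕ, ∀ m : ℕ, N ≤ m → p.eval (m : K) ≠ 0 := by
    have hfin : {m : ℕ | p.eval (m : K) = 0}.Finite := by
      refine Set.Finite.of_finite_image (f := fun m : ℕ => (m : K)) ?_
        Nat.cast_injective.injOn
      refine (p.roots.toFinset.finite_toSet).subset ?_
      rintro _ ⟨m, hm, rfl⟩
      simpa [hp] using hm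
    obtain ⟨N, hN⟩ := hfin.bddAbove
    exact ⟨N + 1, fun m hm h => by have := hN h; omega⟩
  refine ⟨N + 1, fun a e he ha => ?_, fun a ha => ?_⟩
  -- An eigenvector of `T` with eigenvalue `e` is multiplied by `p(e) ≠ 0` under `p(T) = 0`, so it
  -- vanishes.
  · have h1 : Polynomial.aeval T p a = p.eval (e : K) • a := by
      have hT : T a = (e : K) • a := ha
      induction p using Polynomial.induction_on' with
      | add q r hq hr => simp [hq, hr, add_smul]
      | monomial k c =>
        rw [Polynomial.aeval_monomial, Polynomial.eval_monomial]
        have : (T ^ k) a = ((e : K) ^ k) • a := by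
          induction k with
          | zero => simp
          | succ k ih => rw [pow_succ, Module.End.mul_apply, hT, map_smul, ih, smul_smul, pow_succ,
              mul_comm]
        rw [Module.End.mul_apply, this, Module.algebraMap_end_apply, smul_smul]
    have h2 : Polynomial.aeval T p = 0 := minpoly.aeval K T
    rw [h2, LinearMap.zero_apply] at h1
    exact (smul_eq_zero.mp h1.symm).resolve_left (hN e (by omega))
  · let E : Lplus n K := ∑ j, mono (unitExp j) j
    -- Dividing the coefficient at `X^s` by `p(|s| - 1)` solves `p(ad E) b = a`. Then `a` acts as
    -- `p(T)` applied to the action of `b`, hence by zero. This reaches infinite sums although no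
    -- continuity of the representation is given; the bound `N + 1` ensures `|s| - 1 ≥ N`.
    let b : Lplus n K := toLplus fun i => psMk fun s => if s.degree < N + 1 then 0 else
      (p.eval ((s.degree - 1 : ℕ) : K))⁻¹ * MvPowerSeries.coeff s (a.1 (MvPowerSeries.X i))
    have hq : ∀ (q : Polynomial K) (i : Fin n) (s : Fin n →₀ ℕ), MvPowerSeries.coeff s
        ((Polynomial.aeval (LieAlgebra.ad K (Lplus n K) E) q b).1 (MvPowerSeries.X i)) =
        q.eval ((s.degree : K) - 1) * MvPowerSeries.coeff s (b.1 (MvPowerSeries.X i)) := by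
      intro q i s
      induction q using Polynomial.induction_on' with
      | add q r hq hr =>
        rw [Polynomial.eval_add, add_mul, ← hq, ← hr, ← map_add (MvPowerSeries.coeff s),
          map_add (Polynomial.aeval _) q r]
        rfl
      | monomial k c =>
        rw [Polynomial.aeval_monomial, Polynomial.eval_monomial, Module.End.mul_apply,
          Module.algebraMap_end_apply, mul_assoc]
        change c * MvPowerSeries.coeff s ((((LieAlgebra.ad K (Lplus n K) E) ^ k) b).1
          (MvPowerSeries.X i)) = _
        congr 1
        induction k with
        | zero => simp
        | succ k ih =>
          rw [pow_succ', Module.End.mul_apply, pow_succ', mul_assoc, ← ih]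
          exact coeff_euler_lie _ i s
    have hab : Polynomial.aeval (LieAlgebra.ad K (Lplus n K) E) p b = a := by
      refine Lplus.ext_X fun i => ?_
      ext s
      rw [hq]
      by_cases hs0 : s = 0
      · rw [hs0, Lplus.coeff_zero, Lplus.coeff_zero, mul_zero]
      rw [coeff_toLplus_X _ _ hs0, coeff_psMk]
      split_ifs with hs
      · rw [mul_zero, ha i s hs]
      · have h1 : ((s.degree - 1 : ℕ) : K) = (s.degree : K) - 1 := by
          rw [Nat.cast_sub (by omega), Nat.cast_one]
        rw [← h1, ← mul_assoc, mul_inv_cancel₀ (hN _ (by omega)), one_mul]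
    have hcomm : ∀ q : Polynomial K, LieModule.toEnd K (Lplus n K) W
        (Polynomial.aeval (LieAlgebra.ad K (Lplus n K) E) q b) =
        Polynomial.aeval T q (LieModule.toEnd K (Lplus n K) W b) := by
      intro q
      induction q using Polynomial.induction_on' with
      | add q r hq hr => simp only [map_add, LinearMap.add_apply, hq, hr]
      | monomial k c =>
        simp only [Polynomial.aeval_monomial, Module.End.mul_apply, Module.algebraMap_end_apply,
          map_smul]
        congr 1
        induction k with
        | zero => simp
        | succ k ih =>
          rw [pow_succ', Module.End.mul_apply, pow_succ', Module.End.mul_apply, ← ih]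
          exact toEnd_lie _ _ _
    rw [← hab, hcomm, minpoly.aeval, LinearMap.zero_apply]

theorem IsDegreeBound.mono {W : Type u} [AddCommGroup W] [Module K W]
    [LieRingModule (Lplus n K) W] [LieModule K (Lplus n K) W] {N M : ℕ}
    (h : IsDegreeBound (n := n) (K := K) W N) (hM : N ≤ M) :
    IsDegreeBound (n := n) (K := K) W M :=
  ⟨fun a e he => h.weight a e (hM.trans he),
    fun a ha => h.act a fun i => ordIdeal_mono hM (ha i)⟩

variable (n) in
/-- The non-zero exponents of degree less than `N`. -/
def expSet (N : ℕ) : Finset {s : Fin n →₀ ℕ // s ≠ 0} :=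
  (((Finsupp.finite_of_degree_le (σ := Fin n) N).subset
    (fun s (hs : s.degree < N) => hs.le)).preimage
      (f := Subtype.val) Subtype.val_injective.injOn).toFinset

theorem mem_expSet {N : ℕ} {s : {s : Fin n →₀ ℕ // s ≠ 0}} :
    s ∈ expSet n N ↔ s.1.degree < N := by
  rw [expSet, Set.Finite.mem_toFinset]
  rfl

theorem toEnd_mono_eq_zero {W : Type u} [AddCommGroup W] [Module K W]
    [LieRingModule (Lplus n K) W] [LieModule K (Lplus n K) W] {N : ℕ}
    (h : IsDegreeBound (n := n) (K := K) W N)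
    {s : {s : Fin n →₀ ℕ // s ≠ 0}} (hs : N ≤ s.1.degree) (i : Fin n) :
    LieModule.toEnd K (Lplus n K) W (AVMod.mono s i) = 0 := by
  classical
  refine h.act _ fun j => ?_
  rw [mono_X]
  split_ifs
  · intro r hr
    rw [MvPowerSeries.coeff_monomial, if_neg]
    rintro rfl
    omega
  · exact zero_mem _

/-- The monomials `X^s ∂/∂Xᵢ` are homogeneous of degree `|s| - 1`. -/
theorem euler_lie_mono (s : {s : Fin n →₀ ℕ // s ≠ 0}) (i : Fin n) :
    eulerEnd (n := n) (K := K) W * LieModule.toEnd K (Lplus n K) W (AVMod.mono s i) -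
        LieModule.toEnd K (Lplus n K) W (AVMod.mono s i) * eulerEnd (n := n) (K := K) W =
      ((s.1.degree - 1 : ℕ) : K) • LieModule.toEnd K (Lplus n K) W (AVMod.mono s i) := by
  classical
  rw [eulerEnd, ← toEnd_lie, ← map_smul]
  congr 1
  refine Lplus.ext_X fun j => ?_
  ext r
  rw [coeff_euler_lie]
  change _ = ((s.1.degree - 1 : ℕ) : K) * MvPowerSeries.coeff r ((AVMod.mono s i).1 (MvPowerSeries.X j))
  rw [mono_X]
  split_ifs
  · rw [MvPowerSeries.coeff_monomial]
    split_ifs with h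
    · have : 1 ≤ s.1.degree := by
        rw [Nat.one_le_iff_ne_zero]
        intro h0
        exact s.2 ((Finsupp.degree_eq_zero_iff _).mp h0)
      rw [h, Nat.cast_sub this, Nat.cast_one]
    · simp
  · simp

/-- The action of an element of `L̂₊` in terms of the monomials `X^s ∂/∂Xᵢ`. -/
theorem toEnd_eq_sum {W : Type u} [AddCommGroup W] [Module K W]
    [LieRingModule (Lplus n K) W] [LieModule K (Lplus n K) W] {N : ℕ}
    (h : IsDegreeBound (n := n) (K := K) W N) (a : Lplus n K) :
    LieModule.toEnd K (Lplus n K) W a = ∑ s ∈ expSet n N, ∑ i,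
      MvPowerSeries.coeff s.1 (a.1 (MvPowerSeries.X i)) •
        LieModule.toEnd K (Lplus n K) W (AVMod.mono s i) := by
  classical
  rw [← sub_eq_zero]
  simp only [← map_smul, ← map_sum, ← map_sub]
  -- The element and its truncation differ by a field of order `N`, which acts by zero.
  refine h.act _ fun j r hr => ?_
  change MvPowerSeries.coeff r (a.1 (MvPowerSeries.X j) -
    (∑ s ∈ expSet n N, ∑ i, MvPowerSeries.coeff s.1 (a.1 (MvPowerSeries.X i)) •
      (AVMod.mono s i : Lplus n K)).1 (MvPowerSeries.X j)) = 0
  rw [map_sub, sub_eq_zero, Lplus.apply_sum, map_sum]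
  have hterm : ∀ s : {s : Fin n →₀ ℕ // s ≠ 0}, MvPowerSeries.coeff r
      ((∑ i, MvPowerSeries.coeff s.1 (a.1 (MvPowerSeries.X i)) •
        (AVMod.mono s i : Lplus n K)).1 (MvPowerSeries.X j)) =
      if r = s.1 then MvPowerSeries.coeff s.1 (a.1 (MvPowerSeries.X j)) else 0 := by
    intro s
    rw [Lplus.apply_sum, map_sum, Finset.sum_eq_single j]
    · change MvPowerSeries.coeff s.1 (a.1 (MvPowerSeries.X j)) *
        MvPowerSeries.coeff r ((AVMod.mono s j : Lplus n K).1 (MvPowerSeries.X j)) = _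
      rw [mono_X, if_pos rfl, MvPowerSeries.coeff_monomial]
      split_ifs <;> simp
    · intro i _ hij
      change MvPowerSeries.coeff s.1 (a.1 (MvPowerSeries.X i)) *
        MvPowerSeries.coeff r ((AVMod.mono s i : Lplus n K).1 (MvPowerSeries.X j)) = _
      rw [mono_X, if_neg hij, map_zero, mul_zero]
    · simp
  rw [Finset.sum_congr rfl fun s _ => hterm s]
  by_cases hr0 : r = 0
  · rw [hr0, Lplus.coeff_zero]
    refine (Finset.sum_eq_zero fun s _ => ?_).symm
    rw [if_neg fun h => s.2 h.symm]
  · rw [Finset.sum_eq_single ⟨r, hr0⟩]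
    · simp
    · intro s _ hs
      rw [if_neg]
      intro h
      exact hs (Subtype.ext h.symm)
    · intro h
      exact absurd (mem_expSet.mpr hr) h

section LieAct

variable {W} {N : ℕ} (h : IsDegreeBound (n := n) (K := K) W N)
  {R : Type u} [CommRing R] [Algebra K R]

include h

/-- Exponents of degree at least `N` act by zero, so the index set is finite and depends neither on
`v` nor on `R`. Linearity in `v` and naturality in `R` are read off from this form. -/
theorem lieAct_eq_sum (v : Fin n → PS n R) :
    lieAct K W v = ∑ s ∈ expSet n N, ∑ i, MvPowerSeries.coeff s.1 (v i) •
      (LieModule.toEnd K (Lplus n K) W (mono s i)).baseChange R := by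
  rw [lieAct]
  refine finsum_eq_sum_of_support_subset _ fun s hs => ?_
  by_contra hN
  refine hs (Finset.sum_eq_zero fun i _ => ?_)
  rw [toEnd_mono_eq_zero h (not_lt.mp fun h' => hN (mem_expSet.mpr h')), LinearMap.baseChange_zero,
    smul_zero]

theorem lieAct_congr {v w : Fin n → PS n R} (hvw : ∀ i, v i - w i ∈ ordIdeal n R N) :
    lieAct K W v = lieAct K W w := by
  rw [lieAct_eq_sum h, lieAct_eq_sum h]
  refine Finset.sum_congr rfl fun s hs => Finset.sum_congr rfl fun i _ => ?_
  rw [coeff_eq_of_sub_mem_ordIdeal (hvw i) (mem_expSet.mp hs)]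

theorem lieAct_add (v w : Fin n → PS n R) :
    lieAct K W (v + w) = lieAct K W v + lieAct K W w := by
  simp only [lieAct_eq_sum h, Pi.add_apply, map_add, add_smul, Finset.sum_add_distrib]

theorem lieAct_smul (r : R) (v : Fin n → PS n R) :
    lieAct K W (r • v) = r • lieAct K W v := by
  simp only [lieAct_eq_sum h, Pi.smul_apply, Finset.smul_sum, smul_smul]
  rfl

theorem lieAct_zero : lieAct K W (0 : Fin n → PS n R) = 0 := by
  have := lieAct_smul h (0 : R) 0
  rwa [zero_smul, zero_smul] at this

theorem lieAct_sub (v w : Fin n → PS n R) :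
    lieAct K W (v - w) = lieAct K W v - lieAct K W w := by
  have h1 := lieAct_add h (v - w) w
  rw [sub_add_cancel] at h1
  refine LinearMap.ext fun t => ?_
  rw [h1, LinearMap.sub_apply, LinearMap.add_apply]
  abel

theorem lieAct_sum {ι : Type*} (T : Finset ι) (v : ι → Fin n → PS n R) :
    lieAct K W (∑ x ∈ T, v x) = ∑ x ∈ T, lieAct K W (v x) := by
  classical
  induction T using Finset.induction_on with
  | empty => rw [Finset.sum_empty, Finset.sum_empty, lieAct_zero h]
  | insert x T hx ih => rw [Finset.sum_insert hx, Finset.sum_insert hx, lieAct_add h, ih]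

theorem lieAct_map (a : Lplus n K) :
    lieAct K W (fun i => MvPowerSeries.map (algebraMap K R) (a.1 (MvPowerSeries.X i))) =
      (LieModule.toEnd K (Lplus n K) W a).baseChange R := by
  rw [lieAct_eq_sum h, toEnd_eq_sum h a]
  have hbc : ∀ {ι : Type} (T : Finset ι) (f : ι → Module.End K W),
      (∑ x ∈ T, f x).baseChange R = ∑ x ∈ T, (f x).baseChange R :=
    fun T f => map_sum (LinearMap.baseChangeHom K R W W) f T
  rw [hbc]
  refine Finset.sum_congr rfl fun s _ => ?_
  rw [hbc]
  refine Finset.sum_congr rfl fun i _ => ?_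
  rw [MvPowerSeries.coeff_map, algebraMap_smul, LinearMap.baseChange_smul]

theorem lieAct_natural {R' : Type u} [CommRing R'] [Algebra K R'] (f : R →ₐ[K] R')
    (v : Fin n → PS n R) (t : R ⊗[K] W) :
    TensorProduct.map f.toLinearMap LinearMap.id (lieAct K W v t) =
      lieAct K W (fun i => MvPowerSeries.map (f : R →+* R') (v i))
        (TensorProduct.map f.toLinearMap LinearMap.id t) := by
  rw [lieAct_eq_sum h, lieAct_eq_sum h]
  simp only [LinearMap.sum_apply, map_sum, LinearMap.smul_apply]
  refine Finset.sum_congr rfl fun s _ => Finset.sum_congr rfl fun i _ => ?_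
  induction t with
  | zero => simp
  | add a b ha hb => simp only [map_add, smul_add, ha, hb]
  | tmul a w => simp [TensorProduct.smul_tmul', MvPowerSeries.coeff_map]

end LieAct

end LieAction


/-! ### The action of vector fields with coefficients in R respects brackets -/

section LieHom

variable {n : ℕ} {R : Type u} [CommRing R]

/-- The vector field `X^s ∂/∂Xᵢ` with coefficients in `R`. -/
def monoVec (s : Fin n →₀ ℕ) (i : Fin n) : Fin n → PS n R :=
  Pi.single i (MvPowerSeries.monomial s 1)

theorem vecField_map {S : Type u} [CommRing S] (f : R →+* S) (v : Fin n → PS n R) (g : PS n R) :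
    vecField (fun i => MvPowerSeries.map f (v i)) (MvPowerSeries.map f g) =
      MvPowerSeries.map f (vecField v g) := by
  rw [vecField_apply, vecField_apply, map_sum]
  refine Finset.sum_congr rfl fun i _ => ?_
  rw [map_mul]
  congr 1
  ext s
  rw [MvPowerSeries.coeff_pderiv, MvPowerSeries.coeff_map, MvPowerSeries.coeff_map,
    MvPowerSeries.coeff_pderiv, map_mul]
  simp

/-- The coefficients of the bracket of two vector fields. -/
def lieVec (u v : Fin n → PS n R) (i : Fin n) : PS n R := vecField u (v i) - vecField v (u i)

theorem lieVec_mem_ordIdeal {u v : Fin n → PS n R} {a b : ℕ}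
    (hu : ∀ i, u i ∈ ordIdeal n R (a + 1)) (hv : ∀ i, v i ∈ ordIdeal n R (b + 1)) (i : Fin n) :
    lieVec u v i ∈ ordIdeal n R (a + b + 1) := by
  refine sub_mem ?_ ?_
  · have := vecField_mem_ordIdeal hu (hv i)
    rwa [← add_assoc] at this
  · have := vecField_mem_ordIdeal hv (hu i)
    rwa [show b + (a + 1) = a + b + 1 by ring] at this

theorem lieVec_add_left (u u' v : Fin n → PS n R) :
    lieVec (u + u') v = lieVec u v + lieVec u' v := by
  funext i
  simp only [lieVec, vecField_add, Pi.add_apply, Derivation.add_apply, map_add]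
  ring

theorem lieVec_add_right (u v v' : Fin n → PS n R) :
    lieVec u (v + v') = lieVec u v + lieVec u v' := by
  funext i
  simp only [lieVec, vecField_add, Pi.add_apply, Derivation.add_apply, map_add]
  ring

theorem vecField_smul (r : R) (v : Fin n → PS n R) (f : PS n R) :
    vecField (r • v) f = r • vecField v f := by
  simp only [vecField_apply, Pi.smul_apply, Finset.smul_sum, smul_mul_assoc]

theorem lieVec_smul_left (r : R) (u v : Fin n → PS n R) :
    lieVec (r • u) v = r • lieVec u v := by
  funext i
  simp only [lieVec, Pi.smul_apply, Derivation.map_smul, smul_sub, vecField_smul]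

theorem lieVec_smul_right (r : R) (u v : Fin n → PS n R) :
    lieVec u (r • v) = r • lieVec u v := by
  funext i
  simp only [lieVec, Pi.smul_apply, Derivation.map_smul, smul_sub, vecField_smul]

/-- The terms of degree `0 < |s| < N` of a vector field. -/
def truncVec (N : ℕ) (v : Fin n → PS n R) : Fin n → PS n R :=
  ∑ s ∈ expSet n N, ∑ i, MvPowerSeries.coeff s.1 (v i) • monoVec s.1 i

theorem coeff_monoVec [DecidableEq (Fin n →₀ ℕ)] (s r : Fin n →₀ ℕ) (i j : Fin n) :
    MvPowerSeries.coeff r (monoVec (R := R) s i j) = if i = j ∧ r = s then 1 else 0 := by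
  classical
  rw [monoVec, Pi.single_apply]
  by_cases h : j = i
  · rw [if_pos h, MvPowerSeries.coeff_monomial]
    simp [h]
  · rw [if_neg h, map_zero, if_neg fun h' => h h'.1.symm]

theorem sub_truncVec_mem {N : ℕ} {v : Fin n → PS n R} (hv : ∀ i, v i ∈ ordIdeal n R 1)
    (i : Fin n) : v i - truncVec N v i ∈ ordIdeal n R N := by
  classical
  intro r hr
  rw [map_sub, sub_eq_zero, truncVec, Finset.sum_apply, map_sum]
  have hterm : ∀ s : {s : Fin n →₀ ℕ // s ≠ 0}, MvPowerSeries.coeff r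
      ((∑ j, MvPowerSeries.coeff s.1 (v j) • monoVec s.1 j) i) =
      if r = s.1 then MvPowerSeries.coeff r (v i) else 0 := by
    intro s
    rw [Finset.sum_apply, map_sum, Finset.sum_eq_single i]
    · change MvPowerSeries.coeff s.1 (v i) * MvPowerSeries.coeff r (monoVec s.1 i i) = _
      rw [coeff_monoVec]
      by_cases h : r = s.1
      · simp [h]
      · simp [h]
    · intro j _ hj
      change MvPowerSeries.coeff s.1 (v j) * MvPowerSeries.coeff r (monoVec s.1 j i) = _
      rw [coeff_monoVec, if_neg fun h => hj h.1, mul_zero]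
    · simp
  rw [Finset.sum_congr rfl fun s _ => hterm s]
  by_cases hr0 : r = 0
  · rw [Finset.sum_eq_zero]
    · exact hv i r (by rw [hr0, map_zero]; exact Nat.one_pos)
    · intro s _
      rw [if_neg fun h => s.2 (h.symm.trans hr0)]
  · rw [Finset.sum_eq_single ⟨r, hr0⟩]
    · simp
    · intro s _ hs
      rw [if_neg]
      intro h
      exact hs (Subtype.ext h.symm)
    · intro h
      exact absurd (mem_expSet.mpr hr) h

variable {K : Type u} [Field K] [Algebra K R]
  {W : Type u} [AddCommGroup W] [Module K W] [LieRingModule (Lplus n K) W]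
  [LieModule K (Lplus n K) W] {N : ℕ} (h : IsDegreeBound (n := n) (K := K) W N)

include h

theorem lieAct_monoVec (s : {s : Fin n →₀ ℕ // s ≠ 0}) (i : Fin n) :
    lieAct K W (monoVec (R := R) s.1 i) =
      (LieModule.toEnd K (Lplus n K) W (mono s i)).baseChange R := by
  classical
  rw [← lieAct_map h]
  congr 1
  funext j
  rw [mono_X, monoVec, Pi.single_apply]
  by_cases hij : j = i
  · rw [if_pos hij, if_pos hij.symm, MvPowerSeries.map_monomial, (algebraMap K R).map_one]
  · rw [if_neg hij, if_neg fun h => hij h.symm, map_zero]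

/-- The monomial fields have coefficients in `K`, so the relation is the base change of the one that
holds in the Lie module `W`. -/
theorem lieAct_lieVec_mono (s r : {s : Fin n →₀ ℕ // s ≠ 0}) (i j : Fin n) :
    lieAct K W (lieVec (R := R) (monoVec s.1 i) (monoVec r.1 j)) +
        lieAct K W (monoVec r.1 j) * lieAct K W (monoVec s.1 i) =
      lieAct K W (monoVec s.1 i) * lieAct K W (monoVec r.1 j) := by
  classical
  rw [lieAct_monoVec h, lieAct_monoVec h]
  have h1 : lieVec (R := R) (monoVec s.1 i) (monoVec r.1 j) = fun k =>
      MvPowerSeries.map (algebraMap K R)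
        ((⁅(mono s i : Lplus n K), mono r j⁆ : Lplus n K).1 (MvPowerSeries.X k)) := by
    have hm : ∀ (s : {s : Fin n →₀ ℕ // s ≠ 0}) (i : Fin n), monoVec (R := R) s.1 i =
        fun k => MvPowerSeries.map (algebraMap K R)
          ((mono s i : Lplus n K).1 (MvPowerSeries.X k)) := by
      intro s i
      funext j
      rw [mono_X, monoVec, Pi.single_apply]
      by_cases hij : j = i
      · rw [if_pos hij, if_pos hij.symm, MvPowerSeries.map_monomial, (algebraMap K R).map_one]
      · rw [if_neg hij, if_neg fun h => hij h.symm, map_zero]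
    have hv : ∀ (a : Lplus n K), vecField (fun k => a.1 (MvPowerSeries.X k)) = a.1 := by
      intro a
      refine derivation_ext_X (fun r => ?_) fun k => vecField_X _ k
      rw [vecField_C]
      exact (a.1.map_algebraMap r).symm
    funext k
    rw [lieVec, hm s i, hm r j, vecField_map, vecField_map, hv, hv, ← map_sub]
    rfl
  rw [h1, lieAct_map h, toEnd_lie, ← LinearMap.baseChange_mul, ← LinearMap.baseChange_mul,
    ← LinearMap.baseChange_add, sub_add_cancel]

/-- Bilinearity over `R` extends the relation from monomials to truncated fields. Since both fields
vanish at the origin, truncating them at degree `N` alters their bracket only by terms of order `N`,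
and these act by zero. -/
theorem lieAct_lieVec {u v : Fin n → PS n R} (hu : ∀ i, u i ∈ ordIdeal n R 1)
    (hv : ∀ i, v i ∈ ordIdeal n R 1) :
    lieAct K W (lieVec u v) + lieAct K W v * lieAct K W u = lieAct K W u * lieAct K W v := by
  have hpoly : ∀ (u v : Fin n → PS n R), lieAct K W (lieVec (truncVec N u) (truncVec N v)) +
        lieAct K W (truncVec N v) * lieAct K W (truncVec N u) =
      lieAct K W (truncVec N u) * lieAct K W (truncVec N v) := by
    intro u v
    let S : Submodule R (Fin n → PS n R) :=
      Submodule.span R {w | ∃ (s : {s : Fin n →₀ ℕ // s ≠ 0}) (i : Fin n), w = monoVec s.1 i}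
    have hS : ∀ u : Fin n → PS n R, truncVec N u ∈ S := fun u =>
      sum_mem fun s _ => sum_mem fun i _ =>
        Submodule.smul_mem _ _ (Submodule.subset_span ⟨s, i, rfl⟩)
    refine Submodule.span_induction₂ (p := fun u v _ _ => lieAct K W (lieVec u v) +
      lieAct K W v * lieAct K W u = lieAct K W u * lieAct K W v) ?_ ?_ ?_ ?_ ?_ ?_ ?_ (hS u) (hS v)
    · rintro _ _ ⟨s, i, rfl⟩ ⟨r, j, rfl⟩
      exact lieAct_lieVec_mono h s r i j
    · intro v _
      have : lieVec (0 : Fin n → PS n R) v = 0 := by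
        have := lieVec_smul_left (0 : R) 0 v
        rwa [zero_smul, zero_smul] at this
      rw [this, lieAct_zero h, zero_mul, mul_zero, add_zero]
    · intro v _
      have : lieVec v (0 : Fin n → PS n R) = 0 := by
        have := lieVec_smul_right (0 : R) v 0
        rwa [zero_smul, zero_smul] at this
      rw [this, lieAct_zero h, zero_mul, mul_zero, add_zero]
    · intro x y z _ _ _ h1 h2
      rw [lieVec_add_left, lieAct_add h, lieAct_add h, add_mul, mul_add, ← h1, ← h2]
      abel
    · intro x y z _ _ _ h1 h2
      rw [lieVec_add_right, lieAct_add h, lieAct_add h, add_mul, mul_add, ← h1, ← h2]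
      abel
    · intro r x y _ _ h1
      rw [lieVec_smul_left, lieAct_smul h, lieAct_smul h, smul_mul_assoc, mul_smul_comm,
        ← h1, smul_add]
    · intro r x y _ _ h1
      rw [lieVec_smul_right, lieAct_smul h, lieAct_smul h, smul_mul_assoc, mul_smul_comm,
        ← h1, smul_add]
  have htr : ∀ u : Fin n → PS n R, ∀ i, truncVec N u i ∈ ordIdeal n R 1 := by
    classical
    intro u i
    rw [truncVec, Finset.sum_apply]
    refine Ideal.sum_mem _ fun s _ => ?_
    rw [Finset.sum_apply]
    refine Ideal.sum_mem _ fun j _ => Submodule.smul_of_tower_mem (ordIdeal n R 1) (MvPowerSeries.coeff s.1 (u j)) ?_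
    intro r hr
    rw [coeff_monoVec, if_neg]
    rintro ⟨_, rfl⟩
    exact s.2 ((Finsupp.degree_eq_zero_iff _).mp (Nat.lt_one_iff.mp hr))
  have h1 : ∀ u : Fin n → PS n R, (∀ i, u i ∈ ordIdeal n R 1) →
      lieAct K W u = lieAct K W (truncVec N u) := fun u hu =>
    lieAct_congr h (sub_truncVec_mem hu)
  suffices hlie : ∀ i, lieVec u v i - lieVec (truncVec N u) (truncVec N v) i ∈ ordIdeal n R N by
    rw [h1 u hu, h1 v hv, ← hpoly u v, lieAct_congr h hlie]
  intro i
  have h2 : lieVec u v i - lieVec (truncVec N u) (truncVec N v) i =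
      (vecField (u - truncVec N u) (v i) + vecField (truncVec N u) (v i - truncVec N v i)) -
      (vecField (v - truncVec N v) (u i) + vecField (truncVec N v) (u i - truncVec N u i)) := by
    simp only [lieVec, vecField_sub, Derivation.sub_apply, map_sub]
    ring
  rw [h2]
  have h3 : ∀ {u v : Fin n → PS n R}, (∀ i, u i ∈ ordIdeal n R 1) →
      (∀ i, v i ∈ ordIdeal n R 1) →
      vecField (u - truncVec N u) (v i) + vecField (truncVec N u) (v i - truncVec N v i) ∈
        ordIdeal n R N := by
    intro u v hu hv
    refine add_mem ?_ ?_
    · exact vecField_mem_ordIdeal' (fun j => sub_truncVec_mem hu j) (b := 0) (hv i)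
    · have := vecField_mem_ordIdeal (a := 0) (htr u) (sub_truncVec_mem (N := N) hv i)
      rwa [zero_add] at this
  exact sub_mem (h3 hu hv) (h3 hv hu)

omit h in
/-- The operator `δ ⊗ 1` on `R ⊗ W`. -/
def derT (W : Type u) [AddCommGroup W] [Module K W] (δ : Derivation K R R) :
    Module.End K (R ⊗[K] W) :=
  LinearMap.rTensor W (δ : R →ₗ[K] R)

omit h [LieRingModule (Lplus n K) W] [LieModule K (Lplus n K) W] in
theorem derT_tmul (δ : Derivation K R R) (r : R) (w : W) :
    derT W δ (r ⊗ₜ w) = δ r ⊗ₜ w := rfl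

omit h [LieRingModule (Lplus n K) W] [LieModule K (Lplus n K) W] in
theorem derT_smul (δ : Derivation K R R) (r : R) (t : R ⊗[K] W) :
    derT W δ (r • t) = δ r • t + r • derT W δ t := by
  induction t with
  | zero => simp
  | add a b ha hb => rw [smul_add, map_add, ha, hb, map_add, smul_add, smul_add]; abel
  | tmul a w =>
    simp only [TensorProduct.smul_tmul', derT_tmul, smul_eq_mul, Derivation.leibniz,
      TensorProduct.add_tmul]
    rw [add_comm, mul_comm a]

omit h [LieRingModule (Lplus n K) W] [LieModule K (Lplus n K) W] in
theorem derT_baseChange (δ : Derivation K R R) (a : Module.End K W) (t : R ⊗[K] W) :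
    derT W δ (a.baseChange R t) = a.baseChange R (derT W δ t) := by
  induction t with
  | zero => simp
  | add x y hx hy => simp only [map_add, hx, hy]
  | tmul r w => simp [derT_tmul]

theorem derT_lieAct (δ : Derivation K R R) (v : Fin n → PS n R) (t : R ⊗[K] W) :
    derT W δ (lieAct K W v t) =
      lieAct K W (fun i => coeffDer δ (v i)) t + lieAct K W v (derT W δ t) := by
  rw [lieAct_eq_sum h, lieAct_eq_sum h]
  simp only [LinearMap.sum_apply, map_sum, LinearMap.smul_apply, derT_smul,
    ← Finset.sum_add_distrib, coeff_coeffDer, derT_baseChange]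

omit h in
/-- The operator `δ ⊗ 1 + ρ(ξ)` on `R ⊗ W`. -/
def totalAct (W : Type u) [AddCommGroup W] [Module K W] [LieRingModule (Lplus n K) W]
    [LieModule K (Lplus n K) W] (δ : Derivation K R R) (ξ : Fin n → PS n R) :
    Module.End K (R ⊗[K] W) :=
  derT W δ + (lieAct K W ξ).restrictScalars K

omit h in
theorem totalAct_apply (δ : Derivation K R R) (ξ : Fin n → PS n R) (t : R ⊗[K] W) :
    totalAct W δ ξ t = derT W δ t + lieAct K W ξ t := rfl

omit h in
theorem totalAct_smul (δ : Derivation K R R) (ξ : Fin n → PS n R) (r : R) (t : R ⊗[K] W) :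
    totalAct W δ ξ (r • t) = δ r • t + r • totalAct W δ ξ t := by
  rw [totalAct_apply, totalAct_apply, derT_smul, map_smul, smul_add, add_assoc]

omit h [AddCommGroup W] [Module K W] [LieRingModule (Lplus n K) W] [LieModule K (Lplus n K) W] in
theorem adTotal_eq (δ : Derivation K R R) (v ξ : Fin n → PS n R) :
    adTotal δ v ξ = lieVec v ξ - fun i => coeffDer δ (v i) := by
  funext i
  simp only [adTotal, lieVec, totalDer_apply, Pi.sub_apply]
  ring

/-- The commutator of `v` with δ + ξ consists of the bracket of `v` and `ξ` and of -δ(v). The first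
part acts as a commutator by `lieAct_lieVec`, the second by the product rule `derT_lieAct`. -/
theorem lieAct_adTotal (δ : Derivation K R R) {v ξ : Fin n → PS n R}
    (hv : ∀ i, v i ∈ ordIdeal n R 1) (hξ : ∀ i, ξ i ∈ ordIdeal n R 1) (t : R ⊗[K] W) :
    lieAct K W (adTotal δ v ξ) t + totalAct W δ ξ (lieAct K W v t) =
      lieAct K W v (totalAct W δ ξ t) := by
  have h1 := DFunLike.congr_fun (lieAct_lieVec (R := R) h hv hξ) t
  simp only [LinearMap.add_apply, Module.End.mul_apply] at h1
  rw [totalAct_apply, totalAct_apply, map_add, ← h1, derT_lieAct h, adTotal_eq, lieAct_sub h,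
    LinearMap.sub_apply]
  abel

omit h [LieRingModule (Lplus n K) W] [LieModule K (Lplus n K) W] in
theorem derT_lie (δ μ : Derivation K R R) (t : R ⊗[K] W) :
    derT W ⁅δ, μ⁆ t + derT W μ (derT W δ t) = derT W δ (derT W μ t) := by
  induction t with
  | zero => simp
  | add x y hx hy =>
    simp only [map_add, ← hx, ← hy]
    abel
  | tmul r w =>
    simp only [derT_tmul, ← TensorProduct.add_tmul, Derivation.commutator_apply, sub_add_cancel]

/-- The bracket of δ + ξ and μ + ζ has the part ⁅δ, μ⁆ on coefficients and the field [ξ, ζ] + δ(ζ) -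
μ(ξ); each of the pieces acts as the corresponding commutator. The Lie algebra axiom for jet modules
comes from here. -/
theorem totalAct_lie (δ μ : Derivation K R R) {ξ ζ : Fin n → PS n R}
    (hξ : ∀ i, ξ i ∈ ordIdeal n R 1) (hζ : ∀ i, ζ i ∈ ordIdeal n R 1) (t : R ⊗[K] W) :
    totalAct W ⁅δ, μ⁆ (fun i => totalDer δ ξ (ζ i) - totalDer μ ζ (ξ i)) t +
      totalAct W μ ζ (totalAct W δ ξ t) = totalAct W δ ξ (totalAct W μ ζ t) := by
  have h1 := DFunLike.congr_fun (lieAct_lieVec (R := R) h hξ hζ) t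
  simp only [LinearMap.add_apply, Module.End.mul_apply] at h1
  have h2 : (fun i => totalDer δ ξ (ζ i) - totalDer μ ζ (ξ i)) =
      lieVec ξ ζ + ((fun i => coeffDer δ (ζ i)) - fun i => coeffDer μ (ξ i)) := by
    funext i
    simp only [lieVec, totalDer_apply, Pi.add_apply, Pi.sub_apply]
    ring
  simp only [totalAct_apply, map_add]
  rw [h2, lieAct_add h, lieAct_sub h, LinearMap.add_apply, LinearMap.sub_apply, ← h1,
    derT_lieAct h, derT_lieAct h, ← derT_lie δ μ]
  abel

end LieHom


/-! ### Truncated exponentials in an associative algebra -/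

section ExpSum

variable {K : Type*} [Field K] {B : Type*} [Ring B] [Algebra K B]

variable (K) in
/-- The partial sum `∑_{k < M} Tᵏ/k!`. -/
def expSum (M : ℕ) (T : B) : B := ∑ k ∈ Finset.range M, ((k.factorial : K)⁻¹) • T ^ k

variable (K) in
/-- The commutator with `T`. -/
def adOp (T : B) : Module.End K B := LinearMap.mulLeft K T - LinearMap.mulRight K T

theorem adOp_apply (T D : B) : adOp K T D = T * D - D * T := rfl

/-- The Cauchy product contains exactly the terms with `i + j < M`; the remaining terms are errors
in `Z`. The subgroup `Z` stands for operators of high order on power series and for zero on `R ⊗ W`.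
-/
theorem sum_mul_sum_sub_mem (Z : AddSubgroup B) (a b : ℕ → B) (M : ℕ)
    (h : ∀ i j, M ≤ i + j → a i * b j ∈ Z) :
    (∑ k ∈ Finset.range M, ∑ p ∈ Finset.HasAntidiagonal.antidiagonal k, a p.1 * b p.2) -
      (∑ i ∈ Finset.range M, a i) * ∑ j ∈ Finset.range M, b j ∈ Z := by
  classical
  have h1 : (∑ i ∈ Finset.range M, a i) * ∑ j ∈ Finset.range M, b j =
      ∑ p ∈ Finset.range M ×ˢ Finset.range M, a p.1 * b p.2 := by
    rw [Finset.sum_mul_sum, Finset.sum_product]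
  have h2 : (∑ k ∈ Finset.range M, ∑ p ∈ Finset.HasAntidiagonal.antidiagonal k, a p.1 * b p.2) =
      ∑ p ∈ (Finset.range M ×ˢ Finset.range M).filter fun p => p.1 + p.2 < M, a p.1 * b p.2 := by
    rw [Finset.sum_sigma']
    refine Finset.sum_bij' (fun x _ => x.2) (fun p _ => ⟨p.1 + p.2, p⟩) ?_ ?_ ?_ ?_ ?_
    · rintro ⟨k, p⟩ hp
      simp only [Finset.mem_sigma, Finset.mem_range, Finset.HasAntidiagonal.mem_antidiagonal] at hp
      simp only [Finset.mem_filter, Finset.mem_product, Finset.mem_range]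
      omega
    · rintro p hp
      simp only [Finset.mem_filter, Finset.mem_product, Finset.mem_range] at hp
      simp [hp.2]
    · rintro ⟨k, p⟩ hp
      simp only [Finset.mem_sigma, Finset.mem_range, Finset.HasAntidiagonal.mem_antidiagonal] at hp
      obtain ⟨_, rfl⟩ := hp
      rfl
    · intro p _
      rfl
    · intro p _
      rfl
  rw [h1, h2, ← Finset.sum_filter_add_sum_filter_not (Finset.range M ×ˢ Finset.range M)
    (fun p => p.1 + p.2 < M) fun p => a p.1 * b p.2, ← sub_sub, sub_self, zero_sub]
  refine neg_mem (sum_mem fun p hp => h _ _ ?_)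
  exact not_lt.mp (Finset.mem_filter.mp hp).2

/-- Left multiplication by `T` is the sum of `ad T` and right multiplication by `T`. These two
commute, so the binomial theorem applies. -/
theorem pow_mul_eq_sum (T D : B) (k : ℕ) :
    T ^ k * D = ∑ p ∈ Finset.HasAntidiagonal.antidiagonal k,
      k.choose p.1 • (((adOp K T) ^ p.1) D * T ^ p.2) := by
  have hc : Commute (adOp K T) (LinearMap.mulRight K T) := by
    refine LinearMap.ext fun x => ?_
    simp [adOp_apply, sub_mul, mul_assoc]
  have h1 : LinearMap.mulLeft K T = adOp K T + LinearMap.mulRight K T := by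
    rw [adOp]
    abel
  have h2 : T ^ k * D = ((LinearMap.mulLeft K T) ^ k) D := by
    rw [LinearMap.pow_mulLeft]
    rfl
  rw [h2, h1, hc.add_pow', LinearMap.sum_apply]
  refine Finset.sum_congr rfl fun p _ => ?_
  rw [LinearMap.smul_apply, (hc.pow_pow p.1 p.2).eq, Module.End.mul_apply, LinearMap.pow_mulRight]
  rfl

variable [CharZero K]

theorem choose_div_factorial {k i j : ℕ} (h : i + j = k) :
    ((k.factorial : K)⁻¹) * (k.choose i : K) = ((i.factorial : K)⁻¹) * ((j.factorial : K)⁻¹) := by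
  have h1 : (k.choose i : K) * i.factorial * j.factorial = k.factorial := by
    rw [← h]
    have h2 := Nat.add_choose_mul_factorial_mul_factorial j i
    rw [add_comm j i] at h2
    rw [mul_right_comm]
    exact_mod_cast h2
  have hi : (i.factorial : K) ≠ 0 := Nat.cast_ne_zero.mpr i.factorial_ne_zero
  have hj : (j.factorial : K) ≠ 0 := Nat.cast_ne_zero.mpr j.factorial_ne_zero
  have hk : (k.factorial : K) ≠ 0 := Nat.cast_ne_zero.mpr k.factorial_ne_zero
  field_simp
  rw [← h1]

/-- The conjugation formula `exp(T) D = (∑ ad(T)ⁱ(D)/i!) exp(T)` for partial sums. -/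
theorem expSum_mul_sub_mem (Z : AddSubgroup B) (T D : B) (M : ℕ)
    (h : ∀ (c : K) i j, M ≤ i + j → c • (((adOp K T) ^ i) D * T ^ j) ∈ Z) :
    expSum K M T * D - (∑ i ∈ Finset.range M, ((i.factorial : K)⁻¹) • ((adOp K T) ^ i) D) *
      expSum K M T ∈ Z := by
  have h1 := sum_mul_sum_sub_mem Z (fun i => ((i.factorial : K)⁻¹) • ((adOp K T) ^ i) D)
    (fun j => ((j.factorial : K)⁻¹) • T ^ j) M (fun i j hij => by
      rw [smul_mul_smul_comm]
      exact h _ i j hij)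
  convert h1 using 2
  swap
  · rfl
  rw [expSum, Finset.sum_mul]
  refine Finset.sum_congr rfl fun k _ => ?_
  rw [smul_mul_assoc, pow_mul_eq_sum (K := K), Finset.smul_sum]
  refine Finset.sum_congr rfl fun p hp => ?_
  rw [smul_mul_smul_comm, ← choose_div_factorial (Finset.HasAntidiagonal.mem_antidiagonal.mp hp),
    mul_smul, Nat.cast_smul_eq_nsmul]

/-- For `k > 0` the degree `k` part of the product is the binomial expansion of `(T - T)^k / k!`,
which is zero. -/
theorem expSum_mul_neg_sub_mem (Z : AddSubgroup B) (T : B) (M : ℕ) (hM : 0 < M)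
    (h : ∀ (c : K) i, M ≤ i → c • T ^ i ∈ Z) :
    1 - expSum K M T * expSum K M (-T) ∈ Z := by
  have h1 := sum_mul_sum_sub_mem Z (fun i => ((i.factorial : K)⁻¹) • T ^ i)
    (fun j => ((j.factorial : K)⁻¹) • (-T) ^ j) M (fun i j hij => by
      rw [smul_mul_smul_comm, neg_pow, ← mul_assoc, ((Commute.neg_one_right _).pow_right j).eq,
        mul_assoc, ← pow_add]
      rcases neg_one_pow_eq_or B j with h' | h' <;> rw [h']
      · rw [one_mul]
        exact h _ _ hij
      · rw [neg_one_mul, smul_neg]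
        exact neg_mem (h _ _ hij))
  convert h1 using 2
  swap
  · rfl
  rw [Finset.sum_eq_single_of_mem 0 (Finset.mem_range.mpr hM)]
  · simp
  · intro k _ hk
    have h2 : (T + -T) ^ k = 0 := by rw [add_neg_cancel, zero_pow hk]
    rw [(Commute.neg_right (Commute.refl T)).add_pow'] at h2
    have h3 := congrArg (fun x => ((k.factorial : K)⁻¹) • x) h2
    simp only [smul_zero, Finset.smul_sum] at h3
    rw [← h3]
    refine Finset.sum_congr rfl fun p hp => ?_
    rw [smul_mul_smul_comm,
      ← choose_div_factorial (Finset.HasAntidiagonal.mem_antidiagonal.mp hp), mul_smul,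
      Nat.cast_smul_eq_nsmul]

end ExpSum

/-! ### Euler weights and nilpotency -/

section Weights

variable {n : ℕ} {K : Type u} [Field K] (R : Type u) [CommRing R] [Algebra K R]
  (W : Type u) [AddCommGroup W] [Module K W] [LieRingModule (Lplus n K) W]
  [LieModule K (Lplus n K) W]

/-- The operators on `R ⊗ W` that are combinations of operators of weight `≥ d`. -/
def weightGE (d : ℕ) : Submodule R (Module.End R (R ⊗[K] W)) :=
  Submodule.span R {T | ∃ (a : Module.End K W) (e : ℕ), d ≤ e ∧
    eulerEnd (n := n) (K := K) W * a - a * eulerEnd (n := n) (K := K) W = (e : K) • a ∧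
      T = a.baseChange R}

variable {R W}

/-- The commutator with the Euler operator is a derivation, so weights add under multiplication. -/
theorem weightGE_mul {a b : ℕ} {S T : Module.End R (R ⊗[K] W)}
    (hS : S ∈ weightGE (n := n) R W a) (hT : T ∈ weightGE (n := n) R W b) :
    S * T ∈ weightGE (n := n) R W (a + b) := by
  have h1 := Submodule.mul_mem_mul hS hT
  rw [weightGE, weightGE, Submodule.span_mul_span] at h1
  refine Submodule.span_mono ?_ h1
  rintro _ ⟨_, ⟨x, e, he, hx, rfl⟩, _, ⟨y, e', he', hy, rfl⟩, rfl⟩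
  refine ⟨x * y, e + e', by omega, ?_, (LinearMap.baseChange_mul _ _).symm⟩
  have h2 : eulerEnd (n := n) (K := K) W * (x * y) - x * y * eulerEnd (n := n) (K := K) W =
      (eulerEnd (n := n) (K := K) W * x - x * eulerEnd (n := n) (K := K) W) * y +
        x * (eulerEnd (n := n) (K := K) W * y - y * eulerEnd (n := n) (K := K) W) := by
    noncomm_ring
  rw [h2, hx, hy, smul_mul_assoc, mul_smul_comm, ← add_smul]
  push_cast
  rfl

theorem weightGE_eq_zero {N d : ℕ} (h : IsDegreeBound (n := n) (K := K) W N) (hd : N ≤ d)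
    {T : Module.End R (R ⊗[K] W)} (hT : T ∈ weightGE (n := n) R W d) : T = 0 := by
  induction hT using Submodule.span_induction with
  | mem T hT =>
    obtain ⟨a, e, he, ha, rfl⟩ := hT
    rw [h.weight a e (hd.trans he) ha, LinearMap.baseChange_zero]
  | zero => rfl
  | add S T _ _ hS hT => rw [hS, hT, add_zero]
  | smul r T _ hT => rw [hT, smul_zero]

theorem lieAct_mem_weightGE {N d : ℕ} (h : IsDegreeBound (n := n) (K := K) W N)
    {v : Fin n → PS n R} (hv : ∀ i, v i ∈ ordIdeal n R (d + 1)) :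
    lieAct K W v ∈ weightGE (n := n) R W d := by
  rw [lieAct_eq_sum h]
  refine Submodule.sum_mem _ fun s _ => Submodule.sum_mem _ fun i _ => ?_
  by_cases hs : s.1.degree < d + 1
  · rw [hv i _ hs, zero_smul]
    exact zero_mem _
  · exact Submodule.smul_mem _ _ (Submodule.subset_span
      ⟨_, s.1.degree - 1, by omega, euler_lie_mono W s i, rfl⟩)

theorem weightGE_pow {T : Module.End R (R ⊗[K] W)} (hT : T ∈ weightGE (n := n) R W 1) (k : ℕ)
    (hk : k ≠ 0) : T ^ k ∈ weightGE (n := n) R W k := by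
  induction k with
  | zero => exact absurd rfl hk
  | succ k ih =>
    rcases eq_or_ne k 0 with rfl | hk
    · rwa [zero_add, pow_one]
    · rw [pow_succ]
      exact weightGE_mul (ih hk) hT

/-- The `K`-linear operator on `R ⊗ W` underlying `lieAct`. -/
def lieActK (K : Type u) [Field K] {R : Type u} [CommRing R] [Algebra K R] (W : Type u)
    [AddCommGroup W] [Module K W] [LieRingModule (Lplus n K) W] [LieModule K (Lplus n K) W]
    (v : Fin n → PS n R) : Module.End K (R ⊗[K] W) :=
  (lieAct K W v).restrictScalars K

theorem restrictScalars_pow {M : Type*} [AddCommGroup M] [Module K M] [Module R M]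
    [IsScalarTower K R M] (T : Module.End R M) (k : ℕ) :
    (T.restrictScalars K : Module.End K M) ^ k = (T ^ k).restrictScalars K := by
  induction k with
  | zero => rfl
  | succ k ih => rw [pow_succ, ih, pow_succ]; rfl

/-- A field of order two acts by operators of weight at least one, so its `k`-th power has weight at
least `k`, and such weights do not occur beyond the degree bound. Positivity of `N` excludes the
power zero. -/
theorem lieActK_pow_eq_zero {N : ℕ} (h : IsDegreeBound (n := n) (K := K) W N) (hN : 0 < N)
    {v : Fin n → PS n R} (hv : ∀ i, v i ∈ ordIdeal n R 2) {k : ℕ} (hk : N ≤ k) :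
    (lieAct K W v) ^ k = 0 :=
  weightGE_eq_zero h hk (weightGE_pow (lieAct_mem_weightGE h hv) k (by omega))

/-- By nilpotency every cut-off from `N` on gives the same sum. The passage to `K`-linear operators
is needed because exponentials will be commuted past δ ⊗ 1, which is not linear over `R`. -/
theorem expEnd_lieAct_apply {N : ℕ} (h : IsDegreeBound (n := n) (K := K) W N) (hN : 0 < N)
    {v : Fin n → PS n R} (hv : ∀ i, v i ∈ ordIdeal n R 2) {M : ℕ} (hM : N ≤ M) (t : R ⊗[K] W) :
    expEnd K (lieAct K W v) t = expSum K M (lieActK K W v) t := by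
  rw [expEnd, finsum_eq_sum_of_support_subset (s := Finset.range M)]
  · rw [expSum, LinearMap.sum_apply, LinearMap.sum_apply]
    refine Finset.sum_congr rfl fun k _ => ?_
    rw [LinearMap.smul_apply, LinearMap.smul_apply, algebraMap_smul, lieActK, restrictScalars_pow]
    rfl
  · intro k hk
    by_contra hkM
    refine hk ?_
    change algebraMap K R _ • lieAct K W v ^ k = 0
    rw [lieActK_pow_eq_zero h hN hv (by simp at hkM; omega), smul_zero]

end Weights


/-! ### Exponentials of vector fields and the conjugation formula -/

section Exp

variable {n : ℕ} (K : Type u) [Field K] {R : Type u} [CommRing R] [Algebra K R]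

/-- The `K`-linear operator on power series underlying a vector field. -/
def opVec (v : Fin n → PS n R) : Module.End K (PS n R) :=
  (((vecField v).restrictScalars K : Derivation K (PS n R) (PS n R)) : PS n R →ₗ[K] PS n R)

theorem opVec_apply (v : Fin n → PS n R) (f : PS n R) : opVec K v f = vecField v f := rfl

theorem opVec_pow_mem {v : Fin n → PS n R} (hv : ∀ i, v i ∈ ordIdeal n R 2) {b : ℕ} {f : PS n R}
    (hf : f ∈ ordIdeal n R b) (k : ℕ) : (opVec K v ^ k) f ∈ ordIdeal n R (b + k) := by
  induction k with
  | zero => exact hf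
  | succ k ih =>
    rw [pow_succ', Module.End.mul_apply, opVec_apply]
    have := vecField_mem_ordIdeal (a := 1) hv ih
    rwa [show 1 + (b + k) = b + (k + 1) by ring] at this

variable (n R) in
/-- The operators whose values have no terms of degree `< M`. -/
def lowOps (M : ℕ) : AddSubgroup (Module.End K (PS n R)) where
  carrier := {A | ∀ f, A f ∈ ordIdeal n R M}
  add_mem' ha hb f := add_mem (ha f) (hb f)
  zero_mem' _ := zero_mem _
  neg_mem' ha f := neg_mem (ha f)

theorem coeff_expSeries (v : Fin n → PS n R) (f : PS n R) (s : Fin n →₀ ℕ) :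
    MvPowerSeries.coeff s (expSeries K v f) = ∑ k ∈ Finset.range (s.degree + 1),
      ((k.factorial : K)⁻¹) • MvPowerSeries.coeff s ((vecField v)^[k] f) := rfl

/-- Each application of `v` raises the order by one, so coefficients of degree below `M` receive
nothing from the powers `k ≥ M`. This links the coefficientwise definition with the truncated
exponentials. -/
theorem expSeries_sub_expSum_mem {v : Fin n → PS n R} (hv : ∀ i, v i ∈ ordIdeal n R 2) (M : ℕ)
    (f : PS n R) : expSeries K v f - expSum K M (opVec K v) f ∈ ordIdeal n R M := by
  intro s hs
  have h1 : MvPowerSeries.coeff s (expSum K M (opVec K v) f) = ∑ k ∈ Finset.range M,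
      ((k.factorial : K)⁻¹) • MvPowerSeries.coeff s ((vecField v)^[k] f) := by
    rw [expSum, LinearMap.sum_apply, map_sum]
    refine Finset.sum_congr rfl fun k _ => ?_
    rw [LinearMap.smul_apply, Module.End.pow_apply]
    rfl
  rw [map_sub, h1, coeff_expSeries, sub_eq_zero]
  refine Finset.sum_subset (Finset.range_subset_range.mpr hs) fun k _ hk => ?_
  have h3 := opVec_pow_mem K hv (mem_ordIdeal_zero f) k s
    (by simp only [Finset.mem_range, not_lt] at hk; omega)
  rw [Module.End.pow_apply] at h3
  exact (congrArg _ h3).trans (smul_zero _)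

theorem expSeries_add (v : Fin n → PS n R) (f g : PS n R) :
    expSeries K v (f + g) = expSeries K v f + expSeries K v g := by
  ext s
  rw [map_add, coeff_expSeries, coeff_expSeries, coeff_expSeries, ← Finset.sum_add_distrib]
  refine Finset.sum_congr rfl fun k _ => ?_
  rw [iterate_map_add, map_add, smul_add]

theorem expSeries_C (v : Fin n → PS n R) (r : R) :
    expSeries K v (MvPowerSeries.C r : PS n R) = MvPowerSeries.C r := by
  ext s
  rw [coeff_expSeries, Finset.sum_eq_single_of_mem 0 (Finset.mem_range.mpr (Nat.succ_pos _))]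
  · simp
  · intro k _ hk
    obtain ⟨k, rfl⟩ := Nat.exists_eq_succ_of_ne_zero hk
    rw [Function.iterate_succ_apply, vecField_C, iterate_map_zero, map_zero, smul_zero]

variable [CharZero K]

/-- The conjugation formula `exp(v) D = (∑ ad(v)ⁱ(D)/i!) exp(v)`. -/
theorem expSeries_comp_sub_mem {v : Fin n → PS n R} (hv : ∀ i, v i ∈ ordIdeal n R 2)
    (D : Module.End K (PS n R)) (hD : ∀ (i b : ℕ) (f : PS n R), f ∈ ordIdeal n R b →
      ((adOp K (opVec K v)) ^ i) D f ∈ ordIdeal n R (b + i)) (M : ℕ) (f : PS n R) :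
    expSeries K v (D f) - ∑ i ∈ Finset.range M, ((i.factorial : K)⁻¹) •
      ((adOp K (opVec K v)) ^ i) D (expSeries K v f) ∈ ordIdeal n R M := by
  have hZ : ∀ (c : K) (i j : ℕ), M ≤ i + j →
      c • (((adOp K (opVec K v)) ^ i) D * opVec K v ^ j) ∈ lowOps n K R M := by
    intro c i j hij g
    have h0 : ((adOp K (opVec K v)) ^ i) D ((opVec K v ^ j) g) ∈ ordIdeal n R M :=
      ordIdeal_mono (by omega) (hD i _ _ (opVec_pow_mem K hv (mem_ordIdeal_zero g) j))
    exact smul_mem_ordIdeal c h0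
  have h1 := expSum_mul_sub_mem (lowOps n K R M) (opVec K v) D M hZ f
  rw [LinearMap.sub_apply, Module.End.mul_apply, Module.End.mul_apply, LinearMap.sum_apply] at h1
  have h2 := expSeries_sub_expSum_mem K hv M (D f)
  have h3 := expSeries_sub_expSum_mem K hv M f
  have h4 : ∑ i ∈ Finset.range M, ((i.factorial : K)⁻¹) •
      ((adOp K (opVec K v)) ^ i) D (expSeries K v f - expSum K M (opVec K v) f) ∈
        ordIdeal n R M := by
    refine Ideal.sum_mem _ fun i _ => smul_mem_ordIdeal _ ?_
    exact ordIdeal_mono (Nat.le_add_right _ _) (hD i _ _ h3)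
  simp only [map_sub, smul_sub, Finset.sum_sub_distrib] at h4
  have h5 := sub_mem (add_mem h1 h2) h4
  convert h5 using 1
  simp only [LinearMap.smul_apply]
  abel

/-- This is the conjugation formula for the operator of multiplication by `f`: since `v` is a
derivation, the iterated commutators are the multiplications by `v^i(f)`, and they add up to
multiplication by `exp(v) f`. -/
theorem expSeries_mul {v : Fin n → PS n R} (hv : ∀ i, v i ∈ ordIdeal n R 2) (f g : PS n R) :
    expSeries K v (f * g) = expSeries K v f * expSeries K v g := by
  refine eq_of_sub_mem_ordIdeal fun M => ?_
  have hD : ∀ i, ((adOp K (opVec K v)) ^ i) (LinearMap.mulLeft K f) =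
      LinearMap.mulLeft K ((opVec K v ^ i) f) := by
    intro i
    induction i with
    | zero => rfl
    | succ i ih =>
      rw [pow_succ', Module.End.mul_apply, ih, pow_succ', Module.End.mul_apply]
      refine LinearMap.ext fun g => ?_
      change vecField v (_ * g) - _ * vecField v g = vecField v _ * g
      rw [Derivation.leibniz, smul_eq_mul, smul_eq_mul]
      ring
  have h1 := expSeries_comp_sub_mem K hv (LinearMap.mulLeft K f) (fun i b g hg => by
    rw [hD, LinearMap.mulLeft_apply, add_comm]
    have := opVec_pow_mem K hv (mem_ordIdeal_zero f) i
    rw [zero_add] at this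
    exact mul_mem_ordIdeal this hg) M g
  have h2 : ∑ i ∈ Finset.range M, ((i.factorial : K)⁻¹) •
      ((adOp K (opVec K v)) ^ i) (LinearMap.mulLeft K f) (expSeries K v g) =
      expSum K M (opVec K v) f * expSeries K v g := by
    rw [expSum, LinearMap.sum_apply, Finset.sum_mul]
    refine Finset.sum_congr rfl fun i _ => ?_
    rw [hD, LinearMap.smul_apply, smul_mul_assoc]
    rfl
  rw [h2] at h1
  have h3 := Ideal.mul_mem_right (expSeries K v g) _ (expSeries_sub_expSum_mem K hv M f)
  have h4 := sub_mem h1 h3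
  convert h4 using 1
  change _ = expSeries K v (f * g) - _ - _
  ring

/-- The automorphism `exp(v)` of the algebra of power series. -/
def expHom {v : Fin n → PS n R} (hv : ∀ i, v i ∈ ordIdeal n R 2) : PS n R →ₐ[R] PS n R where
  toFun := expSeries K v
  map_one' := expSeries_C K v 1
  map_mul' := expSeries_mul K hv
  map_zero' := by
    have := expSeries_C K v 0
    rwa [map_zero] at this
  map_add' := expSeries_add K v
  commutes' r := expSeries_C K v r

theorem expHom_apply {v : Fin n → PS n R} (hv : ∀ i, v i ∈ ordIdeal n R 2) (f : PS n R) :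
    expHom K hv f = expSeries K v f := rfl

omit [CharZero K] in
theorem expSeries_X_sub_mem {v : Fin n → PS n R} (hv : ∀ i, v i ∈ ordIdeal n R 2) (i : Fin n) :
    expSeries K v (MvPowerSeries.X i : PS n R) - MvPowerSeries.X i ∈ ordIdeal n R 2 := by
  have h1 := expSeries_sub_expSum_mem K hv 2 (MvPowerSeries.X i)
  have h2 : expSum K 2 (opVec K v) (MvPowerSeries.X i : PS n R) = MvPowerSeries.X i + v i := by
    simp [expSum, Finset.sum_range_succ, opVec_apply, vecField_X]
  rw [h2] at h1
  convert add_mem h1 (hv i) using 1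
  ring

theorem expHom_X_mem {v : Fin n → PS n R} (hv : ∀ i, v i ∈ ordIdeal n R 2) (i : Fin n) :
    expHom K hv (MvPowerSeries.X i) ∈ ordIdeal n R 1 := by
  have := add_mem (ordIdeal_mono (by omega) (expSeries_X_sub_mem K hv i)) (X_mem_ordIdeal (R := R) i)
  rwa [sub_add_cancel] at this

theorem neg_mem_ordIdeal {v : Fin n → PS n R} (hv : ∀ i, v i ∈ ordIdeal n R 2) (i : Fin n) :
    (-v) i ∈ ordIdeal n R 2 := neg_mem (hv i)

theorem expSeries_neg {v : Fin n → PS n R} (hv : ∀ i, v i ∈ ordIdeal n R 2) (f : PS n R) :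
    expSeries K v (expSeries K (-v) f) = f := by
  refine (eq_of_sub_mem_ordIdeal fun M => ?_).symm
  have hneg : opVec K (-v) = -opVec K v := by
    refine LinearMap.ext fun g => ?_
    change vecField (-v) g = -vecField v g
    simp [vecField_apply]
  rcases Nat.eq_zero_or_pos M with rfl | hM
  · exact mem_ordIdeal_zero _
  have h1 := expSum_mul_neg_sub_mem (K := K) (lowOps n K R M) (opVec K v) M hM (fun c i hi g =>
    smul_mem_ordIdeal c (ordIdeal_mono (by omega) (opVec_pow_mem K hv (mem_ordIdeal_zero g) i))) f
  rw [← hneg, LinearMap.sub_apply, Module.End.mul_apply, Module.End.one_apply] at h1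
  have h2 := expSeries_sub_expSum_mem K (neg_mem_ordIdeal hv) M f
  have h3 := expSeries_sub_expSum_mem K hv M (expSum K M (opVec K (-v)) f)
  have h4 := algHom_mem_ordIdeal (expHom_X_mem K hv) h2
  rw [map_sub, expHom_apply, expHom_apply] at h4
  convert sub_mem (sub_mem h1 h3) h4 using 1
  ring

/-- The automorphism `exp(v)`, as an equivalence. -/
def expEquiv {v : Fin n → PS n R} (hv : ∀ i, v i ∈ ordIdeal n R 2) : PS n R ≃ₐ[R] PS n R :=
  AlgEquiv.ofAlgHom (expHom K hv) (expHom K (neg_mem_ordIdeal hv))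
    (AlgHom.ext fun f => expSeries_neg K hv f)
    (AlgHom.ext fun f => by
      have := expSeries_neg K (neg_mem_ordIdeal hv) f
      rw [neg_neg] at this
      exact this)

-- The conjugated operator is again a derivation, and it still restricts to δ on constants because
-- the automorphism fixes them. By `eq_totalDer` it has the form δ + ξ', and the assumptions on the
-- variables make `ξ'` vanish at the origin.
omit [CharZero K] in
variable {K} in
theorem exists_conj_totalDer (Φ : PS n R ≃ₐ[R] PS n R)
    (hΦ : ∀ i, Φ (MvPowerSeries.X i) ∈ ordIdeal n R 1)
    (hΨ : ∀ i, Φ.symm (MvPowerSeries.X i) ∈ ordIdeal n R 1)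
    (δ : Derivation K R R) {ξ : Fin n → PS n R} (hξ : ∀ i, ξ i ∈ ordIdeal n R 1) :
    ∃ ξ' : Fin n → PS n R, (∀ i, ξ' i ∈ ordIdeal n R 1) ∧
      ∀ f, Φ (totalDer δ ξ f) = totalDer δ ξ' (Φ f) := by
  let D : Derivation K (PS n R) (PS n R) := Derivation.mk'
    ((Φ.toLinearMap.restrictScalars K) ∘ₗ ((totalDer δ ξ : Derivation K (PS n R) (PS n R)) :
      PS n R →ₗ[K] PS n R) ∘ₗ (Φ.symm.toLinearMap.restrictScalars K)) (fun f g => by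
        change Φ (totalDer δ ξ (Φ.symm (f * g))) = f • Φ (totalDer δ ξ (Φ.symm g)) +
          g • Φ (totalDer δ ξ (Φ.symm f))
        rw [map_mul, Derivation.leibniz, map_add, smul_eq_mul, smul_eq_mul, map_mul, map_mul,
          AlgEquiv.apply_symm_apply, AlgEquiv.apply_symm_apply]
        rfl)
  have hDa : ∀ f, D f = Φ (totalDer δ ξ (Φ.symm f)) := fun _ => rfl
  have hD : D = totalDer δ fun i => D (MvPowerSeries.X i) := eq_totalDer fun r => by
    have h1 : ∀ (Θ : PS n R ≃ₐ[R] PS n R) (r : R), Θ (MvPowerSeries.C r) = MvPowerSeries.C r :=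
      fun Θ r => Θ.commutes r
    rw [hDa, h1, totalDer_C, h1]
  refine ⟨fun i => D (MvPowerSeries.X i), fun i => ?_, fun f => ?_⟩
  · exact algHom_mem_ordIdeal (Φ := Φ.toAlgHom) hΦ (totalDer_mem_ordIdeal hξ (hΨ i))
  · rw [← hD, hDa, AlgEquiv.symm_apply_apply]

section TotalAct

omit [CharZero K]

variable {K} (δ : Derivation K R R) (v ξ : Fin n → PS n R)

/-- The derivation of the coefficients in the iterated commutators `ad(v)ⁱ(δ + ξ)`. -/
def adDer : ℕ → Derivation K R R
  | 0 => δ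
  | _ + 1 => 0

/-- The vector fields in the iterated commutators `ad(v)ⁱ(δ + ξ)`. -/
def adCoef : ℕ → Fin n → PS n R
  | 0 => ξ
  | i + 1 => adTotal (adDer δ i) v (adCoef i)

variable {δ v ξ}

theorem coeffDer_zero (f : PS n R) : coeffDer (0 : Derivation K R R) f = 0 := by
  ext s
  rw [coeff_coeffDer, Derivation.zero_apply, map_zero]

/-- The first commutator has order two because of -δ(v); from then on the coefficients are no longer
differentiated, and each bracket with `v` gains one order. -/
theorem adCoef_mem (hv : ∀ i, v i ∈ ordIdeal n R 2) (hξ : ∀ i, ξ i ∈ ordIdeal n R 1) (k : ℕ)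
    (i : Fin n) : adCoef δ v ξ k i ∈ ordIdeal n R (k + 1) := by
  induction k generalizing i with
  | zero => exact hξ i
  | succ k ih =>
    rw [adCoef]
    cases k with
    | zero => exact adTotal_mem_ordIdeal hv hξ i
    | succ k =>
      rw [adTotal_eq, Pi.sub_apply]
      refine sub_mem ?_ ?_
      · have := lieVec_mem_ordIdeal (a := 1) hv ih i
        rwa [show 1 + (k + 1) + 1 = k + 1 + 1 + 1 by ring] at this
      · rw [adDer, coeffDer_zero]
        exact zero_mem _

theorem adOp_pow_totalDer (k : ℕ) : ((adOp K (opVec K v)) ^ k)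
    ((totalDer δ ξ : Derivation K (PS n R) (PS n R)) : PS n R →ₗ[K] PS n R) =
      ((totalDer (adDer δ k) (adCoef δ v ξ k) : Derivation K (PS n R) (PS n R)) :
        PS n R →ₗ[K] PS n R) := by
  induction k with
  | zero => rfl
  | succ k ih =>
    rw [pow_succ', Module.End.mul_apply, ih]
    refine LinearMap.ext fun f => ?_
    have h1 := DFunLike.congr_fun (lie_totalDer (adDer δ k) v (adCoef δ v ξ k)) f
    rw [Derivation.commutator_apply] at h1
    refine h1.trans ?_
    change _ = totalDer 0 (adCoef δ v ξ (k + 1)) f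
    rw [totalDer_apply, coeffDer_zero, zero_add]
    rfl

variable {W : Type u} [AddCommGroup W] [Module K W] [LieRingModule (Lplus n K) W]
  [LieModule K (Lplus n K) W] {N : ℕ} (h : IsDegreeBound (n := n) (K := K) W N)

theorem totalAct_zero (ξ : Fin n → PS n R) (t : R ⊗[K] W) :
    totalAct W (0 : Derivation K R R) ξ t = lieAct K W ξ t := by
  have : ((0 : Derivation K R R) : R →ₗ[K] R) = 0 := rfl
  rw [totalAct_apply, derT, this, LinearMap.rTensor_zero, LinearMap.zero_apply, zero_add]

-- The recursion is the one of `adOp_pow_totalDer`, now on `R ⊗ W`. This parallelism carries the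
-- conjugation formula from power series over to the module.
include h in
theorem adOp_pow_totalAct (hv : ∀ i, v i ∈ ordIdeal n R 2) (hξ : ∀ i, ξ i ∈ ordIdeal n R 1)
    (k : ℕ) : ((adOp K (lieActK K W v)) ^ k) (totalAct W δ ξ) =
      totalAct W (adDer δ k) (adCoef δ v ξ k) := by
  induction k with
  | zero => rfl
  | succ k ih =>
    rw [pow_succ', Module.End.mul_apply, ih, adOp_apply]
    refine LinearMap.ext fun t => ?_
    have h1 := lieAct_adTotal h (adDer δ k) (fun i => ordIdeal_mono (by omega) (hv i))
      (fun i => ordIdeal_mono (by omega) (adCoef_mem (δ := δ) hv hξ k i)) t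
    rw [LinearMap.sub_apply, Module.End.mul_apply, Module.End.mul_apply, adDer, adCoef,
      totalAct_zero]
    change lieAct K W v _ - totalAct W _ _ (lieAct K W v t) = _
    rw [← h1, add_sub_cancel_right]

include h in
variable [CharZero K] in
/-- If `exp(v)` intertwines two operators `δ + ξ` and `δ + ξ'` on power series, then it intertwines
their actions on `R ⊗ W`. -/
theorem expEnd_totalAct (hN : 0 < N) (hv : ∀ i, v i ∈ ordIdeal n R 2)
    (hξ : ∀ i, ξ i ∈ ordIdeal n R 1) {ξ' : Fin n → PS n R}
    (hconj : ∀ f, expSeries K v (totalDer δ ξ f) = totalDer δ ξ' (expSeries K v f))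
    (t : R ⊗[K] W) :
    expEnd K (lieAct K W v) (totalAct W δ ξ t) =
      totalAct W δ ξ' (expEnd K (lieAct K W v) t) := by
  -- The conjugation formula, evaluated at `exp(-v) X_i`, identifies `ξ'` modulo order `N` with the
  -- finite sum of iterated commutators. Order `N` suffices, since the rest acts by zero.
  have hform : ∀ i, ξ' i - ∑ k ∈ Finset.range N, ((k.factorial : K)⁻¹) • adCoef δ v ξ k i ∈
      ordIdeal n R N := by
    intro i
    have h1 := expSeries_comp_sub_mem K hv
      ((totalDer δ ξ : Derivation K (PS n R) (PS n R)) : PS n R →ₗ[K] PS n R)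
      (fun k b f hf => by
        rw [adOp_pow_totalDer]
        cases k with
        | zero => exact totalDer_mem_ordIdeal hξ hf
        | succ k =>
          change coeffDer 0 f + vecField _ f ∈ _
          rw [coeffDer_zero, zero_add, add_comm]
          exact vecField_mem_ordIdeal (adCoef_mem hv hξ (k + 1)) hf)
      N (expSeries K (-v) (MvPowerSeries.X i))
    rw [expSeries_neg K hv] at h1
    change expSeries K v (totalDer δ ξ _) - _ ∈ _ at h1
    rw [hconj, expSeries_neg K hv, totalDer_X] at h1
    convert h1 using 2
    refine Finset.sum_congr rfl fun k _ => ?_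
    rw [adOp_pow_totalDer]
    exact congrArg _ (totalDer_X _ _ _).symm
  rw [expEnd_lieAct_apply h hN hv le_rfl, expEnd_lieAct_apply h hN hv le_rfl]
  have hpow : ∀ k, N ≤ k → lieActK K W v ^ k = 0 := fun k hk => by
    rw [lieActK, restrictScalars_pow, lieActK_pow_eq_zero h hN hv hk]
    rfl
  -- On `R ⊗ W` there is no error term. If `j ≥ N` the power of `v` is zero; otherwise `i > 0`, so δ
  -- has disappeared from the commutator and the product has weight at least `i + j ≥ N`.
  have h1 := expSum_mul_sub_mem (⊥ : AddSubgroup (Module.End K (R ⊗[K] W))) (lieActK K W v)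
    (totalAct W δ ξ) N (fun c i j hij => by
      rw [AddSubgroup.mem_bot, adOp_pow_totalAct h hv hξ]
      have : totalAct W (adDer δ i) (adCoef δ v ξ i) * lieActK K W v ^ j = 0 := by
        rcases le_or_gt N j with hj | hj
        · rw [hpow j hj, mul_zero]
        · obtain ⟨i, rfl⟩ := Nat.exists_eq_succ_of_ne_zero (show i ≠ 0 by omega)
          have h2 : lieAct K W (adCoef δ v ξ (i + 1)) * lieAct K W v ^ j = 0 := by
            rcases Nat.eq_zero_or_pos j with rfl | hj0
            · rw [pow_zero, mul_one]
              exact weightGE_eq_zero h (by omega) (lieAct_mem_weightGE h (adCoef_mem hv hξ (i + 1)))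
            · exact weightGE_eq_zero h hij (weightGE_mul
                (lieAct_mem_weightGE h (adCoef_mem hv hξ (i + 1)))
                (weightGE_pow (lieAct_mem_weightGE h hv) j (by omega)))
          refine LinearMap.ext fun t => ?_
          rw [lieActK, restrictScalars_pow, Module.End.mul_apply, adDer, totalAct_zero]
          exact DFunLike.congr_fun h2 t
      rw [this, smul_zero])
  rw [AddSubgroup.mem_bot, sub_eq_zero] at h1
  have h2 := DFunLike.congr_fun h1 t
  rw [Module.End.mul_apply, Module.End.mul_apply] at h2
  rw [h2]
  congr 1
  refine LinearMap.ext fun t => ?_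
  have h4 : lieAct K W ξ' = ∑ k ∈ Finset.range N,
      algebraMap K R ((k.factorial : K)⁻¹) • lieAct K W (adCoef δ v ξ k) := by
    rw [lieAct_congr h (w := ∑ k ∈ Finset.range N,
      algebraMap K R ((k.factorial : K)⁻¹) • adCoef δ v ξ k), lieAct_sum h]
    · exact Finset.sum_congr rfl fun k _ => lieAct_smul h _ _
    · intro i
      convert hform i using 2
      rw [Finset.sum_apply]
      exact Finset.sum_congr rfl fun k _ => algebraMap_smul R ((k.factorial : K)⁻¹) (adCoef δ v ξ k i)
  rw [totalAct_apply, h4, LinearMap.sum_apply, LinearMap.sum_apply]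
  obtain ⟨N, rfl⟩ := Nat.exists_eq_succ_of_ne_zero hN.ne'
  -- The term with index zero is split off because it alone contains δ.
  rw [Finset.sum_range_succ', Finset.sum_range_succ']
  have h5 : ∀ k, ((((k + 1).factorial : K)⁻¹) •
      ((adOp K (lieActK K W v)) ^ (k + 1)) (totalAct W δ ξ)) t =
      (algebraMap K R (((k + 1).factorial : K)⁻¹) • lieAct K W (adCoef δ v ξ (k + 1))) t := by
    intro k
    rw [adOp_pow_totalAct h hv hξ, LinearMap.smul_apply, LinearMap.smul_apply, algebraMap_smul,
      adDer, totalAct_zero]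
  rw [Finset.sum_congr rfl fun k _ => h5 k]
  simp [totalAct_apply, adCoef]
  abel

end TotalAct

end Exp


/-! ### Logarithms and factorization of automorphisms -/

section Log

variable {n : ℕ} {K : Type u} [Field K] {R : Type u} [CommRing R] [Algebra K R]

/-- Writing `v A - w B = v (A - B) + (v - w) B`, the first term gains an order from `v`, the second
from the order of `B`, a power of `w` applied to a variable. -/
theorem opVec_pow_X_sub_mem {v w : Fin n → PS n R} (hv : ∀ i, v i ∈ ordIdeal n R 2)
    (hw : ∀ i, w i ∈ ordIdeal n R 2) {k : ℕ} (hvw : ∀ i, v i - w i ∈ ordIdeal n R k) (j : Fin n)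
    (m : ℕ) : (opVec K v ^ (m + 1)) (MvPowerSeries.X j) - (opVec K w ^ (m + 1)) (MvPowerSeries.X j) ∈
      ordIdeal n R (k + m) := by
  induction m with
  | zero =>
    simp only [zero_add, pow_one, opVec_apply, vecField_X, add_zero]
    exact hvw j
  | succ m ih =>
    rw [pow_succ', Module.End.mul_apply, pow_succ' (opVec K w), Module.End.mul_apply]
    have h1 : opVec K v ((opVec K v ^ (m + 1)) (MvPowerSeries.X j)) -
        opVec K w ((opVec K w ^ (m + 1)) (MvPowerSeries.X j)) =
        vecField v ((opVec K v ^ (m + 1)) (MvPowerSeries.X j) -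
          (opVec K w ^ (m + 1)) (MvPowerSeries.X j)) +
        vecField (v - w) ((opVec K w ^ (m + 1)) (MvPowerSeries.X j)) := by
      rw [opVec_apply, opVec_apply, map_sub, vecField_sub, Derivation.sub_apply]
      ring
    rw [h1]
    refine add_mem ?_ ?_
    · have := vecField_mem_ordIdeal (a := 1) hv ih
      rwa [show 1 + (k + m) = k + (m + 1) by ring] at this
    · have h2 := opVec_pow_mem K hw (X_mem_ordIdeal (R := R) j) (m + 1)
      rw [show 1 + (m + 1) = m + 1 + 1 by ring] at h2
      exact vecField_mem_ordIdeal' hvw h2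

/-- The terms of the exponential beyond the linear one are contracting in the field: a difference of
order `k` influences them only from order `k + 1` on. Uniqueness and existence of logarithms both
rest on this estimate. -/
theorem expSeries_X_sub_sub_mem {v w : Fin n → PS n R} (hv : ∀ i, v i ∈ ordIdeal n R 2)
    (hw : ∀ i, w i ∈ ordIdeal n R 2) {k : ℕ} (hvw : ∀ i, v i - w i ∈ ordIdeal n R k) (j : Fin n) :
    (expSeries K v (MvPowerSeries.X j) - expSeries K w (MvPowerSeries.X j)) - (v j - w j) ∈
      ordIdeal n R (k + 1) := by
  have h1 := expSeries_sub_expSum_mem K hv (k + 1 + 1) (MvPowerSeries.X j)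
  have h2 := expSeries_sub_expSum_mem K hw (k + 1 + 1) (MvPowerSeries.X j)
  have h3 : expSum K (k + 1 + 1) (opVec K v) (MvPowerSeries.X j) -
      expSum K (k + 1 + 1) (opVec K w) (MvPowerSeries.X j) - (v j - w j) ∈
        ordIdeal n R (k + 1) := by
    have h4 : expSum K (k + 1 + 1) (opVec K v) (MvPowerSeries.X j) -
      expSum K (k + 1 + 1) (opVec K w) (MvPowerSeries.X j) - (v j - w j) =
      ∑ m ∈ Finset.range k, (((m + 1 + 1).factorial : K)⁻¹) •
        ((opVec K v ^ (m + 1 + 1)) (MvPowerSeries.X j) -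
          (opVec K w ^ (m + 1 + 1)) (MvPowerSeries.X j)) := by
      rw [expSum, expSum, LinearMap.sum_apply, LinearMap.sum_apply, Finset.sum_range_succ',
        Finset.sum_range_succ', Finset.sum_range_succ', Finset.sum_range_succ']
      simp only [LinearMap.smul_apply, smul_sub, Finset.sum_sub_distrib, zero_add, pow_one,
        opVec_apply, vecField_X, pow_zero, Nat.factorial_one, Nat.factorial_zero, Nat.cast_one,
        inv_one, one_smul, Module.End.one_apply]
      ring
    rw [h4]
    refine Ideal.sum_mem _ fun m _ => smul_mem_ordIdeal _ ?_
    exact ordIdeal_mono (by omega) (opVec_pow_X_sub_mem hv hw hvw j (m + 1))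
  have h5 := add_mem h3 (ordIdeal_mono (by omega) (sub_mem h1 h2) : _ ∈ ordIdeal n R (k + 1))
  convert h5 using 1
  ring

theorem expSeries_injective {v w : Fin n → PS n R} (hv : ∀ i, v i ∈ ordIdeal n R 2)
    (hw : ∀ i, w i ∈ ordIdeal n R 2)
    (h : ∀ j, expSeries K v (MvPowerSeries.X j : PS n R) = expSeries K w (MvPowerSeries.X j)) :
    v = w := by
  have h1 : ∀ k i, v i - w i ∈ ordIdeal n R k := by
    intro k
    induction k with
    | zero => exact fun i => mem_ordIdeal_zero _
    | succ k ih =>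
      intro i
      have := expSeries_X_sub_sub_mem (K := K) hv hw ih i
      rw [h, sub_self, zero_sub] at this
      exact neg_mem_iff.mp this
  funext i
  exact eq_of_sub_mem_ordIdeal fun k => h1 k i

/-- Every unipotent automorphism is an exponential. -/
theorem exists_expSeries_eq {φ : Fin n → PS n R}
    (hφ : ∀ i, φ i - MvPowerSeries.X i ∈ ordIdeal n R 2) :
    ∃ v : Fin n → PS n R, (∀ i, v i ∈ ordIdeal n R 2) ∧
      ∀ j, expSeries K v (MvPowerSeries.X j) = φ j := by
  -- The logarithm is a fixed point of `F`. By the contraction estimate the iterates starting from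
  -- zero converge in the topology given by the order.
  let F : (Fin n → PS n R) → Fin n → PS n R := fun v i =>
    v i + φ i - expSeries K v (MvPowerSeries.X i)
  have hF : ∀ v : Fin n → PS n R, (∀ i, v i ∈ ordIdeal n R 2) → ∀ i, F v i ∈ ordIdeal n R 2 := by
    intro v hv i
    have := sub_mem (add_mem (hv i) (hφ i)) (expSeries_X_sub_mem K hv i)
    convert this using 1
    simp only [F]
    ring
  have hFF : ∀ {v w : Fin n → PS n R} {k : ℕ}, (∀ i, v i ∈ ordIdeal n R 2) →
      (∀ i, w i ∈ ordIdeal n R 2) → (∀ i, v i - w i ∈ ordIdeal n R k) →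
      ∀ i, F v i - F w i ∈ ordIdeal n R (k + 1) := by
    intro v w k hv hw hvw i
    have := neg_mem (expSeries_X_sub_sub_mem (K := K) hv hw hvw i)
    convert this using 1
    simp only [F]
    ring
  let u : ℕ → Fin n → PS n R := fun m => F^[m] 0
  have hu : ∀ m i, u m i ∈ ordIdeal n R 2 := by
    intro m
    induction m with
    | zero => exact fun i => zero_mem _
    | succ m ih =>
      simp only [u, Function.iterate_succ_apply']
      exact hF _ ih
  have hstep : ∀ m i, u (m + 1) i - u m i ∈ ordIdeal n R (m + 2) := by
    intro m
    induction m with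
    | zero =>
      intro i
      have := hu 1 i
      simpa [u] using this
    | succ m ih =>
      intro i
      have := hFF (hu (m + 1)) (hu m) ih i
      simpa only [u, Function.iterate_succ_apply'] using this
  have hle : ∀ p m, ∀ i, u (p + m) i - u p i ∈ ordIdeal n R (p + 2) := by
    intro p m
    induction m with
    | zero => intro i; rw [add_zero, sub_self]; exact zero_mem _
    | succ m ih =>
      intro i
      have := add_mem (ordIdeal_mono (by omega) (hstep (p + m) i) : _ ∈ ordIdeal n R (p + 2)) (ih i)
      rwa [sub_add_sub_cancel] at this
  -- The coefficients of degree `|s|` no longer change from the iterate with number `|s|` on.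
  let v : Fin n → PS n R := fun i => psMk fun s => MvPowerSeries.coeff s (u s.degree i)
  have hvu : ∀ m i, v i - u m i ∈ ordIdeal n R (m + 1) := by
    intro m i s hs
    rw [map_sub, coeff_psMk, sub_eq_zero]
    have h1 := hle s.degree (m - s.degree) i
    rw [show s.degree + (m - s.degree) = m by omega] at h1
    exact (coeff_eq_of_sub_mem_ordIdeal h1 (by omega)).symm
  have hv : ∀ i, v i ∈ ordIdeal n R 2 := fun i s hs => hu _ i s hs
  refine ⟨v, hv, fun j => (eq_of_sub_mem_ordIdeal fun k => ?_).symm⟩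
  have h1 := hFF hv (hu k) (hvu k) j
  have h2 : F (u k) = u (k + 1) := (Function.iterate_succ_apply' F k 0).symm
  rw [h2] at h1
  have h3 := sub_mem h1 (hvu (k + 1) j)
  refine ordIdeal_mono (show k ≤ k + 1 + 1 by omega) ?_
  convert h3 using 1
  simp only [F]
  ring

theorem IsFactorization.mem_ordIdeal {φ : Fin n → PS n R} {g : GL (Fin n) R}
    {v : Fin n → PS n R} (h : IsFactorization K φ g v) (i : Fin n) : v i ∈ ordIdeal n R 2 :=
  h.unipotent i

/-- The exponential of a field of order two does not affect linear parts, so the matrix of a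
factorization is visible in the automorphism. -/
theorem IsFactorization.coeff {φ : Fin n → PS n R} {g : GL (Fin n) R} {v : Fin n → PS n R}
    (h : IsFactorization K φ g v) (i k : Fin n) :
    MvPowerSeries.coeff (Finsupp.single k 1) (φ i) = (g : Matrix (Fin n) (Fin n) R) k i := by
  classical
  have hv : ∀ i, v i ∈ ordIdeal n R 2 := h.unipotent
  rw [h.eq, map_sum]
  have h1 : ∀ j, MvPowerSeries.coeff (Finsupp.single k 1)
      (expSeries K v (MvPowerSeries.X j : PS n R)) = if k = j then 1 else 0 := by
    intro j
    rw [coeff_eq_of_sub_mem_ordIdeal (expSeries_X_sub_mem K hv j) (by simp),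
      MvPowerSeries.coeff_X]
    simp [Finsupp.single_left_inj]
  have h2 : ∀ j, MvPowerSeries.coeff (Finsupp.single k 1)
      ((g : Matrix (Fin n) (Fin n) R) j i • expSeries K v (MvPowerSeries.X j : PS n R)) =
      (g : Matrix (Fin n) (Fin n) R) j i * if k = j then 1 else 0 := fun j => by
    rw [← h1]
    rfl
  rw [Finset.sum_congr rfl fun j _ => h2 j]
  simp

theorem IsFactorization.exp_eq {φ : Fin n → PS n R} {g : GL (Fin n) R} {v : Fin n → PS n R}
    (h : IsFactorization K φ g v) (j : Fin n) : expSeries K v (MvPowerSeries.X j : PS n R) =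
      ∑ i, ((g⁻¹ : GL (Fin n) R) : Matrix (Fin n) (Fin n) R) i j • φ i := by
  classical
  have h1 : (g : Matrix (Fin n) (Fin n) R) * ((g⁻¹ : GL (Fin n) R) : Matrix (Fin n) (Fin n) R) =
      1 := g.mul_inv
  simp only [h.eq, Finset.smul_sum, smul_smul]
  rw [Finset.sum_comm]
  have h2 : ∀ k, ∑ i, (((g⁻¹ : GL (Fin n) R) : Matrix (Fin n) (Fin n) R) i j *
      (g : Matrix (Fin n) (Fin n) R) k i) • expSeries K v (MvPowerSeries.X k : PS n R) =
      (if k = j then (1 : R) else 0) • expSeries K v (MvPowerSeries.X k : PS n R) := by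
    intro k
    rw [← Finset.sum_smul]
    congr 1
    have := congrFun (congrFun h1 k) j
    rw [Matrix.mul_apply, Matrix.one_apply] at this
    rw [← this]
    exact Finset.sum_congr rfl fun i _ => mul_comm _ _
  rw [Finset.sum_congr rfl fun k _ => h2 k]
  simp

/-- The matrix is the linear part, and the field is the logarithm of what remains. Uniqueness allows
a factorization restricted to a smaller open set to be identified with any other one given there. -/
theorem IsFactorization.unique {φ : Fin n → PS n R} {g g' : GL (Fin n) R} {v v' : Fin n → PS n R}
    (h : IsFactorization K φ g v) (h' : IsFactorization K φ g' v') : g = g' ∧ v = v' := by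
  have hg : g = g' := by
    ext i j
    rw [← h.coeff, ← h'.coeff]
  refine ⟨hg, expSeries_injective (K := K) h.unipotent h'.unipotent fun j => ?_⟩
  rw [h.exp_eq, h'.exp_eq, hg]

/-- Correcting by the inverse of the linear part makes the automorphism unipotent, and
`exists_expSeries_eq` provides the logarithm. Invertibility of the linear part is the only
obstruction. -/
theorem exists_isFactorization {φ : Fin n → PS n R} (hφ : ∀ i, φ i ∈ ordIdeal n R 1)
    (g : GL (Fin n) R) (hg : ∀ i k, MvPowerSeries.coeff (Finsupp.single k 1) (φ i) =
      (g : Matrix (Fin n) (Fin n) R) k i) : ∃ v, IsFactorization K φ g v := by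
  classical
  have h1 : (g : Matrix (Fin n) (Fin n) R) * ((g⁻¹ : GL (Fin n) R) : Matrix (Fin n) (Fin n) R) =
      1 := g.mul_inv
  have h2 : ((g⁻¹ : GL (Fin n) R) : Matrix (Fin n) (Fin n) R) * (g : Matrix (Fin n) (Fin n) R) =
      1 := g.inv_mul
  obtain ⟨v, hv, hexp⟩ := exists_expSeries_eq (K := K)
    (φ := fun j => ∑ i, ((g⁻¹ : GL (Fin n) R) : Matrix (Fin n) (Fin n) R) i j • φ i) (by
      intro j s hs
      rw [map_sub, sub_eq_zero, map_sum]
      have h3 : ∀ i, MvPowerSeries.coeff s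
          (((g⁻¹ : GL (Fin n) R) : Matrix (Fin n) (Fin n) R) i j • φ i) =
          ((g⁻¹ : GL (Fin n) R) : Matrix (Fin n) (Fin n) R) i j * MvPowerSeries.coeff s (φ i) :=
        fun i => rfl
      rw [Finset.sum_congr rfl fun i _ => h3 i]
      rcases Nat.lt_succ_iff_lt_or_eq.mp hs with hs | hs
      · rw [X_mem_ordIdeal j s hs]
        exact Finset.sum_eq_zero fun i _ => by rw [hφ i s hs, mul_zero]
      · obtain ⟨k, rfl⟩ : s ∈ Set.range (fun a : Fin n => Finsupp.single a 1) := by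
          rw [Finsupp.range_single_one]
          exact hs
        rw [MvPowerSeries.coeff_X]
        have h4 := congrFun (congrFun h1 k) j
        rw [Matrix.mul_apply, Matrix.one_apply] at h4
        simp only [hg, Finsupp.single_left_inj one_ne_zero]
        rw [← h4]
        exact Finset.sum_congr rfl fun i _ => mul_comm _ _)
  refine ⟨v, hv, fun i => ?_⟩
  simp only [hexp, Finset.smul_sum, smul_smul]
  rw [Finset.sum_comm]
  have h5 : ∀ k, ∑ j, ((g : Matrix (Fin n) (Fin n) R) j i *
      ((g⁻¹ : GL (Fin n) R) : Matrix (Fin n) (Fin n) R) k j) • φ k =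
      (if k = i then (1 : R) else 0) • φ k := by
    intro k
    rw [← Finset.sum_smul]
    congr 1
    have := congrFun (congrFun h2 k) i
    rw [Matrix.mul_apply, Matrix.one_apply] at this
    rw [← this]
    exact Finset.sum_congr rfl fun i _ => mul_comm _ _
  rw [Finset.sum_congr rfl fun k _ => h5 k]
  simp

end Log

/-! ### Linear substitutions and the automorphisms exp(v) ∘ g -/

section Linear

variable {n : ℕ} {R : Type u} [CommRing R]

theorem hasSubst_linear (g : Matrix (Fin n) (Fin n) R) :
    MvPowerSeries.HasSubst fun i => ∑ j, g j i • (MvPowerSeries.X j : PS n R) :=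
  MvPowerSeries.hasSubst_of_constantCoeff_zero fun i => by
    rw [map_sum]
    refine Finset.sum_eq_zero fun j _ => ?_
    exact mem_ordIdeal_one.mp (smul_mem_ordIdeal _ (X_mem_ordIdeal j))

/-- The linear substitution `Xᵢ ↦ ∑ⱼ gⱼᵢ Xⱼ`. -/
def linHom (g : Matrix (Fin n) (Fin n) R) : PS n R →ₐ[R] PS n R :=
  MvPowerSeries.substAlgHom (hasSubst_linear g)

theorem linHom_X (g : Matrix (Fin n) (Fin n) R) (i : Fin n) :
    linHom g (MvPowerSeries.X i) = ∑ j, g j i • (MvPowerSeries.X j : PS n R) :=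
  MvPowerSeries.substAlgHom_X (hasSubst_linear g) i

theorem linHom_X_mem (g : Matrix (Fin n) (Fin n) R) (i : Fin n) :
    linHom g (MvPowerSeries.X i) ∈ ordIdeal n R 1 := by
  rw [linHom_X]
  exact Ideal.sum_mem _ fun j _ => smul_mem_ordIdeal _ (X_mem_ordIdeal j)

theorem linHom_mul (g h : Matrix (Fin n) (Fin n) R) (f : PS n R) :
    linHom (g * h) f = linHom g (linHom h f) := by
  have : linHom (g * h) = (linHom g).comp (linHom h) := by
    refine algHom_ext_X (fun i => ?_) fun i => ?_
    · exact algHom_mem_ordIdeal (linHom_X_mem g) (linHom_X_mem h i)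
    · rw [AlgHom.comp_apply, linHom_X, linHom_X, map_sum]
      simp only [map_smul, linHom_X, Finset.smul_sum, smul_smul, Matrix.mul_apply,
        Finset.sum_smul]
      rw [Finset.sum_comm]
      exact Finset.sum_congr rfl fun i _ => Finset.sum_congr rfl fun j _ => by rw [mul_comm]
  rw [this]
  rfl

theorem linHom_one (f : PS n R) : linHom (1 : Matrix (Fin n) (Fin n) R) f = f := by
  classical
  have : linHom (1 : Matrix (Fin n) (Fin n) R) = AlgHom.id R _ := by
    refine algHom_ext_X (fun i => X_mem_ordIdeal i) fun i => ?_
    rw [linHom_X]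
    simp [Matrix.one_apply]
  rw [this]
  rfl

/-- The linear substitution given by an invertible matrix, as an equivalence. -/
def linEquiv (g : GL (Fin n) R) : PS n R ≃ₐ[R] PS n R :=
  AlgEquiv.ofAlgHom (linHom (g : Matrix (Fin n) (Fin n) R))
    (linHom ((g⁻¹ : GL (Fin n) R) : Matrix (Fin n) (Fin n) R))
    (AlgHom.ext fun f => by
      rw [AlgHom.comp_apply, ← linHom_mul, g.mul_inv, linHom_one]
      rfl)
    (AlgHom.ext fun f => by
      rw [AlgHom.comp_apply, ← linHom_mul, g.inv_mul, linHom_one]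
      rfl)

variable {K : Type u} [Field K] [CharZero K] [Algebra K R]

variable (K) in
/-- The automorphism `exp(v) ∘ g` of the algebra of power series. -/
def autEquiv (g : GL (Fin n) R) {v : Fin n → PS n R} (hv : ∀ i, v i ∈ ordIdeal n R 2) :
    PS n R ≃ₐ[R] PS n R :=
  (linEquiv g).trans (expEquiv K hv)

theorem autEquiv_apply (g : GL (Fin n) R) {v : Fin n → PS n R}
    (hv : ∀ i, v i ∈ ordIdeal n R 2) (f : PS n R) :
    autEquiv K g hv f = expSeries K v (linHom (g : Matrix (Fin n) (Fin n) R) f) := rfl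

theorem autEquiv_X {φ : Fin n → PS n R} {g : GL (Fin n) R} {v : Fin n → PS n R}
    (h : IsFactorization K φ g v) (i : Fin n) :
    autEquiv K g h.mem_ordIdeal (MvPowerSeries.X i) = φ i := by
  rw [autEquiv_apply, linHom_X, h.eq]
  change expHom K h.mem_ordIdeal _ = _
  rw [map_sum]
  simp only [map_smul]
  rfl

theorem isFactorization_autEquiv (g : GL (Fin n) R) {v : Fin n → PS n R}
    (hv : ∀ i, v i ∈ ordIdeal n R 2) :
    IsFactorization K (fun i => autEquiv K g hv (MvPowerSeries.X i)) g v := by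
  refine ⟨hv, fun i => ?_⟩
  rw [autEquiv_apply, linHom_X]
  change expHom K hv _ = _
  rw [map_sum]
  simp only [map_smul]
  rfl

end Linear


/-! ### Extension of scalars and coordinates on R ⊗ W -/

section ScalarExtension

variable {K : Type u} [Field K] {W : Type u} [AddCommGroup W] [Module K W]

variable (W) in
/-- The map `R ⊗ W → R' ⊗ W` induced by a homomorphism `R → R'`. -/
abbrev extMap {R R' : Type u} [CommRing R] [Algebra K R] [CommRing R'] [Algebra K R']
    (f : R →ₐ[K] R') : R ⊗[K] W →ₗ[K] R' ⊗[K] W :=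
  TensorProduct.map f.toLinearMap LinearMap.id

variable {R R' : Type u} [CommRing R] [Algebra K R] [CommRing R'] [Algebra K R']

theorem extMap_smul (f : R →ₐ[K] R') (r : R) (t : R ⊗[K] W) :
    extMap W f (r • t) = f r • extMap W f t := by
  induction t with
  | zero => simp
  | add a b ha hb => simp only [smul_add, map_add, ha, hb]
  | tmul a w => simp [extMap, TensorProduct.smul_tmul']

theorem extMap_comp {R'' : Type u} [CommRing R''] [Algebra K R''] (f : R →ₐ[K] R')
    (g : R' →ₐ[K] R'') (t : R ⊗[K] W) : extMap W g (extMap W f t) = extMap W (g.comp f) t := by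
  induction t with
  | zero => simp
  | add a b ha hb => simp only [map_add, ha, hb]
  | tmul a w => simp [extMap]

variable (R) in
/-- The map `1 ⊗ l : R ⊗ W → R` for a linear form `l` on `W`. -/
def coordMap (l : W →ₗ[K] K) : R ⊗[K] W →ₗ[R] R :=
  (TensorProduct.AlgebraTensorModule.rid K R R).toLinearMap ∘ₗ l.baseChange R

theorem coordMap_tmul (l : W →ₗ[K] K) (r : R) (w : W) : coordMap R l (r ⊗ₜ w) = l w • r := by
  simp [coordMap]

/-- Since `W` is free over the field, `R ⊗ W` consists of finitely supported families in `R`.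
Identities of vectors are thereby reduced to identities in `R`. -/
theorem tensor_ext_coord {x y : R ⊗[K] W} (h : ∀ l : W →ₗ[K] K, coordMap R l x = coordMap R l y) :
    x = y := by
  classical
  let b := Module.Basis.ofVectorSpace K W
  have key : ∀ (z : R ⊗[K] W) i, TensorProduct.equivFinsuppOfBasisRight b z i =
      coordMap R (b.coord i) z := by
    intro z i
    induction z with
    | zero => simp
    | add a c ha hc => rw [map_add, map_add, Finsupp.add_apply, ha, hc]
    | tmul r w =>
      rw [coordMap_tmul]
      simp
  refine (TensorProduct.equivFinsuppOfBasisRight b).injective (Finsupp.ext fun i => ?_)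
  rw [key, key, h]

theorem coordMap_extMap (l : W →ₗ[K] K) (f : R →ₐ[K] R') (t : R ⊗[K] W) :
    coordMap R' l (extMap W f t) = f (coordMap R l t) := by
  induction t with
  | zero => simp
  | add a b ha hb => simp only [map_add, ha, hb]
  | tmul a w => simp [extMap, coordMap_tmul]

theorem coordMap_derT (l : W →ₗ[K] K) (δ : Derivation K R R) (t : R ⊗[K] W) :
    coordMap R l (derT W δ t) = δ (coordMap R l t) := by
  induction t with
  | zero => simp
  | add a b ha hb => simp only [map_add, ha, hb]
  | tmul a w => simp [derT_tmul, coordMap_tmul]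

theorem extMap_injective {f : R →ₐ[K] R'} (hf : Function.Injective f) :
    Function.Injective (extMap W f) := fun x y hxy => tensor_ext_coord fun l => hf <| by
  rw [← coordMap_extMap, ← coordMap_extMap, hxy]

/-- Elements of `K[x] ⊗ W` are determined by their values on a non-empty open subset. -/
theorem tensor_ext_eval [Infinite K] {τ : Type} {f : MvPolynomial τ K} (hf : f ≠ 0)
    {x y : MvPolynomial τ K ⊗[K] W} (h : ∀ p : τ → K, MvPolynomial.aeval p f ≠ (0 : K) →
      extMap W (MvPolynomial.aeval p : MvPolynomial τ K →ₐ[K] K) x =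
        extMap W (MvPolynomial.aeval p : MvPolynomial τ K →ₐ[K] K) y) : x = y := by
  refine tensor_ext_coord fun l => ?_
  -- After multiplication by `f` the two polynomials agree at all points, including the zeros of
  -- `f`, and `K` is infinite.
  refine mul_left_cancel₀ hf (MvPolynomial.funext fun p => ?_)
  rw [map_mul, map_mul]
  by_cases hp : MvPolynomial.aeval p f = (0 : K)
  · rw [MvPolynomial.aeval_eq_eval] at hp
    have hp' : MvPolynomial.eval p f = 0 := hp
    rw [hp', zero_mul, zero_mul]
  · have h1 := congrArg (coordMap K l) (h p hp)
    rw [coordMap_extMap, coordMap_extMap, MvPolynomial.aeval_eq_eval] at h1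
    have h2 : MvPolynomial.eval p _ = MvPolynomial.eval p _ := h1
    rw [h2]

/-- Only additivity is built into the maps, so this also applies to commutators with δ ⊗ 1, whose
terms are not linear over `R` although the commutator is. -/
theorem semilinear_ext {M : Type*} [AddCommGroup M] [Module R M] {F G : R ⊗[K] W →+ M}
    (hF : ∀ (r : R) (t : R ⊗[K] W), F (r • t) = r • F t)
    (hG : ∀ (r : R) (t : R ⊗[K] W), G (r • t) = r • G t)
    (h : ∀ w : W, F (1 ⊗ₜ w) = G (1 ⊗ₜ w)) (t : R ⊗[K] W) : F t = G t := by
  induction t with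
  | zero => rw [map_zero, map_zero]
  | add a b ha hb => rw [map_add, map_add, ha, hb]
  | tmul r w =>
    have : r ⊗ₜ[K] w = r • ((1 : R) ⊗ₜ[K] w) := by rw [TensorProduct.smul_tmul', smul_eq_mul, mul_one]
    rw [this, hF, hG, h]

end ScalarExtension

/-! ### Rational representations of GL_n over arbitrary K-algebras -/

section Coaction

variable {n : ℕ} {K : Type u} [Field K] {W : Type u} [AddCommGroup W] [Module K W]
  (σ : GLForm n K W) {R R' : Type u} [CommRing R] [Algebra K R] [CommRing R'] [Algebra K R']

/-- Evaluation of polynomials in the matrix entries at a matrix. -/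
abbrev evalMat (M : Matrix (Fin n) (Fin n) R) : MvPolynomial (Fin n × Fin n) K →ₐ[K] R :=
  MvPolynomial.aeval fun ij : Fin n × Fin n => M ij.1 ij.2

/-- The polynomial part `det(M)^pole · ρ(M)` of a rational representation. -/
def GLForm.polyAct (M : Matrix (Fin n) (Fin n) R) : Module.End R (R ⊗[K] W) :=
  LinearMap.liftBaseChange R (extMap W (evalMat M) ∘ₗ σ.coact)

theorem GLForm.polyAct_tmul (M : Matrix (Fin n) (Fin n) R) (r : R) (w : W) :
    σ.polyAct M (r ⊗ₜ w) = r • extMap W (evalMat M) (σ.coact w) := by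
  simp [GLForm.polyAct]

theorem GLForm.act_apply (g : GL (Fin n) R) (t : R ⊗[K] W) :
    σ.act g t = (((Matrix.GeneralLinearGroup.det g)⁻¹ : Rˣ) : R) ^ σ.pole •
      σ.polyAct (g : Matrix (Fin n) (Fin n) R) t := rfl

theorem GLForm.polyAct_eq (g : GL (Fin n) R) (t : R ⊗[K] W) :
    σ.polyAct (g : Matrix (Fin n) (Fin n) R) t =
      (g : Matrix (Fin n) (Fin n) R).det ^ σ.pole • σ.act g t := by
  rw [GLForm.act_apply, smul_smul, ← mul_pow]
  have : (g : Matrix (Fin n) (Fin n) R).det *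
      (((Matrix.GeneralLinearGroup.det g)⁻¹ : Rˣ) : R) = 1 := by
    rw [← Matrix.GeneralLinearGroup.val_det_apply]
    exact Units.mul_inv _
  rw [this, one_pow, one_smul]

theorem evalMat_comp (f : R →ₐ[K] R') (M : Matrix (Fin n) (Fin n) R) :
    f.comp (evalMat M) = evalMat (M.map f) := by
  ext ij
  simp

theorem GLForm.extMap_polyAct (f : R →ₐ[K] R') (M : Matrix (Fin n) (Fin n) R) (t : R ⊗[K] W) :
    extMap W f (σ.polyAct M t) = σ.polyAct (M.map f) (extMap W f t) := by
  induction t with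
  | zero => simp
  | add a b ha hb => simp only [map_add, ha, hb]
  | tmul r w =>
    rw [GLForm.polyAct_tmul, extMap_smul, extMap_comp, evalMat_comp, TensorProduct.map_tmul,
      GLForm.polyAct_tmul]
    rfl

/-- The image of an invertible matrix under a homomorphism of algebras. -/
abbrev glMap (f : R →ₐ[K] R') : GL (Fin n) R →* GL (Fin n) R' :=
  Matrix.GeneralLinearGroup.map (f : R →+* R')

theorem coe_glMap (f : R →ₐ[K] R') (g : GL (Fin n) R) :
    (glMap f g : Matrix (Fin n) (Fin n) R') = (g : Matrix (Fin n) (Fin n) R).map f := rfl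

theorem GLForm.extMap_act (f : R →ₐ[K] R') (g : GL (Fin n) R) (t : R ⊗[K] W) :
    extMap W f (σ.act g t) = σ.act (glMap f g) (extMap W f t) := by
  rw [GLForm.act_apply, GLForm.act_apply, extMap_smul, GLForm.extMap_polyAct, map_pow]
  congr 2
  have h1 : Matrix.GeneralLinearGroup.det (glMap f g) =
      Units.map (f : R →* R') (Matrix.GeneralLinearGroup.det g) := by
    ext
    rw [Matrix.GeneralLinearGroup.val_det_apply, Units.coe_map,
      Matrix.GeneralLinearGroup.val_det_apply]
    exact (AlgHom.map_det f _).symm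
  rw [h1, ← map_inv]
  rfl

variable {σ} [LieRingModule (Lplus n K) W] [LieModule K (Lplus n K) W] (hσ : σ.Integrates)

include hσ

theorem GLForm.Integrates.polyAct_mul_field (M N : Matrix (Fin n) (Fin n) K)
    (hM : M.det ≠ 0) (hN : N.det ≠ 0) (t : K ⊗[K] W) :
    σ.polyAct (M * N) t = σ.polyAct M (σ.polyAct N t) := by
  obtain ⟨g, rfl⟩ : ∃ g : GL (Fin n) K, (g : Matrix (Fin n) (Fin n) K) = M :=
    ⟨Matrix.GeneralLinearGroup.mkOfDetNeZero M hM, rfl⟩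
  obtain ⟨h, rfl⟩ : ∃ h : GL (Fin n) K, (h : Matrix (Fin n) (Fin n) K) = N :=
    ⟨Matrix.GeneralLinearGroup.mkOfDetNeZero N hN, rfl⟩
  rw [← Units.val_mul, GLForm.polyAct_eq, GLForm.polyAct_eq, GLForm.polyAct_eq, hσ.mul,
    map_smul, smul_smul, Units.val_mul, Matrix.det_mul, mul_pow]
  rfl

/-- Multiplicativity is given over `K` only. For two generic matrices it is an identity between
polynomials in their entries, which can be checked at the points of `K` where both determinants are
non-zero; specialization then gives it over any `R`. The polynomial part is used because it has no
denominators. -/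
theorem GLForm.Integrates.polyAct_mul [Infinite K] (M N : Matrix (Fin n) (Fin n) R)
    (t : R ⊗[K] W) : σ.polyAct (M * N) t = σ.polyAct M (σ.polyAct N t) := by
  classical
  let τ := (Fin n × Fin n) ⊕ (Fin n × Fin n)
  let M₀ : Matrix (Fin n) (Fin n) (MvPolynomial τ K) :=
    Matrix.of fun i j => MvPolynomial.X (Sum.inl (i, j))
  let N₀ : Matrix (Fin n) (Fin n) (MvPolynomial τ K) :=
    Matrix.of fun i j => MvPolynomial.X (Sum.inr (i, j))
  have hmul : ∀ {S : Type u} [CommRing S] [Algebra K S] (p : MvPolynomial τ K →ₐ[K] S),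
      (M₀ * N₀).map p = M₀.map p * N₀.map p := fun p => Matrix.map_mul
  have key : ∀ w : W, σ.polyAct (M₀ * N₀) (1 ⊗ₜ w) = σ.polyAct M₀ (σ.polyAct N₀ (1 ⊗ₜ w)) := by
    intro w
    have hf : M₀.det * N₀.det ≠ 0 := by
      intro h0
      have h1 := congrArg (MvPolynomial.aeval (R := K)
        (Sum.elim (fun ij : Fin n × Fin n => (1 : Matrix (Fin n) (Fin n) K) ij.1 ij.2)
          fun ij => (1 : Matrix (Fin n) (Fin n) K) ij.1 ij.2)) h0
      rw [map_mul, AlgHom.map_det, AlgHom.map_det, map_zero] at h1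
      have h2 : ∀ {A : Matrix (Fin n) (Fin n) K}, A = 1 → A.det = 1 := by
        rintro A rfl
        exact Matrix.det_one
      rw [h2 (by ext i j; simp [M₀]), h2 (by ext i j; simp [N₀]), mul_one] at h1
      exact one_ne_zero h1
    refine tensor_ext_eval hf fun p hp => ?_
    rw [map_mul, AlgHom.map_det, AlgHom.map_det] at hp
    rw [GLForm.extMap_polyAct, GLForm.extMap_polyAct, GLForm.extMap_polyAct, hmul]
    exact hσ.polyAct_mul_field _ _ (left_ne_zero_of_mul hp) (right_ne_zero_of_mul hp) _
  refine semilinear_ext (F := (σ.polyAct (M * N)).toAddMonoidHom)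
    (G := (σ.polyAct M * σ.polyAct N).toAddMonoidHom) (fun r t => map_smul (σ.polyAct (M * N)) r t)
    (fun r t => map_smul (σ.polyAct M * σ.polyAct N) r t) (fun w => ?_) t
  let p : MvPolynomial τ K →ₐ[K] R := MvPolynomial.aeval
    (Sum.elim (fun ij : Fin n × Fin n => M ij.1 ij.2) fun ij => N ij.1 ij.2)
  have hM : M₀.map p = M := by ext i j; simp [M₀, p]
  have hN : N₀.map p = N := by ext i j; simp [N₀, p]
  have h1 := congrArg (extMap W p) (key w)
  rw [GLForm.extMap_polyAct, GLForm.extMap_polyAct, GLForm.extMap_polyAct, hmul, hM, hN,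
    TensorProduct.map_tmul] at h1
  simpa using h1

theorem GLForm.Integrates.act_mul [Infinite K] (g h : GL (Fin n) R) (t : R ⊗[K] W) :
    σ.act (g * h) t = σ.act g (σ.act h t) := by
  rw [GLForm.act_apply, GLForm.act_apply, GLForm.act_apply, Units.val_mul, hσ.polyAct_mul,
    map_smul, smul_smul, map_mul, mul_inv, Units.val_mul, mul_pow]

theorem GLForm.Integrates.act_one (t : R ⊗[K] W) : σ.act (1 : GL (Fin n) R) t = t := by
  refine semilinear_ext (F := (σ.act (1 : GL (Fin n) R)).toAddMonoidHom)
    (G := AddMonoidHom.id _) (fun r t => map_smul (σ.act (1 : GL (Fin n) R)) r t) (fun r t => rfl) (fun w => ?_) t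
  have h1 := GLForm.extMap_act σ (Algebra.ofId K R) 1 (1 ⊗ₜ w)
  rw [hσ.one, map_one] at h1
  simpa using h1.symm

theorem GLForm.Integrates.act_inv [Infinite K] (g : GL (Fin n) R) (t : R ⊗[K] W) :
    σ.act g (σ.act g⁻¹ t) = t := by
  rw [← hσ.act_mul, mul_inv_cancel, hσ.act_one]

theorem GLForm.Integrates.inv_act [Infinite K] (g : GL (Fin n) R) (t : R ⊗[K] W) :
    σ.act g⁻¹ (σ.act g t) = t := by
  rw [← hσ.act_mul, inv_mul_cancel, hσ.act_one]

end Coaction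


/-! ### Conjugation of vector fields by linear substitutions -/

section LinearFields

variable {n : ℕ} {R : Type u} [CommRing R]

/-- The linear vector field `∑ᵢⱼ Nⱼᵢ Xⱼ ∂/∂Xᵢ`. -/
def linVec (N : Matrix (Fin n) (Fin n) R) (i : Fin n) : PS n R :=
  ∑ j, N j i • (MvPowerSeries.X j : PS n R)

theorem linVec_mem (N : Matrix (Fin n) (Fin n) R) (i : Fin n) : linVec N i ∈ ordIdeal n R 1 :=
  Ideal.sum_mem _ fun j _ => smul_mem_ordIdeal _ (X_mem_ordIdeal j)

theorem map_smul_PS {R' : Type u} [CommRing R'] (f : R →+* R') (r : R) (x : PS n R) :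
    MvPowerSeries.map f (r • x) = f r • MvPowerSeries.map f x := by
  rw [MvPowerSeries.smul_eq_C_mul, map_mul, MvPowerSeries.map_C, ← MvPowerSeries.smul_eq_C_mul]

theorem map_linVec {R' : Type u} [CommRing R'] (f : R →+* R') (N : Matrix (Fin n) (Fin n) R)
    (i : Fin n) : MvPowerSeries.map f (linVec N i) = linVec (N.map f) i := by
  rw [linVec, map_sum]
  simp only [map_smul_PS, MvPowerSeries.map_X]
  rfl

theorem linHom_C (g : Matrix (Fin n) (Fin n) R) (r : R) :
    linHom g (MvPowerSeries.C r) = MvPowerSeries.C r :=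
  (linHom g).commutes r

theorem map_linHom {R' : Type u} [CommRing R'] (f : R →+* R') (g : Matrix (Fin n) (Fin n) R)
    (x : PS n R) : MvPowerSeries.map f (linHom g x) = linHom (g.map f) (MvPowerSeries.map f x) := by
  let D : PS n R →+ PS n R' := AddMonoidHom.mk' (fun x => MvPowerSeries.map f (linHom g x) -
    linHom (g.map f) (MvPowerSeries.map f x)) fun a b => by
      simp only [map_add]
      abel
  have hD : ∀ x, D x = MvPowerSeries.map f (linHom g x) -
    linHom (g.map f) (MvPowerSeries.map f x) := fun _ => rfl
  have hX : ∀ k, MvPowerSeries.map f (linHom g (MvPowerSeries.X k)) =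
      linHom (g.map f) (MvPowerSeries.X k) := by
    intro k
    rw [linHom_X, linHom_X, map_sum]
    simp only [map_smul_PS, MvPowerSeries.map_X]
    rfl
  have h : D = 0 := eq_zero_of_semilinear D (fun k => linHom (g.map f) (MvPowerSeries.X k))
    (fun k => linHom_X_mem _ k) (fun r => by
      rw [hD]
      rw [linHom_C, MvPowerSeries.map_C, linHom_C, sub_self]) (fun k x => by
      rw [hD, hD]
      rw [map_mul, map_mul, hX, map_mul, map_mul, MvPowerSeries.map_X]
      ring)
  exact sub_eq_zero.mp (DFunLike.congr_fun h x)

/-- The vector field conjugate to `ξ` under a linear substitution. -/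
def conjVec (g : GL (Fin n) R) (ξ : Fin n → PS n R) (j : Fin n) : PS n R :=
  ∑ i, ((g⁻¹ : GL (Fin n) R) : Matrix (Fin n) (Fin n) R) i j •
    linHom (g : Matrix (Fin n) (Fin n) R) (ξ i)

/-- The vector field `∑ᵢⱼ adj(g)ᵢⱼ g(ξᵢ) ∂/∂Xⱼ`. -/
def adjVec (g : Matrix (Fin n) (Fin n) R) (ξ : Fin n → PS n R) (j : Fin n) : PS n R :=
  ∑ i, g.adjugate i j • linHom g (ξ i)

/-- With the adjugate in place of the inverse, the conjugated field is defined for all matrices and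
commutes with every change of rings. -/
theorem adjVec_eq (g : GL (Fin n) R) (ξ : Fin n → PS n R) :
    adjVec (g : Matrix (Fin n) (Fin n) R) ξ =
      (g : Matrix (Fin n) (Fin n) R).det • conjVec g ξ := by
  have h : (g : Matrix (Fin n) (Fin n) R).adjugate = (g : Matrix (Fin n) (Fin n) R).det •
      ((g⁻¹ : GL (Fin n) R) : Matrix (Fin n) (Fin n) R) := by
    have h1 := Matrix.adjugate_mul (g : Matrix (Fin n) (Fin n) R)
    have h2 : (g : Matrix (Fin n) (Fin n) R) * ((g⁻¹ : GL (Fin n) R) : Matrix (Fin n) (Fin n) R) =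
      1 := g.mul_inv
    rw [← Matrix.mul_one (Matrix.adjugate _), ← h2, ← Matrix.mul_assoc, h1, Matrix.smul_mul,
      Matrix.one_mul]
  funext j
  rw [adjVec, h, Pi.smul_apply, conjVec, Finset.smul_sum]
  exact Finset.sum_congr rfl fun i _ => by rw [smul_smul]; rfl

theorem conjVec_mem (g : GL (Fin n) R) {ξ : Fin n → PS n R} {k : ℕ}
    (hξ : ∀ i, ξ i ∈ ordIdeal n R k) (j : Fin n) : conjVec g ξ j ∈ ordIdeal n R k :=
  Ideal.sum_mem _ fun i _ => smul_mem_ordIdeal _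
    (algHom_mem_ordIdeal (linHom_X_mem (g : Matrix (Fin n) (Fin n) R)) (hξ i))

theorem map_adjVec {R' : Type u} [CommRing R'] (f : R →+* R') (g : Matrix (Fin n) (Fin n) R)
    (ξ : Fin n → PS n R) (j : Fin n) : MvPowerSeries.map f (adjVec g ξ j) =
      adjVec (g.map f) (fun i => MvPowerSeries.map f (ξ i)) j := by
  rw [adjVec, map_sum]
  simp only [map_smul_PS, map_linHom]
  refine Finset.sum_congr rfl fun i _ => ?_
  have := congrFun (congrFun (RingHom.map_adjugate f g) i) j
  rw [← RingHom.mapMatrix_apply, ← this]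
  rfl

theorem adjVec_one (ξ : Fin n → PS n R) : adjVec (1 : Matrix (Fin n) (Fin n) R) ξ = ξ := by
  classical
  funext j
  rw [adjVec]
  simp [Matrix.adjugate_one, Matrix.one_apply, linHom_one]

variable {K : Type u} [Field K] [Algebra K R]

/-- Conjugation of a derivation `δ + ξ` of the algebra of power series by a linear
substitution. -/
theorem linHom_totalDer (g : GL (Fin n) R) (δ : Derivation K R R) (ξ : Fin n → PS n R)
    (f : PS n R) :
    linHom (g : Matrix (Fin n) (Fin n) R) (totalDer δ ξ f) =
      totalDer δ (conjVec g ξ - linVec ((g : Matrix (Fin n) (Fin n) R).map δ *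
        ((g⁻¹ : GL (Fin n) R) : Matrix (Fin n) (Fin n) R)))
        (linHom (g : Matrix (Fin n) (Fin n) R) f) := by
  classical
  set ξ' := conjVec g ξ - linVec ((g : Matrix (Fin n) (Fin n) R).map δ *
        ((g⁻¹ : GL (Fin n) R) : Matrix (Fin n) (Fin n) R)) with hξ'
  have h2 : ((g⁻¹ : GL (Fin n) R) : Matrix (Fin n) (Fin n) R) * (g : Matrix (Fin n) (Fin n) R) =
      1 := g.inv_mul
  have h2' : ∀ i j, ∑ k, ((g⁻¹ : GL (Fin n) R) : Matrix (Fin n) (Fin n) R) i k *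
      (g : Matrix (Fin n) (Fin n) R) k j = if i = j then 1 else 0 := fun i j => by
    rw [← Matrix.mul_apply, h2, Matrix.one_apply]
  -- On a variable, the derivative δ of the entries of `g` produces the linear field with matrix
  -- δ(g), which is exactly compensated by the summand with δ(g) g⁻¹.
  have hX : ∀ k, linHom (g : Matrix (Fin n) (Fin n) R) (ξ k) =
      totalDer δ ξ' (linHom (g : Matrix (Fin n) (Fin n) R) (MvPowerSeries.X k)) := by
    intro k
    have e1 : ∀ (r : R) (x : PS n R), totalDer δ ξ' (r • x) = δ r • x + r • totalDer δ ξ' x := by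
      intro r x
      rw [MvPowerSeries.smul_eq_C_mul, Derivation.leibniz, totalDer_C,
        MvPowerSeries.smul_eq_C_mul, MvPowerSeries.smul_eq_C_mul, smul_eq_mul, smul_eq_mul]
      ring
    rw [linHom_X, map_sum]
    simp only [e1, totalDer_X]
    rw [Finset.sum_add_distrib]
    have e2 : ∑ j, (g : Matrix (Fin n) (Fin n) R) j k • conjVec g ξ j =
        linHom (g : Matrix (Fin n) (Fin n) R) (ξ k) := by
      simp only [conjVec, Finset.smul_sum, smul_smul]
      rw [Finset.sum_comm]
      have : ∀ i, ∑ j, ((g : Matrix (Fin n) (Fin n) R) j k *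
          ((g⁻¹ : GL (Fin n) R) : Matrix (Fin n) (Fin n) R) i j) •
            linHom (g : Matrix (Fin n) (Fin n) R) (ξ i) =
          (if i = k then (1 : R) else 0) • linHom (g : Matrix (Fin n) (Fin n) R) (ξ i) := by
        intro i
        rw [← Finset.sum_smul, ← h2']
        simp only [mul_comm]
      rw [Finset.sum_congr rfl fun i _ => this i]
      simp
    have e3 : ∑ j, (g : Matrix (Fin n) (Fin n) R) j k •
        linVec ((g : Matrix (Fin n) (Fin n) R).map δ *
          ((g⁻¹ : GL (Fin n) R) : Matrix (Fin n) (Fin n) R)) j =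
        ∑ j, δ ((g : Matrix (Fin n) (Fin n) R) j k) • (MvPowerSeries.X j : PS n R) := by
      simp only [linVec, Finset.smul_sum, smul_smul]
      rw [Finset.sum_comm]
      refine Finset.sum_congr rfl fun l _ => ?_
      rw [← Finset.sum_smul]
      congr 1
      have h3 : (((g : Matrix (Fin n) (Fin n) R).map δ *
          ((g⁻¹ : GL (Fin n) R) : Matrix (Fin n) (Fin n) R)) *
            (g : Matrix (Fin n) (Fin n) R)) l k = δ ((g : Matrix (Fin n) (Fin n) R) l k) := by
        rw [Matrix.mul_assoc, h2, Matrix.mul_one]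
        rfl
      rw [← h3, Matrix.mul_apply]
      exact Finset.sum_congr rfl fun j _ => mul_comm _ _
    simp only [hξ', Pi.sub_apply, smul_sub, Finset.sum_sub_distrib, e2, e3]
    abel
  let D : PS n R →+ PS n R := AddMonoidHom.mk' (fun x =>
    linHom (g : Matrix (Fin n) (Fin n) R) (totalDer δ ξ x) -
      totalDer δ ξ' (linHom (g : Matrix (Fin n) (Fin n) R) x)) fun a b => by
      simp only [map_add]
      abel
  have hD : ∀ x, D x = linHom (g : Matrix (Fin n) (Fin n) R) (totalDer δ ξ x) -
      totalDer δ ξ' (linHom (g : Matrix (Fin n) (Fin n) R) x) := fun _ => rfl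
  have h : D = 0 := eq_zero_of_semilinear D
    (fun k => linHom (g : Matrix (Fin n) (Fin n) R) (MvPowerSeries.X k))
    (fun k => linHom_X_mem _ k) (fun r => by
      rw [hD]
      rw [linHom_C, totalDer_C, totalDer_C, linHom_C, sub_self]) (fun k x => by
      rw [hD, hD]
      rw [Derivation.leibniz, totalDer_X, map_mul, Derivation.leibniz, ← hX]
      simp only [smul_eq_mul, map_add, map_mul]
      ring)
  exact sub_eq_zero.mp (DFunLike.congr_fun h f)

end LinearFields

/-! ### Derivations as homomorphisms to dual numbers -/

section DualNumbers

open DualNumber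

variable {K : Type u} [Field K] {W : Type u} [AddCommGroup W] [Module K W]
  {R R' : Type u} [CommRing R] [Algebra K R] [CommRing R'] [Algebra K R']

/-- The homomorphism `r ↦ r + δ(r) ε`. -/
def dualOf (δ : Derivation K R R) : R →ₐ[K] R[ε] where
  toFun r := TrivSqZeroExt.inl r + TrivSqZeroExt.inr (δ r)
  map_one' := by ext <;> simp
  map_mul' a b := by ext <;> simp [mul_comm]
  map_zero' := by ext <;> simp
  map_add' a b := by ext <;> simp
  commutes' c := by
    ext <;> simp [TrivSqZeroExt.algebraMap_eq_inl']

/-- The homomorphism of algebras of dual numbers induced by a homomorphism of algebras. -/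
def dualMap (f : R →ₐ[K] R') : R[ε] →ₐ[K] R'[ε] where
  toFun x := TrivSqZeroExt.inl (f x.fst) + TrivSqZeroExt.inr (f x.snd)
  map_one' := by ext <;> simp
  map_mul' a b := by ext <;> simp
  map_zero' := by ext <;> simp
  map_add' a b := by ext <;> simp
  commutes' c := by
    ext <;> simp [TrivSqZeroExt.algebraMap_eq_inl']

variable (K W) in
/-- The module `A ⊗ W` for a `K`-algebra `A`. -/
abbrev ExtModule (A : Type u) [CommRing A] [Algebra K A] : Type u := A ⊗[K] W

/-- The map `A ⊗ W → B ⊗ W` induced by a linear map between algebras. -/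
abbrev linExt (W : Type u) [AddCommGroup W] [Module K W] {A B : Type u} [CommRing A]
    [Algebra K A] [CommRing B] [Algebra K B] (f : A →ₗ[K] B) : A ⊗[K] W →ₗ[K] B ⊗[K] W :=
  TensorProduct.map f LinearMap.id

variable (W R) in
/-- The coefficient at `ε` of elements of `R[ε] ⊗ W`. -/
def epsCoeff : ExtModule K W R[ε] →ₗ[K] R ⊗[K] W := linExt (K := K) W (A := R[ε]) (B := R)
  { toFun := TrivSqZeroExt.snd
    map_add' := fun _ _ => rfl
    map_smul' := fun c x => by
      rw [Algebra.smul_def, TrivSqZeroExt.algebraMap_eq_inl']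
      simp [Algebra.smul_def] }

theorem epsCoeff_tmul (a : R[ε]) (w : W) : epsCoeff W R (a ⊗ₜ[K] w) = a.snd ⊗ₜ w := rfl

theorem epsCoeff_smul (r : R) (t : R[ε] ⊗[K] W) :
    epsCoeff W R ((TrivSqZeroExt.inl r : R[ε]) • t) = r • epsCoeff W R t := by
  induction t with
  | zero => simp
  | add a b ha hb => simp only [smul_add, map_add, ha, hb]
  | tmul a w => simp [TensorProduct.smul_tmul', epsCoeff_tmul]

/-- The derivation is encoded in a homomorphism of algebras. Naturality of the group action under
homomorphisms thereby becomes a statement about derivatives. -/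
theorem epsCoeff_dualOf (δ : Derivation K R R) (t : R ⊗[K] W) :
    epsCoeff W R (extMap W (dualOf δ) t) = derT W δ t := by
  induction t with
  | zero => simp
  | add a b ha hb => simp only [map_add, ha, hb]
  | tmul a w => simp [extMap, epsCoeff_tmul, dualOf, derT_tmul]

theorem epsCoeff_dualMap (f : R →ₐ[K] R') (t : R[ε] ⊗[K] W) :
    epsCoeff W R' (extMap W (dualMap f) t) = extMap W f (epsCoeff W R t) := by
  induction t with
  | zero => simp
  | add a b ha hb => simp only [map_add, ha, hb]
  | tmul a w => simp [extMap, epsCoeff_tmul, dualMap]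

variable {n : ℕ}

variable (n) in
/-- The group `GL_n` over a commutative ring. -/
abbrev CommGL (A : Type u) [CommRing A] : Type u := GL (Fin n) A

/-- The matrix `1 + ε N`. -/
def dualGL (N : Matrix (Fin n) (Fin n) R) : CommGL n R[ε] where
  val := 1 + N.map TrivSqZeroExt.inr
  inv := 1 - N.map TrivSqZeroExt.inr
  val_inv := by
    have : N.map (TrivSqZeroExt.inr : R → R[ε]) * N.map TrivSqZeroExt.inr = 0 := by
      ext i j <;> simp [Matrix.mul_apply]
    rw [add_mul, mul_sub, mul_sub, this]
    simp
  inv_val := by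
    have : N.map (TrivSqZeroExt.inr : R → R[ε]) * N.map TrivSqZeroExt.inr = 0 := by
      ext i j <;> simp [Matrix.mul_apply]
    rw [sub_mul, mul_add, mul_add, this]
    simp

theorem coe_dualGL (N : Matrix (Fin n) (Fin n) R) :
    (dualGL N : Matrix (Fin n) (Fin n) R[ε]) = 1 + N.map TrivSqZeroExt.inr := rfl

theorem glMap_dualGL (f : R →ₐ[K] R') (N : Matrix (Fin n) (Fin n) R) :
    glMap (dualMap f) (dualGL N) = dualGL (N.map f) := by
  refine Units.ext ?_
  change (1 + N.map TrivSqZeroExt.inr : Matrix (Fin n) (Fin n) R[ε]).map (dualMap f) =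
    1 + (N.map f).map TrivSqZeroExt.inr
  ext i j
  · simp [dualMap, Matrix.one_apply]
    split_ifs <;> simp
  · simp [dualMap, Matrix.one_apply]
    split_ifs <;> simp

/-- The factor δ(g) ε is written as ε δ(g) g⁻¹ · g, which brings in the logarithmic derivative of
`g`. -/
theorem glMap_dualOf (δ : Derivation K R R) (g : GL (Fin n) R) :
    glMap (dualOf δ) g = dualGL ((g : Matrix (Fin n) (Fin n) R).map δ *
      ((g⁻¹ : GL (Fin n) R) : Matrix (Fin n) (Fin n) R)) *
        glMap (TrivSqZeroExt.inlAlgHom K R R) g := by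
  have h2 : ((g⁻¹ : GL (Fin n) R) : Matrix (Fin n) (Fin n) R) * (g : Matrix (Fin n) (Fin n) R) =
      1 := g.inv_mul
  have h3 : ∀ N : Matrix (Fin n) (Fin n) R, N.map (TrivSqZeroExt.inr : R → R[ε]) *
      (g : Matrix (Fin n) (Fin n) R).map (TrivSqZeroExt.inl : R → R[ε]) =
      (N * (g : Matrix (Fin n) (Fin n) R)).map TrivSqZeroExt.inr := by
    intro N
    ext i j
    · simp [Matrix.mul_apply, TrivSqZeroExt.fst_sum, -DualNumber.inr_eq_smul_eps]
    · simp [Matrix.mul_apply, TrivSqZeroExt.snd_sum, -DualNumber.inr_eq_smul_eps]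
  refine Units.ext ?_
  change (g : Matrix (Fin n) (Fin n) R).map (dualOf δ) = (1 + Matrix.map _ _) *
    (g : Matrix (Fin n) (Fin n) R).map TrivSqZeroExt.inl
  rw [add_mul, one_mul, h3, Matrix.mul_assoc, h2, Matrix.mul_one]
  rfl

end DualNumbers


/-! ### The derivative of the group action along a derivation of R -/

section MaurerCartan

open DualNumber

variable {n : ℕ} {K : Type u} [Field K] {W : Type u} [AddCommGroup W] [Module K W]
  [LieRingModule (Lplus n K) W] [LieModule K (Lplus n K) W]
  {σ : GLForm n K W} (hσ : σ.Integrates) {R R' : Type u} [CommRing R] [Algebra K R]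
  [CommRing R'] [Algebra K R'] {N : ℕ} (h : IsDegreeBound (n := n) (K := K) W N)

include h

theorem lieAct_linVec (M : Matrix (Fin n) (Fin n) R) :
    lieAct K W (linVec M) = ∑ j, ∑ i, M j i •
      (LieModule.toEnd K (Lplus n K) W (mono (unitExp j) i)).baseChange R := by
  classical
  have h1 : linVec M = ∑ j, ∑ i, M j i • monoVec (R := R) (Finsupp.single j 1) i := by
    funext k
    rw [linVec, Finset.sum_apply]
    refine Finset.sum_congr rfl fun j _ => ?_
    rw [Finset.sum_apply]
    ext s
    rw [map_sum]
    have : ∀ i, MvPowerSeries.coeff s ((M j i • monoVec (R := R) (Finsupp.single j 1) i) k) =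
        M j i * MvPowerSeries.coeff s (monoVec (R := R) (Finsupp.single j 1) i k) := fun i => rfl
    simp only [this, coeff_monoVec]
    change M j k * MvPowerSeries.coeff s (MvPowerSeries.X j : PS n R) = _
    rw [MvPowerSeries.coeff_X, Finset.sum_eq_single k]
    · simp
    · intro i _ hi
      simp [hi]
    · simp
  rw [h1, lieAct_sum h]
  refine Finset.sum_congr rfl fun j _ => ?_
  rw [lieAct_sum h]
  refine Finset.sum_congr rfl fun i _ => ?_
  rw [lieAct_smul h]
  congr 1
  exact lieAct_monoVec h (unitExp j) i

include hσ

theorem GLForm.Integrates.epsCoeff_act_field (A : Matrix (Fin n) (Fin n) K) (w : W) :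
    epsCoeff W K (σ.act (dualGL A) ((1 : K[ε]) ⊗ₜ[K] w)) = lieAct K W (linVec A) (1 ⊗ₜ w) := by
  rw [hσ.deriv A (dualGL A) (by
    rw [coe_dualGL]
    congr 1
    ext i j <;> simp), map_add, epsCoeff_tmul, epsCoeff_tmul, lieAct_linVec h]
  simp only [TrivSqZeroExt.snd_one, TensorProduct.zero_tmul, zero_add, DualNumber.snd_eps,
    LinearMap.sum_apply, LinearMap.smul_apply, LinearMap.baseChange_tmul, glToLplus]
  rw [← LieModule.toEnd_apply_apply K, map_sum]
  simp only [map_sum, map_smul, LinearMap.sum_apply, LinearMap.smul_apply,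
    TensorProduct.tmul_sum, TensorProduct.tmul_smul]

omit hσ h [LieRingModule (Lplus n K) W] [LieModule K (Lplus n K) W] in
theorem extMap_epsCoeff_act (f : R →ₐ[K] R') (M : Matrix (Fin n) (Fin n) R) (w : W) :
    extMap W f (epsCoeff W R (σ.act (dualGL M) ((1 : R[ε]) ⊗ₜ[K] w))) =
      epsCoeff W R' (σ.act (dualGL (M.map f)) ((1 : R'[ε]) ⊗ₜ[K] w)) := by
  rw [← epsCoeff_dualMap, GLForm.extMap_act, glMap_dualGL, TensorProduct.map_tmul]
  simp

omit hσ in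
theorem extMap_lieAct_linVec (f : R →ₐ[K] R') (M : Matrix (Fin n) (Fin n) R) (w : W) :
    extMap W f (lieAct K W (linVec M) (1 ⊗ₜ w)) = lieAct K W (linVec (M.map f)) (1 ⊗ₜ w) := by
  have e2 : (fun i => MvPowerSeries.map (f : R →+* R') (linVec M i)) = linVec (M.map f) :=
    funext fun i => map_linVec _ _ i
  rw [lieAct_natural h, e2, TensorProduct.map_tmul]
  simp

/-- For the generic matrix, both sides can be compared at points over `K`, where the equality is the
hypothesis on the differential of the representation. The general case is a specialization of the
generic one. -/
theorem GLForm.Integrates.epsCoeff_act_tmul [Infinite K] (M : Matrix (Fin n) (Fin n) R) (w : W) :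
    epsCoeff W R (σ.act (dualGL M) ((1 : R[ε]) ⊗ₜ[K] w)) = lieAct K W (linVec M) (1 ⊗ₜ w) := by
  have hgen : epsCoeff W _ (σ.act (dualGL (Matrix.mvPolynomialX (Fin n) (Fin n) K))
      ((1 : (MvPolynomial (Fin n × Fin n) K)[ε]) ⊗ₜ[K] w)) = lieAct K W (linVec (Matrix.mvPolynomialX (Fin n) (Fin n) K)) (1 ⊗ₜ w) := by
    refine tensor_ext_eval (one_ne_zero) fun p _ => ?_
    rw [extMap_epsCoeff_act, extMap_lieAct_linVec h]
    exact hσ.epsCoeff_act_field h _ w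
  have hf : (Matrix.mvPolynomialX (Fin n) (Fin n) K).map (evalMat M) = M := by
    ext i j
    simp
  have e1 := congrArg (extMap W (evalMat M)) hgen
  rwa [extMap_epsCoeff_act, extMap_lieAct_linVec h, hf] at e1

theorem GLForm.Integrates.epsCoeff_act [Infinite K] (M : Matrix (Fin n) (Fin n) R)
    (t : R ⊗[K] W) :
    epsCoeff W R (σ.act (dualGL M) (extMap W (TrivSqZeroExt.inlAlgHom K R R) t)) =
      lieAct K W (linVec M) t := by
  induction t with
  | zero => simp
  | add a b ha hb => simp only [map_add, ha, hb]
  | tmul r w =>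
    have h1 : r ⊗ₜ[K] w = r • ((1 : R) ⊗ₜ[K] w) := by
      rw [TensorProduct.smul_tmul', smul_eq_mul, mul_one]
    have h2 : extMap W (TrivSqZeroExt.inlAlgHom K R R) (1 ⊗ₜ[K] w) = (1 : R[ε]) ⊗ₜ[K] w := by
      rw [TensorProduct.map_tmul]
      simp
    rw [h1, extMap_smul, map_smul (σ.act (dualGL M)), map_smul (lieAct K W (linVec M)), h2, ← hσ.epsCoeff_act_tmul h]
    exact epsCoeff_smul r _

/-- Apply the homomorphism r ↦ r + δ(r)ε to the action of `g`. By naturality and multiplicativity it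
becomes ρ(1 + ε δ(g)g⁻¹) ρ(g), whose coefficient at ε is the linear field δ(g)g⁻¹ acting on ρ(g).
The commutator of δ ⊗ 1 with ρ(g) is linear over `R`, so vectors `1 ⊗ w` suffice. -/
theorem GLForm.Integrates.derT_act [Infinite K] (g : GL (Fin n) R) (δ : Derivation K R R)
    (t : R ⊗[K] W) : derT W δ (σ.act g t) = σ.act g (derT W δ t) +
      lieAct K W (linVec ((g : Matrix (Fin n) (Fin n) R).map δ *
        ((g⁻¹ : GL (Fin n) R) : Matrix (Fin n) (Fin n) R))) (σ.act g t) := by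
  set M := (g : Matrix (Fin n) (Fin n) R).map δ *
        ((g⁻¹ : GL (Fin n) R) : Matrix (Fin n) (Fin n) R) with hM
  have key := semilinear_ext (F := (derT W δ).toAddMonoidHom.comp (σ.act g).toAddMonoidHom -
      (σ.act g).toAddMonoidHom.comp (derT W δ).toAddMonoidHom)
    (G := (lieAct K W (linVec M) * σ.act g).toAddMonoidHom) (fun r t => ?_)
    (fun r t => map_smul (lieAct K W (linVec M) * σ.act g) r t) (fun w => ?_) t
  · exact sub_eq_iff_eq_add'.mp key
  · change derT W δ (σ.act g (r • t)) - σ.act g (derT W δ (r • t)) =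
      r • (derT W δ (σ.act g t) - σ.act g (derT W δ t))
    rw [map_smul, derT_smul, derT_smul, map_add, map_smul, map_smul, smul_sub]
    abel
  · change derT W δ (σ.act g (1 ⊗ₜ w)) - σ.act g (derT W δ (1 ⊗ₜ w)) =
      lieAct K W (linVec M) (σ.act g (1 ⊗ₜ w))
    rw [derT_tmul, Derivation.map_one_eq_zero, TensorProduct.zero_tmul, map_zero, sub_zero,
      ← epsCoeff_dualOf, GLForm.extMap_act, glMap_dualOf, ← hM, hσ.act_mul,
      ← hσ.epsCoeff_act h, GLForm.extMap_act]
    simp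

end MaurerCartan

/-! ### Conjugated vector fields along a derivation -/

section Adjoint

variable {n : ℕ} {K : Type u} [Field K] {W : Type u} [AddCommGroup W] [Module K W]
  [LieRingModule (Lplus n K) W] [LieModule K (Lplus n K) W]
  {σ : GLForm n K W} (hσ : σ.Integrates) {R : Type u} [CommRing R] [Algebra K R]
  {N : ℕ} (h : IsDegreeBound (n := n) (K := K) W N)

/-- A field with δ-constant coefficients commutes with δ. Conjugation by `g` preserves this, but it
turns δ into δ minus the linear field of δ(g)g⁻¹; hence δ differentiates the conjugated field by
bracketing with that linear field. -/
theorem conjVec_coeffDer (g : GL (Fin n) R) (δ : Derivation K R R) {ξ : Fin n → PS n R}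
    (hδ : ∀ i, coeffDer δ (ξ i) = 0) (i : Fin n) :
    coeffDer δ (conjVec g ξ i) = lieVec (linVec ((g : Matrix (Fin n) (Fin n) R).map δ *
        ((g⁻¹ : GL (Fin n) R) : Matrix (Fin n) (Fin n) R))) (conjVec g ξ) i := by
  classical
  set M := (g : Matrix (Fin n) (Fin n) R).map δ *
        ((g⁻¹ : GL (Fin n) R) : Matrix (Fin n) (Fin n) R) with hM
  have hz : conjVec g (0 : Fin n → PS n R) = 0 := by
    funext j
    simp [conjVec]
  have h0 : (g : Matrix (Fin n) (Fin n) R).map (0 : Derivation K R R) *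
        ((g⁻¹ : GL (Fin n) R) : Matrix (Fin n) (Fin n) R) = 0 := by
    ext i j
    simp [Matrix.mul_apply]
  have hz' : linVec (0 : Matrix (Fin n) (Fin n) R) = 0 := by
    funext j
    simp [linVec]
  have e1 : ∀ f : PS n R, linHom (g : Matrix (Fin n) (Fin n) R) (vecField ξ f) =
      vecField (conjVec g ξ) (linHom (g : Matrix (Fin n) (Fin n) R) f) := by
    intro f
    have := linHom_totalDer g (0 : Derivation K R R) ξ f
    rwa [h0, hz', sub_zero, totalDer_apply, totalDer_apply, coeffDer_zero, coeffDer_zero,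
      zero_add, zero_add] at this
  have e2 : ∀ f : PS n R, linHom (g : Matrix (Fin n) (Fin n) R) (coeffDer δ f) =
      coeffDer δ (linHom (g : Matrix (Fin n) (Fin n) R) f) -
        vecField (linVec M) (linHom (g : Matrix (Fin n) (Fin n) R) f) := by
    intro f
    have := linHom_totalDer g δ 0 f
    rw [← hM, hz, zero_sub, totalDer_apply, totalDer_apply] at this
    have e3 : ∀ f : PS n R, vecField (-linVec M) f = - vecField (linVec M) f := by
      intro f
      simp [vecField_apply]
    have e4 : vecField (0 : Fin n → PS n R) f = 0 := by simp [vecField_apply]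
    rw [e4, add_zero, e3, ← sub_eq_add_neg] at this
    exact this
  -- Evaluating the commutation relation at the preimage of a variable extracts the coefficients of
  -- the field.
  obtain ⟨f, hf⟩ := (linEquiv g).surjective (MvPowerSeries.X i)
  have hf' : linHom (g : Matrix (Fin n) (Fin n) R) f = MvPowerSeries.X i := hf
  have e5 : coeffDer δ (vecField ξ f) = vecField ξ (coeffDer δ f) := by
    rw [vecField_apply, vecField_apply, map_sum]
    refine Finset.sum_congr rfl fun j _ => ?_
    rw [Derivation.leibniz, hδ, smul_zero, add_zero, smul_eq_mul]
    congr 1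
    ext s
    rw [coeff_coeffDer, MvPowerSeries.coeff_pderiv, MvPowerSeries.coeff_pderiv, coeff_coeffDer,
      Derivation.leibniz]
    have : δ ((s j : R) + 1) = 0 := by
      rw [← Nat.cast_succ]
      exact δ.map_natCast _
    rw [this, smul_zero, zero_add, smul_eq_mul, mul_comm]
  have e6 := congrArg (linHom (g : Matrix (Fin n) (Fin n) R)) e5
  rw [e2, e1, e1, e2, hf', vecField_X, coeffDer_X, vecField_X, zero_sub, map_neg] at e6
  rw [lieVec]
  linear_combination e6

include hσ h

/-- The terms with δ(g)g⁻¹ that arise from differentiating ρ(g) and its inverse cancel the bracket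
from `conjVec_coeffDer`. So conjugating the transported field back by ρ(g) gives an operator that is
constant along δ, which is the differential equation behind adjoint equivariance. -/
theorem GLForm.Integrates.derT_conj [Infinite K] (g : GL (Fin n) R) (δ : Derivation K R R)
    {ξ : Fin n → PS n R} (hξ : ∀ i, ξ i ∈ ordIdeal n R 1) (hδ : ∀ i, coeffDer δ (ξ i) = 0)
    (t : R ⊗[K] W) :
    derT W δ (σ.act g⁻¹ (lieAct K W (conjVec g ξ) (σ.act g t))) =
      σ.act g⁻¹ (lieAct K W (conjVec g ξ) (σ.act g (derT W δ t))) := by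
  set M := (g : Matrix (Fin n) (Fin n) R).map δ *
        ((g⁻¹ : GL (Fin n) R) : Matrix (Fin n) (Fin n) R) with hM
  have e1 := hσ.derT_act h g δ t
  have e2 := derT_lieAct h δ (conjVec g ξ) (σ.act g t)
  have e3 := hσ.derT_act h g δ (σ.act g⁻¹ (lieAct K W (conjVec g ξ) (σ.act g t)))
  have e4 := DFunLike.congr_fun (lieAct_lieVec h (linVec_mem M) (conjVec_mem g hξ)) (σ.act g t)
  rw [hσ.act_inv] at e3
  rw [← hM] at e1 e3
  rw [LinearMap.add_apply, Module.End.mul_apply, Module.End.mul_apply] at e4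
  have e5 : (fun i => coeffDer δ (conjVec g ξ i)) = lieVec (linVec M) (conjVec g ξ) :=
    funext fun i => conjVec_coeffDer g δ hδ i
  rw [e5, e1, map_add] at e2
  have e6 : σ.act g (derT W δ (σ.act g⁻¹ (lieAct K W (conjVec g ξ) (σ.act g t)))) =
      lieAct K W (conjVec g ξ) (σ.act g (derT W δ t)) := by
    rw [e2, ← e4] at e3
    refine add_right_cancel (b := lieAct K W (lieVec (linVec M) (conjVec g ξ)) (σ.act g t) +
      lieAct K W (conjVec g ξ) (lieAct K W (linVec M) (σ.act g t))) (e3.symm.trans ?_)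
    abel
  rw [← e6, hσ.inv_act]

end Adjoint


/-! ### Polynomials and power series in a deformation parameter t -/

section Path

variable {K : Type u} [Field K] {R : Type u} [CommRing R] [Algebra K R]

variable (K R) in
/-- The embedding `R[t] → R[[t]]`. -/
def polyToSeries : Polynomial R →ₐ[K] PowerSeries R where
  toRingHom := Polynomial.coeToPowerSeries.ringHom
  commutes' c := by
    rw [IsScalarTower.algebraMap_apply K R (Polynomial R)]
    change ((Polynomial.C (algebraMap K R c) : Polynomial R) : PowerSeries R) = _
    rw [Polynomial.coe_C, PowerSeries.algebraMap_apply]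

theorem polyToSeries_apply (p : Polynomial R) : polyToSeries K R p = (p : PowerSeries R) := rfl

theorem polyToSeries_injective : Function.Injective (polyToSeries K R) :=
  Polynomial.coe_injective R

variable (K R) in
/-- The value at `t = 0` of a power series in `t`. -/
def seriesAtZero : PowerSeries R →ₐ[K] R where
  toRingHom := PowerSeries.constantCoeff
  commutes' c := by
    change PowerSeries.constantCoeff (PowerSeries.C (algebraMap K R c)) = _
    simp

theorem seriesAtZero_apply (p : PowerSeries R) :
    seriesAtZero K R p = PowerSeries.constantCoeff p := rfl

variable (K R) in
/-- The value at `t = a` of a polynomial in `t`. -/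
def polyEval (a : R) : Polynomial R →ₐ[K] R := (Polynomial.aeval a).restrictScalars K

theorem polyEval_apply (a : R) (p : Polynomial R) : polyEval K R a p = p.eval a :=
  congrFun (Polynomial.coe_aeval_eq_eval a) p

variable (K R) in
/-- The derivation `d/dt` of `R[[t]]`. -/
def seriesDer : Derivation K (PowerSeries R) (PowerSeries R) :=
  (PowerSeries.derivative R).restrictScalars K

theorem seriesDer_C (r : R) : seriesDer K R (PowerSeries.C r) = 0 := PowerSeries.derivative_C

variable {W : Type u} [AddCommGroup W] [Module K W]

/-- In characteristic zero a power series is determined by its derivative and its constant term;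
this is applied to each coordinate of `W`. -/
theorem eq_of_derT_eq_zero [CharZero K] {x y : PowerSeries R ⊗[K] W}
    (hx : derT W (seriesDer K R) x = 0) (hy : derT W (seriesDer K R) y = 0)
    (h : extMap W (seriesAtZero K R) x = extMap W (seriesAtZero K R) y) : x = y := by
  have htf : IsAddTorsionFree R := by
    let _ : Algebra ℚ R := Algebra.compHom R (algebraMap ℚ K)
    exact IsAddTorsionFree.of_module_rat R
  refine tensor_ext_coord fun l => PowerSeries.derivative.ext ?_ ?_
  · have h1 := congrArg (coordMap (PowerSeries R) l) hx
    have h2 := congrArg (coordMap (PowerSeries R) l) hy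
    rw [coordMap_derT, map_zero] at h1 h2
    exact h1.trans h2.symm
  · have h1 := congrArg (coordMap R l) h
    rwa [coordMap_extMap, coordMap_extMap] at h1

end Path

/-! ### Equivariance of the group action for the adjoint action -/

section Adjoint

variable {n : ℕ} {K : Type u} [Field K] {W : Type u} [AddCommGroup W] [Module K W]
  [LieRingModule (Lplus n K) W] [LieModule K (Lplus n K) W]
  {σ : GLForm n K W} {R : Type u} [CommRing R] [Algebra K R]
  {N : ℕ} (h : IsDegreeBound (n := n) (K := K) W N)

variable (hσ : σ.Integrates)
include h hσ

/-- Along `g = 1 + tM`, conjugating the action of the transported field back by ρ(g) gives, on `1 ⊗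
w`, a vector with zero derivative in `t` by `derT_conj`. At `t = 0` it is the action of the original
field, so it is so for all `t`. -/
theorem GLForm.Integrates.act_lieAct_path [CharZero K] (M : Matrix (Fin n) (Fin n) R)
    (g : GL (Fin n) (PowerSeries R)) (hg : (g : Matrix (Fin n) (Fin n) (PowerSeries R)) =
      1 + M.map fun r => PowerSeries.X * PowerSeries.C r)
    {ξ : Fin n → PS n R} (hξ : ∀ i, ξ i ∈ ordIdeal n R 1) (w : W) :
    σ.act g (lieAct K W (fun i => MvPowerSeries.map PowerSeries.C (ξ i))
      ((1 : PowerSeries R) ⊗ₜ[K] w)) =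
      lieAct K W (conjVec g fun i => MvPowerSeries.map PowerSeries.C (ξ i))
        (σ.act g ((1 : PowerSeries R) ⊗ₜ[K] w)) := by
  have hi : Infinite K := inferInstance
  set u : Fin n → PS n (PowerSeries R) := fun i => MvPowerSeries.map PowerSeries.C (ξ i) with hu
  have hu1 : ∀ i, u i ∈ ordIdeal n (PowerSeries R) 1 := fun i s hs => by
    rw [hu]
    simp [hξ i s hs]
  have hud : ∀ i, coeffDer (seriesDer K R) (u i) = 0 := fun i => by
    ext1 s
    rw [coeff_coeffDer, hu]
    simp only [MvPowerSeries.coeff_map]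
    rw [seriesDer_C, map_zero]
  have e0 : derT W (seriesDer K R) ((1 : PowerSeries R) ⊗ₜ[K] w) = 0 := by
    rw [derT_tmul, Derivation.map_one_eq_zero, TensorProduct.zero_tmul]
  have hg0 : glMap (seriesAtZero K R) g = 1 := by
    refine Units.ext ?_
    rw [coe_glMap, hg]
    ext i j
    simp [seriesAtZero_apply, Matrix.one_apply]
  -- At `t = 0` the matrix is the identity and the conjugated field is `ξ`. The comparison goes
  -- through `adjVec`, for which compatibility with changes of rings is known.
  have hconj : (fun i => MvPowerSeries.map ((seriesAtZero K R : PowerSeries R →ₐ[K] R) :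
      PowerSeries R →+* R) (conjVec g u i)) = ξ := by
    have h1 := adjVec_eq g u
    have h2 : ∀ i, MvPowerSeries.map ((seriesAtZero K R : PowerSeries R →ₐ[K] R) :
      PowerSeries R →+* R) (u i) = ξ i := by
      intro i
      ext s
      simp [hu, seriesAtZero_apply]
    funext i
    have h3 := map_adjVec ((seriesAtZero K R : PowerSeries R →ₐ[K] R) :
      PowerSeries R →+* R) (g : Matrix (Fin n) (Fin n) (PowerSeries R)) u i
    have h4 : (g : Matrix (Fin n) (Fin n) (PowerSeries R)).map
        ((seriesAtZero K R : PowerSeries R →ₐ[K] R) : PowerSeries R →+* R) = 1 :=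
      congrArg Units.val hg0
    have h5 : seriesAtZero K R (g : Matrix (Fin n) (Fin n) (PowerSeries R)).det = 1 := by
      have := RingHom.map_det ((seriesAtZero K R : PowerSeries R →ₐ[K] R) :
        PowerSeries R →+* R) (g : Matrix (Fin n) (Fin n) (PowerSeries R))
      rw [RingHom.mapMatrix_apply, h4, Matrix.det_one] at this
      exact this
    rw [h4, adjVec_one, h1, Pi.smul_apply, map_smul_PS] at h3
    simp only [h2] at h3
    rw [← h3]
    have h6 : ((seriesAtZero K R : PowerSeries R →ₐ[K] R) : PowerSeries R →+* R)
        (g : Matrix (Fin n) (Fin n) (PowerSeries R)).det = 1 := h5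
    rw [h6, one_smul]
  have key : σ.act g⁻¹ (lieAct K W (conjVec g u) (σ.act g ((1 : PowerSeries R) ⊗ₜ[K] w))) =
      lieAct K W u ((1 : PowerSeries R) ⊗ₜ[K] w) := by
    refine eq_of_derT_eq_zero ?_ ?_ ?_
    · rw [hσ.derT_conj h g _ hu1 hud, e0, map_zero, map_zero, map_zero]
    · rw [derT_lieAct h, e0, map_zero, add_zero]
      have : (fun i => coeffDer (seriesDer K R) (u i)) = 0 := funext hud
      rw [this, lieAct_zero h, LinearMap.zero_apply]
    · rw [GLForm.extMap_act, map_inv, hg0, inv_one, hσ.act_one, lieAct_natural h, hconj,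
        GLForm.extMap_act, hg0, hσ.act_one, lieAct_natural h]
      congr 2
  rw [← key, hσ.act_inv]

/-- The straight path `1 + t(M - 1)` is invertible over `R[[t]]`, where the path argument applies.
Cleared of denominators, the identity has coefficients in `R[t]`, which embeds into `R[[t]]`; there
`t = 1` may be substituted, and this recovers `M`. -/
theorem GLForm.Integrates.polyAct_lieAct [CharZero K] (M : Matrix (Fin n) (Fin n) R)
    {ξ : Fin n → PS n R} (hξ : ∀ i, ξ i ∈ ordIdeal n R 1) (t : R ⊗[K] W) :
    M.det • σ.polyAct M (lieAct K W ξ t) = lieAct K W (adjVec M ξ) (σ.polyAct M t) := by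
  refine semilinear_ext (F := (M.det • (σ.polyAct M * lieAct K W ξ)).toAddMonoidHom)
    (G := (lieAct K W (adjVec M ξ) * σ.polyAct M).toAddMonoidHom)
    (fun r t => map_smul (M.det • (σ.polyAct M * lieAct K W ξ)) r t)
    (fun r t => map_smul (lieAct K W (adjVec M ξ) * σ.polyAct M) r t) (fun w => ?_) t
  change M.det • σ.polyAct M (lieAct K W ξ (1 ⊗ₜ w)) =
    lieAct K W (adjVec M ξ) (σ.polyAct M (1 ⊗ₜ w))
  let Q : Matrix (Fin n) (Fin n) (Polynomial R) :=
    1 + (M - 1).map fun r => Polynomial.X * Polynomial.C r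
  let uP : Fin n → PS n (Polynomial R) := fun i => MvPowerSeries.map Polynomial.C (ξ i)
  have hQ1 : Q.map (polyEval K R 1) = M := by
    ext i j
    simp [Q, polyEval_apply, Matrix.one_apply]
  have key : Q.det • σ.polyAct Q (lieAct K W uP (1 ⊗ₜ w)) =
      lieAct K W (adjVec Q uP) (σ.polyAct Q (1 ⊗ₜ w)) := by
    have hdet : IsUnit (Q.map (polyToSeries K R)).det := by
      rw [PowerSeries.isUnit_iff_constantCoeff]
      have h1 := RingHom.map_det (PowerSeries.constantCoeff (R := R)) (Q.map (polyToSeries K R))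
      have h2 : (PowerSeries.constantCoeff (R := R)).mapMatrix (Q.map (polyToSeries K R)) = 1 := by
        ext i j
        simp [Q, polyToSeries_apply, Matrix.one_apply]
        split_ifs <;> simp
      rw [h1, h2, Matrix.det_one]
      exact isUnit_one
    obtain ⟨g, hg⟩ : ∃ g : GL (Fin n) (PowerSeries R),
        (g : Matrix (Fin n) (Fin n) (PowerSeries R)) = Q.map (polyToSeries K R) :=
      ⟨Matrix.GeneralLinearGroup.mk'' _ hdet, rfl⟩
    refine extMap_injective polyToSeries_injective ?_
    have h1 : (fun i => MvPowerSeries.map ((polyToSeries K R : Polynomial R →ₐ[K] _) :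
        Polynomial R →+* PowerSeries R) (uP i)) =
        fun i => MvPowerSeries.map PowerSeries.C (ξ i) := by
      funext i
      ext1 s
      simp [uP, polyToSeries_apply]
    have h2 : (fun i => MvPowerSeries.map ((polyToSeries K R : Polynomial R →ₐ[K] _) :
        Polynomial R →+* PowerSeries R) (adjVec Q uP i)) =
        (g : Matrix (Fin n) (Fin n) (PowerSeries R)).det •
          conjVec g fun i => MvPowerSeries.map PowerSeries.C (ξ i) := by
      rw [← adjVec_eq, ← h1]
      funext i
      rw [map_adjVec, hg]
      rfl
    have h3 : polyToSeries K R Q.det = (g : Matrix (Fin n) (Fin n) (PowerSeries R)).det := by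
      rw [hg, AlgHom.map_det]
      rfl
    have h4 : extMap W (polyToSeries K R) ((1 : Polynomial R) ⊗ₜ[K] w) =
        (1 : PowerSeries R) ⊗ₜ[K] w := by
      rw [TensorProduct.map_tmul]
      simp
    rw [extMap_smul, h3, GLForm.extMap_polyAct, lieAct_natural h, lieAct_natural h,
      GLForm.extMap_polyAct, h1, h2, ← hg, h4, GLForm.polyAct_eq, GLForm.polyAct_eq,
      hσ.act_lieAct_path h (M - 1) g (by
        rw [hg]
        ext1 i j
        simp [Q, polyToSeries_apply, Matrix.one_apply]
        split_ifs <;> simp [mul_comm]) hξ, lieAct_smul h, LinearMap.smul_apply, map_smul]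
  have e := congrArg (extMap W (polyEval K R 1)) key
  have h1 : (fun i => MvPowerSeries.map ((polyEval K R 1 : Polynomial R →ₐ[K] R) :
      Polynomial R →+* R) (uP i)) = ξ := by
    funext i
    ext s
    simp [uP, polyEval_apply]
  have h2 : (fun i => MvPowerSeries.map ((polyEval K R 1 : Polynomial R →ₐ[K] R) :
      Polynomial R →+* R) (adjVec Q uP i)) = adjVec M ξ := by
    funext i
    rw [map_adjVec]
    exact congrFun (congrArg₂ adjVec hQ1 h1) i
  have h3 : polyEval K R 1 Q.det = M.det := by
    rw [AlgHom.map_det]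
    exact congrArg Matrix.det hQ1
  have h4 : extMap W (polyEval K R 1) ((1 : Polynomial R) ⊗ₜ[K] w) = (1 : R) ⊗ₜ[K] w := by
    rw [TensorProduct.map_tmul]
    simp
  rwa [extMap_smul, h3, GLForm.extMap_polyAct, lieAct_natural h, lieAct_natural h,
      GLForm.extMap_polyAct, h1, h2, hQ1, h4] at e

/-- The representation of `GL_n` is compatible with the adjoint action on `L̂₊`. -/
theorem GLForm.Integrates.act_lieAct [CharZero K] (g : GL (Fin n) R)
    {ξ : Fin n → PS n R} (hξ : ∀ i, ξ i ∈ ordIdeal n R 1) (t : R ⊗[K] W) :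
    σ.act g (lieAct K W ξ t) = lieAct K W (conjVec g ξ) (σ.act g t) := by
  have e := hσ.polyAct_lieAct h (g : Matrix (Fin n) (Fin n) R) hξ t
  rw [adjVec_eq, GLForm.polyAct_eq, GLForm.polyAct_eq, lieAct_smul h, LinearMap.smul_apply,
    map_smul] at e
  have hu : IsUnit (g : Matrix (Fin n) (Fin n) R).det :=
    ⟨Matrix.GeneralLinearGroup.det g, rfl⟩
  exact (hu.pow σ.pole).smul_left_cancel.mp (hu.smul_left_cancel.mp e)

theorem GLForm.Integrates.act_totalAct [CharZero K] (g : GL (Fin n) R) (δ : Derivation K R R)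
    {ξ : Fin n → PS n R} (hξ : ∀ i, ξ i ∈ ordIdeal n R 1) (t : R ⊗[K] W) :
    σ.act g (totalAct W δ ξ t) = totalAct W δ (conjVec g ξ -
      linVec ((g : Matrix (Fin n) (Fin n) R).map δ *
        ((g⁻¹ : GL (Fin n) R) : Matrix (Fin n) (Fin n) R))) (σ.act g t) := by
  have hi : Infinite K := inferInstance
  rw [totalAct_apply, totalAct_apply, map_add, hσ.act_lieAct h g hξ, hσ.derT_act h, lieAct_sub h,
    LinearMap.sub_apply]
  abel

/-- If the automorphism `exp(v) ∘ g` intertwines two operators `δ + ξ` and `δ + ξ'` on power series,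
then its action on `R ⊗ W` intertwines the actions of these operators. -/
theorem GLForm.Integrates.autAct_totalAct [CharZero K] (hN : 0 < N) (g : GL (Fin n) R)
    {v : Fin n → PS n R} (hv : ∀ i, v i ∈ ordIdeal n R 2) (δ : Derivation K R R)
    {ξ ξ' : Fin n → PS n R} (hξ : ∀ i, ξ i ∈ ordIdeal n R 1)
    (hconj : ∀ f, autEquiv K g hv (totalDer δ ξ f) = totalDer δ ξ' (autEquiv K g hv f))
    (t : R ⊗[K] W) :
    autAct σ g v (totalAct W δ ξ t) = totalAct W δ ξ' (autAct σ g v t) := by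
  change expEnd K (lieAct K W v) (σ.act g _) = totalAct W δ ξ' (expEnd K (lieAct K W v) _)
  rw [hσ.act_totalAct h g δ hξ]
  refine expEnd_totalAct h hN hv (fun i => sub_mem (conjVec_mem g hξ i) (linVec_mem _ i)) ?_ _
  intro f
  -- Every series has the form `g f`, so the relation for `exp(v) ∘ g` and that for `g` give the
  -- relation for `exp(v)` alone.
  obtain ⟨f, rfl⟩ := (linEquiv g).surjective f
  exact (congrArg (expSeries K v) (linHom_totalDer g δ ξ f).symm).trans (hconj f)

end Adjoint


/-! ### Naturality and invertibility of the action of automorphisms -/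

section ExpNatural

variable {n : ℕ} {K : Type u} [Field K] {W : Type u} [AddCommGroup W] [Module K W]
  [LieRingModule (Lplus n K) W] [LieModule K (Lplus n K) W]
  {σ : GLForm n K W} {R R' : Type u} [CommRing R] [Algebra K R] [CommRing R'] [Algebra K R']
  {N : ℕ} (h : IsDegreeBound (n := n) (K := K) W N)

theorem map_mem_ordIdeal (f : R →+* R') {x : PS n R} {k : ℕ} (hx : x ∈ ordIdeal n R k) :
    MvPowerSeries.map f x ∈ ordIdeal n R' k := fun s hs => by
  rw [MvPowerSeries.coeff_map, hx s hs, map_zero]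

include h

theorem extMap_expEnd (hN : 0 < N) (f : R →ₐ[K] R') {v : Fin n → PS n R}
    (hv : ∀ i, v i ∈ ordIdeal n R 2) (t : R ⊗[K] W) :
    extMap W f (expEnd K (lieAct K W v) t) =
      expEnd K (lieAct K W fun i => MvPowerSeries.map (f : R →+* R') (v i)) (extMap W f t) := by
  rw [expEnd_lieAct_apply h hN hv le_rfl, expEnd_lieAct_apply h hN
    (fun i => map_mem_ordIdeal (f : R →+* R') (hv i)) le_rfl, expSum, expSum,
    LinearMap.sum_apply, LinearMap.sum_apply, map_sum]
  refine Finset.sum_congr rfl fun k _ => ?_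
  have hk : extMap W f ((lieActK K W v ^ k) t) =
      (lieActK K W (fun i => MvPowerSeries.map (f : R →+* R') (v i)) ^ k) (extMap W f t) := by
    clear * - h
    induction k with
    | zero => rfl
    | succ k ih =>
      rw [pow_succ', pow_succ', Module.End.mul_apply, Module.End.mul_apply, ← ih]
      exact lieAct_natural h f v _
  rw [LinearMap.smul_apply, LinearMap.smul_apply, map_smul, hk]

theorem extMap_autAct (hN : 0 < N) (f : R →ₐ[K] R') (g : GL (Fin n) R) {v : Fin n → PS n R}
    (hv : ∀ i, v i ∈ ordIdeal n R 2) (t : R ⊗[K] W) :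
    extMap W f (autAct σ g v t) = autAct σ (glMap f g)
      (fun i => MvPowerSeries.map (f : R →+* R') (v i)) (extMap W f t) := by
  change extMap W f (expEnd K (lieAct K W v) (σ.act g t)) = expEnd K _ (σ.act _ _)
  rw [extMap_expEnd h hN f hv, GLForm.extMap_act]

theorem expEnd_zero (hN : 0 < N) (t : R ⊗[K] W) :
    expEnd K (lieAct K W (0 : Fin n → PS n R)) t = t := by
  rw [expEnd_lieAct_apply h hN (v := 0) (fun i => zero_mem _) le_rfl, expSum, LinearMap.sum_apply,
    Finset.sum_eq_single 0]
  · simp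
  · intro k _ hk
    have : lieActK K W (0 : Fin n → PS n R) = 0 := by
      rw [lieActK, lieAct_zero h]
      rfl
    rw [this, zero_pow hk, smul_zero, LinearMap.zero_apply]
  · intro h0
    simp at h0
    omega

theorem expEnd_neg [CharZero K] (hN : 0 < N) {v : Fin n → PS n R}
    (hv : ∀ i, v i ∈ ordIdeal n R 2) (t : R ⊗[K] W) :
    expEnd K (lieAct K W v) (expEnd K (lieAct K W (-v)) t) = t := by
  have h1 := expSum_mul_neg_sub_mem (K := K) ⊥ (lieActK K W v) N hN (fun c i hi => by
    rw [lieActK, restrictScalars_pow, lieActK_pow_eq_zero h hN hv hi]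
    exact smul_zero c)
  have h2 : lieActK K W (-v) = -lieActK K W v := by
    have e := lieAct_smul h (-1 : R) v
    rw [neg_one_smul] at e
    refine LinearMap.ext fun x => ?_
    change lieAct K W (-v) x = -lieAct K W v x
    rw [e, LinearMap.smul_apply, neg_one_smul]
  rw [expEnd_lieAct_apply h hN hv le_rfl, expEnd_lieAct_apply h hN (neg_mem_ordIdeal hv) le_rfl, h2,
    ← Module.End.mul_apply]
  have h3 := DFunLike.congr_fun (AddSubgroup.mem_bot.mp h1) t
  rw [LinearMap.sub_apply, Module.End.one_apply, LinearMap.zero_apply] at h3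
  exact (sub_eq_zero.mp h3).symm

theorem GLForm.Integrates.autAct_zero [CharZero K] (hN : 0 < N) (g : GL (Fin n) R)
    (t : R ⊗[K] W) : autAct σ g 0 t = σ.act g t :=
  expEnd_zero h hN _

theorem GLForm.Integrates.exists_autAct_inv [CharZero K] (hσ : σ.Integrates) (hN : 0 < N)
    (g : GL (Fin n) R) {v : Fin n → PS n R} (hv : ∀ i, v i ∈ ordIdeal n R 2) :
    ∃ B : Module.End R (R ⊗[K] W), (∀ t, B (autAct σ g v t) = t) ∧ ∀ t, autAct σ g v (B t) = t := by
  refine ⟨σ.act g⁻¹ * expEnd K (lieAct K W (-v)), fun t => ?_, fun t => ?_⟩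
  · have e := expEnd_neg h hN (neg_mem_ordIdeal hv) (σ.act g t)
    rw [neg_neg] at e
    change σ.act g⁻¹ (expEnd K (lieAct K W (-v)) (expEnd K (lieAct K W v) (σ.act g t))) = t
    rw [e, hσ.inv_act]
  · change expEnd K (lieAct K W v) (σ.act g (σ.act g⁻¹ (expEnd K (lieAct K W (-v)) t))) = t
    rw [hσ.act_inv, expEnd_neg h hN hv]

end ExpNatural

/-! ### Dilations and the deformation of an automorphism to its linear part -/

section Scaling

variable {n : ℕ} {R : Type u} [CommRing R]

/-- The series `f(tX)`. -/
def scaleSeries : PS n R →+* PS n (Polynomial R) :=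
  (MvPowerSeries.rescale fun _ => Polynomial.X).comp (MvPowerSeries.map Polynomial.C)

theorem coeff_scaleSeries (f : PS n R) (s : Fin n →₀ ℕ) :
    MvPowerSeries.coeff s (scaleSeries f) =
      Polynomial.X ^ s.degree * Polynomial.C (MvPowerSeries.coeff s f) := by
  rw [scaleSeries, RingHom.comp_apply, MvPowerSeries.coeff_rescale, MvPowerSeries.coeff_map]
  congr 1
  rw [Finsupp.prod, Finset.prod_pow_eq_pow_sum]
  rfl

theorem scaleSeries_X (i : Fin n) : scaleSeries (MvPowerSeries.X i : PS n R) =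
    (Polynomial.X : Polynomial R) • (MvPowerSeries.X i : PS n (Polynomial R)) := by
  classical
  ext1 s
  rw [coeff_scaleSeries, MvPowerSeries.coeff_X]
  change _ = Polynomial.X * MvPowerSeries.coeff s (MvPowerSeries.X i : PS n (Polynomial R))
  rw [MvPowerSeries.coeff_X]
  split_ifs with hs
  · subst hs
    simp
  · simp

theorem scaleSeries_C (r : R) : scaleSeries (MvPowerSeries.C r : PS n R) =
    MvPowerSeries.C (Polynomial.C r) := by
  classical
  ext1 s
  rw [coeff_scaleSeries, MvPowerSeries.coeff_C, MvPowerSeries.coeff_C]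
  split_ifs with hs
  · subst hs
    simp
  · simp

/-- The vector field `t⁻¹ v(tX)`, for a vector field `v` vanishing at `0`. -/
def scaleVec (v : Fin n → PS n R) (i : Fin n) : PS n (Polynomial R) :=
  psMk fun s => Polynomial.X ^ (s.degree - 1) * Polynomial.C (MvPowerSeries.coeff s (v i))

theorem scaleVec_eval_one (v : Fin n → PS n R) (i : Fin n) :
    MvPowerSeries.map (Polynomial.evalRingHom 1) (scaleVec v i) = v i := by
  ext s
  rw [MvPowerSeries.coeff_map, scaleVec, coeff_psMk]
  simp

theorem scaleVec_eval_zero {v : Fin n → PS n R} (hv : ∀ i, v i ∈ ordIdeal n R 2) (i : Fin n) :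
    MvPowerSeries.map (Polynomial.evalRingHom 0) (scaleVec v i) = 0 := by
  ext s
  rw [MvPowerSeries.coeff_map, scaleVec, coeff_psMk]
  by_cases hs : s.degree < 2
  · rw [hv i s hs]
    simp
  · have : s.degree - 1 ≠ 0 := by omega
    simp [this]

theorem scaleVec_mem {v : Fin n → PS n R} {k : ℕ} (hv : ∀ i, v i ∈ ordIdeal n R k) (i : Fin n) :
    scaleVec v i ∈ ordIdeal n (Polynomial R) k := fun s hs => by
  rw [scaleVec, coeff_psMk, hv i s hs, map_zero, mul_zero]

theorem smul_scaleVec {v : Fin n → PS n R} (hv : ∀ i, v i ∈ ordIdeal n R 1) (i : Fin n) :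
    (Polynomial.X : Polynomial R) • scaleVec v i = scaleSeries (v i) := by
  ext1 s
  rw [coeff_scaleSeries]
  change Polynomial.X * (Polynomial.X ^ (s.degree - 1) *
    Polynomial.C (MvPowerSeries.coeff s (v i))) = _
  by_cases hs : s.degree = 0
  · rw [hv i s (by omega), map_zero, mul_zero, mul_zero, mul_zero]
  · rw [← mul_assoc, ← pow_succ', Nat.sub_add_cancel (by omega)]

theorem scaleSeries_vecField {v : Fin n → PS n R} (hv : ∀ i, v i ∈ ordIdeal n R 1) (f : PS n R) :
    scaleSeries (vecField v f) = vecField (scaleVec v) (scaleSeries f) := by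
  let D : PS n R →+ PS n (Polynomial R) := AddMonoidHom.mk' (fun x =>
    scaleSeries (vecField v x) - vecField (scaleVec v) (scaleSeries x)) fun a b => by
      simp only [map_add]
      abel
  have hD : ∀ x, D x = scaleSeries (vecField v x) - vecField (scaleVec v) (scaleSeries x) :=
    fun _ => rfl
  have h : D = 0 := eq_zero_of_semilinear D (fun k => scaleSeries (MvPowerSeries.X k))
    (fun k => by rw [scaleSeries_X]; exact smul_mem_ordIdeal _ (X_mem_ordIdeal k))
    (fun r => by
      rw [hD, vecField_C, map_zero, scaleSeries_C, vecField_C, sub_zero]) (fun k x => by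
      rw [hD, hD, Derivation.leibniz, map_mul, Derivation.leibniz, vecField_X, scaleSeries_X,
        Derivation.map_smul, vecField_X, smul_scaleVec hv]
      simp only [smul_eq_mul, map_add, map_mul, scaleSeries_X]
      ring)
  exact sub_eq_zero.mp (DFunLike.congr_fun h f)

theorem scaleSeries_linHom (g : Matrix (Fin n) (Fin n) R) (f : PS n R) :
    scaleSeries (linHom g f) = linHom (g.map Polynomial.C) (scaleSeries f) := by
  let D : PS n R →+ PS n (Polynomial R) := AddMonoidHom.mk' (fun x =>
    scaleSeries (linHom g x) - linHom (g.map Polynomial.C) (scaleSeries x)) fun a b => by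
      simp only [map_add]
      abel
  have hD : ∀ x, D x = scaleSeries (linHom g x) - linHom (g.map Polynomial.C) (scaleSeries x) :=
    fun _ => rfl
  have hX : ∀ k, scaleSeries (linHom g (MvPowerSeries.X k)) =
      linHom (g.map Polynomial.C) (scaleSeries (MvPowerSeries.X k)) := by
    intro k
    have e : ∀ (r : R) (x : PS n R), scaleSeries (r • x) = Polynomial.C r • scaleSeries x := by
      intro r x
      rw [MvPowerSeries.smul_eq_C_mul, map_mul, scaleSeries_C, ← MvPowerSeries.smul_eq_C_mul]
    rw [linHom_X, map_sum, scaleSeries_X, map_smul, linHom_X, Finset.smul_sum]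
    refine Finset.sum_congr rfl fun j _ => ?_
    rw [e, scaleSeries_X, smul_comm]
    rfl
  have h : D = 0 := eq_zero_of_semilinear D
    (fun k => linHom (g.map Polynomial.C) (scaleSeries (MvPowerSeries.X k)))
    (fun k => by
      rw [scaleSeries_X, map_smul]
      exact smul_mem_ordIdeal _ (linHom_X_mem _ k))
    (fun r => by rw [hD, linHom_C, scaleSeries_C, linHom_C, sub_self]) (fun k x => by
      rw [hD, hD, map_mul, map_mul, map_mul, map_mul, hX]
      ring)
  exact sub_eq_zero.mp (DFunLike.congr_fun h f)

variable {K : Type u} [Field K] [Algebra K R]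

theorem scaleSeries_expSeries {v : Fin n → PS n R} (hv : ∀ i, v i ∈ ordIdeal n R 1) (f : PS n R) :
    scaleSeries (expSeries K v f) = expSeries K (scaleVec v) (scaleSeries f) := by
  have h : ∀ k, scaleSeries ((vecField v)^[k] f) = (vecField (scaleVec v))^[k] (scaleSeries f) := by
    intro k
    induction k with
    | zero => rfl
    | succ k ih =>
      rw [Function.iterate_succ_apply', Function.iterate_succ_apply', scaleSeries_vecField hv, ih]
  ext1 s
  rw [coeff_scaleSeries, coeff_expSeries, coeff_expSeries, map_sum, Finset.mul_sum]
  refine Finset.sum_congr rfl fun k _ => ?_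
  rw [← h, coeff_scaleSeries, ← mul_smul_comm]
  congr 1
  rw [Algebra.smul_def, map_mul, Algebra.smul_def]
  rfl

/-- Conjugation by the dilation X ↦ tX replaces `v` by t⁻¹v(tX), which is polynomial in `t` and
vanishes at `t = 0` because `v` has order two, and it leaves the linear part unchanged. So the
automorphism is joined to its linear part inside automorphisms over `R[t]`. -/
theorem scaleSeries_autEquiv [CharZero K] (g : GL (Fin n) R) {v : Fin n → PS n R}
    (hv : ∀ i, v i ∈ ordIdeal n R 2) (f : PS n R) :
    scaleSeries (autEquiv K g hv f) =
      autEquiv K (Matrix.GeneralLinearGroup.map Polynomial.C g) (scaleVec_mem hv)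
        (scaleSeries f) := by
  rw [autEquiv_apply, autEquiv_apply,
    scaleSeries_expSeries (fun i => ordIdeal_mono (by norm_num) (hv i)), scaleSeries_linHom]
  rfl

theorem autEquiv_X_mem [CharZero K] (g : GL (Fin n) R) {v : Fin n → PS n R}
    (hv : ∀ i, v i ∈ ordIdeal n R 2) (i : Fin n) :
    autEquiv K g hv (MvPowerSeries.X i) ∈ ordIdeal n R 1 :=
  algHom_mem_ordIdeal (expHom_X_mem K hv) (linHom_X_mem (g : Matrix (Fin n) (Fin n) R) i)

theorem autEquiv_mem [CharZero K] (g : GL (Fin n) R) {v : Fin n → PS n R}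
    (hv : ∀ i, v i ∈ ordIdeal n R 2) {k : ℕ} {f : PS n R} (hf : f ∈ ordIdeal n R k) :
    autEquiv K g hv f ∈ ordIdeal n R k :=
  algHom_mem_ordIdeal (Φ := (autEquiv K g hv : PS n R →ₐ[R] PS n R)) (autEquiv_X_mem g hv) hf

theorem autEquiv_comp_ext [CharZero K] {g₁ g₂ g₃ : GL (Fin n) R}
    {v₁ v₂ v₃ : Fin n → PS n R} (h₁ : ∀ i, v₁ i ∈ ordIdeal n R 2)
    (h₂ : ∀ i, v₂ i ∈ ordIdeal n R 2) (h₃ : ∀ i, v₃ i ∈ ordIdeal n R 2)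
    (h : ∀ i, autEquiv K g₃ h₃ (MvPowerSeries.X i) =
      autEquiv K g₁ h₁ (autEquiv K g₂ h₂ (MvPowerSeries.X i))) (f : PS n R) :
    autEquiv K g₃ h₃ f = autEquiv K g₁ h₁ (autEquiv K g₂ h₂ f) :=
  DFunLike.congr_fun (algHom_ext_X (Φ := (autEquiv K g₃ h₃ : PS n R →ₐ[R] PS n R))
    (Ψ := ((autEquiv K g₁ h₁ : PS n R →ₐ[R] PS n R).comp (autEquiv K g₂ h₂ : PS n R →ₐ[R] PS n R)))
    (fun i => autEquiv_mem g₁ h₁ (autEquiv_X_mem g₂ h₂ i)) h) f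

theorem autEquiv_X_sub_mem [CharZero K] (g : GL (Fin n) R) {v : Fin n → PS n R}
    (hv : ∀ i, v i ∈ ordIdeal n R 2) (i : Fin n) :
    autEquiv K g hv (MvPowerSeries.X i) - linVec (g : Matrix (Fin n) (Fin n) R) i ∈
      ordIdeal n R 2 := by
  rw [(isFactorization_autEquiv (K := K) g hv).eq i, linVec, ← Finset.sum_sub_distrib]
  refine Ideal.sum_mem _ fun j _ => ?_
  rw [← smul_sub]
  exact smul_mem_ordIdeal _ (expSeries_X_sub_mem K hv j)

/-- The linear part of a composition of automorphisms. -/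
theorem linearPart_comp [CharZero K] {g₁ g₂ g₃ : GL (Fin n) R}
    {v₁ v₂ v₃ : Fin n → PS n R} (h₁ : ∀ i, v₁ i ∈ ordIdeal n R 2)
    (h₂ : ∀ i, v₂ i ∈ ordIdeal n R 2) (h₃ : ∀ i, v₃ i ∈ ordIdeal n R 2)
    (h : ∀ i, autEquiv K g₃ h₃ (MvPowerSeries.X i) =
      autEquiv K g₁ h₁ (autEquiv K g₂ h₂ (MvPowerSeries.X i))) : g₃ = g₁ * g₂ := by
  ext k i
  rw [← (isFactorization_autEquiv (K := K) g₃ h₃).coeff, h, Units.val_mul, Matrix.mul_apply]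
  have e1 := autEquiv_mem (K := K) g₁ h₁ (autEquiv_X_sub_mem (K := K) g₂ h₂ i)
  rw [map_sub] at e1
  rw [coeff_eq_of_sub_mem_ordIdeal e1 (by simp), linVec, map_sum, map_sum]
  refine Finset.sum_congr rfl fun j _ => ?_
  rw [map_smul, ← (isFactorization_autEquiv (K := K) g₁ h₁).coeff, mul_comm]
  rfl

theorem autEquiv_symm_X_mem [CharZero K] (g : GL (Fin n) R) {v : Fin n → PS n R}
    (hv : ∀ i, v i ∈ ordIdeal n R 2) (i : Fin n) :
    (autEquiv K g hv).symm (MvPowerSeries.X i) ∈ ordIdeal n R 1 :=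
  algHom_mem_ordIdeal (linHom_X_mem ((g⁻¹ : GL (Fin n) R) : Matrix (Fin n) (Fin n) R))
    (expHom_X_mem K (neg_mem_ordIdeal hv) i)

end Scaling

/-! ### Multiplicativity of the action of automorphisms -/

section Mult

variable {K : Type u} [Field K] {R : Type u} [CommRing R] [Algebra K R]
  {W : Type u} [AddCommGroup W] [Module K W]

theorem extMap_derT {R' : Type u} [CommRing R'] [Algebra K R'] (f : R →ₐ[K] R')
    {δ : Derivation K R R} {δ' : Derivation K R' R'} (hf : ∀ r, f (δ r) = δ' (f r))
    (t : R ⊗[K] W) : extMap W f (derT W δ t) = derT W δ' (extMap W f t) := by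
  induction t with
  | zero => simp
  | add a b ha hb => simp only [map_add, ha, hb]
  | tmul r w => simp [derT_tmul, hf]

variable (K R) in
/-- The derivation `d/dt` of `R[t]`. -/
def polyDer : Derivation K (Polynomial R) (Polynomial R) :=
  (Polynomial.derivative' : Derivation R (Polynomial R) (Polynomial R)).restrictScalars K

theorem eq_of_derT_polyDer_eq_zero [CharZero K] {x y : Polynomial R ⊗[K] W}
    (hx : derT W (polyDer K R) x = 0) (hy : derT W (polyDer K R) y = 0)
    (h : extMap W (polyEval K R 0) x = extMap W (polyEval K R 0) y) : x = y := by
  have hd : ∀ p, polyToSeries K R (polyDer K R p) = seriesDer K R (polyToSeries K R p) :=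
    fun p => (PowerSeries.derivative_coe p).symm
  refine extMap_injective polyToSeries_injective (eq_of_derT_eq_zero ?_ ?_ ?_)
  · rw [← extMap_derT _ hd, hx, map_zero]
  · rw [← extMap_derT _ hd, hy, map_zero]
  · have e : (seriesAtZero K R).comp (polyToSeries K R) = polyEval K R 0 := by
      refine AlgHom.ext fun p => ?_
      rw [AlgHom.comp_apply, seriesAtZero_apply, polyToSeries_apply, polyEval_apply,
        ← Polynomial.coeff_zero_eq_eval_zero, ← PowerSeries.coeff_zero_eq_constantCoeff_apply,
        Polynomial.coeff_coe]
    rw [extMap_comp, extMap_comp, e, h]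

variable {n : ℕ} [LieRingModule (Lplus n K) W] [LieModule K (Lplus n K) W]
  {σ : GLForm n K W} {N : ℕ} (h : IsDegreeBound (n := n) (K := K) W N) (hσ : σ.Integrates)

include h hσ

/-- The action of automorphisms of the algebra of power series on `R ⊗ W` is multiplicative. -/
theorem GLForm.Integrates.autAct_comp [CharZero K] (hN : 0 < N) {g₁ g₂ g₃ : GL (Fin n) R}
    {v₁ v₂ v₃ : Fin n → PS n R} (h₁ : ∀ i, v₁ i ∈ ordIdeal n R 2)
    (h₂ : ∀ i, v₂ i ∈ ordIdeal n R 2) (h₃ : ∀ i, v₃ i ∈ ordIdeal n R 2)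
    (hcomp : ∀ f, autEquiv K g₃ h₃ f = autEquiv K g₁ h₁ (autEquiv K g₂ h₂ f)) (t : R ⊗[K] W) :
    autAct σ g₃ v₃ t = autAct σ g₁ v₁ (autAct σ g₂ v₂ t) := by
  classical
  let ι : R →ₐ[K] Polynomial R := (Polynomial.CAlgHom (R := R) (A := R)).restrictScalars K
  have hi : Infinite K := inferInstance
  have hg : g₃ = g₁ * g₂ := linearPart_comp h₁ h₂ h₃ fun i => hcomp _
  let G₁ := glMap ι g₁
  let G₂ := glMap ι g₂
  let G₃ := glMap ι g₃
  have hG : ∀ (a : R) (g : GL (Fin n) R), glMap (polyEval K R a) (glMap ι g) = g := by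
    intro a g
    refine Units.ext ?_
    rw [coe_glMap, coe_glMap]
    ext i j
    change polyEval K R a (Polynomial.C _) = _
    rw [polyEval_apply, Polynomial.eval_C]
  have hev : ∀ a : R, ((polyEval K R a : Polynomial R →ₐ[K] R) : Polynomial R →+* R) =
      Polynomial.evalRingHom a := fun a => RingHom.ext fun p => polyEval_apply (K := K) a p
  have hev0 : ∀ {v : Fin n → PS n R}, (∀ i, v i ∈ ordIdeal n R 2) →
      (fun i => MvPowerSeries.map ((polyEval K R 0 : Polynomial R →ₐ[K] R) : Polynomial R →+* R)
        (scaleVec v i)) = 0 := fun hv => by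
    rw [hev]
    exact funext fun i => scaleVec_eval_zero hv i
  have hev1 : ∀ v : Fin n → PS n R,
      (fun i => MvPowerSeries.map ((polyEval K R 1 : Polynomial R →ₐ[K] R) : Polynomial R →+* R)
        (scaleVec v i)) = v := fun v => by
    rw [hev]
    exact funext fun i => scaleVec_eval_one v i
  have hS : ∀ f : PS n (Polynomial R), autEquiv K G₃ (scaleVec_mem h₃) f =
      autEquiv K G₁ (scaleVec_mem h₁) (autEquiv K G₂ (scaleVec_mem h₂) f) := by
    refine autEquiv_comp_ext _ _ _ fun i => ?_
    -- The dilation maps the variable to `t` times itself, so the dilated composition law appears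
    -- multiplied by `t`, which is a regular element and can be cancelled.
    have e1 := congrArg scaleSeries (hcomp (MvPowerSeries.X i))
    rw [scaleSeries_autEquiv, scaleSeries_autEquiv, scaleSeries_autEquiv, scaleSeries_X,
      map_smul, map_smul, map_smul] at e1
    ext1 s
    have e2 := congrArg (MvPowerSeries.coeff s) e1
    exact (Polynomial.isRegular_X (R := R)).left e2
  have hz : ∀ i, (0 : Fin n → PS n (Polynomial R)) i ∈ ordIdeal n (Polynomial R) 1 :=
    fun i => zero_mem _
  -- The derivation d/dt is carried by the second automorphism to d/dt + ξ, and this by the first to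
  -- d/dt + ζ. Hence the composite carries d/dt to d/dt + ζ directly.
  obtain ⟨ξ, hξ, hξ'⟩ := exists_conj_totalDer (autEquiv K G₂ (scaleVec_mem h₂))
    (autEquiv_X_mem _ _) (autEquiv_symm_X_mem _ _) (polyDer K R) hz
  obtain ⟨ζ, hζ, hζ'⟩ := exists_conj_totalDer (autEquiv K G₁ (scaleVec_mem h₁))
    (autEquiv_X_mem _ _) (autEquiv_symm_X_mem _ _) (polyDer K R) hξ
  obtain ⟨B₁, hB₁, hB₁'⟩ := hσ.exists_autAct_inv h hN G₁ (scaleVec_mem h₁)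
  obtain ⟨B₂, hB₂, hB₂'⟩ := hσ.exists_autAct_inv h hN G₂ (scaleVec_mem h₂)
  have hder : ∀ x, totalAct W (polyDer K R) (0 : Fin n → PS n (Polynomial R)) x =
      derT W (polyDer K R) x := by
    intro x
    rw [totalAct_apply, lieAct_zero h, LinearMap.zero_apply, add_zero]
  have key : ∀ w : W, autAct σ G₃ (scaleVec v₃) ((1 : Polynomial R) ⊗ₜ[K] w) =
      autAct σ G₁ (scaleVec v₁) (autAct σ G₂ (scaleVec v₂) ((1 : Polynomial R) ⊗ₜ[K] w)) := by
    intro w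
    have e0 : derT W (polyDer K R) ((1 : Polynomial R) ⊗ₜ[K] w) = 0 := by
      rw [derT_tmul, Derivation.map_one_eq_zero, TensorProduct.zero_tmul]
    have a1 := hσ.autAct_totalAct h hN G₁ (scaleVec_mem h₁) (polyDer K R) hξ hζ'
    have a2 := hσ.autAct_totalAct h hN G₂ (scaleVec_mem h₂) (polyDer K R) hz hξ'
    have a3 := hσ.autAct_totalAct h hN G₃ (scaleVec_mem h₃) (polyDer K R) (ξ' := ζ) hz
      (fun f => by rw [hS, hS, hξ', hζ']) ((1 : Polynomial R) ⊗ₜ[K] w)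
    rw [hder, e0, map_zero] at a3
    have b1 : ∀ y, totalAct W (polyDer K R) ξ (B₁ y) = B₁ (totalAct W (polyDer K R) ζ y) := by
      intro y
      rw [← hB₁ (totalAct W (polyDer K R) ξ (B₁ y)), a1, hB₁']
    have b2 : ∀ y, derT W (polyDer K R) (B₂ y) = B₂ (totalAct W (polyDer K R) ξ y) := by
      intro y
      rw [← hder, ← hB₂ (totalAct W (polyDer K R) 0 (B₂ y)), a2, hB₂']
    -- Undoing the two factors on the result of the composite gives a vector that is constant in
    -- `t`. At `t = 0` only linear parts remain, and multiplicativity on GL_n shows that it is `1 ⊗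
    -- w`.
    have b3 : B₂ (B₁ (autAct σ G₃ (scaleVec v₃) ((1 : Polynomial R) ⊗ₜ[K] w))) =
        (1 : Polynomial R) ⊗ₜ[K] w := by
      refine eq_of_derT_polyDer_eq_zero ?_ e0 ?_
      · rw [b2, b1, ← a3, map_zero, map_zero]
      · have c1 : autAct σ G₁ (scaleVec v₁) (autAct σ G₂ (scaleVec v₂)
            (B₂ (B₁ (autAct σ G₃ (scaleVec v₃) ((1 : Polynomial R) ⊗ₜ[K] w))))) =
            autAct σ G₃ (scaleVec v₃) ((1 : Polynomial R) ⊗ₜ[K] w) := by rw [hB₂', hB₁']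
        have c2 := congrArg (extMap W (polyEval K R 0)) c1
        rw [extMap_autAct h hN _ _ (scaleVec_mem h₁), extMap_autAct h hN _ _ (scaleVec_mem h₂),
          extMap_autAct h hN _ _ (scaleVec_mem h₃), hev0 h₁, hev0 h₂, hev0 h₃, hG, hG, hG,
          GLForm.Integrates.autAct_zero h hN, GLForm.Integrates.autAct_zero h hN,
          GLForm.Integrates.autAct_zero h hN, hg, hσ.act_mul] at c2
        have c3 := congrArg (fun x => σ.act g₂⁻¹ (σ.act g₁⁻¹ x)) c2
        simpa only [hσ.inv_act] using c3
    rw [← b3, hB₂', hB₁']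
    rw [b3]
  refine semilinear_ext (F := (autAct σ g₃ v₃).toAddMonoidHom)
    (G := (autAct σ g₁ v₁ * autAct σ g₂ v₂).toAddMonoidHom)
    (fun r t => map_smul (autAct σ g₃ v₃) r t)
    (fun r t => map_smul (autAct σ g₁ v₁ * autAct σ g₂ v₂) r t) (fun w => ?_) t
  -- At `t = 1` the dilated automorphisms become the given ones.
  have c := congrArg (extMap W (polyEval K R 1)) (key w)
  rw [extMap_autAct h hN _ _ (scaleVec_mem h₁), extMap_autAct h hN _ _ (scaleVec_mem h₂),
    extMap_autAct h hN _ _ (scaleVec_mem h₃), hev1, hev1, hev1, hG, hG, hG,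
    TensorProduct.map_tmul] at c
  simpa using c

end Mult


/-! ### The twist by the determinant -/

section TensorDet

variable {n : ℕ} {K : Type u} [Field K] {W : Type u} [AddCommGroup W] [Module K W]
  (σ : GLForm n K W) {R : Type u} [CommRing R] [Algebra K R]

instance : FiniteDimensional K (KTr n K) := inferInstanceAs (FiniteDimensional K K)

/-- The map `R ⊗ W → R ⊗ (W ⊗ W')`, `r ⊗ w ↦ r ⊗ (w ⊗ c)`. -/
def tmulRight (R : Type u) [CommRing R] [Algebra K R] {W' : Type u} [AddCommGroup W']
    [Module K W'] (c : W') : R ⊗[K] W →ₗ[R] R ⊗[K] (W ⊗[K] W') :=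
  ((TensorProduct.mk K W W').flip c).baseChange R

theorem tmulRight_tmul {W' : Type u} [AddCommGroup W'] [Module K W'] (c : W') (r : R) (w : W) :
    tmulRight R c (r ⊗ₜ[K] w) = r ⊗ₜ[K] (w ⊗ₜ[K] c) := rfl

theorem extMap_tmulRight {R' : Type u} [CommRing R'] [Algebra K R'] {W' : Type u}
    [AddCommGroup W'] [Module K W'] (f : R →ₐ[K] R') (c : W') (t : R ⊗[K] W) :
    extMap (W ⊗[K] W') f (tmulRight R c t) = tmulRight R' c (extMap W f t) := by
  induction t with
  | zero => simp
  | add a b ha hb => simp only [map_add, ha, hb]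
  | tmul r w => rfl

theorem coact_tensor_detForm (w : W) (c : KTr n K) :
    (σ.tensor detForm).coact (w ⊗ₜ[K] c) = (Matrix.mvPolynomialX (Fin n) (Fin n) K).det •
      tmulRight (MvPolynomial (Fin n × Fin n) K) c (σ.coact w) := by
  change TensorProduct.map (LinearMap.mul' K _) LinearMap.id
    (TensorProduct.tensorTensorTensorComm K _ W _ (KTr n K) (σ.coact w ⊗ₜ[K]
      ((Matrix.mvPolynomialX (Fin n) (Fin n) K).det ⊗ₜ[K] c))) = _
  induction σ.coact w with
  | zero => simp
  | add a b ha hb => rw [TensorProduct.add_tmul, map_add, map_add, ha, hb, map_add, smul_add]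
  | tmul p w =>
    rw [TensorProduct.tensorTensorTensorComm_tmul, TensorProduct.map_tmul, tmulRight_tmul,
      LinearMap.mul'_apply, TensorProduct.smul_tmul', smul_eq_mul, mul_comm]
    rfl

theorem tensor_detForm_polyAct (M : Matrix (Fin n) (Fin n) R) (w : W) (c : KTr n K) :
    (σ.tensor detForm).polyAct M ((1 : R) ⊗ₜ[K] (w ⊗ₜ[K] c)) =
      M.det • tmulRight R c (σ.polyAct M (1 ⊗ₜ[K] w)) := by
  have h : evalMat M (Matrix.mvPolynomialX (Fin n) (Fin n) K).det = M.det := by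
    rw [AlgHom.map_det]
    congr 1
    ext i j
    simp
  rw [GLForm.polyAct_tmul, GLForm.polyAct_tmul, coact_tensor_detForm, extMap_smul, h,
    extMap_tmulRight, one_smul, one_smul]

theorem tensor_detForm_act (g : GL (Fin n) R) (w : W) (c : KTr n K) :
    (σ.tensor detForm).act g ((1 : R) ⊗ₜ[K] (w ⊗ₜ[K] c)) =
      (g : Matrix (Fin n) (Fin n) R).det • tmulRight R c (σ.act g (1 ⊗ₜ[K] w)) := by
  rw [GLForm.act_apply, GLForm.act_apply, tensor_detForm_polyAct, map_smul, smul_comm]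
  rfl

theorem tensor_detForm_act_tmulRight (g : GL (Fin n) R) (t : R ⊗[K] W) (c : KTr n K) :
    (σ.tensor detForm).act g (tmulRight R c t) =
      (g : Matrix (Fin n) (Fin n) R).det • tmulRight R c (σ.act g t) :=
  semilinear_ext (F := ((σ.tensor detForm).act g ∘ₗ tmulRight R c).toAddMonoidHom)
    (G := ((g : Matrix (Fin n) (Fin n) R).det • (tmulRight R c ∘ₗ σ.act g)).toAddMonoidHom)
    (fun r t => map_smul ((σ.tensor detForm).act g ∘ₗ tmulRight R c) r t)
    (fun r t => map_smul ((g : Matrix (Fin n) (Fin n) R).det • (tmulRight R c ∘ₗ σ.act g)) r t)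
    (fun w => tensor_detForm_act σ g w c) t

theorem traceChar_glToLplus (M : Matrix (Fin n) (Fin n) K) :
    traceChar (glToLplus M) = M.trace := by
  classical
  have h : ∀ j i, traceChar (mono (unitExp j) i : Lplus n K) = if j = i then 1 else 0 := by
    intro j i
    change ∑ k : Fin n, MvPowerSeries.coeff (Finsupp.single k 1)
      ((mono (unitExp j) i : Lplus n K).1 (MvPowerSeries.X k)) = _
    rw [Finset.sum_eq_single i]
    · rw [mono_X, if_pos rfl, MvPowerSeries.coeff_monomial, unitExp]
      simp [Finsupp.single_left_inj, eq_comm]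
    · intro k _ hk
      rw [mono_X, if_neg hk.symm, map_zero]
    · simp
  rw [glToLplus, map_sum, Matrix.trace]
  refine Finset.sum_congr rfl fun j _ => ?_
  rw [map_sum, Finset.sum_eq_single j]
  · rw [map_smul, h, if_pos rfl]
    simp
  · intro i _ hi
    rw [map_smul, h, if_neg hi.symm, smul_zero]
  · simp

theorem end_ext_tmul {M : Type*} [AddCommGroup M] [Module R M] {W' : Type u} [AddCommGroup W']
    [Module K W'] {F G : R ⊗[K] (W ⊗[K] W') →ₗ[R] M}
    (h : ∀ (w : W) (c : W'), F (1 ⊗ₜ[K] (w ⊗ₜ[K] c)) = G (1 ⊗ₜ[K] (w ⊗ₜ[K] c))) : F = G := by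
  refine LinearMap.ext fun t => semilinear_ext (F := F.toAddMonoidHom) (G := G.toAddMonoidHom)
    (fun r t => map_smul F r t) (fun r t => map_smul G r t) (fun x => ?_) t
  change F (1 ⊗ₜ x) = G (1 ⊗ₜ x)
  induction x with
  | zero => simp
  | add a b ha hb => rw [TensorProduct.tmul_add, map_add, map_add, ha, hb]
  | tmul w c => exact h w c

open DualNumber in
/-- The twist of a rational `L̂₊`-module by the trace character is rational. -/
theorem GLForm.Integrates.tensor_detForm [LieRingModule (Lplus n K) W]
    [LieModule K (Lplus n K) W] {σ : GLForm n K W} (hσ : σ.Integrates) :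
    (σ.tensor (detForm (n := n) (K := K))).Integrates where
  one := by
    refine end_ext_tmul fun w c => ?_
    rw [tensor_detForm_act, hσ.one]
    simp [tmulRight_tmul]
  mul g h := by
    refine end_ext_tmul fun w c => ?_
    rw [Module.End.mul_apply, tensor_detForm_act, tensor_detForm_act, map_smul,
      tensor_detForm_act_tmulRight, hσ.mul, Units.val_mul, Matrix.det_mul, mul_smul,
      Module.End.mul_apply, smul_comm]
  deriv M g hg x := by
    -- Since ε² = 0, only the linear term of det(1 + εM) survives: the determinant character
    -- differentiates to the trace.
    have hdet : (g : Matrix (Fin n) (Fin n) K[ε]).det = 1 + algebraMap K K[ε] M.trace * ε := by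
      have h1 : M.map (fun a => a • (ε : K[ε])) = (ε : K[ε]) • M.map (algebraMap K K[ε]) := by
        refine Matrix.ext fun i j => ?_
        rw [Matrix.map_apply, Matrix.smul_apply, Matrix.map_apply, Algebra.smul_def, smul_eq_mul,
          mul_comm]
      rw [hg, h1, Matrix.det_one_add_smul]
      have h2 : (ε : K[ε]) ^ 2 = 0 := by rw [sq, DualNumber.eps_mul_eps]
      have h3 : (M.map (algebraMap K K[ε])).trace = algebraMap K K[ε] M.trace := by
        simp [Matrix.trace]
      rw [h2, mul_zero, add_zero, h3]
    induction x with
    | zero => simp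
    | add a b ha hb =>
      rw [TensorProduct.tmul_add, map_add, ha, hb, lie_add, TensorProduct.tmul_add]
      abel
    | tmul w c =>
      rw [tensor_detForm_act, hdet, hσ.deriv M g hg w, map_add, tmulRight_tmul, tmulRight_tmul,
        TensorProduct.LieModule.lie_tmul_right]
      have h4 : ⁅glToLplus M, c⁆ = M.trace • c := by
        rw [← traceChar_glToLplus]
        rfl
      rw [h4, TensorProduct.tmul_smul, TensorProduct.tmul_add, add_smul, one_smul, smul_add,
        TensorProduct.smul_tmul', TensorProduct.smul_tmul', smul_eq_mul, smul_eq_mul, mul_one,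
        mul_assoc, DualNumber.eps_mul_eps, mul_zero, TensorProduct.zero_tmul, add_zero,
        ← Algebra.smul_def, TensorProduct.tmul_smul, ← TensorProduct.smul_tmul']
      abel

end TensorDet


/-! ### Formal Taylor expansion for commuting derivations -/

section TaylorSeries

theorem prod_ofFn_pow_add_single {B : Type*} [Monoid B] {n : ℕ} (a : Fin n → B)
    (ha : ∀ i j, Commute (a i) (a j)) (s : Fin n → ℕ) (i : Fin n) :
    (List.ofFn fun j => a j ^ (s j + if j = i then 1 else 0)).prod =
      (List.ofFn fun j => a j ^ s j).prod * a i := by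
  induction n with
  | zero => exact i.elim0
  | succ n ih =>
    rw [List.ofFn_succ, List.ofFn_succ, List.prod_cons, List.prod_cons]
    refine Fin.cases ?_ (fun i => ?_) i
    · have h : Commute (a 0) (List.ofFn fun j : Fin n => a j.succ ^ s j.succ).prod := by
        refine Commute.list_prod_right _ _ fun y hy => ?_
        obtain ⟨j, rfl⟩ := (List.mem_ofFn' _ _).mp hy
        exact (ha _ _).pow_right _
      simp only [if_true, Fin.succ_ne_zero, if_false, add_zero, pow_succ]
      rw [mul_assoc, mul_assoc, h.eq]
    · have := ih (fun j => a j.succ) (fun _ _ => ha _ _) (fun j => s j.succ) i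
      simp only [Fin.succ_inj]
      rw [this, mul_assoc, if_neg (Fin.succ_ne_zero i).symm, add_zero]

variable {n : ℕ} {K : Type u} [Field K] {R : Type u} [CommRing R] [Algebra K R]

/-- The power series `F` lies in `I_{k+1}` if it has no constant term and its derivatives lie in
`I_k`. -/
theorem mem_ordIdeal_of_pderiv (K : Type u) [Field K] [CharZero K] [Algebra K R] {F : PS n R}
    {k : ℕ} (h0 : MvPowerSeries.constantCoeff F = 0)
    (h : ∀ i, MvPowerSeries.pderiv R i F ∈ ordIdeal n R k) : F ∈ ordIdeal n R (k + 1) := by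
  intro s hs
  by_cases hs0 : s = 0
  · subst hs0
    exact h0
  · obtain ⟨i, hi⟩ : ∃ i, s i ≠ 0 := by
      by_contra hcon
      push Not at hcon
      exact hs0 (Finsupp.ext hcon)
    have hle : Finsupp.single i 1 ≤ s := by simpa using Nat.one_le_iff_ne_zero.mpr hi
    have hss : s - Finsupp.single i 1 + Finsupp.single i 1 = s := tsub_add_cancel_of_le hle
    have hdeg : (s - Finsupp.single i 1).degree < k := by
      have := congrArg Finsupp.degree hss
      rw [map_add, Finsupp.degree_single] at this
      omega
    have h1 := h i _ hdeg
    rw [MvPowerSeries.coeff_pderiv, hss] at h1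
    have h2 : (((s - Finsupp.single i 1 : Fin n →₀ ℕ) i : R) + 1) =
        algebraMap K R (((s - Finsupp.single i 1 : Fin n →₀ ℕ) i : K) + 1) := by simp
    have h3 : IsUnit (((s - Finsupp.single i 1 : Fin n →₀ ℕ) i : R) + 1) := by
      rw [h2]
      exact (IsUnit.mk0 _ (Nat.cast_add_one_ne_zero _)).map _
    exact (h3.mul_left_eq_zero).mp h1

variable {d : Fin n → Derivation K R R}

theorem coeff_taylor (d : Fin n → Derivation K R R) (f : R) (s : Fin n →₀ ℕ) :
    MvPowerSeries.coeff s (taylor d f) = ((∏ i, (s i).factorial : ℕ) : K)⁻¹ •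
      (List.ofFn fun i => ((d i : R →ₗ[K] R) : Module.End K R) ^ s i).prod f := rfl

theorem constantCoeff_taylor (f : R) : MvPowerSeries.constantCoeff (taylor d f) = f := by
  rw [← MvPowerSeries.coeff_zero_eq_constantCoeff_apply, coeff_taylor]
  simp

theorem taylor_add (f g : R) : taylor d (f + g) = taylor d f + taylor d g := by
  ext s
  rw [map_add, coeff_taylor, coeff_taylor, coeff_taylor, map_add, smul_add]

/-- Taylor expansion, as an additive map. -/
def taylorHom (d : Fin n → Derivation K R R) : R →+ PS n R :=
  AddMonoidHom.mk' (taylor d) fun f g => taylor_add f g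

theorem taylor_sub (f g : R) : taylor d (f - g) = taylor d f - taylor d g :=
  map_sub (taylorHom d) f g

theorem taylor_zero : taylor d (0 : R) = 0 := map_zero (taylorHom d)

theorem taylor_smul (c : K) (f : R) : taylor d (c • f) = c • taylor d f := by
  ext s
  change MvPowerSeries.coeff s (taylor d (c • f)) = c • MvPowerSeries.coeff s (taylor d f)
  rw [coeff_taylor, coeff_taylor, map_smul, smul_comm]

theorem map_taylor {R' : Type u} [CommRing R'] [Algebra K R'] (φ : R →ₐ[K] R')
    {d' : Fin n → Derivation K R' R'} (h : ∀ i f, φ (d i f) = d' i (φ f)) (f : R) :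
    MvPowerSeries.map (φ : R →+* R') (taylor d f) = taylor d' (φ f) := by
  have h0 : ∀ (i : Fin n) (k : ℕ) (f : R), φ ((((d i : R →ₗ[K] R) : Module.End K R) ^ k) f) =
      (((d' i : R' →ₗ[K] R') : Module.End K R') ^ k) (φ f) := by
    intro i k f
    induction k with
    | zero => rfl
    | succ k ih =>
      rw [pow_succ', pow_succ', Module.End.mul_apply, Module.End.mul_apply, ← ih]
      exact h _ _
  have h1 : ∀ (L : List (Fin n × ℕ)) f, φ ((L.map fun p =>
      ((d p.1 : R →ₗ[K] R) : Module.End K R) ^ p.2).prod f) = (L.map fun p =>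
        ((d' p.1 : R' →ₗ[K] R') : Module.End K R') ^ p.2).prod (φ f) := by
    intro L
    induction L with
    | nil => intro f; rfl
    | cons p L ih =>
      intro f
      rw [List.map_cons, List.map_cons, List.prod_cons, List.prod_cons, Module.End.mul_apply,
        Module.End.mul_apply, ← ih, h0]
  ext s
  rw [MvPowerSeries.coeff_map, coeff_taylor, coeff_taylor]
  have h2 := h1 (List.ofFn fun i => (i, s i)) f
  rw [List.map_ofFn, List.map_ofFn] at h2
  exact (map_smul φ _ _).trans (congrArg _ h2)

variable (hd : ∀ i j f, d i (d j f) = d j (d i f))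

include hd

theorem commute_der (i j : Fin n) : Commute ((d i : R →ₗ[K] R) : Module.End K R)
    ((d j : R →ₗ[K] R) : Module.End K R) := LinearMap.ext fun f => hd i j f

theorem coeffDer_taylor (i : Fin n) (f : R) : coeffDer (d i) (taylor d f) = taylor d (d i f) := by
  ext s
  rw [coeff_coeffDer, coeff_taylor, coeff_taylor, Derivation.map_smul]
  congr 1
  have : Commute ((d i : R →ₗ[K] R) : Module.End K R)
      (List.ofFn fun j => ((d j : R →ₗ[K] R) : Module.End K R) ^ s j).prod := by
    refine Commute.list_prod_right _ _ fun y hy => ?_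
    obtain ⟨j, rfl⟩ := (List.mem_ofFn' _ _).mp hy
    exact (commute_der hd _ _).pow_right _
  exact LinearMap.congr_fun this.eq f

variable [CharZero K]

/-- The factor `s_i + 1` from differentiating the monomial turns the reciprocal of the factorial at
`s + e_i` into that at `s`. Together with `constantCoeff_taylor` this drives the inductions on the
order of a difference of Taylor series. -/
theorem pderiv_taylor (i : Fin n) (f : R) :
    MvPowerSeries.pderiv R i (taylor d f) = taylor d (d i f) := by
  ext s
  rw [MvPowerSeries.coeff_pderiv, coeff_taylor, coeff_taylor]
  have h1 := prod_ofFn_pow_add_single (fun j => ((d j : R →ₗ[K] R) : Module.End K R))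
    (commute_der hd) s i
  have h2 : ∀ j, (s + Finsupp.single i 1 : Fin n →₀ ℕ) j = s j + if j = i then 1 else 0 := fun j => by
    rw [Finsupp.add_apply, Finsupp.single_apply]
    simp [eq_comm]
  have h3 : ∏ j, ((s + Finsupp.single i 1 : Fin n →₀ ℕ) j).factorial = (s i + 1) * ∏ j, (s j).factorial := by
    rw [← Finset.mul_prod_erase _ _ (Finset.mem_univ i),
      ← Finset.mul_prod_erase _ (fun j => (s j).factorial) (Finset.mem_univ i), h2, if_pos rfl,
      Nat.factorial_succ, mul_assoc]
    congr 2
    refine Finset.prod_congr rfl fun j hj => ?_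
    rw [h2, if_neg (Finset.ne_of_mem_erase hj), add_zero]
  simp only [h2] at h3 ⊢
  rw [h1, h3, Module.End.mul_apply]
  have h4 : ((s i : R) + 1) = algebraMap K R ((s i : K) + 1) := by simp
  rw [h4, mul_comm, ← Algebra.smul_def, smul_smul]
  congr 1
  have h5 : ((s i : K) + 1) ≠ 0 := Nat.cast_add_one_ne_zero _
  push_cast
  rw [mul_inv, ← mul_assoc, mul_inv_cancel₀ h5, one_mul]

/-- The difference of the two sides has no constant term, and by the Leibniz rule its partial
derivatives are sums of differences of the same kind. Induction on the order shows that it is zero.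
-/
theorem taylor_mul (f g : R) : taylor d (f * g) = taylor d f * taylor d g := by
  have h : ∀ k, ∀ f g : R, taylor d (f * g) - taylor d f * taylor d g ∈ ordIdeal n R k := by
    intro k
    induction k with
    | zero => exact fun _ _ => mem_ordIdeal_zero _
    | succ k ih =>
      intro f g
      refine mem_ordIdeal_of_pderiv K ?_ fun i => ?_
      · rw [map_sub, map_mul, constantCoeff_taylor, constantCoeff_taylor, constantCoeff_taylor,
          sub_self]
      · rw [map_sub, Derivation.leibniz, pderiv_taylor hd, pderiv_taylor hd, pderiv_taylor hd,
          Derivation.leibniz, taylor_add, smul_eq_mul, smul_eq_mul, smul_eq_mul, smul_eq_mul]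
        have := add_mem (ih f (d i g)) (ih g (d i f))
        convert this using 1
        ring
  exact eq_of_sub_mem_ordIdeal fun k => h k f g

end TaylorSeries

/-! ### Local coordinates and coordinate changes -/

section Frames

variable {n : ℕ} {K : Type u} [Field K] {R : Type u} [CommRing R] [Algebra K R]

/-- `x₁, …, xₙ` are local coordinates with dual derivations `d₁, …, dₙ`, such that derivations are
determined by their values at the coordinates. -/
structure IsFrame (x : Fin n → R) (d : Fin n → Derivation K R R) : Prop where
  apply_x : ∀ i j, d i (x j) = if i = j then 1 else 0
  ext : ∀ δ δ' : Derivation K R R, (∀ i, δ (x i) = δ' (x i)) → δ = δ'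

/-- The expansion of the derivation `δ`, with the constant terms removed. -/
def frameVec (x : Fin n → R) (d : Fin n → Derivation K R R) (δ : Derivation K R R) (i : Fin n) :
    PS n R :=
  taylor d (δ (x i)) - MvPowerSeries.C (δ (x i))

/-- The images of the coordinates under the change of coordinates. -/
def frameChange (x : Fin n → R) (d' : Fin n → Derivation K R R) (i : Fin n) : PS n R :=
  taylor d' (x i) - MvPowerSeries.C (x i)

variable {x : Fin n → R} {d : Fin n → Derivation K R R}

theorem frameChange_apply (x : Fin n → R) (d' : Fin n → Derivation K R R) (i : Fin n) :
    frameChange x d' i = taylor d' (x i) - MvPowerSeries.C (x i) := rfl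

theorem frameVec_mem (δ : Derivation K R R) (i : Fin n) : frameVec x d δ i ∈ ordIdeal n R 1 := by
  rw [mem_ordIdeal_one, frameVec, map_sub, constantCoeff_taylor, MvPowerSeries.constantCoeff_C,
    sub_self]

theorem taylor_sum {ι : Type*} (s : Finset ι) (f : ι → R) :
    taylor d (∑ i ∈ s, f i) = ∑ i ∈ s, taylor d (f i) :=
  map_sum (taylorHom d) f s

theorem _root_.Derivation.sum_smul_apply (a : Fin n → R) (d : Fin n → Derivation K R R) (f : R) :
    (∑ i, a i • d i) f = ∑ i, a i * d i f := by
  have := congrFun (map_sum (Derivation.coeFnAddMonoidHom (R := K) (A := R) (M := R))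
    (fun i => a i • d i) Finset.univ) f
  rw [Finset.sum_apply] at this
  exact this

theorem autEquiv_frameChange_X [CharZero K] {g : GL (Fin n) R} {v : Fin n → PS n R}
    (hf : IsFactorization K (frameChange x d) g v) (i : Fin n) :
    autEquiv K g hf.mem_ordIdeal (MvPowerSeries.X i) = taylor d (x i) - MvPowerSeries.C (x i) :=
  autEquiv_X hf i

namespace IsFrame

variable (F : IsFrame x d)

include F

theorem eq_sum (δ : Derivation K R R) : δ = ∑ i, δ (x i) • d i := by
  refine F.ext _ _ fun j => ?_
  rw [Derivation.sum_smul_apply]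
  simp [F.apply_x]

theorem apply_eq_sum (δ : Derivation K R R) (f : R) : δ f = ∑ i, δ (x i) * d i f := by
  conv_lhs => rw [F.eq_sum δ]
  rw [Derivation.sum_smul_apply]

/-- The functions `d i (x k)` are constant, so the bracket kills all coordinates, and derivations
are determined there. -/
theorem lie_eq_zero (i j : Fin n) : ⁅d i, d j⁆ = 0 := by
  refine F.ext _ _ fun k => ?_
  rw [Derivation.commutator_apply, F.apply_x, F.apply_x]
  split_ifs <;> simp

theorem comm (i j : Fin n) (f : R) : d i (d j f) = d j (d i f) := by
  have := DFunLike.congr_fun (F.lie_eq_zero i j) f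
  rw [Derivation.commutator_apply] at this
  exact sub_eq_zero.mp this

variable [CharZero K]

/-- The series f(x + X) depends on x and X only through their sum. Moving x by δ(x) and X by the
difference of the values of δ(x) at x + X and at x moves the sum by the value at x + X, and so
produces the expansion of δf. The jet action is built on this identity. -/
theorem totalDer_taylor (δ : Derivation K R R) (f : R) :
    totalDer δ (frameVec x d δ) (taylor d f) = taylor d (δ f) := by
  have h1 : coeffDer δ (taylor d f) = ∑ i, MvPowerSeries.C (δ (x i)) * taylor d (d i f) := by
    ext s
    rw [coeff_coeffDer, F.apply_eq_sum δ, map_sum]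
    refine Finset.sum_congr rfl fun i _ => ?_
    rw [MvPowerSeries.coeff_C_mul, ← coeffDer_taylor F.comm, coeff_coeffDer]
  have h2 : taylor d (δ f) = ∑ i, taylor d (δ (x i)) * taylor d (d i f) := by
    rw [F.apply_eq_sum δ, taylor_sum]
    exact Finset.sum_congr rfl fun i _ => taylor_mul F.comm _ _
  rw [totalDer_apply, h1, vecField_apply, h2, ← Finset.sum_add_distrib]
  refine Finset.sum_congr rfl fun i _ => ?_
  rw [pderiv_taylor F.comm, frameVec]
  ring

variable {y : Fin n → R} {d' : Fin n → Derivation K R R} (F' : IsFrame y d')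

include F'

omit [CharZero K] in
/-- The Jacobian matrix of a change of coordinates is invertible. -/
theorem exists_jacobian : ∃ g : GL (Fin n) R, ∀ k i,
    (g : Matrix (Fin n) (Fin n) R) k i = d' k (x i) := by
  classical
  have h : ∀ {x y : Fin n → R} {d d' : Fin n → Derivation K R R}, IsFrame x d → IsFrame y d' →
      (Matrix.of fun k i => d' k (x i)) * (Matrix.of fun k i => d k (y i)) = 1 := by
    intro x y d d' F F'
    ext k j
    rw [Matrix.mul_apply, Matrix.one_apply, ← F'.apply_x, F.apply_eq_sum (d' k)]
    rfl
  exact ⟨⟨Matrix.of fun k i => d' k (x i), Matrix.of fun k i => d k (y i), h F F', h F' F⟩,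
    fun _ _ => rfl⟩

theorem exists_isFactorization :
    ∃ g v, IsFactorization K (frameChange x d') g v := by
  obtain ⟨g, hg⟩ := F.exists_jacobian F'
  have h1 : ∀ i, frameChange x d' i ∈ ordIdeal n R 1 := fun i => by
    rw [mem_ordIdeal_one, frameChange_apply, map_sub, constantCoeff_taylor,
      MvPowerSeries.constantCoeff_C, sub_self]
  obtain ⟨v, hv⟩ := AVMod.exists_isFactorization (K := K) h1 g fun i k => by
    classical
    have h2 := congrArg MvPowerSeries.constantCoeff (pderiv_taylor F'.comm k (x i))
    rw [constantCoeff_taylor, ← MvPowerSeries.coeff_zero_eq_constantCoeff_apply,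
      MvPowerSeries.coeff_pderiv] at h2
    rw [frameChange_apply, map_sub, MvPowerSeries.coeff_C, if_neg (by simp), sub_zero, hg, ← h2]
    simp
  exact ⟨g, v, hv⟩

variable {g : GL (Fin n) R} {v : Fin n → PS n R} (hf : IsFactorization K (frameChange x d') g v)

/-- The change of coordinates transforms Taylor series into each other. -/
theorem autEquiv_taylor (f : R) :
    autEquiv K g hf.mem_ordIdeal (taylor d f) = taylor d' f := by
  -- This is the chain rule for the substitution. The difference of the two sides is semilinear over
  -- the automorphism: for `X_j G`, the term where `X_j` is differentiated cancels the derivative of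
  -- the image of `X_j`.
  have chain : ∀ (k : Fin n) (G : PS n R), MvPowerSeries.pderiv R k
      (autEquiv K g hf.mem_ordIdeal G) = ∑ i, taylor d' (d' k (x i)) *
        autEquiv K g hf.mem_ordIdeal (MvPowerSeries.pderiv R i G) := by
    classical
    intro k G
    let D : PS n R →+ PS n R := AddMonoidHom.mk' (fun G => MvPowerSeries.pderiv R k
      (autEquiv K g hf.mem_ordIdeal G) - ∑ i, taylor d' (d' k (x i)) *
        autEquiv K g hf.mem_ordIdeal (MvPowerSeries.pderiv R i G)) fun a b => by
        simp only [map_add, mul_add, Finset.sum_add_distrib]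
        abel
    have hD : ∀ G, D G = MvPowerSeries.pderiv R k
      (autEquiv K g hf.mem_ordIdeal G) - ∑ i, taylor d' (d' k (x i)) *
        autEquiv K g hf.mem_ordIdeal (MvPowerSeries.pderiv R i G) := fun _ => rfl
    have hC : ∀ r, autEquiv K g hf.mem_ordIdeal (MvPowerSeries.C r : PS n R) =
        MvPowerSeries.C r := fun r => AlgEquiv.commutes _ r
    have h : D = 0 := eq_zero_of_semilinear D
      (fun k => autEquiv K g hf.mem_ordIdeal (MvPowerSeries.X k))
      (fun k => autEquiv_X_mem _ _ k)
      (fun r => by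
        rw [hD, hC]
        simp) (fun j G => by
        rw [hD, hD, map_mul, Derivation.leibniz, autEquiv_frameChange_X hf, map_sub,
          pderiv_taylor F'.comm, MvPowerSeries.pderiv_C, sub_zero, mul_sub, Finset.mul_sum]
        have e : ∀ i, taylor d' (d' k (x i)) * autEquiv K g hf.mem_ordIdeal
            (MvPowerSeries.pderiv R i (MvPowerSeries.X j * G)) =
            (if i = j then taylor d' (d' k (x j)) * autEquiv K g hf.mem_ordIdeal G else 0) +
            (taylor d' (x j) - MvPowerSeries.C (x j)) * (taylor d' (d' k (x i)) *
              autEquiv K g hf.mem_ordIdeal (MvPowerSeries.pderiv R i G)) := by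
          intro i
          rw [Derivation.leibniz, MvPowerSeries.pderiv_X, map_add, smul_eq_mul, smul_eq_mul,
            map_mul, map_mul, autEquiv_frameChange_X hf, Pi.single_apply]
          by_cases hij : j = i
          · subst hij
            rw [if_pos rfl, if_pos rfl, map_one]
            ring
          · rw [if_neg hij, if_neg fun h => hij h.symm, map_zero]
            ring
        rw [Finset.sum_congr rfl fun i _ => e i, Finset.sum_add_distrib, Finset.sum_ite_eq' ]
        simp only [Finset.mem_univ, if_true, smul_eq_mul]
        ring)
    exact sub_eq_zero.mp (DFunLike.congr_fun h G)
  -- By the chain rule in both coordinate systems, the partial derivatives of the difference for `f`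
  -- are combinations of the differences for the functions `d j f`, so the order can be raised step
  -- by step.
  have h : ∀ k, ∀ f : R, autEquiv K g hf.mem_ordIdeal (taylor d f) - taylor d' f ∈
      ordIdeal n R k := by
    intro k
    induction k with
    | zero => exact fun _ => mem_ordIdeal_zero _
    | succ k ih =>
      intro f
      refine mem_ordIdeal_of_pderiv K ?_ fun i => ?_
      · have h1 : taylor d f - MvPowerSeries.C f ∈ ordIdeal n R 1 := by
          rw [mem_ordIdeal_one, map_sub, constantCoeff_taylor, MvPowerSeries.constantCoeff_C,
            sub_self]
        have h2 := mem_ordIdeal_one.mp (autEquiv_mem (K := K) g hf.mem_ordIdeal h1)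
        have h3 : autEquiv K g hf.mem_ordIdeal (MvPowerSeries.C f : PS n R) =
          MvPowerSeries.C f := AlgEquiv.commutes _ f
        rw [map_sub, h3, map_sub, MvPowerSeries.constantCoeff_C] at h2
        rw [map_sub, constantCoeff_taylor, h2]
      · rw [map_sub, chain, pderiv_taylor F'.comm, F.apply_eq_sum (d' i), taylor_sum, ← Finset.sum_sub_distrib]
        refine Ideal.sum_mem _ fun j _ => ?_
        rw [pderiv_taylor F.comm, taylor_mul F'.comm, ← mul_sub]
        exact Ideal.mul_mem_left _ _ (ih _)
  exact eq_of_sub_mem_ordIdeal fun k => h k f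

/-- Both sides restrict to δ on constants. On variables the claim combines `autEquiv_taylor` with
`totalDer_taylor`. Transferred to `R ⊗ W` by `autAct_totalAct`, it says that gluing commutes with
vector fields. -/
theorem autEquiv_totalDer (δ : Derivation K R R) (f : PS n R) :
    autEquiv K g hf.mem_ordIdeal (totalDer δ (frameVec x d δ) f) =
      totalDer δ (frameVec y d' δ) (autEquiv K g hf.mem_ordIdeal f) := by
  let D : PS n R →+ PS n R := AddMonoidHom.mk' (fun f =>
    autEquiv K g hf.mem_ordIdeal (totalDer δ (frameVec x d δ) f) -
      totalDer δ (frameVec y d' δ) (autEquiv K g hf.mem_ordIdeal f)) fun a b => by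
    simp only [map_add]
    abel
  have hD : ∀ f, D f = autEquiv K g hf.mem_ordIdeal (totalDer δ (frameVec x d δ) f) -
      totalDer δ (frameVec y d' δ) (autEquiv K g hf.mem_ordIdeal f) := fun _ => rfl
  have hC : ∀ r, autEquiv K g hf.mem_ordIdeal (MvPowerSeries.C r : PS n R) =
      MvPowerSeries.C r := fun r => AlgEquiv.commutes _ r
  have hX : ∀ k, autEquiv K g hf.mem_ordIdeal (frameVec x d δ k) =
      totalDer δ (frameVec y d' δ) (autEquiv K g hf.mem_ordIdeal (MvPowerSeries.X k)) := by
    intro k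
    rw [autEquiv_frameChange_X hf, frameVec, map_sub, map_sub, hC, totalDer_C,
      F'.totalDer_taylor, F.autEquiv_taylor F' hf]
  have h : D = 0 := eq_zero_of_semilinear D
    (fun k => autEquiv K g hf.mem_ordIdeal (MvPowerSeries.X k))
    (fun k => autEquiv_X_mem _ _ k)
    (fun r => by rw [hD, totalDer_C, hC, hC, totalDer_C, sub_self]) (fun k f => by
      rw [hD, hD, Derivation.leibniz, totalDer_X, map_mul, Derivation.leibniz, ← hX]
      simp only [smul_eq_mul, map_add, map_mul]
      ring)
  exact sub_eq_zero.mp (DFunLike.congr_fun h f)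

omit F in
/-- The coordinate changes satisfy the cocycle condition. -/
theorem autEquiv_frameChange {z : Fin n → R} {g' g'' : GL (Fin n) R} {d'' : Fin n → Derivation K R R}
    (F'' : IsFrame z d'') {v' v'' : Fin n → PS n R}
    (hf' : IsFactorization K (frameChange y d'') g' v')
    (hf'' : IsFactorization K (frameChange x d'') g'' v'') (f : PS n R) :
    autEquiv K g'' hf''.mem_ordIdeal f =
      autEquiv K g' hf'.mem_ordIdeal (autEquiv K g hf.mem_ordIdeal f) := by
  refine autEquiv_comp_ext _ _ _ (fun i => ?_) f
  have hC : ∀ r, autEquiv K g' hf'.mem_ordIdeal (MvPowerSeries.C r : PS n R) =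
      MvPowerSeries.C r := fun r => AlgEquiv.commutes _ r
  rw [autEquiv_frameChange_X hf'', autEquiv_frameChange_X hf, map_sub, hC,
    F'.autEquiv_taylor F'' hf']

end IsFrame

end Frames


/-! ### Étale charts provide frames -/

section ChartFrames

variable {n : ℕ} {K : Type u} [Field K]

/-- A derivation that vanishes on the elements of a subalgebra vanishes on the elements that
are algebraic over it. -/
theorem derivation_eq_zero_of_isAlgebraic [CharZero K] {B R : Type u} [CommRing B] [IsDomain B]
    [Algebra K B] [CommRing R] [IsDomain R] [Algebra K R] (φ : B →ₐ[K] R)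
    (hφ : Function.Injective φ) (S : Subalgebra K B) (D : Derivation K R R)
    (hD : ∀ s ∈ S, D (φ s) = 0) {b : B} (hb : IsAlgebraic S b) : D (φ b) = 0 := by
  have : CharZero S := charZero_of_injective_algebraMap (algebraMap K S).injective
  have key : ∀ p : Polynomial S, D (φ (Polynomial.aeval b p)) =
      φ (Polynomial.aeval b (Polynomial.derivative p)) * D (φ b) := by
    intro p
    induction p using Polynomial.induction_on' with
    | add p q hp hq => simp only [map_add, hp, hq, add_mul]
    | monomial k s =>
      rw [Polynomial.derivative_monomial, Polynomial.aeval_monomial, Polynomial.aeval_monomial,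
        map_mul φ, map_mul φ, map_pow φ, map_pow φ, Derivation.leibniz, Derivation.leibniz_pow]
      have h1 : D (φ (algebraMap S B s)) = 0 := hD s s.2
      rw [h1, map_mul, map_mul φ, map_natCast, map_natCast]
      simp only [smul_eq_mul, nsmul_eq_mul, mul_zero, add_zero]
      ring
  obtain ⟨p, hp0, hp⟩ := hb
  -- From `p(b) = 0` one gets `p'(b) D(b) = 0`. In a domain either `D(b) = 0`, or `p'` is a relation
  -- of smaller degree; in characteristic zero `p'` is non-zero unless `p` is constant.
  induction hk : p.natDegree using Nat.strong_induction_on generalizing p with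
  | _ k ih =>
    have h1 := key p
    rw [hp, map_zero, map_zero] at h1
    rcases mul_eq_zero.mp h1.symm with h2 | h2
    · have h3 : Polynomial.aeval b (Polynomial.derivative p) = 0 :=
        hφ (h2.trans (map_zero φ).symm)
      by_cases hk0 : p.natDegree = 0
      · obtain ⟨s, rfl⟩ := Polynomial.natDegree_eq_zero.mp hk0
        rw [Polynomial.aeval_C] at hp
        have : s = 0 := Subtype.ext hp
        simp [this] at hp0
      · have h4 : (Polynomial.derivative p).natDegree < k :=
          hk ▸ Polynomial.natDegree_derivative_lt hk0
        refine ih _ h4 _ (fun h5 => hk0 ?_) h3 rfl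
        exact Polynomial.derivative_eq_zero.mp h5
    · exact h2

/-- A derivation that vanishes at the coordinates vanishes on the polynomials in them, then on
algebraic elements, then on fractions by the quotient rule. The fractions cover both smaller open
sets and the local ring. -/
theorem derivation_ext_of_isAlgebraic [CharZero K] {B R : Type u} [CommRing B] [IsDomain B]
    [Algebra K B] [CommRing R] [IsDomain R] [Algebra K R] (φ : B →ₐ[K] R)
    (hφ : Function.Injective φ) (hloc : ∀ f : R, ∃ b b' : B, b ≠ 0 ∧ φ b * f = φ b')
    (x : Fin n → B) (hx : ∀ b : B, IsAlgebraic (Algebra.adjoin K (Set.range x)) b)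
    (D D' : Derivation K R R) (h : ∀ i, D (φ (x i)) = D' (φ (x i))) : D = D' := by
  have h0 : ∀ b, (D - D') (φ b) = 0 := fun b =>
    derivation_eq_zero_of_isAlgebraic φ hφ (Algebra.adjoin K (Set.range x)) (D - D') (by
      intro s hs
      induction hs using Algebra.adjoin_induction with
      | mem s hs =>
        obtain ⟨i, rfl⟩ := hs
        rw [Derivation.sub_apply, h, sub_self]
      | algebraMap c => rw [AlgHom.commutes, Derivation.map_algebraMap]
      | add a b _ _ ha hb => rw [map_add, map_add, ha, hb, add_zero]
      | mul a b _ _ ha hb => rw [map_mul, Derivation.leibniz, ha, hb, smul_zero, smul_zero,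
          add_zero]) (hx b)
  rw [← sub_eq_zero]
  ext f
  obtain ⟨b, b', hb, hf⟩ := hloc f
  have h1 := congrArg (D - D') hf
  rw [Derivation.leibniz, h0, h0, smul_zero, add_zero, smul_eq_mul] at h1
  exact (mul_eq_zero.mp h1).resolve_left fun h2 => hb (hφ (h2.trans (map_zero φ).symm))

variable {X : Scheme.{u}} [X.Over (Spec (.of K))] [IsIntegral X]

theorem resFun_injective {U V : X.Opens} (h : V ≤ U) [Nonempty V] :
    Function.Injective (resFun K h) :=
  map_injective_of_isIntegral X (homOfLE h)

theorem germFun_injective {U : X.Opens} {P : X} (hP : P ∈ U) :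
    Function.Injective (germFun K hP) :=
  germ_injective_of_isIntegral X P hP

/-- Functions on an open subset of an affine open set `U` are quotients of functions on `U`. -/
theorem exists_mul_resFun {U V : X.Opens} (hU : IsAffineOpen U) (h : V ≤ U) [Nonempty V]
    (f : Γ(X, V)) : ∃ b b' : Γ(X, U), b ≠ 0 ∧ resFun K h b * f = resFun K h b' := by
  have : Nonempty U := ⟨⟨_, h (Classical.arbitrary V).2⟩⟩
  have := functionField_isFractionRing_of_isAffineOpen X U hU
  obtain ⟨b', b, hb, he⟩ := IsFractionRing.div_surjective (A := Γ(X, U))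
    (X.germToFunctionField V f)
  refine ⟨b, b', nonZeroDivisors.ne_zero hb, ?_⟩
  apply Scheme.germToFunctionField_injective X V
  have hres : ∀ a : Γ(X, U), X.germToFunctionField V (resFun K h a) =
      algebraMap Γ(X, U) X.functionField a := fun a =>
    TopCat.Presheaf.germ_res_apply X.presheaf (homOfLE h) _ _ a
  have hb0 : algebraMap Γ(X, U) X.functionField b ≠ 0 := by
    rw [Ne, FaithfulSMul.algebraMap_eq_zero_iff]
    exact nonZeroDivisors.ne_zero hb
  rw [map_mul, hres, hres, ← he, mul_div_cancel₀ _ hb0]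

variable [CharZero K] (c : EtaleChart K X n)

namespace EtaleChart

/-- The parameters of a chart, as functions on an open subset. -/
def coord {V : X.Opens} (hV : V ≤ c.U) (i : Fin n) : Γ(X, V) := resFun K hV (c.x i)

/-- The derivations `∂/∂xᵢ` on an open subset of a chart. -/
def partialDer {V : X.Opens} (hV : V ≤ c.U) (i : Fin n) : Derivation K Γ(X, V) Γ(X, V) :=
  (c.pd i).der V hV

omit [IsIntegral X] [CharZero K] in
theorem partialDer_coord {V : X.Opens} (hV : V ≤ c.U) (i j : Fin n) :
    c.partialDer hV i (c.coord hV j) = if i = j then 1 else 0 := by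
  rw [partialDer, coord, ← (c.pd i).der_res _ _ hV le_rfl]
  have := c.pd_x i j
  rw [VectorField.app] at this
  rw [this]
  split_ifs
  · exact map_one _
  · exact map_zero _

theorem isFrame {V : X.Opens} (hV : V ≤ c.U) : IsFrame (c.coord hV) (c.partialDer hV) where
  apply_x := c.partialDer_coord hV
  ext δ δ' h := by
    by_cases hne : Nonempty V
    · have : Nonempty c.U := ⟨⟨_, hV hne.some.2⟩⟩
      exact derivation_ext_of_isAlgebraic (resFun K hV) (resFun_injective hV)
        (exists_mul_resFun c.isAffine hV) c.x c.isAlgebraic δ δ' h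
    -- Over the empty set the ring of functions is zero, and there is nothing to compare.
    · have hbot : V = ⊥ := by
        ext Q
        exact ⟨fun hQ => (hne ⟨⟨Q, hQ⟩⟩).elim, fun hQ => hQ.elim⟩
      subst hbot
      have : Subsingleton Γ(X, ⊥) := CommRingCat.subsingleton_of_isTerminal X.sheaf.isTerminalOfEmpty
      exact Derivation.ext fun _ => Subsingleton.elim _ _

theorem isFrame_stalk {P : X} (hP : P ∈ c.U) :
    IsFrame (fun i => germFun K hP (c.x i)) (fun i => (c.pd i).stalk hP) where
  apply_x i j := by
    rw [VectorField.stalk_germ _ hP le_rfl]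
    have := c.pd_x i j
    rw [VectorField.app] at this
    rw [this]
    split_ifs
    · exact map_one _
    · exact map_zero _
  ext δ δ' h := by
    have : Nonempty c.U := ⟨⟨_, hP⟩⟩
    refine derivation_ext_of_isAlgebraic (germFun K hP) (germFun_injective hP) (fun f => ?_) c.x
      c.isAlgebraic δ δ' h
    obtain ⟨V, hV, hPV, f, rfl⟩ := VectorField.exists_germ_le (K := K) hP f
    have : Nonempty V := ⟨⟨_, hPV⟩⟩
    obtain ⟨b, b', hb, he⟩ := exists_mul_resFun (K := K) c.isAffine hV f
    refine ⟨b, b', hb, ?_⟩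
    rw [← germFun_res K hV hPV, ← germFun_res K hV hPV, ← map_mul, he]

omit [IsIntegral X] [CharZero K] in
theorem taylor_res {V V' : X.Opens} (hV : V ≤ c.U) (h : V' ≤ V) (f : Γ(X, V)) :
    MvPowerSeries.map (resFun K h : Γ(X, V) →+* Γ(X, V'))
      (AVMod.taylor (c.partialDer hV) f) =
      AVMod.taylor (c.partialDer (h.trans hV)) (resFun K h f) :=
  map_taylor (resFun K h) (fun i f => (c.pd i).der_res V V' h hV f) f

omit [IsIntegral X] [CharZero K] in
theorem coord_res {V V' : X.Opens} (hV : V ≤ c.U) (h : V' ≤ V) (i : Fin n) :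
    resFun K h (c.coord hV i) = c.coord (h.trans hV) i := resFun_comp K hV h _

end EtaleChart

end ChartFrames


/-! ### Powers and the Taylor series of the unit -/

section TaylorPow

variable {n : ℕ} {K : Type u} [Field K] [CharZero K] {R : Type u} [CommRing R] [Algebra K R]
  {d : Fin n → Derivation K R R}

theorem pow_mem_ordIdeal {f : PS n R} (hf : f ∈ ordIdeal n R 1) (k : ℕ) :
    f ^ k ∈ ordIdeal n R k := by
  induction k with
  | zero => exact mem_ordIdeal_zero _
  | succ k ih =>
    rw [pow_succ]
    exact mul_mem_ordIdeal ih hf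

theorem taylor_one (hd : ∀ i j f, d i (d j f) = d j (d i f)) : taylor d (1 : R) = 1 := by
  refine eq_of_sub_mem_ordIdeal fun k => ?_
  cases k with
  | zero => exact mem_ordIdeal_zero _
  | succ k =>
    refine mem_ordIdeal_of_pderiv K ?_ fun i => ?_
    · rw [map_sub, constantCoeff_taylor, map_one, sub_self]
    · rw [map_sub, pderiv_taylor hd, Derivation.map_one_eq_zero, Derivation.map_one_eq_zero,
        taylor_zero, sub_zero]
      exact zero_mem _

end TaylorPow

/-! ### The jet action in local coordinates -/

section FrameAct

variable {n : ℕ} {K : Type u} [Field K] {R : Type u} [CommRing R] [Algebra K R]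

theorem map_expSeries {R' : Type u} [CommRing R'] [Algebra K R'] (φ : R →ₐ[K] R')
    (v : Fin n → PS n R) (f : PS n R) :
    MvPowerSeries.map (φ : R →+* R') (expSeries K v f) =
      expSeries K (fun i => MvPowerSeries.map (φ : R →+* R') (v i))
        (MvPowerSeries.map (φ : R →+* R') f) := by
  ext s
  rw [MvPowerSeries.coeff_map, coeff_expSeries, coeff_expSeries, map_sum]
  refine Finset.sum_congr rfl fun k _ => ?_
  have h : (vecField fun i => MvPowerSeries.map (φ : R →+* R') (v i))^[k]
      (MvPowerSeries.map (φ : R →+* R') f) =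
      MvPowerSeries.map (φ : R →+* R') ((vecField v)^[k] f) := by
    clear * -
    induction k with
    | zero => rfl
    | succ k ih =>
      rw [Function.iterate_succ_apply', Function.iterate_succ_apply', ih, vecField_map]
  rw [h, MvPowerSeries.coeff_map]
  exact map_smul φ _ _

theorem IsFactorization.map {R' : Type u} [CommRing R'] [Algebra K R'] (φ : R →ₐ[K] R')
    {ψ : Fin n → PS n R} {g : GL (Fin n) R} {v : Fin n → PS n R}
    (h : IsFactorization K ψ g v) :
    IsFactorization K (fun i => MvPowerSeries.map (φ : R →+* R') (ψ i)) (glMap φ g)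
      (fun i => MvPowerSeries.map (φ : R →+* R') (v i)) where
  unipotent i s hs := by
    rw [MvPowerSeries.coeff_map, h.unipotent i s hs, map_zero]
  eq i := by
    rw [h.eq, map_sum]
    refine Finset.sum_congr rfl fun j _ => ?_
    rw [MvPowerSeries.smul_eq_C_mul, MvPowerSeries.smul_eq_C_mul, map_mul, MvPowerSeries.map_C,
      map_expSeries, MvPowerSeries.map_X]
    rfl

variable {W : Type u} [AddCommGroup W] [Module K W] [LieRingModule (Lplus n K) W]
  [LieModule K (Lplus n K) W]

/-- Constant terms are discarded in `lieAct`. So the field `frameVec`, which vanishes at the origin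
as the theory requires, acts like the full Taylor series in the formula for jets. -/
theorem lieAct_sub_C (v : Fin n → PS n R) (r : Fin n → R) :
    lieAct K W (fun i => v i - MvPowerSeries.C (r i)) = lieAct K W v := by
  classical
  rw [lieAct, lieAct]
  refine finsum_congr fun s => Finset.sum_congr rfl fun i _ => ?_
  rw [map_sub, MvPowerSeries.coeff_C, if_neg s.2, sub_zero]

variable (W) in
/-- The action on `R ⊗ W` of a derivation of `R`, computed in local coordinates. -/
def frameAct (x : Fin n → R) (d : Fin n → Derivation K R R) (δ : Derivation K R R) :
    R ⊗[K] W →ₗ[K] R ⊗[K] W :=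
  totalAct W δ (frameVec x d δ)

variable {x : Fin n → R} {d : Fin n → Derivation K R R}

theorem frameAct_apply (δ : Derivation K R R) (t : R ⊗[K] W) :
    frameAct W x d δ t = derT W δ t + lieAct K W (fun i => taylor d (δ (x i))) t := by
  rw [frameAct, totalAct_apply]
  congr 2
  exact lieAct_sub_C _ _

theorem frameAct_smul (δ : Derivation K R R) (r : R) (t : R ⊗[K] W) :
    frameAct W x d δ (r • t) = δ r • t + r • frameAct W x d δ t :=
  totalAct_smul δ _ r t

variable {N : ℕ} (h : IsDegreeBound (n := n) (K := K) W N)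

include h

theorem frameAct_add (δ μ : Derivation K R R) (t : R ⊗[K] W) :
    frameAct W x d (δ + μ) t = frameAct W x d δ t + frameAct W x d μ t := by
  rw [frameAct_apply, frameAct_apply, frameAct_apply]
  have h1 : (fun i => taylor d ((δ + μ) (x i))) =
      (fun i => taylor d (δ (x i))) + fun i => taylor d (μ (x i)) :=
    funext fun i => taylor_add _ _
  have h2 : derT W (δ + μ) t = derT W δ t + derT W μ t := by
    refine TensorProduct.induction_on t (by simp) (fun r w => ?_) fun a b ha hb => ?_
    · rw [derT_tmul, derT_tmul, derT_tmul, Derivation.add_apply, TensorProduct.add_tmul]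
    · rw [map_add, map_add, map_add, ha, hb]
      abel
  rw [h1, lieAct_add h, LinearMap.add_apply, h2]
  abel

theorem frameAct_smul_left (a : K) (δ : Derivation K R R) (t : R ⊗[K] W) :
    frameAct W x d (a • δ) t = a • frameAct W x d δ t := by
  rw [frameAct_apply, frameAct_apply]
  have h1 : (fun i => taylor d ((a • δ) (x i))) =
      (algebraMap K R a) • fun i => taylor d (δ (x i)) := by
    funext i
    rw [Derivation.smul_apply, taylor_smul, Pi.smul_apply, algebraMap_smul]
  have h2 : derT W (a • δ) t = a • derT W δ t := by
    refine TensorProduct.induction_on t (by simp) (fun r w => ?_) fun a b ha hb => ?_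
    · rw [derT_tmul, derT_tmul, Derivation.smul_apply, TensorProduct.smul_tmul']
    · rw [map_add, map_add, ha, hb, smul_add]
  rw [h1, lieAct_smul h, LinearMap.smul_apply, h2, smul_add, algebraMap_smul]

theorem extMap_frameAct {R' : Type u} [CommRing R'] [Algebra K R'] (φ : R →ₐ[K] R')
    {d' : Fin n → Derivation K R' R'} (hd : ∀ i f, φ (d i f) = d' i (φ f))
    {δ : Derivation K R R} {δ' : Derivation K R' R'} (hδ : ∀ f, φ (δ f) = δ' (φ f))
    (t : R ⊗[K] W) :
    extMap W φ (frameAct W x d δ t) =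
      frameAct W (fun i => φ (x i)) d' δ' (extMap W φ t) := by
  rw [frameAct_apply, frameAct_apply, map_add]
  congr 1
  · refine TensorProduct.induction_on t (by simp) (fun r w => ?_) fun a b ha hb => ?_
    · simp [extMap, derT_tmul, hδ]
    · simp only [map_add, ha, hb]
  · have h1 : (fun i => taylor d' (δ' (φ (x i)))) =
        fun i => MvPowerSeries.map (φ : R →+* R') (taylor d (δ (x i))) :=
      funext fun i => by rw [map_taylor φ hd, hδ]
    rw [h1]
    exact lieAct_natural h φ _ t

variable [CharZero K]

/-- By `totalDer_taylor`, the expansions of two derivations bracket to the expansion of their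
bracket; then `totalAct_lie` applies. -/
theorem IsFrame.frameAct_lie (F : IsFrame x d) (δ μ : Derivation K R R) (t : R ⊗[K] W) :
    frameAct W x d ⁅δ, μ⁆ t =
      frameAct W x d δ (frameAct W x d μ t) - frameAct W x d μ (frameAct W x d δ t) := by
  have h1 := totalAct_lie h δ μ (frameVec_mem (x := x) (d := d) δ)
    (frameVec_mem (x := x) (d := d) μ) t
  have h2 : (fun i => totalDer δ (frameVec x d δ) (frameVec x d μ i) -
      totalDer μ (frameVec x d μ) (frameVec x d δ i)) = frameVec x d ⁅δ, μ⁆ := by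
    funext i
    rw [frameVec, frameVec, frameVec, map_sub, map_sub, F.totalDer_taylor, F.totalDer_taylor,
      totalDer_C, totalDer_C, Derivation.commutator_apply, taylor_sub, map_sub]
    abel
  rw [h2] at h1
  exact eq_sub_of_add_eq h1

/-- The elements `∑ₖ (-1)ᵏ (N choose k) fᵏ # f^(N-k) δ` act by zero. -/
theorem frameAct_differentiable (F : IsFrame x d) (hN : 0 < N) (f : R) (δ : Derivation K R R)
    (t : R ⊗[K] W) :
    ∑ k ∈ Finset.range (N + 1), ((-1) ^ k * (N.choose k : R) * f ^ k) •
      frameAct W x d (f ^ (N - k) • δ) t = 0 := by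
  have hbin : ∀ {B : Type u} [CommRing B] (a b : B), ∑ k ∈ Finset.range (N + 1),
      (-1) ^ k * (N.choose k : B) * a ^ k * b ^ (N - k) = (b - a) ^ N := by
    intro B _ a b
    rw [show b - a = -a + b by ring, add_pow]
    refine Finset.sum_congr rfl fun k _ => ?_
    rw [neg_pow]
    ring
  have h1 : ∀ k, derT W (f ^ (N - k) • δ) t = f ^ (N - k) • derT W δ t := by
    intro k
    refine TensorProduct.induction_on t (by simp) (fun r w => ?_) fun a b ha hb => ?_
    · rw [derT_tmul, derT_tmul, Derivation.smul_apply, TensorProduct.smul_tmul']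
    · rw [map_add, map_add, ha, hb, smul_add]
  simp only [frameAct_apply, smul_add, Finset.sum_add_distrib, h1, smul_smul]
  -- The part δ ⊗ 1 is linear over functions in δ, so the alternating sum is the binomial expansion
  -- of (f - f)^N and drops out.
  rw [← Finset.sum_smul, hbin, sub_self, zero_pow hN.ne', zero_smul, zero_add]
  have h2 : ∀ k, ((-1) ^ k * (N.choose k : R) * f ^ k) •
      lieAct K W (fun i => taylor d ((f ^ (N - k) • δ) (x i))) t =
      lieAct K W (((-1) ^ k * (N.choose k : R) * f ^ k) •
        fun i => taylor d ((f ^ (N - k) • δ) (x i))) t := fun k => by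
    rw [lieAct_smul h, LinearMap.smul_apply]
  rw [Finset.sum_congr rfl fun k _ => h2 k, ← LinearMap.sum_apply, ← lieAct_sum h]
  have hpow : ∀ k, taylor d (f ^ k) = taylor d f ^ k := fun k => by
    induction k with
    | zero => rw [pow_zero, pow_zero, taylor_one F.comm]
    | succ k ih => rw [pow_succ, pow_succ, taylor_mul F.comm, ih]
  have h3 : lieAct K W (∑ k ∈ Finset.range (N + 1), ((-1) ^ k * (N.choose k : R) * f ^ k) •
      fun i => taylor d ((f ^ (N - k) • δ) (x i))) = lieAct K W (0 : Fin n → PS n R) := by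
    refine lieAct_congr h fun i => ?_
    rw [Pi.zero_apply, sub_zero, Finset.sum_apply]
    have h4 : ∀ k, (((-1) ^ k * (N.choose k : R) * f ^ k) •
        fun i => taylor d ((f ^ (N - k) • δ) (x i))) i =
        ((-1) ^ k * (N.choose k : PS n R) * (MvPowerSeries.C f) ^ k *
          (taylor d f) ^ (N - k)) * taylor d (δ (x i)) := fun k => by
      rw [Pi.smul_apply, MvPowerSeries.smul_eq_C_mul, Derivation.smul_apply, smul_eq_mul,
        taylor_mul F.comm, hpow]
      simp only [map_mul, map_pow, map_neg, map_one, map_natCast]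
      ring
    -- The remaining field is (f(x + X) - f(x))^N times the expansion of δ. It has order `N`, hence
    -- acts by zero.
    rw [Finset.sum_congr rfl fun k _ => h4 k, ← Finset.sum_mul, hbin]
    refine Ideal.mul_mem_right _ _ ?_
    have h5 : taylor d f - MvPowerSeries.C f ∈ ordIdeal n R 1 := by
      rw [mem_ordIdeal_one, map_sub, constantCoeff_taylor, MvPowerSeries.constantCoeff_C, sub_self]
    exact pow_mem_ordIdeal h5 N
  rw [h3, lieAct_zero h, LinearMap.zero_apply]

end FrameAct


/-! ### The jet bundle is a sheaf of AV-modules, trivial in charts -/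

section JetBundle

variable {n : ℕ} {K : Type u} [Field K] {X : Scheme.{u}} [X.Over (Spec (.of K))]
  {W : Type u} [AddCommGroup W] [Module K W]
  [LieRingModule (Lplus n K) W] [LieModule K (Lplus n K) W]

theorem jetOp_apply {U : X.Opens} (η : VectorField K U) (c : EtaleChart K X n)
    (t : Γ(X, U ⊓ c.U) ⊗[K] W) :
    jetOp W η c t = frameAct W (c.coord inf_le_right) (c.partialDer inf_le_right)
      (η.der (U ⊓ c.U) inf_le_left) t :=
  (frameAct_apply _ _).symm

/-- The action of a vector field on `W`-valued functions on an open subset of a chart. -/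
def EtaleChart.act (W : Type u) [AddCommGroup W] [Module K W]
    [LieRingModule (Lplus n K) W] [LieModule K (Lplus n K) W]
    (c : EtaleChart K X n) {V : X.Opens} (hV : V ≤ c.U) (η : VectorField K V) :
    Γ(X, V) ⊗[K] W →ₗ[K] Γ(X, V) ⊗[K] W :=
  frameAct W (c.coord hV) (c.partialDer hV) (η.der V le_rfl)

theorem EtaleChart.coordChange_res (c c' : EtaleChart K X n) {V V' : X.Opens} (hc : V ≤ c.U)
    (hc' : V ≤ c'.U) (h : V' ≤ V) (i : Fin n) :
    MvPowerSeries.map (resFun K h : Γ(X, V) →+* Γ(X, V')) (coordChange c c' hc hc' i) =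
      coordChange c c' (h.trans hc) (h.trans hc') i := by
  change MvPowerSeries.map _ (AVMod.taylor (c'.partialDer hc') (c.coord hc i) -
    MvPowerSeries.C (c.coord hc i)) = AVMod.taylor (c'.partialDer (h.trans hc'))
      (c.coord (h.trans hc) i) - MvPowerSeries.C (c.coord (h.trans hc) i)
  rw [map_sub, c'.taylor_res, MvPowerSeries.map_C, c.coord_res hc h]
  congr 2
  exact c.coord_res hc h i

theorem resTensor_frameAct {N : ℕ} (h : IsDegreeBound (n := n) (K := K) W N)
    (c : EtaleChart K X n) {V V' : X.Opens} (hV : V ≤ c.U) (hV' : V' ≤ V)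
    {δ : Derivation K Γ(X, V) Γ(X, V)} {δ' : Derivation K Γ(X, V') Γ(X, V')}
    (hδ : ∀ f, resFun K hV' (δ f) = δ' (resFun K hV' f)) (t : Γ(X, V) ⊗[K] W) :
    resTensor W hV' (frameAct W (c.coord hV) (c.partialDer hV) δ t) =
      frameAct W (c.coord (hV'.trans hV)) (c.partialDer (hV'.trans hV)) δ'
        (resTensor W hV' t) := by
  have h1 := extMap_frameAct h (resFun K hV') (x := c.coord hV) (d := c.partialDer hV)
    (d' := c.partialDer (hV'.trans hV))
    (fun i f => (c.pd i).der_res V V' hV' hV f) hδ t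
  have h2 : (fun i => resFun K hV' (c.coord hV i)) = c.coord (hV'.trans hV) :=
    funext fun i => c.coord_res hV hV' i
  rw [h2] at h1
  exact h1

variable [CharZero K] [IsIntegral X] {σ : GLForm n K W} {N : ℕ}

/-- Stability of the gluing condition is the intertwining property of the coordinate change; the
other axioms hold chart by chart. -/
theorem GLForm.Integrates.isJetAction (hσ : σ.Integrates)
    (h : IsDegreeBound (n := n) (K := K) W N) (hN : 0 < N) : IsJetAction X σ where
  mem U η s hs := by
    intro c c' V hU hc hc' g v hf
    change resTensor W _ (jetOp W η c' (s c')) = autAct σ g v (resTensor W _ (jetOp W η c (s c)))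
    rw [jetOp_apply, jetOp_apply,
      resTensor_frameAct h c' inf_le_right (le_inf hU hc')
        (δ' := η.der V hU) (fun f => η.der_res _ _ _ _ f),
      resTensor_frameAct h c inf_le_right (le_inf hU hc)
        (δ' := η.der V hU) (fun f => η.der_res _ _ _ _ f), hs c c' V hU hc hc' g v hf]
    exact (hσ.autAct_totalAct h hN g hf.mem_ordIdeal (η.der V hU) (frameVec_mem _)
      ((c.isFrame hc).autEquiv_totalDer (c'.isFrame hc') hf (η.der V hU)) _).symm
  add U η μ c t := by
    rw [jetOp_apply, jetOp_apply, jetOp_apply]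
    exact frameAct_add h _ _ t
  smul U a η c t := by
    rw [jetOp_apply, jetOp_apply]
    exact frameAct_smul_left h a _ t
  lie U η μ c t := by
    simp only [jetOp_apply]
    exact (c.isFrame inf_le_right).frameAct_lie h _ _ t
  res U V hle η c t := by
    rw [jetOp_apply, jetOp_apply]
    exact resTensor_frameAct h c inf_le_right (inf_le_inf_right c.U hle)
      (fun f => η.der_res _ _ _ _ f) t

/-- The component of a section of the jet bundle in a chart. -/
def jetComponent (hJ : IsJetAction X σ) (c : EtaleChart K X n) (U : X.Opens) :
    (jet σ hJ).obj U →+ Γ(X, U ⊓ c.U) ⊗[K] W where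
  toFun := fun s : jetSections σ U => s.1 c
  map_zero' := rfl
  map_add' _ _ := rfl

theorem jet_isDifferentiable (h : IsDegreeBound (n := n) (K := K) W N) (hN : 0 < N)
    (hJ : IsJetAction X σ) : (jet σ hJ).IsDifferentiable N := by
  intro U f η m
  refine Subtype.ext (funext fun c => ?_)
  have h1 := frameAct_differentiable h (c.isFrame (inf_le_right : U ⊓ c.U ≤ c.U)) hN
    (resFun K inf_le_left f) (η.der (U ⊓ c.U) inf_le_left) (jetComponent hJ c U m)
  change jetComponent hJ c U (∑ k ∈ Finset.range (N + 1), _) = 0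
  rw [map_sum]
  refine Eq.trans (Finset.sum_congr rfl fun k _ => ?_) h1
  change resFun K (inf_le_left : U ⊓ c.U ≤ U) ((-1) ^ k * (N.choose k : Γ(X, U)) * f ^ k) •
    jetOp W (f ^ (N - k) • η) c (jetComponent hJ c U m) = _
  rw [jetOp_apply]
  have h2 : (f ^ (N - k) • η).der (U ⊓ c.U) inf_le_left =
      resFun K (inf_le_left : U ⊓ c.U ≤ U) (f ^ (N - k)) • η.der (U ⊓ c.U) inf_le_left := rfl
  rw [h2]
  simp only [map_mul, map_pow, map_neg, map_one, map_natCast]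

variable (hJ : IsJetAction X σ)

/-- The value of a section of the jet bundle in a chart. -/
def chartValue (c : EtaleChart K X n) {U : X.Opens} (hU : U ≤ c.U) :
    (jet σ hJ).obj U →+ Γ(X, U) ⊗[K] W :=
  (resTensor W (le_inf le_rfl hU)).toAddMonoidHom.comp (jetComponent hJ c U)

omit [CharZero K] [IsIntegral X]

theorem chartValue_apply (c : EtaleChart K X n) {U : X.Opens} (hU : U ≤ c.U)
    (s : (jet σ hJ).obj U) :
    chartValue hJ c hU s = resTensor W (le_inf le_rfl hU) (jetComponent hJ c U s) := rfl

theorem chartValue_smul (c : EtaleChart K X n) {U : X.Opens} (hU : U ≤ c.U) (f : Γ(X, U))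
    (s : (jet σ hJ).obj U) : chartValue hJ c hU (f • s) = f • chartValue hJ c hU s := by
  rw [chartValue_apply, chartValue_apply]
  change resTensor W _ (resFun K (inf_le_left : U ⊓ c.U ≤ U) f • jetComponent hJ c U s) = _
  rw [resTensor_smul, resFun_comp, resFun_id]

theorem chartValue_res (c : EtaleChart K X n) {U V : X.Opens} (hU : U ≤ c.U) (hV : V ≤ U)
    (s : (jet σ hJ).obj U) :
    chartValue hJ c (hV.trans hU) ((jet σ hJ).res hV s) =
      resTensor W hV (chartValue hJ c hU s) := by
  rw [chartValue_apply, chartValue_apply]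
  change resTensor W _ (resTensor W _ (jetComponent hJ c U s)) = _
  rw [resTensor_comp, resTensor_comp]

theorem chartValue_act (h : IsDegreeBound (n := n) (K := K) W N) (c : EtaleChart K X n)
    {U : X.Opens} (hU : U ≤ c.U) (η : VectorField K U) (s : (jet σ hJ).obj U) :
    chartValue hJ c hU ((jet σ hJ).act η s) = c.act W hU η (chartValue hJ c hU s) := by
  rw [chartValue_apply, chartValue_apply]
  change resTensor W _ (jetOp W η c (jetComponent hJ c U s)) = _
  rw [jetOp_apply]
  exact resTensor_frameAct h c inf_le_right _ (fun f => η.der_res _ _ _ _ f) _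

variable [CharZero K] [IsIntegral X]

theorem exists_coordChange_factorization (c c' : EtaleChart K X n) {V : X.Opens}
    (hc : V ≤ c.U) (hc' : V ≤ c'.U) : ∃ g v, IsFactorization K (coordChange c c' hc hc') g v :=
  (c.isFrame hc).exists_isFactorization (c'.isFrame hc')

/-- Each other component of a section is obtained from the one in `c` by a gluing map, and a gluing
map exists because the Jacobian is invertible. -/
theorem chartValue_injective (c : EtaleChart K X n) {U : X.Opens} (hU : U ≤ c.U) :
    Function.Injective (chartValue hJ c hU) := by
  rw [injective_iff_map_eq_zero]
  intro s hs
  refine Subtype.ext (funext fun c' => ?_)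
  have hc : U ⊓ c'.U ≤ c.U := inf_le_left.trans hU
  obtain ⟨g, v, hf⟩ := exists_coordChange_factorization c c' hc inf_le_right
  have h1 := s.2 c c' (U ⊓ c'.U) inf_le_left hc inf_le_right g v hf
  have h2 : resTensor W (le_inf inf_le_left inf_le_right : U ⊓ c'.U ≤ U ⊓ c'.U) (s.1 c') =
      s.1 c' := resTensor_id _
  have h3 : resTensor W (le_inf inf_le_left hc : U ⊓ c'.U ≤ U ⊓ c.U) (s.1 c) = 0 := by
    rw [chartValue_apply] at hs
    rw [← resTensor_comp (le_inf le_rfl hU) (inf_le_left : U ⊓ c'.U ≤ U)]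
    exact (congrArg _ hs).trans (map_zero _)
  rw [h2, h3, map_zero] at h1
  exact h1

/-- A function in the chart `c` is distributed to all charts by the gluing maps. The result is
consistent because the coordinate changes form a cocycle and the action is multiplicative;
uniqueness of factorizations makes the choices compatible with restriction. -/
theorem GLForm.Integrates.chartValue_surjective (hσ : σ.Integrates)
    (h : IsDegreeBound (n := n) (K := K) W N) (hN : 0 < N) (c : EtaleChart K X n)
    {U : X.Opens} (hU : U ≤ c.U) : Function.Surjective (chartValue hJ c hU) := by
  intro t
  choose g v hf using fun c' : EtaleChart K X n =>
    exists_coordChange_factorization c c' ((inf_le_left : U ⊓ c'.U ≤ U).trans hU) inf_le_right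
  have hres : ∀ (c' : EtaleChart K X n) (V : X.Opens) (hV : V ≤ U) (hc' : V ≤ c'.U)
      (g' : GL (Fin n) Γ(X, V)) (v' : Fin n → PS n Γ(X, V)),
      IsFactorization K (coordChange c c' (hV.trans hU) hc') g' v' →
      resTensor W (le_inf hV hc') (autAct σ (g c') (v c') (resTensor W inf_le_left t)) =
        autAct σ g' v' (resTensor W hV t) := by
    intro c' V hV hc' g' v' hf'
    have h1 := extMap_autAct (σ := σ) h hN (resFun K (le_inf hV hc' : V ≤ U ⊓ c'.U)) (g c')
      (hf c').mem_ordIdeal (resTensor W inf_le_left t)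
    have h2 := (hf c').map (resFun K (le_inf hV hc' : V ≤ U ⊓ c'.U))
    have h3 : (fun i => MvPowerSeries.map
        (resFun K (le_inf hV hc' : V ≤ U ⊓ c'.U) : Γ(X, U ⊓ c'.U) →+* Γ(X, V))
        (coordChange c c' ((inf_le_left : U ⊓ c'.U ≤ U).trans hU) inf_le_right i)) =
        coordChange c c' (hV.trans hU) hc' :=
      funext fun i => EtaleChart.coordChange_res c c' _ _ _ i
    rw [h3] at h2
    obtain ⟨e1, e2⟩ := h2.unique hf'
    rw [e1, e2] at h1
    refine h1.trans (congrArg _ ?_)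
    exact resTensor_comp _ _ t
  refine ⟨⟨fun c' => autAct σ (g c') (v c') (resTensor W inf_le_left t), ?_⟩, ?_⟩
  · intro c' c'' V hV hc' hc'' g' v' hf'
    obtain ⟨g₁, v₁, hf₁⟩ := exists_coordChange_factorization c c' (hV.trans hU) hc'
    obtain ⟨g₂, v₂, hf₂⟩ := exists_coordChange_factorization c c'' (hV.trans hU) hc''
    rw [hres c'' V hV hc'' g₂ v₂ hf₂, hres c' V hV hc' g₁ v₁ hf₁]
    exact hσ.autAct_comp h hN hf'.mem_ordIdeal hf₁.mem_ordIdeal hf₂.mem_ordIdeal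
      (IsFrame.autEquiv_frameChange (c'.isFrame hc') hf₁ (c''.isFrame hc'') hf' hf₂) _
  · obtain ⟨g₁, v₁, hf₁⟩ := exists_coordChange_factorization c c hU hU
    refine (hres c U le_rfl hU g₁ v₁ hf₁).trans ?_
    rw [resTensor_id]
    obtain ⟨B, hB, -⟩ := hσ.exists_autAct_inv h hN g₁ hf₁.mem_ordIdeal
    -- The transition from the chart to itself is idempotent by the cocycle condition, and it is
    -- invertible, so it acts as the identity.
    have h1 := hσ.autAct_comp h hN hf₁.mem_ordIdeal hf₁.mem_ordIdeal hf₁.mem_ordIdeal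
      (IsFrame.autEquiv_frameChange (c.isFrame hU) hf₁ (c.isFrame hU) hf₁ hf₁) t
    rw [← hB (autAct σ g₁ v₁ t), ← h1, hB]

end JetBundle


/-! ### Normal forms in the smash product -/

section SmashAlgebra

variable {K : Type u} [Field K] {A : Type u} [CommRing A] [Algebra K A]

namespace Smash

/-- The universal property of the smash product. -/
def lift {B : Type u} [Ring B] [Algebra K B] (f : A →ₐ[K] B) (v : Derivation K A A →ₗ[K] B)
    (hlie : ∀ η μ, v ⁅η, μ⁆ = v η * v μ - v μ * v η)
    (hleib : ∀ η a, v η * f a = f (η a) + f a * v η) : Smash K A →ₐ[K] B :=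
  RingQuot.liftAlgHom K ⟨FreeAlgebra.lift K (Sum.elim f v), by
    intro x y h
    induction h with
    | fun_scalar c => simp
    | vec_lie η μ => simp [hlie]
    | leibniz η a => simp [hleib]
    | _ => simp⟩

section

variable {B : Type u} [Ring B] [Algebra K B] (f : A →ₐ[K] B) (v : Derivation K A A →ₗ[K] B)
    (hlie : ∀ η μ, v ⁅η, μ⁆ = v η * v μ - v μ * v η)
    (hleib : ∀ η a, v η * f a = f (η a) + f a * v η)

theorem lift_fn (a : A) : lift f v hlie hleib (fn K a) = f a := by
  change RingQuot.liftAlgHom K _ (RingQuot.mkAlgHom K (SmashRel K A) _) = _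
  rw [RingQuot.liftAlgHom_mkAlgHom_apply]
  simp

theorem lift_vec (η : Derivation K A A) : lift f v hlie hleib (vec η) = v η := by
  change RingQuot.liftAlgHom K _ (RingQuot.mkAlgHom K (SmashRel K A) _) = _
  rw [RingQuot.liftAlgHom_mkAlgHom_apply]
  simp

end

theorem toEnd_fn (a b : A) : toEnd K A (fn K a) b = a * b := by
  have h : toEnd K A (fn K a) = LinearMap.mulLeft K a := by
    change RingQuot.liftAlgHom K _ (RingQuot.mkAlgHom K (SmashRel K A) _) = _
    rw [RingQuot.liftAlgHom_mkAlgHom_apply]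
    simp
  rw [h]
  rfl

theorem toEnd_vec (η : Derivation K A A) (b : A) : toEnd K A (vec η) b = η b := by
  have h : toEnd K A (vec η) = (η : A →ₗ[K] A) := by
    change RingQuot.liftAlgHom K _ (RingQuot.mkAlgHom K (SmashRel K A) _) = _
    rw [RingQuot.liftAlgHom_mkAlgHom_apply]
    simp
  rw [h]
  rfl

@[elab_as_elim]
theorem induction {P : Smash K A → Prop} (scalar : ∀ c : K, P (algebraMap K _ c))
    (fn : ∀ a, P (fn K a)) (vec : ∀ η, P (vec η)) (add : ∀ s t, P s → P t → P (s + t))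
    (mul : ∀ s t, P s → P t → P (s * t)) (s : Smash K A) : P s := by
  obtain ⟨x, rfl⟩ := RingQuot.mkAlgHom_surjective K (SmashRel K A) s
  change P (mk K A x)
  induction x using FreeAlgebra.induction with
  | grade0 c =>
    rw [AlgHom.commutes]
    exact scalar c
  | grade1 x => exact x.casesOn (fun a => fn a) fun η => vec η
  | add x y hx hy =>
    rw [map_add]
    exact add _ _ hx hy
  | mul x y hx hy =>
    rw [map_mul]
    exact mul _ _ hx hy

variable {n : ℕ}

/-- The monomials in the derivations `d₁, …, dₙ`. -/
def diffMonomial (d : Fin n → Derivation K A A) (α : Fin n →₀ ℕ) : Smash K A :=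
  (List.ofFn fun i => vec (d i) ^ α i).prod

variable {x : Fin n → A} {d : Fin n → Derivation K A A}

theorem diffMonomial_zero : diffMonomial d 0 = 1 := by
  simp [diffMonomial]

theorem commute_vec (hd : ∀ i j, ⁅d i, d j⁆ = 0) (i j : Fin n) :
    Commute (vec (d i)) (vec (d j)) := by
  have h := vec_lie K (d i) (d j)
  have h0 : vec (0 : Derivation K A A) = 0 := by
    simpa using vec_smul K (0 : K) (0 : Derivation K A A)
  rw [hd, h0] at h
  exact (sub_eq_zero.mp h.symm)

theorem vec_mul_diffMonomial (hd : ∀ i j, ⁅d i, d j⁆ = 0) (i : Fin n) (α : Fin n →₀ ℕ) :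
    vec (d i) * diffMonomial d α = diffMonomial d (α + Finsupp.single i 1) := by
  have h1 : Commute (vec (d i)) (diffMonomial d α) := by
    refine Commute.list_prod_right _ _ fun y hy => ?_
    obtain ⟨j, rfl⟩ := (List.mem_ofFn' _ _).mp hy
    exact (commute_vec hd _ _).pow_right _
  rw [h1.eq, diffMonomial, diffMonomial,
    ← prod_ofFn_pow_add_single (fun j => vec (d j)) (commute_vec hd) α i]
  congr 2
  funext j
  congr 1
  rw [Finsupp.add_apply, Finsupp.single_apply]
  simp [eq_comm]

theorem toEnd_diffMonomial (α : Fin n →₀ ℕ) : toEnd K A (diffMonomial d α) =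
    (List.ofFn fun i => ((d i : A →ₗ[K] A) : Module.End K A) ^ α i).prod := by
  rw [diffMonomial, map_list_prod, List.map_ofFn]
  congr 2
  funext i
  rw [Function.comp_apply, map_pow]
  congr 1
  exact LinearMap.ext fun b => toEnd_vec (d i) b

/-- A representation of the smash product that is linear over functions is determined by its
values on the elements `a d^α`. -/
theorem exists_normalForm {B : Type u} [Ring B] [Algebra K B] (Φ : Smash K A →ₐ[K] B)
    (F : IsFrame x d) (hΦ : ∀ (f : A) (δ : Derivation K A A),
      Φ (vec (f • δ)) = Φ (fn K f) * Φ (vec δ)) (s : Smash K A) :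
    ∃ a : (Fin n →₀ ℕ) →₀ A, Φ s = a.sum fun α f => Φ (fn K f) * Φ (diffMonomial d α) := by
  let G : ((Fin n →₀ ℕ) →₀ A) →+ B := Finsupp.liftAddHom fun α =>
    AddMonoidHom.mk' (fun f => Φ (fn K f) * Φ (diffMonomial d α)) fun f g => by
      rw [fn_add, map_add, add_mul]
  have hG : ∀ a, G a = a.sum fun α f => Φ (fn K f) * Φ (diffMonomial d α) := fun a => rfl
  have hs : ∀ α f, G (Finsupp.single α f) = Φ (fn K f) * Φ (diffMonomial d α) := fun α f => by
    rw [hG, Finsupp.sum_single_index]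
    rw [fn_zero, map_zero, zero_mul]
  -- It suffices that the span of the normal forms contains the unit and is stable under left
  -- multiplication by the generators.
  have hmem : ∀ (T : B), (∀ α f, T * G (Finsupp.single α f) ∈ G.range) →
      ∀ y ∈ G.range, T * y ∈ G.range := by
    rintro T hT _ ⟨a, rfl⟩
    induction a using Finsupp.induction_linear with
    | zero =>
      rw [map_zero, mul_zero]
      exact zero_mem _
    | add a b ha hb =>
      rw [map_add, mul_add]
      exact add_mem ha hb
    | single α f => exact hT α f
  have hfn : ∀ g : A, ∀ y ∈ G.range, Φ (fn K g) * y ∈ G.range := fun g => hmem _ fun α f => by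
    refine ⟨Finsupp.single α (g * f), ?_⟩
    rw [hs, hs, fn_mul, map_mul, mul_assoc]
  have hd : ∀ i, ∀ y ∈ G.range, Φ (vec (d i)) * y ∈ G.range := fun i => hmem _ fun α f => by
    refine ⟨Finsupp.single α (d i f) + Finsupp.single (α + Finsupp.single i 1) f, ?_⟩
    rw [map_add, hs, hs, hs, ← mul_assoc, ← map_mul Φ (vec (d i)), vec_mul_fn, map_add, add_mul,
      ← vec_mul_diffMonomial F.lie_eq_zero, map_mul, map_mul, mul_assoc]
  have key : ∀ s : Smash K A, ∀ y ∈ G.range, Φ s * y ∈ G.range := by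
    intro s
    induction s using Smash.induction with
    | scalar c =>
      intro y hy
      rw [← fn_scalar]
      exact hfn _ y hy
    | fn a => exact hfn a
    | vec η =>
      intro y hy
      -- Only here is linearity over functions used. It fails in the smash product itself, where
      -- `vec (f • δ)` is not the product of `fn K f` and `vec δ`.
      have h1 : Φ (vec η) = ∑ i, Φ (fn K (η (x i))) * Φ (vec (d i)) := by
        let v : Derivation K A A →+ Smash K A := AddMonoidHom.mk' vec fun a b => vec_add K a b
        have h2 : vec η = ∑ i, vec (η (x i) • d i) := by
          conv_lhs => rw [F.eq_sum η]
          exact map_sum v _ _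
        rw [h2, map_sum]
        exact Finset.sum_congr rfl fun i _ => hΦ _ _
      rw [h1, Finset.sum_mul]
      refine sum_mem fun i _ => ?_
      rw [mul_assoc]
      exact hfn _ _ (hd i y hy)
    | add s t hs ht =>
      intro y hy
      rw [map_add, add_mul]
      exact add_mem (hs y hy) (ht y hy)
    | mul s t hs ht =>
      intro y hy
      rw [map_mul, mul_assoc]
      exact hs _ (ht y hy)
  obtain ⟨a, ha⟩ := key s 1 ⟨Finsupp.single 0 1, by
    rw [hs, diffMonomial_zero, fn_one, map_one, mul_one]⟩
  exact ⟨a, by rw [← hG, ha, mul_one]⟩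

variable [CharZero K]

theorem toEnd_diffMonomial_apply (α : Fin n →₀ ℕ) (f : A) : toEnd K A (diffMonomial d α) f =
    ((∏ i, (α i).factorial : ℕ) : K) • MvPowerSeries.coeff α (taylor d f) := by
  have hf : ((∏ i, (α i).factorial : ℕ) : K) ≠ 0 :=
    Nat.cast_ne_zero.mpr (Finset.prod_ne_zero_iff.mpr fun i _ => Nat.factorial_ne_zero _)
  rw [toEnd_diffMonomial, coeff_taylor, smul_smul, mul_inv_cancel₀ hf, one_smul]

theorem _root_.AVMod.IsFrame.taylor_x (F : IsFrame x d) (i : Fin n) :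
    taylor d (x i) = MvPowerSeries.C (x i) + MvPowerSeries.X i := by
  rw [← sub_eq_zero, ← sub_sub]
  refine eq_of_sub_mem_ordIdeal (g := 0) fun k => ?_
  rw [sub_zero]
  cases k with
  | zero => exact mem_ordIdeal_zero _
  | succ k =>
    classical
    refine mem_ordIdeal_of_pderiv K ?_ fun j => ?_
    · rw [map_sub, map_sub, constantCoeff_taylor, MvPowerSeries.constantCoeff_C,
        MvPowerSeries.constantCoeff_X, sub_self, sub_zero]
    · have h1 : taylor d (d j (x i)) = if j = i then 1 else 0 := by
        rw [F.apply_x]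
        split_ifs
        · exact taylor_one F.comm
        · exact taylor_zero
      rw [map_sub, map_sub, pderiv_taylor F.comm, MvPowerSeries.pderiv_C, sub_zero, h1,
        MvPowerSeries.pderiv_X, Pi.single_apply]
      simp only [eq_comm (a := i), sub_self]
      exact zero_mem _

/-- The elements `d^α` of `End_K(A)` are linearly independent over `A`. -/
theorem normalForm_unique (F : IsFrame x d) (a : (Fin n →₀ ℕ) →₀ A)
    (ha : ∀ f : A, (a.sum fun α b => b * toEnd K A (diffMonomial d α) f) = 0) : a = 0 := by
  classical
  -- A relation among the operators says that the `A`-linear functional `T` kills all Taylor series.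
  -- These are closed under products, so `T` kills the `A`-algebra that they generate. It contains
  -- the variables, as the Taylor series of `x_i` minus `x_i`, and hence all monomials, on which `T`
  -- reads off the coefficients up to factorials.
  let T : PS n A →ₗ[A] A := a.sum fun α b =>
    (algebraMap K A ((∏ i, (α i).factorial : ℕ) : K) * b) • MvPowerSeries.coeff α
  have hT : ∀ G, T G = a.sum fun α b =>
      (algebraMap K A ((∏ i, (α i).factorial : ℕ) : K) * b) * MvPowerSeries.coeff α G := fun G => by
    simp only [T, Finsupp.sum, LinearMap.sum_apply, LinearMap.smul_apply, smul_eq_mul]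
  have h0 : ∀ f, T (taylor d f) = 0 := fun f => by
    rw [hT, ← ha f]
    refine Finset.sum_congr rfl fun α _ => ?_
    change _ * _ * _ = a α * toEnd K A (diffMonomial d α) f
    rw [toEnd_diffMonomial_apply, Algebra.smul_def]
    ring
  let M : Submonoid (PS n A) :=
    { carrier := Set.range (taylor d)
      one_mem' := ⟨1, taylor_one F.comm⟩
      mul_mem' := by
        rintro _ _ ⟨f, rfl⟩ ⟨g, rfl⟩
        exact ⟨f * g, taylor_mul F.comm f g⟩ }
  have h1 : ∀ G ∈ Algebra.adjoin A (M : Set (PS n A)), T G = 0 := by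
    intro G hG
    have h2 : G ∈ Submodule.span A (M : Set (PS n A)) := by
      have := Algebra.adjoin_eq_span A (M : Set (PS n A))
      rw [Submonoid.closure_eq] at this
      rw [← this]
      exact hG
    clear hG
    induction h2 using Submodule.span_induction with
    | mem G h =>
      obtain ⟨f, rfl⟩ := h
      exact h0 f
    | zero => exact map_zero T
    | add G H _ _ hG hH => rw [map_add, hG, hH, add_zero]
    | smul r G _ hG => rw [map_smul, hG, smul_zero]
  have hX : ∀ i, (MvPowerSeries.X i : PS n A) ∈ Algebra.adjoin A (M : Set (PS n A)) := fun i => by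
    have h2 := F.taylor_x i
    rw [← sub_eq_iff_eq_add'] at h2
    rw [← h2]
    exact sub_mem (Algebra.subset_adjoin ⟨x i, rfl⟩) (Subalgebra.algebraMap_mem _ (x i))
  have hmon : ∀ β : Fin n →₀ ℕ, MvPowerSeries.monomial β (1 : A) ∈
      Algebra.adjoin A (M : Set (PS n A)) := fun β => by
    rw [MvPowerSeries.monomial_one_eq]
    exact Subalgebra.prod_mem _ fun i _ => pow_mem (hX i) _
  ext β
  have h2 := h1 _ (hmon β)
  rw [hT, Finsupp.sum, Finset.sum_eq_single β] at h2
  · rw [MvPowerSeries.coeff_monomial_same, mul_one, Nat.cast_prod, map_prod] at h2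
    rw [Finsupp.zero_apply]
    have h3 : IsUnit (∏ i, algebraMap K A ((β i).factorial : K)) := by
      rw [← map_prod]
      exact (IsUnit.mk0 _ (Finset.prod_ne_zero_iff.mpr fun i _ =>
        Nat.cast_ne_zero.mpr (Nat.factorial_ne_zero _))).map _
    exact (h3.mul_right_eq_zero).mp h2
  · intro α _ hαβ
    rw [MvPowerSeries.coeff_monomial_ne hαβ, mul_zero]
  · intro hβ
    rw [Finsupp.notMem_support_iff.mp hβ, mul_zero, zero_mul]

end Smash

end SmashAlgebra


/-! ### Divergence, formal adjoints and delta functions -/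

section DeltaFunctions

variable {n : ℕ} {K : Type u} [Field K] {A : Type u} [CommRing A] [Algebra K A]
  {x : Fin n → A} {d : Fin n → Derivation K A A}

/-- The divergence of a derivation. -/
def divergence (x : Fin n → A) (d : Fin n → Derivation K A A) : Derivation K A A →ₗ[K] A where
  toFun δ := ∑ i, d i (δ (x i))
  map_add' δ μ := by simp [Finset.sum_add_distrib]
  map_smul' c δ := by simp [Finset.smul_sum]

theorem divergence_apply (δ : Derivation K A A) : divergence x d δ = ∑ i, d i (δ (x i)) := rfl

theorem IsFrame.divergence_smul (F : IsFrame x d) (f : A) (δ : Derivation K A A) :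
    divergence x d (f • δ) = f * divergence x d δ + δ f := by
  rw [divergence_apply, divergence_apply, F.apply_eq_sum δ f, Finset.mul_sum,
    ← Finset.sum_add_distrib]
  refine Finset.sum_congr rfl fun i _ => ?_
  rw [Derivation.smul_apply, smul_eq_mul, Derivation.leibniz, smul_eq_mul, smul_eq_mul]

/-- Besides the expected terms, one gets the trace of the product of the two Jacobian matrices,
which is symmetric in the derivations and cancels. -/
theorem IsFrame.divergence_lie (F : IsFrame x d) (δ μ : Derivation K A A) :
    divergence x d ⁅δ, μ⁆ = δ (divergence x d μ) - μ (divergence x d δ) := by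
  have h : ∀ δ μ : Derivation K A A, ∑ i, d i (δ (μ (x i))) =
      (∑ i, ∑ j, d i (δ (x j)) * d j (μ (x i))) + δ (divergence x d μ) := by
    intro δ μ
    rw [F.apply_eq_sum δ (divergence x d μ)]
    simp only [divergence_apply, map_sum, Finset.mul_sum]
    rw [Finset.sum_comm (f := fun i j => δ (x i) * d i (d j (μ (x j)))), ← Finset.sum_add_distrib]
    refine Finset.sum_congr rfl fun i _ => ?_
    rw [F.apply_eq_sum δ, map_sum, ← Finset.sum_add_distrib]
    refine Finset.sum_congr rfl fun j _ => ?_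
    rw [Derivation.leibniz, smul_eq_mul, smul_eq_mul, F.comm i j]
    ring
  have h1 : divergence x d ⁅δ, μ⁆ = ∑ i, d i (δ (μ (x i))) - ∑ i, d i (μ (δ (x i))) := by
    rw [divergence_apply, ← Finset.sum_sub_distrib]
    refine Finset.sum_congr rfl fun i _ => ?_
    rw [Derivation.commutator_apply, map_sub]
  have h2 : ∑ i, ∑ j, d i (δ (x j)) * d j (μ (x i)) =
      ∑ i, ∑ j, d i (μ (x j)) * d j (δ (x i)) := by
    rw [Finset.sum_comm]
    exact Finset.sum_congr rfl fun i _ => Finset.sum_congr rfl fun j _ => mul_comm _ _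
  rw [h1, h δ μ, h μ δ, h2]
  abel

/-- The formal adjoint, as a homomorphism to the opposite algebra of `End_K(A)`. -/
def adjointHom (F : IsFrame x d) : Smash K A →ₐ[K] (Module.End K A)ᵐᵒᵖ :=
  Smash.lift
    { toFun := fun a => MulOpposite.op (LinearMap.mulLeft K a)
      map_one' := by
        apply MulOpposite.unop_injective
        ext b
        simp
      map_mul' := fun a b => by
        apply MulOpposite.unop_injective
        ext c
        simp [mul_left_comm]
      map_zero' := by
        apply MulOpposite.unop_injective
        ext b
        simp
      map_add' := fun a b => by
        apply MulOpposite.unop_injective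
        ext c
        simp [add_mul]
      commutes' := fun c => by
        apply MulOpposite.unop_injective
        ext b
        simp [Algebra.smul_def, Module.algebraMap_end_apply] }
    { toFun := fun δ => MulOpposite.op (-((δ : A →ₗ[K] A) + LinearMap.mulLeft K (divergence x d δ)))
      map_add' := fun δ μ => by
        apply MulOpposite.unop_injective
        ext b
        simp [add_mul]
        abel
      map_smul' := fun c δ => by
        apply MulOpposite.unop_injective
        ext b
        simp [add_comm] }
    (fun δ μ => by
      apply MulOpposite.unop_injective
      ext b
      change -(⁅δ, μ⁆ b + divergence x d ⁅δ, μ⁆ * b) =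
        -(μ (-(δ b + divergence x d δ * b)) + divergence x d μ * -(δ b + divergence x d δ * b)) -
        -(δ (-(μ b + divergence x d μ * b)) + divergence x d δ * -(μ b + divergence x d μ * b))
      rw [F.divergence_lie, Derivation.commutator_apply]
      simp only [map_neg, map_add, Derivation.leibniz, smul_eq_mul]
      ring)
    (fun δ a => by
      apply MulOpposite.unop_injective
      ext b
      simp
      ring)

variable (F : IsFrame x d)

theorem adjointHom_fn (a b : A) : (adjointHom F (Smash.fn K a)).unop b = a * b := by
  rw [adjointHom, Smash.lift_fn]
  rfl

theorem adjointHom_vec (δ : Derivation K A A) (b : A) :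
    (adjointHom F (Smash.vec δ)).unop b = -(δ b + divergence x d δ * b) := by
  rw [adjointHom, Smash.lift_vec]
  rfl

theorem adjointHom_mul (s t : Smash K A) (b : A) :
    (adjointHom F (s * t)).unop b = (adjointHom F t).unop ((adjointHom F s).unop b) := by
  rw [map_mul]
  rfl

include F in
theorem divergence_frame (i : Fin n) : divergence x d (d i) = 0 := by
  rw [divergence_apply]
  refine Finset.sum_eq_zero fun j _ => ?_
  rw [F.apply_x]
  split_ifs <;> simp

variable [CharZero K]

/-- Elements of the smash product that act by zero on `A` have zero adjoint. -/
theorem adjointHom_eq_zero {s : Smash K A} (hs : Smash.toEnd K A s = 0) :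
    adjointHom F s = 0 := by
  -- The normal form is taken for the action on `A` and for the adjoint simultaneously, with the
  -- same coefficients. These vanish by independence in End(A), and so the adjoint vanishes too.
  let Φ : Smash K A →ₐ[K] Module.End K A × (Module.End K A)ᵐᵒᵖ :=
    (Smash.toEnd K A).prod (adjointHom F)
  obtain ⟨a, ha⟩ := Smash.exists_normalForm Φ F (fun f δ => Prod.ext
    (LinearMap.ext fun b => by
      change Smash.toEnd K A (Smash.vec (f • δ)) b =
        Smash.toEnd K A (Smash.fn K f) (Smash.toEnd K A (Smash.vec δ) b)
      rw [Smash.toEnd_vec, Smash.toEnd_vec, Smash.toEnd_fn, Derivation.smul_apply, smul_eq_mul])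
    (MulOpposite.unop_injective (LinearMap.ext fun b => by
      change (adjointHom F (Smash.vec (f • δ))).unop b =
        (adjointHom F (Smash.fn K f) * adjointHom F (Smash.vec δ)).unop b
      rw [← map_mul, adjointHom_mul, adjointHom_vec, adjointHom_vec, adjointHom_fn,
        F.divergence_smul, Derivation.smul_apply, Derivation.leibniz, smul_eq_mul, smul_eq_mul]
      ring))) s
  have h1 : a = 0 := Smash.normalForm_unique F a fun f => by
    have h2 := congrArg (fun y => y.1 f) ha
    change Smash.toEnd K A s f = _ at h2
    rw [hs, Finsupp.sum, Prod.fst_sum, LinearMap.sum_apply] at h2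
    refine Eq.trans (Finset.sum_congr rfl fun α _ => ?_) h2.symm
    exact (Smash.toEnd_fn _ _).symm
  have h3 := congrArg Prod.snd ha
  rw [h1, Finsupp.sum_zero_index] at h3
  exact h3

variable (m : Ideal A) (K) in
/-- The delta function. -/
def deltaGen : DeltaModule K A m := Submodule.Quotient.mk 1

omit [CharZero K] in
theorem smul_deltaGen (m : Ideal A) (s : Smash K A) :
    s • deltaGen K m = (Submodule.Quotient.mk (Smash.toDiffOp K A s) : DeltaModule K A m) := by
  change Submodule.Quotient.mk (Smash.toDiffOp K A s • (1 : Smash.DiffOp K A)) = _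
  rw [smul_eq_mul, mul_one]

omit [CharZero K] in
theorem toDiffOp_surjective : Function.Surjective (Smash.toDiffOp K A) :=
  (Smash.toEnd K A).rangeRestrict_surjective

omit [CharZero K] in
theorem exists_smul_deltaGen {m : Ideal A} (z : DeltaModule K A m) :
    ∃ s : Smash K A, s • deltaGen K m = z := by
  obtain ⟨y, rfl⟩ := Submodule.Quotient.mk_surjective _ z
  obtain ⟨s, rfl⟩ := toDiffOp_surjective y
  exact ⟨s, smul_deltaGen m s⟩

omit [CharZero K] in
theorem toDiffOp_eq_zero {s : Smash K A} (h : Smash.toDiffOp K A s = 0) :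
    Smash.toEnd K A s = 0 := congrArg Subtype.val h

omit [CharZero K] in
theorem fn_smul_deltaGen_of_mem {m : Ideal A} {f : A} (hf : f ∈ m) :
    Smash.fn K f • deltaGen K m = 0 := by
  rw [smul_deltaGen]
  exact (Submodule.Quotient.mk_eq_zero _).mpr (Submodule.subset_span ⟨f, hf, rfl⟩)

omit [CharZero K] in
/-- Differential operators are linear over functions. -/
theorem vec_smul_delta {m : Ideal A} (f : A) (δ : Derivation K A A) (z : DeltaModule K A m) :
    Smash.vec (f • δ) • z = Smash.fn K f • Smash.vec δ • z := by
  have h : Smash.toDiffOp K A (Smash.vec (f • δ)) =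
      Smash.toDiffOp K A (Smash.fn K f) * Smash.toDiffOp K A (Smash.vec δ) := by
    refine Subtype.ext (LinearMap.ext fun b => ?_)
    change Smash.toEnd K A (Smash.vec (f • δ)) b =
      Smash.toEnd K A (Smash.fn K f) (Smash.toEnd K A (Smash.vec δ) b)
    rw [Smash.toEnd_vec, Smash.toEnd_vec, Smash.toEnd_fn, Derivation.smul_apply, smul_eq_mul]
  change Smash.toDiffOp K A (Smash.vec (f • δ)) • z =
    Smash.toDiffOp K A (Smash.fn K f) • Smash.toDiffOp K A (Smash.vec δ) • z
  rw [h, mul_smul]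

/-- Delta functions as functionals on functions. -/
theorem exists_deltaPairing {m : Ideal A} (p : A →ₐ[K] K) (hp : ∀ f ∈ m, p f = 0) :
    ∃ Ψ : DeltaModule K A m →+ (A →ₗ[K] K), ∀ (s : Smash K A) (g : A),
      Ψ (s • deltaGen K m) g = p ((adjointHom F s).unop g) := by
  let π : Smash K A →+ DeltaModule K A m :=
    AddMonoidHom.mk' (fun s => s • deltaGen K m) fun s t => add_smul s t _
  let θ : Smash K A →+ (A →ₗ[K] K) :=
    AddMonoidHom.mk' (fun s => p.toLinearMap ∘ₗ (adjointHom F s).unop) fun s t => by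
      ext g
      simp
  have hθ : ∀ s g, θ s g = p ((adjointHom F s).unop g) := fun _ _ => rfl
  have hker : ∀ s t : Smash K A, Smash.toDiffOp K A s = Smash.toDiffOp K A t →
      adjointHom F s = adjointHom F t := fun s t h => by
    rw [← sub_eq_zero, ← map_sub]
    refine adjointHom_eq_zero F (toDiffOp_eq_zero ?_)
    rw [map_sub, h, sub_self]
  -- Adjoints reverse products, so for an operator in D𝔪 the function from 𝔪 is multiplied on last
  -- and the value at the point is zero. By `hker`, the choice of a preimage in the smash product
  -- does not matter.
  have key : ∀ y ∈ Submodule.span (Smash.DiffOp K A)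
      ((fun f => Smash.toDiffOp K A (Smash.fn K f)) '' (m : Set A)),
      ∀ s : Smash K A, Smash.toDiffOp K A s = y → ∀ g, p ((adjointHom F s).unop g) = 0 := by
    intro y hy
    induction hy using Submodule.span_induction with
    | mem y hy =>
      obtain ⟨f, hf, rfl⟩ := hy
      intro s hs g
      rw [hker _ _ hs, adjointHom_fn, map_mul, hp f hf, zero_mul]
    | zero =>
      intro s hs g
      rw [hker s 0 (hs.trans (map_zero _).symm), map_zero]
      exact map_zero p
    | add y z _ _ hy hz =>
      intro s hs g
      obtain ⟨t, ht⟩ := toDiffOp_surjective (K := K) y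
      have h1 := hy t ht g
      have h2 := hz (s - t) (by rw [map_sub, hs, ht, add_sub_cancel_left]) g
      rw [map_sub] at h2
      change p ((adjointHom F s).unop g - (adjointHom F t).unop g) = 0 at h2
      rwa [map_sub, h1, sub_zero] at h2
    | smul r y _ hy =>
      intro s hs g
      obtain ⟨t, rfl⟩ := toDiffOp_surjective (K := K) r
      obtain ⟨u, rfl⟩ := toDiffOp_surjective (K := K) y
      have h1 : Smash.toDiffOp K A s = Smash.toDiffOp K A (t * u) := by
        rw [hs, map_mul, smul_eq_mul]
      rw [hker _ _ h1, adjointHom_mul]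
      exact hy u rfl _
  have hle : π.ker ≤ θ.ker := fun s hs => by
    have h1 : s • deltaGen K m = 0 := hs
    rw [smul_deltaGen] at h1
    refine LinearMap.ext fun g => ?_
    exact key _ ((Submodule.Quotient.mk_eq_zero _).mp h1) s rfl g
  have hsurj : Function.Surjective π := fun z => exists_smul_deltaGen z
  refine ⟨π.liftOfSurjective hsurj ⟨θ, hle⟩, fun s g => ?_⟩
  rw [← hθ]
  exact DFunLike.congr_fun (AddMonoidHom.liftOfRightInverse_comp_apply π _ _ ⟨θ, hle⟩ s) g

-- The derivations of the frame have divergence zero, so each one is minus its adjoint, and the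
-- reversal of factors has no effect because they commute.
omit [CharZero K] in
theorem adjointHom_diffMonomial (α : Fin n →₀ ℕ) (g : A) :
    (adjointHom F (Smash.diffMonomial d α)).unop g =
      (-1) ^ α.degree * Smash.toEnd K A (Smash.diffMonomial d α) g := by
  induction hk : α.degree generalizing α g with
  | zero =>
    obtain rfl : α = 0 := (Finsupp.degree_eq_zero_iff α).mp hk
    rw [Smash.diffMonomial_zero, map_one, map_one]
    simp
  | succ k ih =>
    obtain ⟨i, hi⟩ : ∃ i, α i ≠ 0 := by
      by_contra hcon
      push Not at hcon
      rw [show α = 0 from Finsupp.ext hcon, map_zero] at hk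
      omega
    have hα : α - Finsupp.single i 1 + Finsupp.single i 1 = α :=
      tsub_add_cancel_of_le (by simpa using Nat.one_le_iff_ne_zero.mpr hi)
    have hdeg : (α - Finsupp.single i 1).degree = k := by
      have := congrArg Finsupp.degree hα
      rw [map_add, Finsupp.degree_single] at this
      omega
    have hc : Smash.vec (d i) * Smash.diffMonomial d (α - Finsupp.single i 1) =
        Smash.diffMonomial d (α - Finsupp.single i 1) * Smash.vec (d i) := by
      refine Commute.list_prod_right _ _ fun y hy => ?_
      obtain ⟨j, rfl⟩ := (List.mem_ofFn' _ _).mp hy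
      exact (Smash.commute_vec F.lie_eq_zero _ _).pow_right _
    rw [← hα, ← Smash.vec_mul_diffMonomial F.lie_eq_zero, adjointHom_mul, ih _ _ hdeg,
      adjointHom_vec, divergence_frame F, zero_mul, add_zero, hc, map_mul, Module.End.mul_apply,
      Smash.toEnd_vec, map_neg, pow_succ]
    ring

/-- The functions `(x - x(P))^β` are dual to the delta functions `d^α δ`. -/
theorem exists_dual_function (p : A →ₐ[K] K) (β : Fin n →₀ ℕ) : ∃ g : A, ∀ α,
    p ((adjointHom F (Smash.diffMonomial d α)).unop g) ≠ 0 ↔ α = β := by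
  classical
  -- Taylor expansion at the point is multiplicative and sends `x_i - x_i(P)` to the variable `X_i`,
  -- so the monomial in these functions expands to the single monomial `X^β`.
  let T : A →* PS n K :=
    { toFun := fun f => MvPowerSeries.map (p : A →+* K) (taylor d f)
      map_one' := by rw [taylor_one F.comm, map_one]
      map_mul' := fun f g => by rw [taylor_mul F.comm, map_mul] }
  have hT : ∀ f, T f = MvPowerSeries.map (p : A →+* K) (taylor d f) := fun _ => rfl
  have hX : ∀ i, T (x i - algebraMap K A (p (x i))) = MvPowerSeries.X i := fun i => by
    have h1 : algebraMap K A (p (x i)) = p (x i) • 1 := Algebra.algebraMap_eq_smul_one _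
    rw [hT, taylor_sub, F.taylor_x, h1, taylor_smul, taylor_one F.comm, map_sub, map_add,
      MvPowerSeries.map_C, MvPowerSeries.map_X]
    have h2 : MvPowerSeries.map (p : A →+* K) (p (x i) • (1 : PS n A)) =
        MvPowerSeries.C (p (x i)) := by
      ext s
      rw [MvPowerSeries.coeff_map]
      change p (p (x i) • MvPowerSeries.coeff s 1) = _
      rw [map_smul, MvPowerSeries.coeff_one, MvPowerSeries.coeff_C]
      split_ifs <;> simp
    rw [h2]
    simp
  refine ⟨β.prod fun i k => (x i - algebraMap K A (p (x i))) ^ k, fun α => ?_⟩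
  have h3 : T (β.prod fun i k => (x i - algebraMap K A (p (x i))) ^ k) =
      MvPowerSeries.monomial β 1 := by
    rw [MvPowerSeries.monomial_one_eq, Finsupp.prod, map_prod]
    refine Finset.prod_congr rfl fun i _ => ?_
    rw [map_pow, hX]
  have hf : ((∏ i, (α i).factorial : ℕ) : K) ≠ 0 :=
    Nat.cast_ne_zero.mpr (Finset.prod_ne_zero_iff.mpr fun i _ => Nat.factorial_ne_zero _)
  have h4 := congrArg (MvPowerSeries.coeff α) h3
  rw [hT, MvPowerSeries.coeff_map] at h4
  change p _ = _ at h4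
  rw [adjointHom_diffMonomial, Smash.toEnd_diffMonomial_apply, map_mul, map_smul, h4,
    MvPowerSeries.coeff_monomial]
  have h5 : p ((-1) ^ α.degree) ≠ 0 := by
    rw [map_pow, map_neg, map_one]
    exact pow_ne_zero _ (by simp)
  split_ifs with h
  · simp only [h, smul_eq_mul, mul_one, iff_true]
    exact mul_ne_zero (h ▸ h5) (h ▸ hf)
  · simp [h]

end DeltaFunctions


/-! ### AV-modules over a ring, their tensor products and delta functions -/

section Actions

variable (K : Type u) [Field K] (A : Type u) [CommRing A] [Algebra K A]

/-- An action of the derivations of `A` on an `A`-module, as in an `AV`-module. -/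
structure AVAction (M : Type u) [AddCommGroup M] [Module A M] where
  act : Derivation K A A → M →+ M
  add_act : ∀ (η μ : Derivation K A A) (m : M), act (η + μ) m = act η m + act μ m
  smul_act : ∀ (c : K) (η : Derivation K A A) (m : M),
    act (c • η) m = algebraMap K A c • act η m
  lie_act : ∀ (η μ : Derivation K A A) (m : M),
    act ⁅η, μ⁆ m = act η (act μ m) - act μ (act η m)
  leibniz : ∀ (η : Derivation K A A) (f : A) (m : M),
    act η (f • m) = η f • m + f • act η m

variable {K A}

namespace AVAction

variable {M : Type u} [AddCommGroup M] [Module A M] (a : AVAction K A M)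

/-- The corresponding representation of the smash product. -/
def smash : Smash K A →+* AddMonoid.End M :=
  -- The `K`-structure is induced from `A` and used only locally. The operators are `K`-linear
  -- because derivations kill constants.
  letI : Module K M := Module.compHom M (algebraMap K A)
  haveI : IsScalarTower K A M := ⟨fun c f m => by
    rw [Algebra.smul_def, mul_smul]; rfl⟩
  (Module.toAddMonoidEnd (Module.End K M) M).comp (Smash.lift
    (B := Module.End K M)
    (Algebra.lsmul K K M)
    { toFun := fun η =>
        { toFun := a.act η
          map_add' := map_add _
          map_smul' := fun c m => by
            change a.act η (algebraMap K A c • m) = algebraMap K A c • a.act η m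
            rw [a.leibniz, Derivation.map_algebraMap, zero_smul, zero_add] }
      map_add' := fun η μ => LinearMap.ext fun m => a.add_act η μ m
      map_smul' := fun c η => LinearMap.ext fun m => a.smul_act c η m }
    (fun η μ => LinearMap.ext fun m => a.lie_act η μ m)
    (fun η f => LinearMap.ext fun m => a.leibniz η f m)).toRingHom

theorem smash_fn (f : A) (m : M) : a.smash (Smash.fn K f) m = f • m := by
  let _ : Module K M := Module.compHom M (algebraMap K A)
  have : IsScalarTower K A M := ⟨fun c f m => by
    rw [Algebra.smul_def, mul_smul]; rfl⟩
  exact DFunLike.congr_fun (Smash.lift_fn (B := Module.End K M) _ _ _ _ f) m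

theorem smash_vec (η : Derivation K A A) (m : M) : a.smash (Smash.vec η) m = a.act η m := by
  let _ : Module K M := Module.compHom M (algebraMap K A)
  have : IsScalarTower K A M := ⟨fun c f m => by
    rw [Algebra.smul_def, mul_smul]; rfl⟩
  exact DFunLike.congr_fun (Smash.lift_vec (B := Module.End K M) _ _ _ _ η) m

variable {N : Type u} [AddCommGroup N] [Module A N] (b : AVAction K A N)

/-- The operator `η(m ⊗ n) = ηm ⊗ n + m ⊗ ηn`. -/
def tensorOp (η : Derivation K A A) : M ⊗[A] N →+ M ⊗[A] N :=
  TensorProduct.liftAddHom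
    { toFun := fun m =>
        { toFun := fun n => a.act η m ⊗ₜ n + m ⊗ₜ b.act η n
          map_zero' := by simp
          map_add' := fun n n' => by
            rw [TensorProduct.tmul_add, map_add, TensorProduct.tmul_add]; abel }
      map_zero' := by ext n; simp
      map_add' := fun m m' => by
        ext n
        simp only [AddMonoidHom.add_apply, AddMonoidHom.coe_mk, ZeroHom.coe_mk, map_add,
          TensorProduct.add_tmul]
        abel }
    (fun f m n => by
      simp only [AddMonoidHom.coe_mk, ZeroHom.coe_mk, a.leibniz, b.leibniz,
        TensorProduct.add_tmul, TensorProduct.tmul_add, TensorProduct.smul_tmul]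
      abel)

theorem tensorOp_tmul (η : Derivation K A A) (m : M) (n : N) :
    a.tensorOp b η (m ⊗ₜ n) = a.act η m ⊗ₜ n + m ⊗ₜ b.act η n := rfl

/-- The tensor product of two actions. -/
def tensor : AVAction K A (M ⊗[A] N) where
  act := a.tensorOp b
  add_act η μ t := by
    induction t with
    | zero => simp
    | add x y hx hy => rw [map_add, map_add, map_add, hx, hy]; abel
    | tmul m n =>
      rw [tensorOp_tmul, tensorOp_tmul, tensorOp_tmul, a.add_act, b.add_act,
        TensorProduct.add_tmul, TensorProduct.tmul_add]
      abel
  smul_act c η t := by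
    induction t with
    | zero => simp
    | add x y hx hy => rw [map_add, map_add, hx, hy, smul_add]
    | tmul m n =>
      rw [tensorOp_tmul, tensorOp_tmul, a.smul_act, b.smul_act, smul_add,
        TensorProduct.smul_tmul', TensorProduct.tmul_smul]
  lie_act η μ t := by
    induction t with
    | zero => simp
    | add x y hx hy => simp only [map_add, hx, hy]; abel
    | tmul m n =>
      simp only [tensorOp_tmul, map_add, a.lie_act, b.lie_act, TensorProduct.sub_tmul,
        TensorProduct.tmul_sub]
      abel
  leibniz η f t := by
    induction t with
    | zero => simp
    | add x y hx hy => simp only [map_add, hx, hy, smul_add]; abel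
    | tmul m n =>
      simp only [tensorOp_tmul, TensorProduct.smul_tmul', a.leibniz, smul_add,
        TensorProduct.add_tmul]
      abel

theorem tensor_act_tmul (η : Derivation K A A) (m : M) (n : N) :
    (a.tensor b).act η (m ⊗ₜ n) = a.act η m ⊗ₜ n + m ⊗ₜ b.act η n := rfl

end AVAction

instance (m : Ideal A) : Module A (DeltaModule K A m) :=
  Module.compHom (DeltaModule K A m)
    ({ toFun := Smash.fn K
       map_one' := Smash.fn_one K
       map_mul' := Smash.fn_mul K
       map_zero' := Smash.fn_zero K
       map_add' := Smash.fn_add K } : A →+* Smash K A)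

theorem delta_smul_def {m : Ideal A} (f : A) (z : DeltaModule K A m) :
    f • z = Smash.fn K f • z := rfl

/-- The action on delta functions. -/
def deltaAction (m : Ideal A) : AVAction K A (DeltaModule K A m) where
  act η := DistribSMul.toAddMonoidHom _ (Smash.vec η)
  add_act η μ z := by
    change Smash.vec (η + μ) • z = Smash.vec η • z + Smash.vec μ • z
    rw [Smash.vec_add, add_smul]
  smul_act c η z := by
    change Smash.vec (c • η) • z = Smash.fn K (algebraMap K A c) • Smash.vec η • z
    rw [Smash.vec_smul, Smash.fn_scalar, ← mul_smul, Algebra.smul_def]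
  lie_act η μ z := by
    change Smash.vec ⁅η, μ⁆ • z =
      Smash.vec η • Smash.vec μ • z - Smash.vec μ • Smash.vec η • z
    rw [Smash.vec_lie, sub_smul, mul_smul, mul_smul]
  leibniz η f z := by
    change Smash.vec η • Smash.fn K f • z =
      Smash.fn K (η f) • z + Smash.fn K f • Smash.vec η • z
    rw [← mul_smul, Smash.vec_mul_fn, add_smul, mul_smul]

theorem deltaAction_act {m : Ideal A} (η : Derivation K A A) (z : DeltaModule K A m) :
    (deltaAction m).act η z = Smash.vec η • z := rfl

variable {n : ℕ} {W : Type u} [AddCommGroup W] [Module K W] [LieRingModule (Lplus n K) W]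
  [LieModule K (Lplus n K) W] {N : ℕ} (h : IsDegreeBound (n := n) (K := K) W N) [CharZero K]
  {x : Fin n → A} {d : Fin n → Derivation K A A} (F : IsFrame x d)

/-- The action on `A ⊗ W` in local coordinates. -/
def frameAction : AVAction K A (A ⊗[K] W) where
  act η := (frameAct W x d η).toAddMonoidHom
  add_act η μ t := frameAct_add h η μ t
  smul_act c η t := by
    rw [algebraMap_smul]
    exact frameAct_smul_left h c η t
  lie_act η μ t := F.frameAct_lie h η μ t
  leibniz η f t := frameAct_smul η f t

theorem frameAction_act (η : Derivation K A A) (t : A ⊗[K] W) :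
    (frameAction h F).act η t = frameAct W x d η t := rfl

end Actions

/-! ### Spanning of induced modules by monomials in the derivations -/

section Spanning

variable {n : ℕ} {K : Type u} [Field K] {A : Type u} [CommRing A] [Algebra K A]
  {x : Fin n → A} {d : Fin n → Derivation K A A} (F : IsFrame x d)
  {M : Type u} [AddCommGroup M] [Module (Smash K A) M]

include F in
/-- If an additive subgroup `M₀` is stable under `A` and under the derivations with values in `m`, where
`A = K + m`, then the submodule it generates is spanned by the `d^α z` with `z ∈ M₀`. -/
theorem smul_mem_diffSpan {m : Ideal A} (hm : ∀ f : A, ∃ c : K, f - algebraMap K A c ∈ m)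
    (M₀ : AddSubgroup M) (hfn : ∀ f : A, ∀ z ∈ M₀, Smash.fn K f • z ∈ M₀)
    (hvec : ∀ η ∈ m • (⊤ : Submodule A (Derivation K A A)), ∀ z ∈ M₀, Smash.vec η • z ∈ M₀)
    (s : Smash K A) {y : M}
    (hy : y ∈ AddSubgroup.closure {y | ∃ α, ∃ z ∈ M₀, y = Smash.diffMonomial d α • z}) :
    s • y ∈ AddSubgroup.closure {y | ∃ α, ∃ z ∈ M₀, y = Smash.diffMonomial d α • z} := by
  set S := AddSubgroup.closure {y | ∃ α, ∃ z ∈ M₀, y = Smash.diffMonomial d α • z} with hS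
  have hgen : ∀ α, ∀ z ∈ M₀, Smash.diffMonomial d α • z ∈ S := fun α z hz =>
    AddSubgroup.subset_closure ⟨α, z, hz, rfl⟩
  have hclos : ∀ s : Smash K A, (∀ α, ∀ z ∈ M₀, s • Smash.diffMonomial d α • z ∈ S) →
      ∀ y ∈ S, s • y ∈ S := by
    intro s hs y hy
    induction hy using AddSubgroup.closure_induction with
    | mem y hy =>
      obtain ⟨α, z, hz, rfl⟩ := hy
      exact hs α z hz
    | zero =>
      rw [smul_zero]
      exact zero_mem _
    | add a b _ _ ha hb =>
      rw [smul_add]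
      exact add_mem ha hb
    | neg a _ ha =>
      rw [smul_neg]
      exact neg_mem ha
  have hd : ∀ i, ∀ y ∈ S, Smash.vec (d i) • y ∈ S := fun i => hclos _ fun α z hz => by
    rw [← mul_smul, Smash.vec_mul_diffMonomial F.lie_eq_zero]
    exact hgen _ z hz
  have hind : ∀ P : (Fin n →₀ ℕ) → Prop, P 0 → (∀ α i, P α → P (α + Finsupp.single i 1)) →
      ∀ α, P α := by
    intro P h0 h1 α
    induction hk : α.degree generalizing α with
    | zero =>
      obtain rfl : α = 0 := (Finsupp.degree_eq_zero_iff α).mp hk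
      exact h0
    | succ k ih =>
      obtain ⟨i, hi⟩ : ∃ i, α i ≠ 0 := by
        by_contra hcon
        push Not at hcon
        rw [show α = 0 from Finsupp.ext hcon, map_zero] at hk
        omega
      have hα : α - Finsupp.single i 1 + Finsupp.single i 1 = α :=
        tsub_add_cancel_of_le (by simpa using Nat.one_le_iff_ne_zero.mpr hi)
      rw [← hα]
      refine h1 _ _ (ih _ ?_)
      have := congrArg Finsupp.degree hα
      rw [map_add, Finsupp.degree_single] at this
      omega
  have hfnS : ∀ f : A, ∀ y ∈ S, Smash.fn K f • y ∈ S := by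
    have h1 : ∀ α, ∀ f : A, ∀ z ∈ M₀, Smash.fn K f • Smash.diffMonomial d α • z ∈ S := by
      refine hind _ (fun f z hz => ?_) fun α i hα f z hz => ?_
      · rw [Smash.diffMonomial_zero, one_smul]
        have := hgen 0 _ (hfn f z hz)
        rwa [Smash.diffMonomial_zero, one_smul] at this
      · have h2 : Smash.fn K f * Smash.vec (d i) =
            Smash.vec (d i) * Smash.fn K f - Smash.fn K (d i f) := by
          rw [Smash.vec_mul_fn, add_sub_cancel_left]
        rw [← Smash.vec_mul_diffMonomial F.lie_eq_zero, mul_smul, ← mul_smul, h2, sub_smul,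
          mul_smul]
        exact sub_mem (hd i _ (hα f z hz)) (hα _ z hz)
    exact fun f => hclos _ fun α z hz => h1 α f z hz
  have hvecS : ∀ η : Derivation K A A, ∀ y ∈ S, Smash.vec η • y ∈ S := by
    -- Moving a derivation past `d i` costs its bracket with `d i`, which is another derivation; the
    -- induction therefore runs over all of them at once.
    have h1 : ∀ α, ∀ η : Derivation K A A, ∀ z ∈ M₀,
        Smash.vec η • Smash.diffMonomial d α • z ∈ S := by
      refine hind _ (fun η z hz => ?_) fun α i hα η z hz => ?_
      · rw [Smash.diffMonomial_zero, one_smul]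
        have hz0 : z ∈ S := by
          have := hgen 0 z hz
          rwa [Smash.diffMonomial_zero, one_smul] at this
        -- The coefficients are split into their values at the point and a remainder in 𝔪. The
        -- constants contribute multiples of the `d i`, and the remainder lies in 𝔪V, which
        -- preserves `M₀`.
        choose c hc using fun i => hm (η (x i))
        have h2 : η = (∑ i, c i • d i) + ∑ i, (η (x i) - algebraMap K A (c i)) • d i := by
          conv_lhs => rw [F.eq_sum η]
          rw [← Finset.sum_add_distrib]
          refine Finset.sum_congr rfl fun i _ => ?_
          rw [sub_smul, algebraMap_smul, add_sub_cancel]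
        have h3 : Smash.vec (∑ i, c i • d i) • z = ∑ i, Smash.fn K (algebraMap K A (c i)) •
            Smash.vec (d i) • z := by
          let v : Derivation K A A →+ Smash K A := AddMonoidHom.mk' Smash.vec fun a b =>
            Smash.vec_add K a b
          have h4 : Smash.vec (∑ i, c i • d i) = ∑ i, Smash.vec (c i • d i) := map_sum v _ _
          rw [h4, Finset.sum_smul]
          refine Finset.sum_congr rfl fun i _ => ?_
          rw [Smash.vec_smul, Smash.fn_scalar, ← mul_smul, Algebra.smul_def]
        rw [h2, Smash.vec_add, add_smul, h3]
        refine add_mem (sum_mem fun i _ => hfnS _ _ (hd i z hz0)) ?_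
        have := hgen 0 _ (hvec (∑ i, (η (x i) - algebraMap K A (c i)) • d i)
          (sum_mem fun i _ => Submodule.smul_mem_smul (hc i) trivial) z hz)
        rwa [Smash.diffMonomial_zero, one_smul] at this
      · have h2 : Smash.vec η * Smash.vec (d i) =
            Smash.vec (d i) * Smash.vec η + Smash.vec ⁅η, d i⁆ := by
          rw [Smash.vec_lie, add_sub_cancel]
        rw [← Smash.vec_mul_diffMonomial F.lie_eq_zero, mul_smul, ← mul_smul, h2, add_smul,
          mul_smul]
        exact add_mem (hd i _ (hα η z hz)) (hα _ z hz)
    exact fun η => hclos _ fun α z hz => h1 α η z hz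
  induction s using Smash.induction generalizing y with
  | scalar c =>
    rw [← Smash.fn_scalar]
    exact hfnS _ y hy
  | fn a => exact hfnS a y hy
  | vec η => exact hvecS η y hy
  | add s t hs ht =>
    rw [add_smul]
    exact add_mem (hs hy) (ht hy)
  | mul s t hs ht =>
    rw [mul_smul]
    exact hs (ht hy)

end Spanning


/-! ### Action of functions and of 𝔪V on the delta function and on jets at P -/

section Rudakov

variable {n : ℕ} {K : Type u} [Field K] [CharZero K] {A : Type u} [CommRing A] [Algebra K A]
  {x : Fin n → A} {d : Fin n → Derivation K A A} (F : IsFrame x d)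
  {m : Ideal A} {p : A →ₐ[K] K} (hp : ∀ f, f ∈ m ↔ p f = 0)

include hp in
omit [CharZero K] in
theorem sub_algebraMap_mem (f : A) : f - algebraMap K A (p f) ∈ m := by
  rw [hp, map_sub, AlgHom.commutes, Algebra.algebraMap_self_apply, sub_self]

include hp in
omit [CharZero K] in
theorem smul_deltaGen_eq (f : A) : f • deltaGen K m = algebraMap K A (p f) • deltaGen K m := by
  have h := fn_smul_deltaGen_of_mem (K := K) (sub_algebraMap_mem hp f)
  rw [← delta_smul_def, sub_smul] at h
  exact sub_eq_zero.mp h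

-- For `f` in 𝔪, one has f μ δ_P = μ f δ_P - μ(f) δ_P = -μ(f)(P) δ_P, and the divergence of `f • μ`
-- at P is μ(f)(P). This scalar is the reason for the twist by the trace.
include F hp in
omit [CharZero K] in
theorem vec_smul_deltaGen {η : Derivation K A A} (hη : η ∈ m • (⊤ : Submodule A (Derivation K A A))) :
    Smash.vec η • deltaGen K m = -algebraMap K A (p (divergence x d η)) • deltaGen K m := by
  induction hη using Submodule.smul_induction_on' with
  | smul f hf μ _ =>
    have h1 : Smash.fn K f * Smash.vec μ = Smash.vec μ * Smash.fn K f - Smash.fn K (μ f) := by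
      rw [Smash.vec_mul_fn, add_sub_cancel_left]
    rw [vec_smul_delta, ← mul_smul, h1, sub_smul, mul_smul, fn_smul_deltaGen_of_mem hf, smul_zero,
      zero_sub, ← delta_smul_def, smul_deltaGen_eq hp, F.divergence_smul, map_add, map_mul,
      (hp f).mp hf, zero_mul, zero_add, neg_smul]
  | add η _ μ _ h1 h2 =>
    rw [Smash.vec_add, add_smul, h1, h2, map_add, map_add, map_add, neg_add, add_smul]

variable {W : Type u} [AddCommGroup W] [Module K W]

/-- The value at a point of a `W`-valued function. -/
def evalPoint (p : A →ₐ[K] K) (W : Type u) [AddCommGroup W] [Module K W] : A ⊗[K] W →+ W :=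
  (TensorProduct.lid K W).toLinearMap.toAddMonoidHom.comp (extMap W p).toAddMonoidHom

omit [CharZero K] in
theorem evalPoint_tmul (f : A) (w : W) : evalPoint p W (f ⊗ₜ w) = p f • w := by
  simp [evalPoint, extMap]

-- Functions move across the tensor product to the delta function, which sees only their values at
-- P.
include hp in
omit [CharZero K] in
theorem deltaGen_tmul (t : A ⊗[K] W) :
    deltaGen K m ⊗ₜ[A] t = deltaGen K m ⊗ₜ[A] ((1 : A) ⊗ₜ[K] evalPoint p W t) := by
  induction t with
  | zero => simp
  | add a b ha hb => rw [map_add, TensorProduct.tmul_add, ha, hb, TensorProduct.tmul_add,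
      TensorProduct.tmul_add]
  | tmul f w =>
    have h1 : (f ⊗ₜ[K] w : A ⊗[K] W) = f • ((1 : A) ⊗ₜ[K] w) := by
      rw [TensorProduct.smul_tmul', smul_eq_mul, mul_one]
    have h2 : algebraMap K A (p f) • ((1 : A) ⊗ₜ[K] w) = (1 : A) ⊗ₜ[K] (p f • w) := by
      rw [algebraMap_smul, TensorProduct.tmul_smul]
    rw [evalPoint_tmul, ← h2, h1, ← TensorProduct.smul_tmul, smul_deltaGen_eq hp,
      TensorProduct.smul_tmul]

variable [LieRingModule (Lplus n K) W] [LieModule K (Lplus n K) W]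

include hp in
omit [CharZero K] in
theorem IsExpansion.map_taylor {η : Derivation K A A} {ξ : Lplus n K}
    (hξ : IsExpansion A m x d η ξ) (i : Fin n) :
    MvPowerSeries.map (p : A →+* K) (taylor d (η (x i))) = ξ.1 (MvPowerSeries.X i) := by
  ext s
  have h1 := (hp _).mp (hξ i s)
  rw [map_sub, AlgHom.commutes, Algebra.algebraMap_self_apply] at h1
  rw [MvPowerSeries.coeff_map]
  exact sub_eq_zero.mp h1

-- The summand δ ⊗ 1 kills `1 ⊗ w`. In the other summand, evaluation at P turns the Taylor
-- coefficients into those of `ξ`.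
include hp in
omit [CharZero K] in
theorem evalPoint_frameAct {N : ℕ} (h : IsDegreeBound (n := n) (K := K) W N)
    {η : Derivation K A A} {ξ : Lplus n K} (hξ : IsExpansion A m x d η ξ) (w : W) :
    evalPoint p W (frameAct W x d η ((1 : A) ⊗ₜ[K] w)) = ⁅ξ, w⁆ := by
  rw [frameAct_apply, derT_tmul, Derivation.map_one_eq_zero, TensorProduct.zero_tmul, zero_add]
  have h1 := lieAct_natural h p (fun i => taylor d (η (x i))) ((1 : A) ⊗ₜ[K] w)
  have h2 : (fun i => MvPowerSeries.map (p : A →+* K) (taylor d (η (x i)))) =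
      fun i => MvPowerSeries.map (algebraMap K K) (ξ.1 (MvPowerSeries.X i)) := funext fun i => by
    rw [hξ.map_taylor hp i]
    ext s
    rw [MvPowerSeries.coeff_map]
    rfl
  rw [h2, lieAct_map h] at h1
  change TensorProduct.lid K W (TensorProduct.map p.toLinearMap LinearMap.id _) = _
  rw [h1]
  simp

-- The coefficient at `X_i` of the expansion of η(x_i) is the value at P of ∂_i η(x_i).
include F hp in
theorem IsExpansion.traceChar_eq {η : Derivation K A A} {ξ : Lplus n K}
    (hξ : IsExpansion A m x d η ξ) : traceChar ξ = p (divergence x d η) := by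
  rw [divergence_apply]
  refine Eq.trans ?_ (map_sum p _ _).symm
  change ∑ i : Fin n, MvPowerSeries.coeff (Finsupp.single i 1) (ξ.1 (MvPowerSeries.X i)) = _
  refine Finset.sum_congr rfl fun i _ => ?_
  have h2 := congrArg MvPowerSeries.constantCoeff (pderiv_taylor F.comm i (η (x i)))
  rw [constantCoeff_taylor, ← MvPowerSeries.coeff_zero_eq_constantCoeff_apply,
    MvPowerSeries.coeff_pderiv] at h2
  rw [← hξ.map_taylor hp, MvPowerSeries.coeff_map, ← h2]
  simp

-- Values of a derivation in 𝔪V lie in 𝔪, so the constant terms dropped by `toLplus` are zero to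
-- begin with.
include hp in
omit [CharZero K] in
theorem exists_isExpansion {η : Derivation K A A}
    (hη : η ∈ m • (⊤ : Submodule A (Derivation K A A))) :
    ∃ ξ : Lplus n K, IsExpansion A m x d η ξ := by
  have hm : ∀ f, η f ∈ m := by
    induction hη using Submodule.smul_induction_on' with
    | smul f hf μ _ => exact fun g => Ideal.mul_mem_right _ _ hf
    | add η _ μ _ h1 h2 => exact fun g => add_mem (h1 g) (h2 g)
  refine ⟨toLplus fun i => MvPowerSeries.map (p : A →+* K) (taylor d (η (x i))), fun i s => ?_⟩
  rw [hp, map_sub, AlgHom.commutes, Algebra.algebraMap_self_apply, sub_eq_zero]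
  by_cases hs : s = 0
  · subst hs
    rw [Lplus.coeff_zero, MvPowerSeries.coeff_zero_eq_constantCoeff_apply, constantCoeff_taylor]
    exact (hp _).mp (hm _)
  · rw [coeff_toLplus_X _ _ hs, MvPowerSeries.coeff_map]
    rfl

include F in
theorem IsFrame.frameAct_one_tmul {N : ℕ} (h : IsDegreeBound (n := n) (K := K) W N) (i : Fin n)
    (w : W) : frameAct W x d (d i) ((1 : A) ⊗ₜ[K] w) = 0 := by
  have h1 : frameVec x d (d i) = 0 := funext fun j => by
    rw [frameVec, F.apply_x]
    split_ifs
    · rw [taylor_one F.comm, map_one, sub_self]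
      rfl
    · rw [taylor_zero, map_zero, sub_self]
      rfl
  rw [frameAct, totalAct_apply, h1, lieAct_zero h, derT_tmul, Derivation.map_one_eq_zero,
    TensorProduct.zero_tmul, LinearMap.zero_apply, add_zero]

variable {N : ℕ} (h : IsDegreeBound (n := n) (K := K) W N)

/-- The coordinate derivations have constant coefficients, so they annihilate `1 ⊗ w`, and by the
Leibniz rule they act on the delta factor only. -/
theorem smash_diffMonomial_tmul (α : Fin n →₀ ℕ) (z : DeltaModule K A m) (w : W) :
    ((deltaAction m).tensor (frameAction h F)).smash (Smash.diffMonomial d α)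
      (z ⊗ₜ[A] ((1 : A) ⊗ₜ[K] w)) = (Smash.diffMonomial d α • z) ⊗ₜ[A] ((1 : A) ⊗ₜ[K] w) := by
  induction hk : α.degree generalizing α with
  | zero =>
    obtain rfl : α = 0 := (Finsupp.degree_eq_zero_iff α).mp hk
    rw [Smash.diffMonomial_zero, map_one, one_smul]
    rfl
  | succ k ih =>
    obtain ⟨i, hi⟩ : ∃ i, α i ≠ 0 := by
      by_contra hcon
      push Not at hcon
      rw [show α = 0 from Finsupp.ext hcon, map_zero] at hk
      omega
    have hα : α - Finsupp.single i 1 + Finsupp.single i 1 = α :=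
      tsub_add_cancel_of_le (by simpa using Nat.one_le_iff_ne_zero.mpr hi)
    have hdeg : (α - Finsupp.single i 1).degree = k := by
      have := congrArg Finsupp.degree hα
      rw [map_add, Finsupp.degree_single] at this
      omega
    rw [← hα, ← Smash.vec_mul_diffMonomial F.lie_eq_zero, map_mul, AddMonoid.End.coe_mul,
      Function.comp_apply, ih _ hdeg, AVAction.smash_vec, AVAction.tensor_act_tmul, frameAction_act,
      F.frameAct_one_tmul h, TensorProduct.tmul_zero, add_zero, deltaAction_act, mul_smul]

end Rudakov


/-! ### The isomorphism over the local ring -/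

section RudakovEquiv

variable {n : ℕ} {K : Type u} [Field K] [CharZero K] {A : Type u} [CommRing A] [Algebra K A]
  {x : Fin n → A} {d : Fin n → Derivation K A A} (F : IsFrame x d)
  {m : Ideal A} {p : A →ₐ[K] K} (hp : ∀ f, f ∈ m ↔ p f = 0)

section Pairing

variable (W : Type u) [AddCommGroup W] [Module K W]

/-- Integration of a `W`-valued function against a functional. -/
def pairValue (φ : A →ₗ[K] K) (g : A) : A ⊗[K] W →+ W :=
  ((TensorProduct.lid K W).toLinearMap ∘ₗ LinearMap.rTensor W φ).toAddMonoidHom.comp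
    (DistribSMul.toAddMonoidHom _ g)

omit [CharZero K] in
theorem pairValue_tmul (φ : A →ₗ[K] K) (g f : A) (w : W) :
    pairValue W φ g (f ⊗ₜ w) = φ (g * f) • w := by
  change TensorProduct.lid K W (LinearMap.rTensor W φ (g • f ⊗ₜ[K] w)) = _
  rw [TensorProduct.smul_tmul', smul_eq_mul, LinearMap.rTensor_tmul, TensorProduct.lid_tmul]

include F in
/-- The pairing of a delta function with values in `W` with a test function. -/
theorem exists_tensorPairing (hp0 : ∀ f ∈ m, p f = 0) (g : A) :
    ∃ Θ : DeltaModule K A m ⊗[A] (A ⊗[K] W) →+ W, ∀ (s : Smash K A) (f : A) (w : W),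
      Θ ((s • deltaGen K m) ⊗ₜ[A] (f ⊗ₜ[K] w)) = p ((adjointHom F s).unop (g * f)) • w := by
  obtain ⟨Ψ, hΨ⟩ := exists_deltaPairing (K := K) F p hp0
  have hΨ' : ∀ (a : A) z b, Ψ (a • z) b = Ψ z (a * b) := by
    intro a z b
    obtain ⟨s, rfl⟩ := exists_smul_deltaGen z
    rw [delta_smul_def, ← mul_smul, hΨ, hΨ, adjointHom_mul, adjointHom_fn]
  refine ⟨TensorProduct.liftAddHom
    { toFun := fun z => pairValue W (Ψ z) g
      map_zero' := ?_
      map_add' := fun y z => ?_ } ?_, fun s f w => ?_⟩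
  · ext t
    induction t with
    | zero => simp
    | add a b ha hb => rw [map_add, ha, hb, map_add]
    | tmul f w => rw [pairValue_tmul, map_zero, LinearMap.zero_apply, zero_smul]; rfl
  · ext t
    induction t with
    | zero => simp
    | add a b ha hb => rw [map_add, ha, hb, map_add]
    | tmul f w =>
      rw [AddMonoidHom.add_apply, pairValue_tmul, pairValue_tmul, pairValue_tmul, map_add,
        LinearMap.add_apply, add_smul]
  · intro a z t
    change pairValue W (Ψ (a • z)) g t = pairValue W (Ψ z) g (a • t)
    induction t with
    | zero => simp
    | add a b ha hb => rw [map_add, ha, hb, smul_add, map_add]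
    | tmul f w =>
      rw [TensorProduct.smul_tmul', smul_eq_mul, pairValue_tmul, pairValue_tmul, hΨ', mul_left_comm]
  · change pairValue W (Ψ (s • deltaGen K m)) g (f ⊗ₜ w) = _
    rw [pairValue_tmul, hΨ]

end Pairing

variable {W : Type u} [AddCommGroup W] [Module K W] [LieRingModule (Lplus n K) W]
  [LieModule K (Lplus n K) W]

variable (n K W) in
/-- The identification of the vector spaces `W` and `W ⊗ K_tr`. -/
def trTensor : W ≃ₗ[K] W ⊗[K] KTr n K := (TensorProduct.rid K W).symm

omit [CharZero K] in
theorem lie_trTensor (ξ : Lplus n K) (w : W) :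
    ⁅ξ, trTensor n K W w⁆ = trTensor n K W (⁅ξ, w⁆ + traceChar ξ • w) := by
  have h1 : ∀ w : W, trTensor n K W w = w ⊗ₜ[K] (show KTr n K from (1 : K)) := fun w =>
    TensorProduct.rid_symm_apply w
  have h2 : ⁅ξ, (show KTr n K from (1 : K))⁆ = traceChar ξ • (show KTr n K from (1 : K)) := rfl
  rw [map_add, map_smul, h1, h1, TensorProduct.LieModule.lie_tmul_right, h2,
    TensorProduct.tmul_smul]

variable {N : ℕ} (h : IsDegreeBound (n := n) (K := K) (W ⊗[K] KTr n K) N)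

variable (n K A m W) in
/-- The tensor product of the module of delta functions with functions with values
in `W ⊗ K_tr`. -/
abbrev DeltaTensor : Type u := DeltaModule K A m ⊗[A] (A ⊗[K] (W ⊗[K] KTr n K))

/-- The action of derivations on the product of delta functions and jets. -/
abbrev deltaTensorAction : AVAction K A (DeltaTensor n K A m W) :=
  (deltaAction m).tensor (frameAction h F)

variable (n K A m W) in
/-- The map `w ↦ δ ⊗ w`. -/
def deltaVec : W →+ DeltaTensor n K A m W where
  toFun w := deltaGen K m ⊗ₜ[A] ((1 : A) ⊗ₜ[K] trTensor n K W w)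
  map_zero' := by rw [map_zero, TensorProduct.tmul_zero, TensorProduct.tmul_zero]
  map_add' v w := by rw [map_add, TensorProduct.tmul_add, TensorProduct.tmul_add]

omit [CharZero K] [LieRingModule (Lplus n K) W] [LieModule K (Lplus n K) W] in
theorem deltaVec_apply (w : W) : deltaVec n K A m W w =
    deltaGen K m ⊗ₜ[A] ((1 : A) ⊗ₜ[K] trTensor n K W w) := rfl

omit [CharZero K] [LieRingModule (Lplus n K) W] [LieModule K (Lplus n K) W] in
theorem algebraMap_smul_deltaVec (c : K) (w : W) :
    algebraMap K A c • deltaVec n K A m W w = deltaVec n K A m W (c • w) := by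
  rw [deltaVec_apply, deltaVec_apply, map_smul, TensorProduct.tmul_smul, ← algebraMap_smul A c,
    TensorProduct.tmul_smul]

-- On the delta function η acts by minus its divergence at P, and on `W ⊗ K_tr` by `ξ` plus the
-- trace of `ξ`, which equals this divergence. The two scalars cancel, and exactly the action on `W`
-- remains.
include hp in
theorem act_deltaVec {η : Derivation K A A} (hη : η ∈ m • (⊤ : Submodule A (Derivation K A A)))
    {ξ : Lplus n K} (hξ : IsExpansion A m x d η ξ) (w : W) :
    (deltaTensorAction F h (m := m)).act η (deltaVec n K A m W w) = deltaVec n K A m W ⁅ξ, w⁆ := by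
  rw [deltaVec_apply, AVAction.tensor_act_tmul, deltaAction_act, frameAction_act,
    vec_smul_deltaGen F hp hη, deltaGen_tmul hp, evalPoint_frameAct hp h hξ, lie_trTensor,
    hξ.traceChar_eq F hp, neg_smul, TensorProduct.neg_tmul, ← TensorProduct.smul_tmul',
    ← deltaVec_apply, ← deltaVec_apply, map_add, algebraMap_smul_deltaVec]
  abel

variable (m) in
/-- The map from the free module that induces the isomorphism of the Rudakov module with the
tensor product. -/
def rudakovLift : Smash K A ⊗[K] W →+ DeltaTensor n K A m W :=
  TensorProduct.liftAddHom
    { toFun := fun s => ((deltaTensorAction F h).smash s).comp (deltaVec n K A m W)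
      map_zero' := by
        ext w
        rw [map_zero]
        rfl
      map_add' := fun s t => by
        ext w
        rw [map_add]
        rfl }
    (fun c s w => by
      change (deltaTensorAction F h).smash (c • s) _ =
        (deltaTensorAction F h).smash s (deltaVec n K A m W (c • w))
      have h1 : c • s = s * Smash.fn K (algebraMap K A c) := by
        rw [Smash.fn_scalar, Algebra.smul_def, Algebra.commutes]
      rw [h1, map_mul, AddMonoid.End.coe_mul, Function.comp_apply, AVAction.smash_fn,
        algebraMap_smul_deltaVec])

theorem rudakovLift_tmul (s : Smash K A) (w : W) : rudakovLift F m h (s ⊗ₜ w) =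
    (deltaTensorAction F h).smash s (deltaVec n K A m W w) := rfl

theorem rudakovLift_smul (s : Smash K A) (t : Smash K A ⊗[K] W) : rudakovLift F m h (s • t) =
    (deltaTensorAction F h).smash s (rudakovLift F m h t) := by
  induction t with
  | zero => simp
  | add a b ha hb => rw [smul_add, map_add, map_add, map_add, ha, hb]
  | tmul r w =>
    rw [TensorProduct.smul_tmul', smul_eq_mul, rudakovLift_tmul, rudakovLift_tmul, map_mul]
    rfl

include hp in
theorem rudakovLift_rel {t : Smash K A ⊗[K] W} (ht : t ∈ inducedRel A W m x d) :
    rudakovLift F m h t = 0 := by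
  induction ht using Submodule.span_induction with
  | zero => exact map_zero _
  | add a b _ _ ha hb => rw [map_add, ha, hb, add_zero]
  | smul s a _ ha => rw [rudakovLift_smul, ha, map_zero]
  | mem t ht =>
    rcases ht with ⟨f, hf, w, rfl⟩ | ⟨η, hη, ξ, hξ, w, rfl⟩
    · rw [rudakovLift_tmul, AVAction.smash_fn, deltaVec_apply, TensorProduct.smul_tmul',
        delta_smul_def, fn_smul_deltaGen_of_mem hf, TensorProduct.zero_tmul]
    · rw [map_sub, rudakovLift_tmul, rudakovLift_tmul, AVAction.smash_vec,
        act_deltaVec F hp h hη hξ, map_one]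
      exact sub_self _

/-- The homomorphism from the Rudakov module to the tensor product. -/
def rudakovHom : RudakovModule A W m x d →+ DeltaTensor n K A m W :=
  QuotientAddGroup.lift (inducedRel A W m x d).toAddSubgroup (rudakovLift F m h)
    fun _ ht => rudakovLift_rel F hp h ht

theorem rudakovHom_mk (t : Smash K A ⊗[K] W) :
    rudakovHom F hp h (Submodule.Quotient.mk t) = rudakovLift F m h t := rfl

theorem rudakovHom_smul (s : Smash K A) (r : RudakovModule A W m x d) :
    rudakovHom F hp h (s • r) = (deltaTensorAction F h).smash s (rudakovHom F hp h r) := by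
  obtain ⟨t, rfl⟩ := Submodule.Quotient.mk_surjective _ r
  rw [← Submodule.Quotient.mk_smul, rudakovHom_mk, rudakovHom_mk, rudakovLift_smul]

variable (x d m W) in
/-- The image of `W` in the Rudakov module. -/
def rudakovVec : W →+ RudakovModule A W m x d where
  toFun w := Submodule.Quotient.mk (1 ⊗ₜ w)
  map_zero' := by rw [TensorProduct.tmul_zero]; rfl
  map_add' v w := by rw [TensorProduct.tmul_add]; rfl

variable (x d m W) in
/-- Linear combinations of the monomials in the `∂/∂xᵢ`, with coefficients in `W`. -/
def rudakovSum : ((Fin n →₀ ℕ) →₀ W) →+ RudakovModule A W m x d :=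
  Finsupp.liftAddHom fun α => (DistribSMul.toAddMonoidHom (RudakovModule A W m x d)
    (Smash.diffMonomial d α)).comp (rudakovVec x d m W)

omit [CharZero K] [LieModule K (Lplus n K) W] in
theorem smul_rudakovVec (s : Smash K A) (w : W) :
    s • rudakovVec x d m W w = Submodule.Quotient.mk (s ⊗ₜ w) := by
  change s • (Submodule.Quotient.mk (1 ⊗ₜ w) : RudakovModule A W m x d) = _
  rw [← Submodule.Quotient.mk_smul, TensorProduct.smul_tmul', smul_eq_mul, mul_one]

-- By the defining relations the image of `W` is stable under functions and under 𝔪V. Only this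
-- spanning half of a PBW statement is established directly; independence is seen after mapping to
-- the tensor product.
include F hp in
omit [CharZero K] [LieModule K (Lplus n K) W] in
theorem rudakovSum_surjective : Function.Surjective (rudakovSum x d m W) := by
  have h1 := smul_mem_diffSpan F (M := RudakovModule A W m x d) (m := m)
    (fun f => ⟨p f, sub_algebraMap_mem hp f⟩) (rudakovVec x d m W).range ?_ ?_
  · have h2 : AddSubgroup.closure {y : RudakovModule A W m x d |
        ∃ α, ∃ z ∈ (rudakovVec x d m W).range, y = Smash.diffMonomial d α • z} ≤
        (rudakovSum x d m W).range := by
      rw [AddSubgroup.closure_le]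
      rintro _ ⟨α, _, ⟨w, rfl⟩, rfl⟩
      exact ⟨Finsupp.single α w, by simp [rudakovSum]⟩
    intro y
    obtain ⟨t, rfl⟩ := Submodule.Quotient.mk_surjective _ y
    change _ ∈ (rudakovSum x d m W).range
    refine h2 ?_
    induction t with
    | zero => exact zero_mem _
    | add a b ha hb => exact add_mem ha hb
    | tmul s w =>
      rw [← smul_rudakovVec]
      refine h1 s (AddSubgroup.subset_closure ⟨0, _, ⟨w, rfl⟩, ?_⟩)
      rw [Smash.diffMonomial_zero, one_smul]
  · rintro f _ ⟨w, rfl⟩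
    refine ⟨p f • w, ?_⟩
    have h3 : (Smash.fn K (f - algebraMap K A (p f)) ⊗ₜ[K] w : Smash K A ⊗[K] W) ∈
        inducedRel A W m x d :=
      Submodule.subset_span (Or.inl ⟨_, sub_algebraMap_mem hp f, w, rfl⟩)
    have h4 := (Submodule.Quotient.mk_eq_zero _).mpr h3
    rw [← smul_rudakovVec] at h4
    have h5 : Smash.fn K f = Smash.fn K (f - algebraMap K A (p f)) + algebraMap K _ (p f) := by
      rw [← Smash.fn_scalar, ← Smash.fn_add, sub_add_cancel]
    rw [h5, add_smul, h4, zero_add, smul_rudakovVec, Algebra.algebraMap_eq_smul_one,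
      TensorProduct.smul_tmul]
    rfl
  · rintro η hη _ ⟨w, rfl⟩
    obtain ⟨ξ, hξ⟩ := exists_isExpansion hp (x := x) (d := d) hη
    refine ⟨⁅ξ, w⁆, ?_⟩
    rw [smul_rudakovVec]
    have h3 : Smash.vec η ⊗ₜ[K] w - 1 ⊗ₜ[K] ⁅ξ, w⁆ ∈ inducedRel A W m x d :=
      Submodule.subset_span (Or.inr ⟨η, hη, ξ, hξ, w, rfl⟩)
    exact ((Submodule.Quotient.eq _).mpr h3).symm

theorem rudakovHom_rudakovSum (u : (Fin n →₀ ℕ) →₀ W) :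
    rudakovHom F hp h (rudakovSum x d m W u) = u.sum fun α w =>
      (Smash.diffMonomial d α • deltaGen K m) ⊗ₜ[A] ((1 : A) ⊗ₜ[K] trTensor n K W w) := by
  rw [rudakovSum, Finsupp.liftAddHom_apply, Finsupp.sum, map_sum]
  refine Finset.sum_congr rfl fun α _ => ?_
  change rudakovHom F hp h (Smash.diffMonomial d α • rudakovVec x d m W (u α)) = _
  rw [smul_rudakovVec, rudakovHom_mk, rudakovLift_tmul, deltaVec_apply, smash_diffMonomial_tmul]

/-- Pairing the image with the test function dual to ∂^β δ_P isolates the coefficient at β, up to a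
non-zero scalar. -/
theorem rudakovHom_injective : Function.Injective (rudakovHom (W := W) F hp h) := by
  rw [injective_iff_map_eq_zero]
  intro y hy
  obtain ⟨u, rfl⟩ := rudakovSum_surjective F hp y
  suffices hu : u = 0 by rw [hu, map_zero]
  ext β
  obtain ⟨g, hg⟩ := exists_dual_function F p β
  obtain ⟨Θ, hΘ⟩ := exists_tensorPairing F (W ⊗[K] KTr n K) (m := m) (fun f hf => (hp f).mp hf) g
  have h1 := congrArg Θ hy
  rw [rudakovHom_rudakovSum, map_zero, Finsupp.sum, map_sum, Finset.sum_eq_single β] at h1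
  · rw [hΘ, mul_one, smul_eq_zero] at h1
    rcases h1 with h1 | h1
    · exact absurd h1 ((hg β).mpr rfl)
    · simpa using h1
  · intro α _ hα
    have h2 : p ((adjointHom F (Smash.diffMonomial d α)).unop g) = 0 := by
      by_contra h3
      exact hα ((hg α).mp h3)
    rw [hΘ, mul_one, h2, zero_smul]
  · intro hβ
    rw [Finsupp.notMem_support_iff.mp hβ, map_zero, TensorProduct.tmul_zero,
      TensorProduct.tmul_zero, map_zero]

include F hp in
omit [CharZero K] in
theorem delta_mem_span (z : DeltaModule K A m) : z ∈ AddSubgroup.closure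
    {y : DeltaModule K A m | ∃ (α : Fin n →₀ ℕ) (c : K),
      y = Smash.diffMonomial d α • algebraMap K A c • deltaGen K m} := by
  let M₀ : AddSubgroup (DeltaModule K A m) := AddMonoidHom.range
    (AddMonoidHom.mk' (fun c : K => algebraMap K A c • deltaGen K m) fun a b => by
      rw [map_add, add_smul])
  have h1 := smul_mem_diffSpan F (M := DeltaModule K A m) (m := m)
    (fun f => ⟨p f, sub_algebraMap_mem hp f⟩) M₀ ?_ ?_
  · have h2 : AddSubgroup.closure {y : DeltaModule K A m |
        ∃ α, ∃ z ∈ M₀, y = Smash.diffMonomial d α • z} ≤ AddSubgroup.closure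
        {y : DeltaModule K A m | ∃ (α : Fin n →₀ ℕ) (c : K),
        y = Smash.diffMonomial d α • algebraMap K A c • deltaGen K m} := by
      refine AddSubgroup.closure_mono ?_
      rintro _ ⟨α, _, ⟨c, rfl⟩, rfl⟩
      exact ⟨α, c, rfl⟩
    obtain ⟨s, rfl⟩ := exists_smul_deltaGen z
    refine h2 (h1 s (AddSubgroup.subset_closure ⟨0, deltaGen K m, ⟨1, ?_⟩, ?_⟩))
    · change algebraMap K A 1 • deltaGen K m = _
      rw [map_one, one_smul]
    · rw [Smash.diffMonomial_zero, one_smul]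
  · rintro f _ ⟨c, rfl⟩
    refine ⟨p f * c, ?_⟩
    change algebraMap K A (p f * c) • deltaGen K m = f • algebraMap K A c • deltaGen K m
    rw [smul_comm, smul_deltaGen_eq hp f, ← mul_smul, ← map_mul, mul_comm]
  · rintro η hη _ ⟨c, rfl⟩
    refine ⟨-(c * p (divergence x d η)), ?_⟩
    change algebraMap K A _ • deltaGen K m = (deltaAction m).act η (algebraMap K A c • deltaGen K m)
    rw [AVAction.leibniz, Derivation.map_algebraMap, zero_smul, zero_add, deltaAction_act,
      vec_smul_deltaGen F hp hη, ← mul_smul, map_neg, map_mul, mul_neg]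

/-- Scalars from `A` can be moved to the delta factor, and delta functions are combinations of the
∂^α δ_P, whose products with constant vectors are visibly in the image. -/
theorem rudakovHom_surjective : Function.Surjective (rudakovHom (W := W) F hp h) := by
  have h1 : ∀ z w, (z ⊗ₜ[A] ((1 : A) ⊗ₜ[K] trTensor n K W w) : DeltaTensor n K A m W) ∈
      (rudakovHom F hp h).range := by
    intro z w
    induction delta_mem_span F hp z using AddSubgroup.closure_induction with
    | zero => rw [TensorProduct.zero_tmul]; exact zero_mem _
    | add a b _ _ ha hb => rw [TensorProduct.add_tmul]; exact add_mem ha hb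
    | neg a _ ha => rw [TensorProduct.neg_tmul]; exact neg_mem ha
    | mem z hz =>
      obtain ⟨α, c, rfl⟩ := hz
      refine ⟨Submodule.Quotient.mk (Smash.diffMonomial d α ⊗ₜ (c • w)), ?_⟩
      rw [rudakovHom_mk, rudakovLift_tmul, ← algebraMap_smul_deltaVec, deltaVec_apply,
        TensorProduct.smul_tmul', smash_diffMonomial_tmul]
  intro t
  change t ∈ (rudakovHom F hp h).range
  induction t using TensorProduct.induction_on with
  | zero => exact zero_mem _
  | add a b ha hb => exact add_mem ha hb
  | tmul z t =>
    induction t with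
    | zero => rw [TensorProduct.tmul_zero]; exact zero_mem _
    | add a b ha hb => rw [TensorProduct.tmul_add]; exact add_mem ha hb
    | tmul f w =>
      have h2 := h1 (f • z) ((trTensor n K W).symm w)
      rwa [LinearEquiv.apply_symm_apply, TensorProduct.smul_tmul, TensorProduct.smul_tmul',
        smul_eq_mul, mul_one] at h2

/-- The Rudakov module of `W` is the tensor product of delta functions and functions with values
in `W ⊗ K_tr`. -/
def rudakovEquiv : RudakovModule A W m x d ≃+ DeltaTensor n K A m W :=
  AddEquiv.ofBijective (rudakovHom F hp h)
    ⟨rudakovHom_injective F hp h, rudakovHom_surjective F hp h⟩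

theorem rudakovEquiv_fn (f : A) (r : RudakovModule A W m x d) :
    rudakovEquiv F hp h (Smash.fn K f • r) = f • rudakovEquiv F hp h r := by
  refine (rudakovHom_smul F hp h _ r).trans ?_
  rw [AVAction.smash_fn]
  rfl

theorem rudakovEquiv_vec (η : Derivation K A A) (r : RudakovModule A W m x d) :
    rudakovEquiv F hp h (Smash.vec η • r) =
      (deltaTensorAction F h).act η (rudakovEquiv F hp h r) := by
  refine (rudakovHom_smul F hp h _ r).trans ?_
  rw [AVAction.smash_vec]
  rfl

end RudakovEquiv


/-! ### Values at closed points -/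

section ClosedPoint

variable (K : Type u) [Field K] {X : Scheme.{u}} [X.Over (Spec (.of K))]

/-- The algebra structure on the stalk was defined through global sections. Its identification with
the structure morphism makes it comparable with the residue field. -/
theorem SpecMap_algebraMap_stalk (P : X) :
    Spec.map (CommRingCat.ofHom (algebraMap K (X.presheaf.stalk P))) =
      X.fromSpecStalk P ≫ (X ↘ Spec (.of K)) := by
  have h1 : CommRingCat.ofHom (algebraMap K (X.presheaf.stalk P)) =
      (Scheme.ΓSpecIso (.of K)).inv ≫ (X ↘ Spec (.of K)).appTop ≫
        X.presheaf.germ ⊤ P trivial := by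
    ext c
    change (X.presheaf.germ ⊤ P trivial).hom ((X.presheaf.map (homOfLE (le_top : (⊤ : X.Opens) ≤ ⊤)).op).hom _) = _
    exact TopCat.Presheaf.germ_res_apply X.presheaf _ _ _ _
  rw [h1, Spec.map_comp, Spec.map_comp, ← Scheme.fromSpecStalk_toSpecΓ]
  simp only [Category.assoc]
  rw [← Scheme.toSpecΓ_naturality_assoc, ← SpecMap_ΓSpecIso_hom, ← Spec.map_comp,
    Iso.inv_hom_id, Spec.map_id, Category.comp_id]

/-- The value of a germ at a closed point, for a scheme locally of finite type over an
algebraically closed field. -/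
theorem exists_value [IsAlgClosed K] [LocallyOfFiniteType (X ↘ Spec (.of K))] {P : X}
    (hP : IsClosed {P}) : ∃ p : X.presheaf.stalk P →ₐ[K] K,
      ∀ f, f ∈ IsLocalRing.maximalIdeal (X.presheaf.stalk P) ↔ p f = 0 := by
  -- By the Nullstellensatz, the residue field at a closed point is the algebraically closed base
  -- field.
  let e := residueFieldIsoBase (X ↘ Spec (.of K)) P hP
  have he : CommRingCat.ofHom (algebraMap K (X.presheaf.stalk P)) ≫ X.residue P = e.inv := by
    apply Spec.map_injective
    rw [SpecMap_residueFieldIsoBase_inv, Spec.map_comp, SpecMap_algebraMap_stalk,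
      Scheme.fromSpecResidueField, Category.assoc]
  have he' : CommRingCat.ofHom (algebraMap K (X.presheaf.stalk P)) ≫ X.residue P ≫ e.hom = 𝟙 _ := by
    rw [← Category.assoc, he, Iso.inv_hom_id]
  refine ⟨{ toRingHom := (X.residue P ≫ e.hom).hom
            commutes' := fun c => DFunLike.congr_fun (congrArg CommRingCat.Hom.hom he') c },
    fun f => ?_⟩
  change _ ↔ e.hom.hom ((X.residue P).hom f) = 0
  rw [map_eq_zero_iff e.hom.hom e.commRingCatIsoToRingEquiv.injective]
  exact (IsLocalRing.residue_eq_zero_iff f).symm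

end ClosedPoint

/-! ### Differentiability of tensor products, sheaves and delta functions -/

section Differentiability

variable {K : Type u} [Field K] {X : Scheme.{u}} [X.Over (Spec (.of K))]

namespace VectorField

theorem stalk_fun_smul {U : X.Opens} {P : X} (g : Γ(X, U)) (η : VectorField K U) (hP : P ∈ U) :
    (g • η).stalk hP = germFun K hP g • η.stalk hP := by
  ext a
  obtain ⟨V', hV', hPV, f, rfl⟩ := exists_germ_le (K := K) hP a
  rw [Derivation.smul_apply, stalk_germ _ hP hV', stalk_germ _ hP hV', smul_eq_mul,
    ← germFun_res K hV' hPV g, ← map_mul]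
  rfl

theorem restrict_smul {U V : X.Opens} (h : V ≤ U) (g : Γ(X, U)) (η : VectorField K U) :
    (g • η).restrict h = resFun K h g • η.restrict h := by
  ext V' hV' f
  change resFun K (hV'.trans h) g * _ = resFun K hV' (resFun K h g) * _
  rw [resFun_comp]
  rfl

end VectorField

namespace AVPresheaf

variable {M M' : AVPresheaf K X} {N : ℕ}

theorem sum_choose_eq_zero (R : Type*) [CommRing R] (hN : 1 ≤ N) :
    ∑ k ∈ Finset.range (N + 1), (-1) ^ k * (N.choose k : R) = 0 := by
  have h1 := add_pow (-1 : R) 1 N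
  rw [neg_add_cancel, zero_pow (by omega)] at h1
  rw [h1]
  exact Finset.sum_congr rfl fun k _ => by rw [one_pow, mul_one]

/-- A vector field acts on a tensor as a sum of two terms, and in each of them the relation for the
corresponding factor applies separately. -/
theorem IsDifferentiable.preTensor (h : M.IsDifferentiable N) (h' : M'.IsDifferentiable N) :
    (preTensor M M').IsDifferentiable N := by
  intro U f η t
  change ∑ k ∈ Finset.range (N + 1), ((-1) ^ k * (N.choose k : Γ(X, U)) * f ^ k) •
    tensorAct M M' (f ^ (N - k) • η) t = 0
  induction t using TensorProduct.induction_on with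
  | zero => simp
  | add a b ha hb => simp only [map_add, smul_add, Finset.sum_add_distrib, ha, hb, add_zero]
  | tmul m m' =>
    have h1 := congrArg (fun z => z ⊗ₜ[Γ(X, U)] m') (h U f η m)
    have h2 := congrArg (fun z => m ⊗ₜ[Γ(X, U)] z) (h' U f η m')
    simp only [TensorProduct.sum_tmul, TensorProduct.tmul_sum, TensorProduct.zero_tmul,
      TensorProduct.tmul_zero] at h1 h2
    simp only [tensorAct_tmul, smul_add, Finset.sum_add_distrib]
    refine (congrArg₂ (· + ·) (Eq.trans ?_ h1) (Eq.trans ?_ h2)).trans (add_zero _)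
    · exact Finset.sum_congr rfl fun k _ => TensorProduct.smul_tmul' _ _ _
    · exact Finset.sum_congr rfl fun k _ => (TensorProduct.tmul_smul _ _ _).symm

theorem IsDifferentiable.sheafify (h : M.IsDifferentiable N) : M.sheafify.IsDifferentiable N := by
  intro U f η s
  refine M.shSections_ext fun P => ?_
  obtain ⟨V, hV, hP, m, hm⟩ := M.exists_germ P.2 (s.1 P)
  let ev : M.sheafify.obj U →+ M.Stalk P.1 := AddMonoidHom.mk' (fun s => s.1 P) fun _ _ => rfl
  let γ : M.obj V →+ M.Stalk P.1 := AddMonoidHom.mk' (M.germ hP) fun a b => M.germ_add hP a b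
  change ev (∑ k ∈ Finset.range (N + 1), ((-1) ^ k * (N.choose k : Γ(X, U)) * f ^ k) •
    M.sheafify.act (f ^ (N - k) • η) s) = ev 0
  rw [map_sum, map_zero, ← map_zero γ, ← h V (resFun K hV f) (η.restrict hV) m, map_sum]
  refine Finset.sum_congr rfl fun k _ => ?_
  change (M.smulOp _).stalk P.2 ((M.actOp _).stalk P.2 (s.1 P)) = M.germ hP _
  rw [← hm, LocalOp.stalk_germ _ _ hV, LocalOp.stalk_germ _ _ hV]
  refine congrArg _ ?_
  change resFun K hV ((-1) ^ k * (N.choose k : Γ(X, U)) * f ^ k) •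
    M.act ((f ^ (N - k) • η).restrict hV) m = _
  rw [VectorField.restrict_smul]
  simp only [map_mul, map_pow, map_neg, map_one, map_natCast]

theorem Iso.isDifferentiable (e : Iso M M') (h : M'.IsDifferentiable N) : M.IsDifferentiable N := by
  intro U f η m
  apply (e.equiv U).injective
  rw [map_zero, map_sum, ← h U f η (e.equiv U m)]
  exact Finset.sum_congr rfl fun k _ => by rw [e.map_smul, e.map_act]

end AVPresheaf

/-- In a D-module the action is linear over functions in the vector field, so every summand is a
multiple of f^N η and the alternating sum of binomial coefficients is zero. -/
theorem delta_isDifferentiable (P : X) {N : ℕ} (hN : 1 ≤ N) :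
    (delta K P).IsDifferentiable N := by
  intro U f η z
  have h1 : ∀ g : Γ(X, U), (delta K P).act (g • η) z = g • (delta K P).act η z := by
    intro g
    funext h
    change Smash.vec ((g • η).stalk h.down) • z h =
      Smash.fn K (germFun K h.down g) • Smash.vec (η.stalk h.down) • z h
    rw [VectorField.stalk_fun_smul, vec_smul_delta]
  have h2 : ∀ k ∈ Finset.range (N + 1), ((-1) ^ k * (N.choose k : Γ(X, U)) * f ^ k) •
      (delta K P).act (f ^ (N - k) • η) z =
      ((-1) ^ k * (N.choose k : Γ(X, U))) • f ^ N • (delta K P).act η z := by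
    intro k hk
    rw [h1, ← mul_smul, ← mul_smul, mul_assoc _ (f ^ k), ← pow_add,
      Nat.add_sub_cancel' (Nat.lt_succ_iff.mp (Finset.mem_range.mp hk))]
  rw [Finset.sum_congr rfl h2, ← Finset.sum_smul, AVPresheaf.sum_choose_eq_zero _ hN, zero_smul]

end Differentiability


/-! ### Presheaves supported at a closed point -/

section SkyscraperIso

variable {K : Type u} [Field K] {X : Scheme.{u}} [X.Over (Spec (.of K))]

namespace AVPresheaf

/-- The inverse isomorphism. -/
def Iso.symm {M N : AVPresheaf K X} (e : Iso M N) : Iso N M where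
  equiv U := (e.equiv U).symm
  map_smul U f m := (e.equiv U).injective (by
    rw [AddEquiv.apply_symm_apply, e.map_smul, AddEquiv.apply_symm_apply])
  map_act U η m := (e.equiv U).injective (by
    rw [AddEquiv.apply_symm_apply, e.map_act, AddEquiv.apply_symm_apply])
  map_res h m := (e.equiv _).injective (by
    rw [AddEquiv.apply_symm_apply, e.map_res, AddEquiv.apply_symm_apply])

variable (M : AVPresheaf K X) {P : X}

theorem subsingleton_stalk {V : X.Opens} (hP : P ∈ V)
    (hV : ∀ U ≤ V, Subsingleton (M.obj U)) : Subsingleton (M.Stalk P) := by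
  refine ⟨fun a b => ?_⟩
  obtain ⟨U, hU, hPU, m, m', rfl, rfl⟩ := M.exists_germ₂ hP a b
  have := hV U hU
  rw [Subsingleton.elim m m']

/-- The sections near `P` of a presheaf that is constant near `P` and vanishes outside of `P`. -/
structure PointSupport (P : X) (R : Type u) [AddCommGroup R]
    [Module (Smash K (X.presheaf.stalk P)) R] where
  U₀ : X.Opens
  mem : P ∈ U₀
  equiv : ∀ U : X.Opens, U ≤ U₀ → P ∈ U → (M.obj U ≃+ R)
  equiv_res : ∀ {U V : X.Opens} (h : V ≤ U) (hU : U ≤ U₀) (hP : P ∈ V) (m : M.obj U),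
    equiv V (h.trans hU) hP (M.res h m) = equiv U hU (h hP) m
  equiv_smul : ∀ (U : X.Opens) (hU : U ≤ U₀) (hP : P ∈ U) (f : Γ(X, U)) (m : M.obj U),
    equiv U hU hP (f • m) = Smash.fn K (germFun K hP f) • equiv U hU hP m
  equiv_act : ∀ (U : X.Opens) (hU : U ≤ U₀) (hP : P ∈ U) (η : VectorField K U) (m : M.obj U),
    equiv U hU hP (M.act η m) = Smash.vec (η.stalk hP) • equiv U hU hP m
  subsingleton : ∀ U : X.Opens, P ∉ U → Subsingleton (M.obj U)

variable {M} {R : Type u} [AddCommGroup R] [Module (Smash K (X.presheaf.stalk P)) R]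

namespace PointSupport

variable (S : M.PointSupport P R)

/-- The stalk at the point of support. -/
theorem exists_stalkEquiv : ∃ E : M.Stalk P ≃+ R, ∀ (U : X.Opens) (hU : U ≤ S.U₀) (hP : P ∈ U)
    (m : M.obj U), E (M.germ hP m) = S.equiv U hU hP m := by
  let E₀ : M.Stalk P → R := DirectLimit.lift (M.nhdRes P)
    (fun i m => S.equiv (i.U ⊓ S.U₀) inf_le_right ⟨i.mem, S.mem⟩ (M.res inf_le_left m))
    (fun i j hij m => by
      change _ = S.equiv (j.U ⊓ S.U₀) _ _ (M.res _ (M.res hij m))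
      rw [M.res_comp, ← S.equiv_res (inf_le_inf_right S.U₀ hij : j.U ⊓ S.U₀ ≤ i.U ⊓ S.U₀)
        inf_le_right ⟨j.mem, S.mem⟩, M.res_comp])
  have h1 : ∀ (U : X.Opens) (hU : U ≤ S.U₀) (hP : P ∈ U) (m : M.obj U),
      E₀ (M.germ hP m) = S.equiv U hU hP m := fun U hU hP m =>
    S.equiv_res (inf_le_left : U ⊓ S.U₀ ≤ U) hU ⟨hP, S.mem⟩ m
  let E : M.Stalk P →+ R := AddMonoidHom.mk' E₀ fun a b => by
    obtain ⟨U, hU, hP, m, m', rfl, rfl⟩ := M.exists_germ₂ S.mem a b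
    rw [← germ_add, h1 U hU, h1 U hU, h1 U hU, map_add]
  refine ⟨AddEquiv.ofBijective E ⟨fun a b hab => ?_, fun r => ?_⟩, h1⟩
  · obtain ⟨U, hU, hP, m, m', rfl, rfl⟩ := M.exists_germ₂ S.mem a b
    have h2 : S.equiv U hU hP m = S.equiv U hU hP m' := by
      rw [← h1, ← h1]
      exact hab
    rw [(S.equiv U hU hP).injective h2]
  · refine ⟨M.germ S.mem ((S.equiv S.U₀ le_rfl S.mem).symm r), ?_⟩
    exact (h1 S.U₀ le_rfl S.mem _).trans ((S.equiv S.U₀ le_rfl S.mem).apply_symm_apply r)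

include S in
theorem subsingleton_stalk_of_ne (hP : IsClosed {P}) {Q : X} (hQ : Q ≠ P) :
    Subsingleton (M.Stalk Q) :=
  M.subsingleton_stalk (V := ⟨{P}ᶜ, hP.isOpen_compl⟩) hQ
    fun U hU => S.subsingleton U fun h => hU h rfl

include S in
/-- The associated sheaf is a skyscraper sheaf. -/
theorem nonempty_iso (hP : IsClosed {P}) : Nonempty (Iso (skyscraper K P R) M.sheafify) := by
  classical
  obtain ⟨E, hE⟩ := S.exists_stalkEquiv
  let D : ∀ U, M.shSections U →+ (PLift (P ∈ U) → R) := fun U =>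
    AddMonoidHom.mk' (fun s h => E (s.1 ⟨P, h.down⟩)) fun s t => by
      funext h
      exact map_add E _ _
  -- The stalks away from P vanish, so a section is determined by its germ at P.
  have hinj : ∀ U, Function.Injective (D U) := by
    intro U s t hst
    refine M.shSections_ext fun Q => ?_
    obtain ⟨Q, hQ⟩ := Q
    by_cases h : Q = P
    · subst h
      exact E.injective (congrFun hst ⟨hQ⟩)
    · have := S.subsingleton_stalk_of_ne hP h
      exact Subsingleton.elim _ _
  have hsurj : ∀ U, Function.Surjective (D U) := by
    intro U φ
    by_cases hU : P ∈ U
    · let V := U ⊓ S.U₀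
      have hPV : P ∈ V := ⟨hU, S.mem⟩
      let m := (S.equiv V inf_le_right hPV).symm (φ ⟨hU⟩)
      -- The section with prescribed germ at P is extended by zero. At points outside `V` it is
      -- locally zero, because the complement of the closed point is open and all stalks there
      -- vanish.
      refine ⟨⟨fun Q => if hQ : Q.1 ∈ V then M.germ hQ m else 0, fun Q => ?_⟩, ?_⟩
      · by_cases hQ : Q.1 ∈ V
        · exact ⟨V, inf_le_left, hQ, m, fun Q' hQ' => dif_pos hQ'⟩
        · have hne : Q.1 ≠ P := fun h => hQ (h ▸ hPV)
          refine ⟨U ⊓ ⟨{P}ᶜ, hP.isOpen_compl⟩, inf_le_left, ⟨Q.2, hne⟩, 0, fun Q' hQ' => ?_⟩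
          have := S.subsingleton_stalk_of_ne hP (Q := Q') hQ'.2
          exact Subsingleton.elim _ _
      · funext h
        change E (if hQ : P ∈ V then M.germ hQ m else 0) = φ h
        rw [dif_pos hPV, hE V inf_le_right, AddEquiv.apply_symm_apply]
    · exact ⟨0, funext fun h => absurd h.down hU⟩
  have hsmul : ∀ (U : X.Opens) (hPU : P ∈ U) (f : Γ(X, U)) (a : M.Stalk P),
      E ((M.smulOp f).stalk hPU a) = Smash.fn K (germFun K hPU f) • E a := by
    intro U hPU f a
    obtain ⟨V, hV, hPV, m, rfl⟩ := M.exists_germ (U := U ⊓ S.U₀) ⟨hPU, S.mem⟩ a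
    rw [LocalOp.stalk_germ _ _ (hV.trans inf_le_left), hE V (hV.trans inf_le_right),
      hE V (hV.trans inf_le_right), ← germFun_res K (hV.trans inf_le_left) hPV]
    exact S.equiv_smul V _ _ _ m
  have hact : ∀ (U : X.Opens) (hPU : P ∈ U) (η : VectorField K U) (a : M.Stalk P),
      E ((M.actOp η).stalk hPU a) = Smash.vec (η.stalk hPU) • E a := by
    intro U hPU η a
    obtain ⟨V, hV, hPV, m, rfl⟩ := M.exists_germ (U := U ⊓ S.U₀) ⟨hPU, S.mem⟩ a
    rw [LocalOp.stalk_germ _ _ (hV.trans inf_le_left), hE V (hV.trans inf_le_right),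
      hE V (hV.trans inf_le_right), ← VectorField.stalk_restrict η (hV.trans inf_le_left) hPV]
    exact S.equiv_act V _ _ _ m
  exact ⟨Iso.symm
    { equiv := fun U => AddEquiv.ofBijective (D U) ⟨hinj U, hsurj U⟩
      map_smul := fun U f s => funext fun h => hsmul U h.down f _
      map_act := fun U η s => funext fun h => hact U h.down η _
      map_res := fun h s => rfl }⟩

end PointSupport

end AVPresheaf

end SkyscraperIso

/-! ### Tensor products with trivialized modules under base change -/

section BaseChange

variable {K : Type u} [Field K] {A B : Type u} [CommRing A] [Algebra K A] [CommRing B] [Algebra K B]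
  (φ : B →ₐ[K] A) {Y Z S W : Type u} [AddCommGroup Y] [Module B Y] [AddCommGroup Z] [Module A Z]
  [AddCommGroup S] [Module B S] [AddCommGroup W] [Module K W]
  (θ : Y ≃+ Z) (hθ : ∀ (b : B) (y : Y), θ (b • y) = φ b • θ y) (κ : S ≃ₗ[B] B ⊗[K] W)

include hθ in
/-- The base change of a tensor product with a trivialized module, in case the first factor is already
a module over the larger ring. -/
theorem exists_tensorEquiv : ∃ e : Y ⊗[B] S ≃+ Z ⊗[A] (A ⊗[K] W), ∀ y s,
    e (y ⊗ₜ s) = θ y ⊗ₜ extMap W φ (κ s) := by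
  let f : Y ⊗[B] S →+ Z ⊗[A] (A ⊗[K] W) := TensorProduct.liftAddHom
    { toFun := fun y =>
        { toFun := fun s => θ y ⊗ₜ[A] extMap W φ (κ s)
          map_zero' := by simp
          map_add' := fun s t => by rw [map_add, map_add, TensorProduct.tmul_add] }
      map_zero' := by
        ext s
        change θ 0 ⊗ₜ[A] _ = 0
        rw [map_zero, TensorProduct.zero_tmul]
      map_add' := fun y z => by
        ext s
        change θ (y + z) ⊗ₜ[A] _ = θ y ⊗ₜ[A] _ + θ z ⊗ₜ[A] _
        rw [map_add, TensorProduct.add_tmul] }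
    (fun b y s => by
      change θ (b • y) ⊗ₜ[A] extMap W φ (κ s) = θ y ⊗ₜ[A] extMap W φ (κ (b • s))
      rw [hθ, map_smul, extMap_smul, TensorProduct.smul_tmul])
  have hf : ∀ y s, f (y ⊗ₜ s) = θ y ⊗ₜ[A] extMap W φ (κ s) := fun _ _ => rfl
  -- In the inverse, scalars from the larger ring are absorbed by the first factor, which is already
  -- a module over it; no assumption on the homomorphism `φ` is needed.
  let g₁ : Z → A ⊗[K] W →+ Y ⊗[B] S := fun z => TensorProduct.liftAddHom
    { toFun := fun a =>
        { toFun := fun w => θ.symm (a • z) ⊗ₜ[B] κ.symm (1 ⊗ₜ w)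
          map_zero' := by simp
          map_add' := fun v w => by
            rw [TensorProduct.tmul_add, map_add, TensorProduct.tmul_add] }
      map_zero' := by
        ext w
        change θ.symm ((0 : A) • z) ⊗ₜ[B] _ = 0
        rw [zero_smul, map_zero, TensorProduct.zero_tmul]
      map_add' := fun a b => by
        ext w
        change θ.symm ((a + b) • z) ⊗ₜ[B] _ = θ.symm (a • z) ⊗ₜ[B] _ + θ.symm (b • z) ⊗ₜ[B] _
        rw [add_smul, map_add, TensorProduct.add_tmul] }
    (fun c a w => by
      change θ.symm ((c • a) • z) ⊗ₜ[B] κ.symm (1 ⊗ₜ w) =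
        θ.symm (a • z) ⊗ₜ[B] κ.symm (1 ⊗ₜ (c • w))
      have h1 : (1 : B) ⊗ₜ[K] (c • w) = algebraMap K B c • ((1 : B) ⊗ₜ[K] w) := by
        rw [algebraMap_smul, TensorProduct.tmul_smul]
      have h2 : θ.symm ((c • a) • z) = algebraMap K B c • θ.symm (a • z) := by
        apply θ.injective
        rw [hθ, AddEquiv.apply_symm_apply, AddEquiv.apply_symm_apply, AlgHom.commutes,
          Algebra.smul_def, mul_smul]
      rw [h1, h2, κ.symm.map_smul, TensorProduct.smul_tmul])
  have hg₁ : ∀ z a w, g₁ z (a ⊗ₜ w) = θ.symm (a • z) ⊗ₜ[B] κ.symm (1 ⊗ₜ w) := fun _ _ _ => rfl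
  let g : Z ⊗[A] (A ⊗[K] W) →+ Y ⊗[B] S := TensorProduct.liftAddHom
    { toFun := g₁
      map_zero' := by
        ext t
        induction t with
        | zero => simp
        | add s t hs ht => rw [map_add, hs, ht, map_add]
        | tmul a w =>
          rw [hg₁, smul_zero, map_zero, TensorProduct.zero_tmul]
          rfl
      map_add' := fun y z => by
        ext t
        induction t with
        | zero => simp
        | add s t hs ht => rw [map_add, hs, ht, map_add]
        | tmul a w =>
          rw [AddMonoidHom.add_apply, hg₁, hg₁, hg₁, smul_add, map_add, TensorProduct.add_tmul] }
    (fun a z t => by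
      change g₁ (a • z) t = g₁ z (a • t)
      induction t with
      | zero => simp
      | add s t hs ht => rw [map_add, hs, ht, smul_add, map_add]
      | tmul b w =>
        rw [TensorProduct.smul_tmul', smul_eq_mul, hg₁, hg₁, ← mul_smul, mul_comm])
  have hg : ∀ z a w, g (z ⊗ₜ (a ⊗ₜ w)) = θ.symm (a • z) ⊗ₜ[B] κ.symm (1 ⊗ₜ w) := fun _ _ _ => rfl
  have hextMap : ∀ (b : B) (w : W), extMap W φ (b ⊗ₜ w) = φ b ⊗ₜ w := fun _ _ => rfl
  have hgf : ∀ t, g (f t) = t := by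
    intro t
    induction t with
    | zero => simp
    | add s t hs ht => rw [map_add, map_add, hs, ht]
    | tmul y s =>
      obtain ⟨t, rfl⟩ := κ.symm.surjective s
      induction t with
      | zero => simp
      | add s t hs ht =>
        rw [map_add, TensorProduct.tmul_add, map_add, map_add, hs, ht]
      | tmul b w =>
        have h1 : (b ⊗ₜ[K] w : B ⊗[K] W) = b • (1 ⊗ₜ w) := by
          rw [TensorProduct.smul_tmul', smul_eq_mul, mul_one]
        rw [hf, LinearEquiv.apply_symm_apply, hextMap, hg, ← hθ, AddEquiv.symm_apply_apply, h1,
          κ.symm.map_smul, TensorProduct.smul_tmul]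
  have hfg : ∀ t, f (g t) = t := by
    intro t
    induction t with
    | zero => simp
    | add s t hs ht => rw [map_add, map_add, hs, ht]
    | tmul z t =>
      induction t with
      | zero => simp
      | add s t hs ht => rw [TensorProduct.tmul_add, map_add, map_add, hs, ht]
      | tmul a w =>
        rw [hg, hf, LinearEquiv.apply_symm_apply, AddEquiv.apply_symm_apply, hextMap, map_one,
          TensorProduct.smul_tmul, TensorProduct.smul_tmul', smul_eq_mul, mul_one]
  exact ⟨{ f with invFun := g, left_inv := hgf, right_inv := hfg }, hf⟩

end BaseChange


theorem AVPresheaf.preTensor_hom_ext {K : Type u} [Field K] {X : Scheme.{u}}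
    [X.Over (Spec (.of K))] {M M' : AVPresheaf K X} {U : X.Opens} {B : Type u} [AddCommMonoid B]
    {f g : (M.preTensor M').obj U →+ B}
    (h : ∀ m m', f (m ⊗ₜ[Γ(X, U)] m') = g (m ⊗ₜ[Γ(X, U)] m')) (t : (M.preTensor M').obj U) :
    f t = g t := by
  induction t using TensorProduct.induction_on with
  | zero => exact (map_zero f).trans (map_zero g).symm
  | add a b ha hb => exact (map_add f a b).trans ((congrArg₂ _ ha hb).trans (map_add g a b).symm)
  | tmul m m' => exact h m m'

/-! ### Sections of the product of delta functions and jets near P -/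

section PointTensor

variable {n : ℕ} {K : Type u} [Field K] [CharZero K] {X : Scheme.{u}} [X.Over (Spec (.of K))]
  [IsIntegral X] {W : Type u} [AddCommGroup W] [Module K W] [LieRingModule (Lplus n K) W]
  [LieModule K (Lplus n K) W] {σ : GLForm n K W} {N : ℕ} (hJ : IsJetAction X σ)
  (hσ : σ.Integrates) (h : IsDegreeBound (n := n) (K := K) W N) (hN : 0 < N)
  (c : EtaleChart K X n) {P : X}

/-- Sections of the jet bundle are functions with values in `W`. -/
def chartEquiv {U : X.Opens} (hU : U ≤ c.U) : (jet σ hJ).obj U ≃ₗ[Γ(X, U)] Γ(X, U) ⊗[K] W :=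
  LinearEquiv.ofBijective
    ({ toFun := chartValue hJ c hU
       map_add' := map_add _
       map_smul' := chartValue_smul hJ c hU } : (jet σ hJ).obj U →ₗ[Γ(X, U)] Γ(X, U) ⊗[K] W)
    ⟨chartValue_injective hJ c hU, hσ.chartValue_surjective hJ h hN c hU⟩

variable (K) in
/-- The sections of the skyscraper sheaf of delta functions over a neighbourhood of `P`. -/
def deltaEval {U : X.Opens} (hP : P ∈ U) : (delta K P).obj U ≃+
    DeltaModule K (X.presheaf.stalk P) (IsLocalRing.maximalIdeal (X.presheaf.stalk P)) where
  toFun z := z ⟨hP⟩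
  invFun z := fun _ => z
  left_inv _ := rfl
  right_inv _ := rfl
  map_add' _ _ := rfl

include hσ h hN in
theorem exists_deltaJetEquiv {U : X.Opens} (hU : U ≤ c.U) (hP : P ∈ U) :
    ∃ e : (AVPresheaf.preTensor (delta K P) (jet σ hJ)).obj U ≃+
      DeltaModule K (X.presheaf.stalk P) (IsLocalRing.maximalIdeal (X.presheaf.stalk P))
        ⊗[X.presheaf.stalk P] (X.presheaf.stalk P ⊗[K] W),
      ∀ (z : (delta K P).obj U) (s : (jet σ hJ).obj U), e (z ⊗ₜ[Γ(X, U)] s) =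
        deltaEval K hP z ⊗ₜ extMap W (germFun K hP) (chartValue hJ c hU s) :=
  exists_tensorEquiv (germFun K hP) (deltaEval K hP) (fun _ _ => rfl)
    (chartEquiv hJ hσ h hN c hU)

/-- The sections of the product of delta functions and jets over a neighbourhood of `P`. -/
def deltaJetEquiv {U : X.Opens} (hU : U ≤ c.U) (hP : P ∈ U) :
    (AVPresheaf.preTensor (delta K P) (jet σ hJ)).obj U ≃+
      DeltaModule K (X.presheaf.stalk P) (IsLocalRing.maximalIdeal (X.presheaf.stalk P))
        ⊗[X.presheaf.stalk P] (X.presheaf.stalk P ⊗[K] W) :=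
  (exists_deltaJetEquiv hJ hσ h hN c hU hP).choose

theorem deltaJetEquiv_tmul {U : X.Opens} (hU : U ≤ c.U) (hP : P ∈ U) (z : (delta K P).obj U)
    (s : (jet σ hJ).obj U) : deltaJetEquiv hJ hσ h hN c hU hP (z ⊗ₜ[Γ(X, U)] s) =
      deltaEval K hP z ⊗ₜ extMap W (germFun K hP) (chartValue hJ c hU s) :=
  (exists_deltaJetEquiv hJ hσ h hN c hU hP).choose_spec z s

theorem deltaJetEquiv_res {U V : X.Opens} (hV : V ≤ U) (hU : U ≤ c.U) (hP : P ∈ V)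
    (t : (AVPresheaf.preTensor (delta K P) (jet σ hJ)).obj U) :
    deltaJetEquiv hJ hσ h hN c (hV.trans hU) hP
      ((AVPresheaf.preTensor (delta K P) (jet σ hJ)).res hV t) =
      deltaJetEquiv hJ hσ h hN c hU (hV hP) t := by
  refine AVPresheaf.preTensor_hom_ext
    (f := (deltaJetEquiv hJ hσ h hN c (hV.trans hU) hP).toAddMonoidHom.comp
      ((AVPresheaf.preTensor (delta K P) (jet σ hJ)).res hV))
    (g := (deltaJetEquiv hJ hσ h hN c hU (hV hP)).toAddMonoidHom) (fun z s => ?_) t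
  refine Eq.trans ?_ (deltaJetEquiv_tmul hJ hσ h hN c hU (hV hP) z s).symm
  refine (deltaJetEquiv_tmul hJ hσ h hN c (hV.trans hU) hP ((delta K P).res hV z)
    ((jet σ hJ).res hV s)).trans ?_
  rw [chartValue_res hJ c hU hV s]
  refine congrArg₂ _ rfl ?_
  induction chartValue hJ c hU s with
  | zero => simp
  | add a b ha hb => rw [map_add, map_add, ha, hb, map_add]
  | tmul f w =>
    change germFun K hP (resFun K hV f) ⊗ₜ[K] w = germFun K (hV hP) f ⊗ₜ[K] w
    rw [germFun_res]

theorem deltaJetEquiv_smul {U : X.Opens} (hU : U ≤ c.U) (hP : P ∈ U) (f : Γ(X, U))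
    (t : (AVPresheaf.preTensor (delta K P) (jet σ hJ)).obj U) :
    deltaJetEquiv hJ hσ h hN c hU hP (f • t) =
      germFun K hP f • deltaJetEquiv hJ hσ h hN c hU hP t := by
  refine AVPresheaf.preTensor_hom_ext
    (f := (deltaJetEquiv hJ hσ h hN c hU hP).toAddMonoidHom.comp
      (DistribSMul.toAddMonoidHom _ f))
    (g := (DistribSMul.toAddMonoidHom _ (germFun K hP f)).comp
      (deltaJetEquiv hJ hσ h hN c hU hP).toAddMonoidHom) (fun z s => ?_) t
  refine Eq.trans ?_ (congrArg (germFun K hP f • ·) (deltaJetEquiv_tmul hJ hσ h hN c hU hP z s).symm)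
  refine (deltaJetEquiv_tmul hJ hσ h hN c hU hP (f • z) s).trans ?_
  exact (TensorProduct.smul_tmul' (germFun K hP f) (deltaEval K hP z) _).symm

/-- Taking germs commutes with vector fields and with Taylor expansion, so the action in the chart
becomes the action in the frame of the local ring; the Leibniz rule then treats both factors. -/
theorem deltaJetEquiv_act {U : X.Opens} (hU : U ≤ c.U) (hP : P ∈ U) (η : VectorField K U)
    (t : (AVPresheaf.preTensor (delta K P) (jet σ hJ)).obj U) :
    deltaJetEquiv hJ hσ h hN c hU hP
      ((AVPresheaf.preTensor (delta K P) (jet σ hJ)).act η t) =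
      ((deltaAction _).tensor (frameAction h (c.isFrame_stalk (hU hP)))).act (η.stalk hP)
        (deltaJetEquiv hJ hσ h hN c hU hP t) := by
  refine AVPresheaf.preTensor_hom_ext
    (f := (deltaJetEquiv hJ hσ h hN c hU hP).toAddMonoidHom.comp
      ((AVPresheaf.preTensor (delta K P) (jet σ hJ)).act η))
    (g := (((deltaAction _).tensor (frameAction h (c.isFrame_stalk (hU hP)))).act
      (η.stalk hP)).comp (deltaJetEquiv hJ hσ h hN c hU hP).toAddMonoidHom) (fun z s => ?_) t
  refine Eq.trans ?_ (congrArg (((deltaAction _).tensor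
    (frameAction h (c.isFrame_stalk (hU hP)))).act (η.stalk hP))
    (deltaJetEquiv_tmul hJ hσ h hN c hU hP z s).symm)
  rw [AVAction.tensor_act_tmul, frameAction_act, deltaAction_act]
  refine (map_add (deltaJetEquiv hJ hσ h hN c hU hP) ((delta K P).act η z ⊗ₜ[Γ(X, U)] s)
    (z ⊗ₜ[Γ(X, U)] (jet σ hJ).act η s)).trans ?_
  refine (congrArg₂ _ (deltaJetEquiv_tmul hJ hσ h hN c hU hP _ s)
    (deltaJetEquiv_tmul hJ hσ h hN c hU hP z _)).trans ?_
  rw [chartValue_act hJ h]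
  refine congrArg₂ _ rfl (congrArg _ ?_)
  refine (extMap_frameAct h (germFun K hP) (d' := fun i => (c.pd i).stalk (hU hP))
    (δ' := η.stalk hP) (fun i f => ((c.pd i).stalk_germ (hU hP) hU hP f).symm)
    (fun f => (η.stalk_germ hP le_rfl hP f).symm) _).trans ?_
  have h1 : (fun i => germFun K hP (c.coord hU i)) = fun i => germFun K (hU hP) (c.x i) :=
    funext fun i => germFun_res K hU hP (c.x i)
  rw [h1]

omit [CharZero K] [IsIntegral X] in
theorem subsingleton_deltaTensor (M : AVPresheaf K X) {U : X.Opens} (hP : P ∉ U) :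
    Subsingleton ((AVPresheaf.preTensor (delta K P) M).obj U) := by
  have h1 : ∀ t : (AVPresheaf.preTensor (delta K P) M).obj U, t = 0 := by
    intro t
    induction t using TensorProduct.induction_on with
    | zero => rfl
    | add a b ha hb => exact (congrArg₂ _ ha hb).trans (add_zero _)
    | tmul z s =>
      have h2 : z = 0 := funext fun h => absurd h.down hP
      rw [h2]
      exact TensorProduct.zero_tmul _ _
  exact ⟨fun a b => (h1 a).trans (h1 b).symm⟩

end PointTensor

/-! ### The isomorphism of sheaves -/

section Main

variable {n : ℕ} {K : Type u} [Field K] [CharZero K] [IsAlgClosed K] {X : Scheme.{u}}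
  [X.Over (Spec (.of K))] [IsIntegral X] [LocallyOfFiniteType (X ↘ Spec (.of K))]
  {W : Type u} [AddCommGroup W] [Module K W] [LieRingModule (Lplus n K) W]
  [LieModule K (Lplus n K) W] {σ : GLForm n K (W ⊗[K] KTr n K)} {N : ℕ} (hJ : IsJetAction X σ)

/-- The sheaf of Rudakov modules of `W` is the tensor product of the sheaf of delta functions with the
jet bundle of `W ⊗ K_tr`. -/
theorem nonempty_rudakov_iso (hσ : σ.Integrates)
    (h : IsDegreeBound (n := n) (K := K) (W ⊗[K] KTr n K) N) (hN : 0 < N)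
    (c : EtaleChart K X n) {P : X} (hP : IsClosed {P}) (hc : P ∈ c.U) :
    Nonempty (AVPresheaf.Iso (rudakov W c hc) ((delta K P).tensor (jet σ hJ))) := by
  obtain ⟨p, hp⟩ := exists_value K hP
  let L := rudakovEquiv (c.isFrame_stalk hc) hp h
  let S : (AVPresheaf.preTensor (delta K P) (jet σ hJ)).PointSupport P
      (RudakovModule (X.presheaf.stalk P) W (IsLocalRing.maximalIdeal (X.presheaf.stalk P))
        (fun i => germFun K hc (c.x i)) (fun i => (c.pd i).stalk hc)) :=
    { U₀ := c.U
      mem := hc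
      equiv := fun U hU hPU => (deltaJetEquiv hJ hσ h hN c hU hPU).trans L.symm
      equiv_res := fun hV hU hPV t =>
        congrArg L.symm (deltaJetEquiv_res hJ hσ h hN c hV hU hPV t)
      equiv_smul := fun U hU hPU f t => L.injective (by
        rw [rudakovEquiv_fn]
        simp only [AddEquiv.trans_apply]
        rw [AddEquiv.apply_symm_apply, deltaJetEquiv_smul]
        exact congrArg _ (L.apply_symm_apply _).symm)
      equiv_act := fun U hU hPU η t => L.injective (by
        rw [rudakovEquiv_vec]
        simp only [AddEquiv.trans_apply]
        rw [AddEquiv.apply_symm_apply, deltaJetEquiv_act]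
        exact congrArg _ (L.apply_symm_apply _).symm)
      subsingleton := fun U hPU => subsingleton_deltaTensor _ hPU }
  exact S.nonempty_iso hP

end Main

end

end AVMod

theorem theorem24 (K : Type u) [Field K] [IsAlgClosed K] [CharZero K] (n : ℕ)
    (X : Scheme.{u}) [X.Over (Spec (.of K))] [IsIntegral X]
    [SmoothOfRelativeDimension n (X ↘ Spec (.of K))]
    (P : X) (hP : IsClosed {P})
    (W : Type u) [AddCommGroup W] [Module K W] [FiniteDimensional K W]
    [LieRingModule (AVMod.Lplus n K) W] [LieModule K (AVMod.Lplus n K) W]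
    (σ : AVMod.GLForm n K W) (hσ : σ.Integrates)
    (c : AVMod.EtaleChart K X n) (hc : P ∈ c.U) :
    ∃ hJ : AVMod.IsJetAction X (σ.tensor (AVMod.detForm (n := n) (K := K))),
      (∃ N : ℕ, 1 ≤ N ∧ (AVMod.rudakov W c hc).IsDifferentiable N ∧
        ((AVMod.delta K P).tensor (AVMod.jet _ hJ)).IsDifferentiable N) ∧
      Nonempty (AVMod.AVPresheaf.Iso (AVMod.rudakov W c hc)
        ((AVMod.delta K P).tensor (AVMod.jet (σ.tensor AVMod.detForm) hJ))) := by
  have : Smooth (X ↘ Spec (.of K)) := SmoothOfRelativeDimension.smooth n _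
  obtain ⟨N₀, h₀⟩ := AVMod.exists_degreeBound n K (W ⊗[K] AVMod.KTr n K)
  -- The bound is taken for the twisted module and raised by one, so that it is positive and can
  -- serve as the order of differentiability as well.
  have h := h₀.mono N₀.le_succ
  have hN : 0 < N₀ + 1 := N₀.succ_pos
  have hJ : AVMod.IsJetAction X (σ.tensor (AVMod.detForm (n := n) (K := K))) :=
    hσ.tensor_detForm.isJetAction h hN
  obtain ⟨e⟩ := AVMod.nonempty_rudakov_iso hJ hσ.tensor_detForm h hN c hP hc
  have hd : ((AVMod.delta K P).tensor (AVMod.jet _ hJ)).IsDifferentiable (N₀ + 1) :=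
    ((AVMod.delta_isDifferentiable P hN).preTensor (AVMod.jet_isDifferentiable h hN hJ)).sheafify
  -- Differentiability of the Rudakov sheaf is not computed but transported along the isomorphism.
  exact ⟨hJ, ⟨N₀ + 1, hN, e.isDifferentiable hd, hd⟩, ⟨e⟩⟩
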